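/- **Coefficients.** Work in $\mathbb Q(p,q)$ and put, for $r,s\in\mathbb Z$, $[r\nu+s]=\dfrac{p^rq^s-p^{-r}q^{-s}}{q-q^{-1}}$. Let $n\in\{\tfrac15,\tfrac14,\tfrac13,\tfrac12,\tfrac23,1,\tfrac32,2,3,5\}$ be the ten points of the exceptional series. Let $\Sigma$ be the set of all $[u\nu+v]$ ($u,v\in\mathbb Z$) whose specialisation $p\mapsto t^{a},\ q\mapsto t^{b}$, namely $\frac{t^{ua+vb}-t^{-ua-vb}}{t^b-t^{-b}}$, is non-zero for each of the ten points $n=a/b$ (lowest terms). Let $\mathbb k\subset\mathbb Q(p,q)$ be the subring generated by $p^{\pm1},q^{\pm1},[\nu]$ and the inverses of the elements of $\Sigma$. Put $$\delta=\tfrac{[6\nu+1][5\nu-1][4\nu]}{[\nu+1][2\nu]},\quad \phi=\tfrac{[3\nu][6\nu+2][4\nu-2]}{[\nu][3\nu+1][2\nu-1]},\quad \tau=\tfrac{[2\nu]}{[\nu]}\left(p^4+p^2q^2-p^2+q^2-1+q^{-2}-p^{-2}+p^{-2}q^{-2}+p^{-4}\right),$$ $$\xi=(q-q^{-1})^2[\nu+1],\quad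 \zeta=-\tfrac{[4\nu-2]}{[2\nu-1][\nu]},\quad \zeta^*=\tfrac{[6\nu+2][\nu+1]}{[3\nu+1][\nu]},$$ $$b_0=\xi\zeta\zeta^*,\quad b_1=\delta^{-1}(\phi-\xi)(\phi-\zeta)(\phi-\zeta^*),\quad b_2=\phi^{-1}(\tau-\xi)(\tau-\zeta)(\tau-\zeta^*),$$ $$b_3=\xi\zeta+\xi\zeta^*+\zeta\zeta^*,\quad b_4=\xi+\zeta+\zeta^*,$$ $$c_1=c_4=-\tfrac{[\nu+1]^2}{[\nu]^4}\left(q^2p^3-2q^2p-2p^3+q^2p^{-1}+p+p^{-1}+q^{-2}p-2p^{-3}-2q^{-2}p^{-1}+q^{-2}p^{-3}\right),$$ $$c_2=c_3=\tfrac{[6\nu]^2[\nu+1]^2}{[\nu]^3[2\nu][3\nu]^2},$$ $$c_5=\tfrac{[\nu+1]}{[\nu]^2}\left(2q^2p^3+p^5-q^2p-2p^3+2q^2p^{-1}+2q^{-2}p-2p^{-3}-q^{-2}p^{-1}+p^{-5}+2q^{-2}p^{-3}\right),$$ $$c_6=c_9=\tfrac{[\nu+1]}{[\nu]^2}\left(2q^2p+p^3-2p-2p^{-1}+p^{-3}+2q^{-2}p^{-1}\right),$$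 $$c_7=c_8=\tfrac{[\nu+1]}{[\nu]^2}\left(q^2p^3+p^5+q^2p-p^3+q^2p^{-1}-p-p^{-1}+q^{-2}p-p^{-3}+q^{-2}p^{-1}+p^{-5}+q^{-2}p^{-3}\right),$$ $$c_{10}=\tfrac{1}{[\nu]^2}\left(p^3[\nu]^2+qp^2[\nu]-2[\nu+1]-q^{-1}[\nu]+p^{-3}[\nu]^2+p^{-2}[\nu+1]\right),$$ $$c_{11}=c_{14}=-\tfrac{[6\nu][\nu+1]}{[\nu][2\nu][3\nu]},\quad c_{12}=c_{13}=-\tfrac{[\nu+1]}{[\nu]^2},\quad c_{15}=-2\tfrac{[\nu+1]}{[\nu]^2}+\tfrac{[6\nu]}{[\nu]^2[3\nu]}\left([\nu+1]^2+1\right),$$ $$c_0=\tau^3-\left(c_3+\delta c_4+\phi(c_6+c_7)+\tau c_9+\phi^2(c_{11}+c_{12})+\tau^2(c_{10}+c_{13})+\tau\phi c_{15}\right).$$ **The algebra $A(3)_{\rm loc}$** is the $\mathbb Q(p,q)$-algebra with generators $H_i,K_i,U_i$ ($i=1,2$; $j=3-i$) and relations $H_iK_i=K_iH_i=\tau K_i$,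 $H_iU_i=U_iH_i=\phi U_i$, $K_i^2=\phi K_i$, $K_iU_i=U_iK_i=0$, $U_i^2=\delta U_i$, $H_1K_2H_1=H_2K_1H_2$, $K_iU_jK_i=H_jU_iH_j$, $K_iU_jH_i=H_jU_iK_j$, $K_iU_jU_i=H_jU_i$, $U_iU_jK_i=U_iH_j$, $U_iU_jU_i=U_i$, $(H_i-\xi)(H_i-\zeta)(H_i-\zeta^*)=b_2K_i+b_1U_i$, and, with $\gamma=(c_2-c_1)b_0^{-1}$, $$\begin{aligned}H_2^2H_1H_2-H_1^2H_2H_1={}&\gamma(H_1^2H_2K_1-H_2^2H_1K_2)+c_{15}(H_2H_1H_2-H_1H_2H_1)+c_{11}(H_1H_2^2-H_2H_1^2)\\&+c_{12}(H_2^2H_1-H_1^2H_2)+c_{10}(K_2H_1H_2-K_1H_2H_1)+(c_{12}+\gamma b_4)(H_2H_1K_2-H_1H_2K_1)\\&+(c_6+\gamma b_2)\tau^{-1}(K_2H_1K_2-K_1H_2K_1)+c_6(K_2H_1-K_1H_2)+(c_7-\gamma b_3)(H_1K_2-H_2K_1)\\&+(c_0+\gamma b_1)(U_2H_1-U_1H_2)+(c_5-c_7)(H_1H_2-H_2H_1)+c_2(H_1U_2-H_2U_1)+c_1(H_1-H_2).\end{aligned}$$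 **The ideals.** In $A(3)_{\rm loc}$ put $Z_1=\tau^{-1}K_1H_2K_1$, $Z_2=\tau^{-1}K_2H_1K_2$, $Z_5=\tau^{-1}K_1K_2H_1K_2$, $Z_6=\tau^{-1}K_2K_1H_2K_1$, $$Z_3=b_0^{-1}(H_1^2H_2K_1-b_4H_1H_2K_1+b_3H_2K_1-b_2Z_1-b_1U_1H_2),\quad Z_4=b_0^{-1}(H_2^2H_1K_2-b_4H_2H_1K_2+b_3H_1K_2-b_2Z_2-b_1U_2H_1),$$ $$Z_0=b_1^{-1}(\tau^{-1}K_1K_2H_1K_2K_1-b_4K_1K_2K_1+b_3Z_1-b_0K_1-b_2K_1U_2K_1),$$ $$\begin{aligned}Z_7=c_{11}^{-1}\bigl(&H_1^2H_2H_1-c_0U_1H_2-c_1Z_3-c_2Z_4-c_3H_2U_1-c_4H_2-c_5H_2H_1-c_6Z_1-c_7H_2K_1-c_8H_1H_2\\&-c_9K_1H_2-c_{10}K_1H_2H_1-c_{11}H_2H_1^2-c_{12}H_1^2H_2-c_{13}H_1H_2K_1-c_{15}H_1H_2H_1\bigr).\end{aligned}$$ Let $\mathcal B^{(0)}=\{Z_0\}$.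 Let $\mathcal B^{(1)}$ consist of the 25 elements $U_1$, $U_1H_2$, $U_1U_2$, $U_1K_2$, $U_1K_2H_1$, $H_2U_1$, $K_1U_2K_1$, $K_1U_2$, $K_1U_2H_1$, $K_1U_2K_1H_2$, $U_2U_1$, $U_2K_1$, $U_2$, $U_2H_1$, $U_2K_1H_2$, $K_2U_1$, $K_2U_1H_2$, $H_1U_2$, $K_2U_1K_2$, $K_2U_1K_2H_1$, $H_1K_2U_1$, $H_1K_2U_1H_2$, $H_1^2U_2$, $H_1K_2U_1K_2$, $H_1K_2U_1K_2H_1$. Let $\mathcal B^{(2)}$ consist of the 34 elements $H_2^2K_1$, $H_2H_1K_2$, $H_2K_1$, $H_2K_1K_2$, $H_1H_2K_1$, $H_1^2K_2$, $H_1^2K_2H_1$, $H_1^2K_2H_1^2$, $H_1K_2$, $H_1K_2H_1$, $H_1K_2H_1H_2$, $H_1K_2H_1^2$, $H_1K_2K_1$, $H_1K_2K_1H_2$, $K_2$, $K_2H_1$, $K_2H_1H_2$, $K_2H_1^2$, $K_2K_1$, $K_2K_1H_2$, $K_2K_1K_2$, $K_1$, $K_1H_2$, $K_1H_2^2$, $K_1H_2H_1$,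 $K_1K_2$, $K_1K_2H_1$, $K_1K_2K_1$, $Z_1,\dots,Z_6$. Let $\mathcal B^{(3)}$ consist of the 20 elements $1$, $H_1$, $H_2$, $H_1^2$, $H_1H_2$, $H_2H_1$, $H_2^2$, $H_1^2H_2$, $H_1H_2H_1$, $H_1H_2^2$, $H_2H_1^2$, $H_2H_1H_2$, $H_2^2H_1$, $H_1^2H_2^2$, $H_1H_2H_1H_2$, $H_1H_2^2H_1$, $H_2H_1H_2H_1$, $H_2^2H_1^2$, $H_1H_2H_1H_2H_1$, $Z_7$. (These represent diagrams of cut length $0,1,2,3$.) Let $J^{(i)}$ be the $\mathbb k$-span of $\mathcal B^{(0)}\cup\dots\cup\mathcal B^{(i)}$, with $J^{(-1)}=0$, and $A(3)=J^{(3)}$. **The irreducible representations.** Put $\mathrm{Irr}^0=\{I\}$, $\mathrm{Irr}^1=\{L\}$, $\mathrm{Irr}^2=\{X_2,Y_2,Y_2^*\}$, $\mathrm{Irr}^3=\{X_3,Y_3,Y_3^*,A,C,C^*\}$, $w=q^2p+p^3-p-p^{-1}+p^{-3}+q^{-2}p^{-1}$. The representation $\rho_R$ sends $H_1$ to the matrix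 below, and $H_2$ to the same matrix rotated by 180 degrees: $I:(\tau)$; $X_3:(\xi)$; $Y_3:(\zeta)$; $Y_3^*:(\zeta^*)$; $$C:\begin{pmatrix}\zeta&0\\-\frac{[6\nu]}{[2\nu][3\nu]}&\xi\end{pmatrix},\quad C^*:\begin{pmatrix}\zeta^*&0\\-\frac{[6\nu][\nu+1]}{[2\nu][3\nu]}&\xi\end{pmatrix},\quad A:\begin{pmatrix}\zeta&0&0\\\frac{[6\nu]}{[2\nu][3\nu]}&\xi&0\\0&\frac{[6\nu][\nu+1]}{[3\nu][\nu]}&\zeta^*\end{pmatrix},$$ $$Y_2:\begin{pmatrix}\zeta&0&0\\\frac{[6\nu]}{[3\nu][2\nu]}&\xi&0\\\zeta&\frac{[3\nu-1]w}{[\nu]}&\tau\end{pmatrix},\quad Y_2^*:\begin{pmatrix}\zeta^*&0&0\\-\frac{[6\nu][\nu+1]}{[3\nu][2\nu]}&\xi&0\\\zeta^*&\frac{[4\nu+1]w}{[\nu]}&\tau\end{pmatrix},$$ $$X_2:\begin{pmatrix}\xi&0&0&0\\\frac{[6\nu]}{[2\nu][3\nu]}&\zeta&0&0\\\frac{[6\nu]}{[2\nu][3\nu]}&\frac{[6\nu]}{[3\nu]}&\zeta^*&0\\\xi&\frac{[6\nu]([2\nu][2]+1)}{[2\nu][3\nu]}&-\frac{[6\nu]([6\nu+2][\nu]-[3\nu+1])}{[2\nu][3\nu][3\nu+1]}&\tau\end{pmatrix},$$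 $$L:\begin{pmatrix}\zeta&0&0&0&0\\-\frac{[2\nu-2][2\nu]-[\nu-1]^2}{[\nu-1][\nu]}&\tau&0&0&0\\\frac{[4\nu-2]}{[\nu][2\nu-1]}&-\frac{w}{[\nu]}&\xi&0&0\\-\frac{[3\nu][4\nu-2]}{[\nu][2\nu-1]}&m&\frac{[\nu+1][12\nu]}{[3\nu][4\nu]}&\zeta^*&0\\0&0&\frac{[4\nu-2][6\nu+1]}{[\nu][2\nu-1]}&\frac{[4\nu-2][6\nu+2]}{[\nu][2\nu-1][3\nu+1]}&\phi\end{pmatrix},$$ where $m=q^2p^3+q^2p+q^2p^{-1}-2p-2p^{-1}+q^{-2}p+q^{-2}p^{-1}+q^{-2}p^{-3}$. **The top algebra** $\hat A(3)$ is the $\mathbb k$-algebra with generators $H_1,H_2$ and relations (with $i=1,2$, $j=3-i$) $$(H_i-\xi)(H_i-\zeta)(H_i-\zeta^*)=0,\qquad H_i^2H_jH_i-H_iH_jH_i^2=(c_{11}-c_{12})(H_jH_i^2-H_i^2H_j)+(c_5-c_7)(H_jH_i-H_iH_j),$$ $$\begin{aligned}H_2^2H_1H_2-H_1^2H_2H_1={}&c_{15}(H_2H_1H_2-H_1H_2H_1)+c_{11}(H_1H_2^2-H_2H_1^2)+c_{12}(H_2^2H_1-H_1^2H_2)\\&+(c_5-c_7)(H_1H_2-H_2H_1)+c_1(H_1-H_2).\end{aligned}$$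 **Proposition.** $A(3)$ is a $\mathbb k$-subalgebra of $A(3)_{\rm loc}$, the $J^{(j)}$ are two-sided ideals of it, and the matrices above define representations $\rho_R$ of $A(3)_{\rm loc}$ over $\mathbb Q(p,q)$ which restrict to representations of $A(3)$ with entries in $\mathbb k$. For each $j=0,\dots,3$ the $A(3)$-$A(3)$-bimodule map $$J^{(j)}\to\prod_{R\in\mathrm{Irr}^j}\mathrm{Mat}_{\dim R}(\mathbb k),\qquad x\mapsto(\rho_R(x))_R,$$ has kernel $J^{(j-1)}$. The action of $A(3)$ on $\mathbb Q(p,q)\otimes_{\mathbb k}(J^{(j)}/J^{(j-1)})$ extends to an $A(3)_{\rm loc}$-$A(3)_{\rm loc}$-bimodule structure, and the induced map $$\mathbb Q(p,q)\otimes_{\mathbb k}\left(J^{(j)}/J^{(j-1)}\right)\to\prod_{R\in\mathrm{Irr}^j}\mathrm{Mat}_{\dim R}(\mathbb Q(p,q))$$ is an isomorphism of $A(3)_{\rm loc}$-$A(3)_{\rm loc}$-bimodules. Moreover there is an isomorphism of $\mathbb k$-algebras $\hat A(3)\cong A(3)/J^{(2)}$ with $H_k\mapsto H_k$ for $k=1,2$.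 -/

import Mathlib

open scoped TensorProduct

noncomputable section

namespace ExcSeries

/-! ## Coefficients -/

/-- The field `ℚ(p, q)` of rational functions in two variables. -/
abbrev Kpq : Type := FractionRing (MvPolynomial (Fin 2) ℚ)

/-- The variable `p` (heuristically `q ^ ν`). -/
def p : Kpq := algebraMap (MvPolynomial (Fin 2) ℚ) Kpq (MvPolynomial.X 0)

/-- The variable `q`. -/
def q : Kpq := algebraMap (MvPolynomial (Fin 2) ℚ) Kpq (MvPolynomial.X 1)

/-- The Laurent monomial `p ^ a * q ^ b`. -/
def mon (a b : ℤ) : Kpq := p ^ a * q ^ b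

/-- The quantum integer `[r ν + s] = (p^r q^s - p^(-r) q^(-s)) / (q - q⁻¹)`. -/
def qi (r s : ℤ) : Kpq := (mon r s - mon (-r) (-s)) / (q - q⁻¹)

/-- The ten points `n = r / s` (in lowest terms) of the exceptional series, in the order
`∅, OSp(1|2), A₁, A₂, G₂, D₄, F₄, E₆, E₇, E₈`. -/
def excPoints : List (ℤ × ℤ) :=
  [(1, 5), (1, 4), (1, 3), (1, 2), (2, 3), (1, 1), (3, 2), (2, 1), (3, 1), (5, 1)]

/-- The image of `[u ν + v]` under the specialisation `p ↦ t ^ r`, `q ↦ t ^ s`, as a rational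
function of `t`. -/
def theta (r s u v : ℤ) : RatFunc ℚ :=
  (RatFunc.X ^ (u * r + v * s) - RatFunc.X ^ (-(u * r + v * s))) /
    (RatFunc.X ^ s - RatFunc.X ^ (-s))

/-- The set `Σ` of all quantum integers `[u ν + v]` whose specialisation at every point of the
exceptional series is non-zero. -/
def Sig : Set Kpq :=
  {x | ∃ u v : ℤ, x = qi u v ∧ ∀ c ∈ excPoints, theta c.1 c.2 u v ≠ 0}

/-- The coefficient ring: the subring of `ℚ(p, q)` generated by `p^{±1}`, `q^{±1}`, `[ν]` and
the inverses of the elements of `Σ`. -/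
def coeffRing : Subring Kpq :=
  Subring.closure ({p, p⁻¹, q, q⁻¹, qi 1 0} ∪ {x | ∃ y ∈ Sig, x = y⁻¹})

/-- The coefficient ring as a type. -/
abbrev kk : Type := coeffRing

/-! ## Constants -/

/-- The value of a circle. -/
def delta : Kpq := qi 6 1 * qi 5 (-1) * qi 4 0 / (qi 1 1 * qi 2 0)

/-- The value of a bigon. -/
def phi : Kpq := qi 3 0 * qi 6 2 * qi 4 (-2) / (qi 1 0 * qi 3 1 * qi 2 (-1))

/-- The value of a triangle. -/
def tau : Kpq :=
  qi 2 0 / qi 1 0 * (mon 4 0 + mon 2 2 - mon 2 0 + mon 0 2 - 1 + mon 0 (-2) - mon (-2) 0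
    + mon (-2) (-2) + mon (-4) 0)

/-- Eigenvalue of `H` on `X₂`. -/
def xi : Kpq := (q - q⁻¹) ^ 2 * qi 1 1

/-- Eigenvalue of `H` on `Y₂`. -/
def zeta : Kpq := -(qi 4 (-2) / (qi 2 (-1) * qi 1 0))

/-- Eigenvalue of `H` on `Y₂*`. -/
def zetas : Kpq := qi 6 2 * qi 1 1 / (qi 3 1 * qi 1 0)

/-! The coefficients of `H³ = b₀ + b₁ U + b₂ K - b₃ H + b₄ H²`. -/

def b0 : Kpq := xi * zeta * zetas
def b1 : Kpq := delta⁻¹ * ((phi - xi) * (phi - zeta) * (phi - zetas))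
def b2 : Kpq := phi⁻¹ * ((tau - xi) * (tau - zeta) * (tau - zetas))
def b3 : Kpq := xi * zeta + xi * zetas + zeta * zetas
def b4 : Kpq := xi + zeta + zetas

/-! The coefficients of the relation expressing a square adjacent to a pentagon. -/

def c1 : Kpq :=
  -(qi 1 1 ^ 2 / qi 1 0 ^ 4 * (mon 3 2 - 2 * mon 1 2 - 2 * mon 3 0 + mon (-1) 2 + mon 1 0
    + mon (-1) 0 + mon 1 (-2) - 2 * mon (-3) 0 - 2 * mon (-1) (-2) + mon (-3) (-2)))

def c2 : Kpq := qi 6 0 ^ 2 * qi 1 1 ^ 2 / (qi 1 0 ^ 3 * qi 2 0 * qi 3 0 ^ 2)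

def c5 : Kpq :=
  qi 1 1 / qi 1 0 ^ 2 * (2 * mon 3 2 + mon 5 0 - mon 1 2 - 2 * mon 3 0 + 2 * mon (-1) 2
    + 2 * mon 1 (-2) - 2 * mon (-3) 0 - mon (-1) (-2) + mon (-5) 0 + 2 * mon (-3) (-2))

def c6 : Kpq :=
  qi 1 1 / qi 1 0 ^ 2 * (2 * mon 1 2 + mon 3 0 - 2 * mon 1 0 - 2 * mon (-1) 0 + mon (-3) 0
    + 2 * mon (-1) (-2))

def c7 : Kpq :=
  qi 1 1 / qi 1 0 ^ 2 * (mon 3 2 + mon 5 0 + mon 1 2 - mon 3 0 + mon (-1) 2 - mon 1 0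
    - mon (-1) 0 + mon 1 (-2) - mon (-3) 0 + mon (-1) (-2) + mon (-5) 0 + mon (-3) (-2))

def c10 : Kpq :=
  (mon 3 0 * qi 1 0 ^ 2 + mon 2 1 * qi 1 0 - 2 * qi 1 1 - mon 0 (-1) * qi 1 0
    + mon (-3) 0 * qi 1 0 ^ 2 + mon (-2) 0 * qi 1 1) / qi 1 0 ^ 2

def c11 : Kpq := -(qi 6 0 * qi 1 1 / (qi 1 0 * qi 2 0 * qi 3 0))

def c12 : Kpq := -(qi 1 1 / qi 1 0 ^ 2)

def c15 : Kpq :=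
  -(2 * (qi 1 1 / qi 1 0 ^ 2) - qi 6 0 / (qi 1 0 ^ 2 * qi 3 0) * (qi 1 1 ^ 2 + 1))

def c3 : Kpq := c2
def c4 : Kpq := c1
def c8 : Kpq := c7
def c9 : Kpq := c6
def c13 : Kpq := c12
def c14 : Kpq := c11

def c0 : Kpq :=
  tau ^ 3 - (c3 + delta * c4 + phi * (c6 + c7) + tau * c9 + phi ^ 2 * (c11 + c12)
    + tau ^ 2 * (c10 + c13) + tau * phi * c15)

/-! ## The algebra `A(3)` over the field `ℚ(p, q)` -/

/-- The six generators `H_i`, `K_i`, `U_i`; the index `0 : Fin 2` stands for `i = 1` and the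
index `1 : Fin 2` for `i = 2`. -/
inductive Gen : Type
  | H (i : Fin 2)
  | K (i : Fin 2)
  | U (i : Fin 2)

/-- The free algebra on the six generators. -/
abbrev Fr : Type := FreeAlgebra Kpq Gen

def fH (i : Fin 2) : Fr := FreeAlgebra.ι Kpq (Gen.H i)
def fK (i : Fin 2) : Fr := FreeAlgebra.ι Kpq (Gen.K i)
def fU (i : Fin 2) : Fr := FreeAlgebra.ι Kpq (Gen.U i)

/-- The right-hand side of the quartic relation. -/
def quarticRHS : Fr :=
  ((c2 - c1) * b0⁻¹) • (fH 0 ^ 2 * fH 1 * fK 0 - fH 1 ^ 2 * fH 0 * fK 1)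
  + c15 • (fH 1 * fH 0 * fH 1 - fH 0 * fH 1 * fH 0)
  + c11 • (fH 0 * fH 1 ^ 2 - fH 1 * fH 0 ^ 2)
  + c12 • (fH 1 ^ 2 * fH 0 - fH 0 ^ 2 * fH 1)
  + c10 • (fK 1 * fH 0 * fH 1 - fK 0 * fH 1 * fH 0)
  + (c12 + (c2 - c1) * b0⁻¹ * b4) • (fH 1 * fH 0 * fK 1 - fH 0 * fH 1 * fK 0)
  + ((c6 + (c2 - c1) * b0⁻¹ * b2) * tau⁻¹) • (fK 1 * fH 0 * fK 1 - fK 0 * fH 1 * fK 0)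
  + c6 • (fK 1 * fH 0 - fK 0 * fH 1)
  + (c7 - (c2 - c1) * b0⁻¹ * b3) • (fH 0 * fK 1 - fH 1 * fK 0)
  + (c0 + (c2 - c1) * b0⁻¹ * b1) • (fU 1 * fH 0 - fU 0 * fH 1)
  + (c5 - c7) • (fH 0 * fH 1 - fH 1 * fH 0)
  + c2 • (fH 0 * fU 1 - fH 1 * fU 0)
  + c1 • (fH 0 - fH 1)

/-- The defining relations; in `Fin 2` the index different from `i` is `i + 1`. -/
inductive Rel : Fr → Fr → Prop
  | HK (i : Fin 2) : Rel (fH i * fK i) (tau • fK i)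
  | KH (i : Fin 2) : Rel (fK i * fH i) (tau • fK i)
  | HU (i : Fin 2) : Rel (fH i * fU i) (phi • fU i)
  | UH (i : Fin 2) : Rel (fU i * fH i) (phi • fU i)
  | KK (i : Fin 2) : Rel (fK i ^ 2) (phi • fK i)
  | KU (i : Fin 2) : Rel (fK i * fU i) 0
  | UK (i : Fin 2) : Rel (fU i * fK i) 0
  | UU (i : Fin 2) : Rel (fU i ^ 2) (delta • fU i)
  | HKH : Rel (fH 0 * fK 1 * fH 0) (fH 1 * fK 0 * fH 1)
  | KUK (i : Fin 2) : Rel (fK i * fU (i + 1) * fK i) (fH (i + 1) * fU i * fH (i + 1))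
  | KUH (i : Fin 2) : Rel (fK i * fU (i + 1) * fH i) (fH (i + 1) * fU i * fK (i + 1))
  | KUU (i : Fin 2) : Rel (fK i * fU (i + 1) * fU i) (fH (i + 1) * fU i)
  | UUK (i : Fin 2) : Rel (fU i * fU (i + 1) * fK i) (fU i * fH (i + 1))
  | UUU (i : Fin 2) : Rel (fU i * fU (i + 1) * fU i) (fU i)
  | cubic (i : Fin 2) :
      Rel ((fH i - algebraMap Kpq Fr xi) * (fH i - algebraMap Kpq Fr zeta)
        * (fH i - algebraMap Kpq Fr zetas)) (b2 • fK i + b1 • fU i)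
  | quartic : Rel (fH 1 ^ 2 * fH 0 * fH 1 - fH 0 ^ 2 * fH 1 * fH 0) quarticRHS

/-- The algebra `A(3)_loc` over `ℚ(p, q)`. -/
def Aloc : Type := RingQuot Rel

instance : Ring Aloc := inferInstanceAs (Ring (RingQuot Rel))

instance : Algebra Kpq Aloc := inferInstanceAs (Algebra Kpq (RingQuot Rel))

/-- The quotient map from the free algebra. -/
def mkLoc : Fr →ₐ[Kpq] Aloc := RingQuot.mkAlgHom Kpq Rel

def H1 : Aloc := mkLoc (fH 0)
def H2 : Aloc := mkLoc (fH 1)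
def K1 : Aloc := mkLoc (fK 0)
def K2 : Aloc := mkLoc (fK 1)
def U1 : Aloc := mkLoc (fU 0)
def U2 : Aloc := mkLoc (fU 1)

/-! The eight diagrams that are not words in the generators. Write `M₁, M₂ : 3 → 2` for the
diagrams merging the strands `1, 2`, respectively `2, 3`, `Mᵢ*` for their mirror images,
so that `Kᵢ = Mᵢ Mᵢ*`, and `U, K, H` for the two-strand diagrams. Then `Z₁ = M₁ H M₁*`,
`Z₂ = M₂ H M₂*`, `Z₃ = M₂ M₁*`, `Z₄ = M₁ M₂*`, `Z₅ = M₁ H² M₂*`, `Z₆ = M₂ H² M₁*`,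
`Z₀ = M₁ U M₁*` (a trivalent vertex on the left and one on the right), and `Z₇` is a square whose
four corners are joined to the top strand, the bottom strand and the two middle endpoints. -/

/-- From `K₁ H₂ K₁ = τ Z₁` (removal of a triangle). -/
def Z1 : Aloc := tau⁻¹ • (K1 * H2 * K1)

/-- From `K₂ H₁ K₂ = τ Z₂`. -/
def Z2 : Aloc := tau⁻¹ • (K2 * H1 * K2)

/-- From the square-square relation in `H₁² H₂ K₁`. -/
def Z3 : Aloc :=
  b0⁻¹ • (H1 ^ 2 * H2 * K1 - b4 • (H1 * H2 * K1) + b3 • (H2 * K1) - b2 • Z1 - b1 • (U1 * H2))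

/-- From the square-square relation in `H₂² H₁ K₂`. -/
def Z4 : Aloc :=
  b0⁻¹ • (H2 ^ 2 * H1 * K2 - b4 • (H2 * H1 * K2) + b3 • (H1 * K2) - b2 • Z2 - b1 • (U2 * H1))

/-- From `K₁ K₂ H₁ K₂ = τ Z₅`. -/
def Z5 : Aloc := tau⁻¹ • (K1 * K2 * H1 * K2)

/-- From `K₂ K₁ H₂ K₁ = τ Z₆`. -/
def Z6 : Aloc := tau⁻¹ • (K2 * K1 * H2 * K1)

/-- From the square-pentagon relation in `H₁² H₂ H₁`. -/
def Z7 : Aloc :=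
  c11⁻¹ • (H1 ^ 2 * H2 * H1 -
    (c0 • (U1 * H2) + c1 • Z3 + c2 • Z4 + c3 • (H2 * U1) + c4 • H2
      + c5 • (H2 * H1) + c6 • Z1 + c7 • (H2 * K1) + c8 • (H1 * H2) + c9 • (K1 * H2)
      + c10 • (K1 * H2 * H1) + c11 • (H2 * H1 ^ 2) + c12 • (H1 ^ 2 * H2) + c13 • (H1 * H2 * K1)
      + c15 • (H1 * H2 * H1)))

/-- From the square-square relation in `τ⁻¹ K₁ K₂ H₁ K₂ K₁ = M₁ H³ M₁*`. -/
def Z0 : Aloc :=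
  b1⁻¹ • (tau⁻¹ • (K1 * K2 * H1 * K2 * K1) - b4 • (K1 * K2 * K1) + b3 • Z1 - b0 • K1
    - b2 • (K1 * U2 * K1))

/-- `basis j` lists the basis diagrams of cut length `j` in `Hom(3, 3)`:
`1, 25, 34, 20` diagrams for `j = 0, 1, 2, 3`. -/
def basis : ℕ → List Aloc
  | 0 => [Z0]
  | 1 =>
    [U1, U1 * H2, U1 * U2, U1 * K2, U1 * K2 * H1,
     H2 * U1, K1 * U2 * K1, K1 * U2, K1 * U2 * H1, K1 * U2 * K1 * H2,
     U2 * U1, U2 * K1, U2, U2 * H1, U2 * K1 * H2,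
     K2 * U1, K2 * U1 * H2, H1 * U2, K2 * U1 * K2, K2 * U1 * K2 * H1,
     H1 * K2 * U1, H1 * K2 * U1 * H2, H1 ^ 2 * U2, H1 * K2 * U1 * K2, H1 * K2 * U1 * K2 * H1]
  | 2 =>
    [H2 ^ 2 * K1, H2 * H1 * K2, H2 * K1, H2 * K1 * K2,
     H1 * H2 * K1, H1 ^ 2 * K2, H1 ^ 2 * K2 * H1, H1 ^ 2 * K2 * H1 ^ 2,
     H1 * K2, H1 * K2 * H1, H1 * K2 * H1 * H2, H1 * K2 * H1 ^ 2,
     H1 * K2 * K1, H1 * K2 * K1 * H2, K2, K2 * H1,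
     K2 * H1 * H2, K2 * H1 ^ 2, K2 * K1,
     K2 * K1 * H2, K2 * K1 * K2,
     K1, K1 * H2, K1 * H2 ^ 2, K1 * H2 * H1,
     K1 * K2, K1 * K2 * H1, K1 * K2 * K1,
     Z1, Z2, Z3, Z4, Z5, Z6]
  | 3 =>
    [1, H1, H2, H1 ^ 2, H1 * H2, H2 * H1, H2 ^ 2,
     H1 ^ 2 * H2, H1 * H2 * H1, H1 * H2 ^ 2, H2 * H1 ^ 2, H2 * H1 * H2, H2 ^ 2 * H1,
     H1 ^ 2 * H2 ^ 2, H1 * H2 * H1 * H2, H1 * H2 ^ 2 * H1, H2 * H1 * H2 * H1, H2 ^ 2 * H1 ^ 2,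
     H1 * H2 * H1 * H2 * H1, Z7]
  | _ => []

/-- `J i` is the span over the coefficient ring of the basis diagrams of cut length `≤ i`; in
particular `J (-1) = 0`. -/
def J (i : ℤ) : Submodule kk Aloc :=
  Submodule.span kk {x | ∃ j : ℕ, (j : ℤ) ≤ i ∧ x ∈ basis j}

/-! ## The irreducible representations -/

/-- Labels of the irreducible representations (`Y2s`, `Y3s`, `Cs` stand for `Y₂*`, `Y₃*`,
`C*`). -/
inductive Irr : Type
  | I | L | X2 | Y2 | Y2s | X3 | Y3 | Y3s | A | C | Cs

/-- The level of an irreducible representation: `Irr^j` is the set of labels of level `j`. -/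
def Irr.level : Irr → ℕ
  | .I => 0
  | .L => 1
  | .X2 => 2 | .Y2 => 2 | .Y2s => 2
  | .X3 => 3 | .Y3 => 3 | .Y3s => 3 | .A => 3 | .C => 3 | .Cs => 3

/-- The dimension of an irreducible representation. -/
def Irr.dim : Irr → ℕ
  | .I => 1
  | .L => 5
  | .X2 => 4 | .Y2 => 3 | .Y2s => 3
  | .X3 => 1 | .Y3 => 1 | .Y3s => 1 | .A => 3 | .C => 2 | .Cs => 2

/-- `n × n` matrices for `n` the dimension of `R`. -/
abbrev Mat (R : Irr) (S : Type) : Type := Matrix (Fin R.dim) (Fin R.dim) S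

/-- A Laurent polynomial that occurs in several matrix entries. -/
def w : Kpq := mon 1 2 + mon 3 0 - mon 1 0 - mon (-1) 0 + mon (-3) 0 + mon (-1) (-2)

/-- The matrix of `H₁` in each irreducible representation. -/
def matH : (R : Irr) → Mat R Kpq
  | .I => !![tau]
  | .L =>
    !![zeta, 0, 0, 0, 0;
       -((qi 2 (-2) * qi 2 0 - qi 1 (-1) ^ 2) / (qi 1 (-1) * qi 1 0)), tau, 0, 0, 0;
       qi 4 (-2) / (qi 1 0 * qi 2 (-1)), -(w / qi 1 0), xi, 0, 0;
       -(qi 3 0 * qi 4 (-2) / (qi 1 0 * qi 2 (-1))),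
         mon 3 2 + mon 1 2 + mon (-1) 2 - 2 * mon 1 0 - 2 * mon (-1) 0 + mon 1 (-2)
           + mon (-1) (-2) + mon (-3) (-2),
         qi 1 1 * qi 12 0 / (qi 3 0 * qi 4 0), zetas, 0;
       0, 0, qi 4 (-2) * qi 6 1 / (qi 1 0 * qi 2 (-1)),
         qi 4 (-2) * qi 6 2 / (qi 1 0 * qi 2 (-1) * qi 3 1), phi]
  | .X2 =>
    !![xi, 0, 0, 0;
       qi 6 0 / (qi 2 0 * qi 3 0), zeta, 0, 0;
       qi 6 0 / (qi 2 0 * qi 3 0), qi 6 0 / qi 3 0, zetas, 0;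
       xi, qi 6 0 * (qi 2 0 * qi 0 2 + 1) / (qi 2 0 * qi 3 0),
         -(qi 6 0 * (qi 6 2 * qi 1 0 - qi 3 1) / (qi 2 0 * qi 3 0 * qi 3 1)), tau]
  | .Y2 =>
    !![zeta, 0, 0;
       qi 6 0 / (qi 3 0 * qi 2 0), xi, 0;
       zeta, qi 3 (-1) * w / qi 1 0, tau]
  | .Y2s =>
    !![zetas, 0, 0;
       -(qi 6 0 * qi 1 1 / (qi 3 0 * qi 2 0)), xi, 0;
       zetas, qi 4 1 * w / qi 1 0, tau]
  | .X3 => !![xi]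
  | .Y3 => !![zeta]
  | .Y3s => !![zetas]
  | .A =>
    !![zeta, 0, 0;
       qi 6 0 / (qi 2 0 * qi 3 0), xi, 0;
       0, qi 6 0 * qi 1 1 / (qi 3 0 * qi 1 0), zetas]
  | .C =>
    !![zeta, 0;
       -(qi 6 0 / (qi 2 0 * qi 3 0)), xi]
  | .Cs =>
    !![zetas, 0;
       -(qi 6 0 * qi 1 1 / (qi 2 0 * qi 3 0)), xi]

/-- A square matrix rotated by 180 degrees. -/
def rot180 {n : ℕ} (M : Matrix (Fin n) (Fin n) Kpq) : Matrix (Fin n) (Fin n) Kpq :=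
  M.submatrix Fin.rev Fin.rev

/-- The product of the matrix algebras over `S` of the irreducible representations of level
`j`. -/
abbrev MatLevel (j : ℕ) (S : Type) : Type := ∀ R : {R : Irr // R.level = j}, Mat R.1 S

/-! ## The top algebra `Â(3)` -/

theorem p_ne : p ≠ 0 := by
  unfold p
  simp [MvPolynomial.X_ne_zero]

theorem q_ne : q ≠ 0 := by
  unfold q
  simp [MvPolynomial.X_ne_zero]

/-- Two monomials in `p, q` that differ at some rational point differ in the field. -/
theorem pow_ne (a b c d : ℕ) (x y : ℚ) (h : x ^ a * y ^ b ≠ x ^ c * y ^ d) :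
    p ^ a * q ^ b ≠ p ^ c * q ^ d := by
  intro e
  apply h
  unfold p q at e
  rw [← map_pow, ← map_pow, ← map_mul, ← map_pow, ← map_pow, ← map_mul] at e
  have e' := IsFractionRing.injective (MvPolynomial (Fin 2) ℚ) Kpq e
  have := congrArg (MvPolynomial.eval ![x, y]) e'
  simpa using this

theorem q_sub_ne : q - q⁻¹ ≠ 0 := by
  have h := pow_ne 0 2 0 0 1 2 (by norm_num)
  intro e
  apply h
  have := q_ne
  field_simp at e
  linear_combination e

theorem mon_add (a b c d : ℤ) : mon (a + c) (b + d) = mon a b * mon c d := by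
  unfold mon
  rw [zpow_add₀ p_ne, zpow_add₀ q_ne]
  ring

theorem p_mem : p ∈ coeffRing := Subring.subset_closure (by simp)
theorem pinv_mem : p⁻¹ ∈ coeffRing := Subring.subset_closure (by simp)
theorem q_mem : q ∈ coeffRing := Subring.subset_closure (by simp)
theorem qinv_mem : q⁻¹ ∈ coeffRing := Subring.subset_closure (by simp)

theorem zpow_mem_coeff {x : Kpq} (h : x ∈ coeffRing) (h' : x⁻¹ ∈ coeffRing) (a : ℤ) :
    x ^ a ∈ coeffRing := by
  cases a with
  | ofNat n => simpa using pow_mem h n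
  | negSucc n =>
    rw [zpow_negSucc, ← inv_pow]
    exact pow_mem h' _

theorem mon_mem (a b : ℤ) : mon a b ∈ coeffRing :=
  mul_mem (zpow_mem_coeff p_mem pinv_mem a) (zpow_mem_coeff q_mem qinv_mem b)

theorem qi_add (a b c d : ℤ) : qi (a + c) (b + d) = mon c d * qi a b + mon (-a) (-b) * qi c d := by
  unfold qi
  have h1 := mon_add a b c d
  have h2 := mon_add (-a) (-b) (-c) (-d)
  have e1 : -(a + c) = -a + -c := by ring
  have e2 : -(b + d) = -b + -d := by ring
  rw [e1, e2, h1, h2]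
  have := q_sub_ne
  field_simp
  ring

theorem qi_neg (a b : ℤ) : qi (-a) (-b) = -qi a b := by
  unfold qi
  rw [neg_neg, neg_neg]
  ring

theorem qi_zero : qi 0 0 = 0 := by simp [qi]

theorem qi_nat_mem (a b : ℤ) (h : qi a b ∈ coeffRing) (n : ℕ) :
    qi (n * a) (n * b) ∈ coeffRing := by
  induction n with
  | zero => simp [qi_zero]
  | succ n ih =>
    have := qi_add (n * a) (n * b) a b
    rw [show ((n + 1 : ℕ) : ℤ) * a = n * a + a by push_cast; ring,
      show ((n + 1 : ℕ) : ℤ) * b = n * b + b by push_cast; ring, this]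
    exact add_mem (mul_mem (mon_mem _ _) ih) (mul_mem (mon_mem _ _) h)

theorem qi_int_mem (a b : ℤ) (h : qi a b ∈ coeffRing) (n : ℤ) :
    qi (n * a) (n * b) ∈ coeffRing := by
  obtain ⟨m, rfl | rfl⟩ := n.eq_nat_or_neg
  · exact qi_nat_mem a b h m
  · rw [neg_mul, neg_mul, qi_neg]
    exact neg_mem (qi_nat_mem a b h m)

theorem qi_mem (r s : ℤ) : qi r s ∈ coeffRing := by
  have h1 : qi 1 0 ∈ coeffRing := Subring.subset_closure (by simp)
  have h2 : qi 0 1 ∈ coeffRing := by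
    have : qi 0 1 = 1 := by
      unfold qi mon
      simp [q_sub_ne]
    rw [this]
    exact one_mem _
  have e1 := qi_int_mem 1 0 h1 r
  have e2 := qi_int_mem 0 1 h2 s
  have := qi_add r 0 0 s
  rw [add_zero, zero_add] at this
  rw [this]
  simp only [mul_one, mul_zero] at e1 e2
  exact add_mem (mul_mem (mon_mem _ _) e1) (mul_mem (mon_mem _ _) e2)

theorem ratX_sub_ne (m : ℤ) (hm : m ≠ 0) :
    (RatFunc.X ^ m - RatFunc.X ^ (-m) : RatFunc ℚ) ≠ 0 := by
  have key : ∀ n : ℕ, n ≠ 0 → (RatFunc.X ^ n : RatFunc ℚ) ≠ 1 := by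
    intro n hn e
    rw [← RatFunc.algebraMap_X, ← map_pow, ← map_one (algebraMap (Polynomial ℚ) (RatFunc ℚ))] at e
    have := congrArg (Polynomial.eval 2) (RatFunc.algebraMap_injective ℚ e)
    simp only [Polynomial.eval_pow, Polynomial.eval_X, Polynomial.eval_one] at this
    exact absurd this (one_lt_pow₀ (by norm_num) hn).ne'
  intro e
  have hX : (RatFunc.X : RatFunc ℚ) ≠ 0 := RatFunc.X_ne_zero
  have e1 : (RatFunc.X : RatFunc ℚ) ^ (m + m) = 1 := by
    rw [zpow_add₀ hX]
    nth_rewrite 1 [sub_eq_zero.mp e]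
    rw [← zpow_add₀ hX]
    simp
  have e2 : (RatFunc.X : RatFunc ℚ) ^ (2 * m.natAbs) = 1 := by
    rcases Int.natAbs_eq m with h | h
    · have : (m + m) = ((2 * m.natAbs : ℕ) : ℤ) := by omega
      rw [this, zpow_natCast] at e1
      exact e1
    · have : (m + m) = -((2 * m.natAbs : ℕ) : ℤ) := by omega
      rw [this, zpow_neg, zpow_natCast, inv_eq_one] at e1
      exact e1
  exact key _ (by omega) e2

theorem theta_ne (r s u v : ℤ) (hs : s ≠ 0) (h : u * r + v * s ≠ 0) : theta r s u v ≠ 0 :=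
  div_ne_zero (ratX_sub_ne _ h) (ratX_sub_ne _ hs)

/-- `[u ν + v]` is invertible in the coefficient ring if `u n + v ≠ 0` at all ten points. -/
theorem qi_inv_mem (u v : ℤ) (h : ∀ c ∈ excPoints, u * c.1 + v * c.2 ≠ 0) :
    (qi u v)⁻¹ ∈ coeffRing := by
  apply Subring.subset_closure
  right
  refine ⟨qi u v, ⟨u, v, rfl, fun c hc => theta_ne _ _ _ _ ?_ (h c hc)⟩, rfl⟩
  revert c
  decide

theorem qi10_inv : (qi 1 0)⁻¹ ∈ coeffRing := qi_inv_mem 1 0 (by decide)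
theorem qi20_inv : (qi 2 0)⁻¹ ∈ coeffRing := qi_inv_mem 2 0 (by decide)
theorem qi30_inv : (qi 3 0)⁻¹ ∈ coeffRing := qi_inv_mem 3 0 (by decide)
theorem qi31_inv : (qi 3 1)⁻¹ ∈ coeffRing := qi_inv_mem 3 1 (by decide)

theorem two_mem : (2 : Kpq) ∈ coeffRing := by
  have := add_mem (one_mem coeffRing) (one_mem coeffRing)
  rwa [one_add_one_eq_two] at this

theorem xi_mem : xi ∈ coeffRing :=
  mul_mem (pow_mem (sub_mem q_mem qinv_mem) _) (qi_mem _ _)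

theorem zeta_mem : zeta ∈ coeffRing := by
  have h : zeta = -((mon 2 (-1) + mon (-2) 1) * (qi 1 0)⁻¹) := by
    have hn : mon 2 (-1) - mon (-2) 1 ≠ 0 := by
      have h := pow_ne 4 0 0 2 2 1 (by norm_num)
      have hp := p_ne
      have hq := q_ne
      intro e
      apply h
      unfold mon at e
      simp only [zpow_neg, zpow_ofNat] at e
      field_simp at e
      linear_combination e
    have e4 : mon 4 (-2) = mon 2 (-1) * mon 2 (-1) :=
      (congrArg₂ mon (by norm_num) (by norm_num)).trans (mon_add 2 (-1) 2 (-1))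
    have e5 : mon (-4) 2 = mon (-2) 1 * mon (-2) 1 :=
      (congrArg₂ mon (by norm_num) (by norm_num)).trans (mon_add (-2) 1 (-2) 1)
    have hr : qi 4 (-2) / qi 2 (-1) = mon 2 (-1) + mon (-2) 1 := by
      unfold qi
      simp only [neg_neg]
      rw [e4, e5, div_div_div_cancel_right₀ q_sub_ne, div_eq_iff hn]
      ring
    unfold zeta
    rw [← hr, div_mul_eq_div_div]
    rfl
  rw [h]
  exact neg_mem (mul_mem (add_mem (mon_mem _ _) (mon_mem _ _)) qi10_inv)

theorem zetas_mem : zetas ∈ coeffRing := by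
  unfold zetas
  rw [div_eq_mul_inv, mul_inv]
  exact mul_mem (mul_mem (qi_mem _ _) (qi_mem _ _)) (mul_mem qi31_inv qi10_inv)

theorem c1_mem : c1 ∈ coeffRing := by
  unfold c1
  rw [div_eq_mul_inv, ← inv_pow]
  refine neg_mem (mul_mem (mul_mem (pow_mem (qi_mem _ _) _) (pow_mem qi10_inv _)) ?_)
  repeat' first
    | exact mul_mem two_mem (mon_mem _ _) | exact mon_mem _ _ | apply sub_mem | apply add_mem

theorem c5_mem : c5 ∈ coeffRing := by
  unfold c5
  rw [div_eq_mul_inv, ← inv_pow]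
  refine mul_mem (mul_mem (qi_mem _ _) (pow_mem qi10_inv _)) ?_
  repeat' first
    | exact mul_mem two_mem (mon_mem _ _) | exact mon_mem _ _ | apply sub_mem | apply add_mem

theorem c7_mem : c7 ∈ coeffRing := by
  unfold c7
  rw [div_eq_mul_inv, ← inv_pow]
  refine mul_mem (mul_mem (qi_mem _ _) (pow_mem qi10_inv _)) ?_
  repeat' first
    | exact mul_mem two_mem (mon_mem _ _) | exact mon_mem _ _ | apply sub_mem | apply add_mem

theorem c11_mem : c11 ∈ coeffRing := by
  unfold c11
  rw [div_eq_mul_inv, mul_inv, mul_inv]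
  exact neg_mem (mul_mem (mul_mem (qi_mem _ _) (qi_mem _ _))
    (mul_mem (mul_mem qi10_inv qi20_inv) qi30_inv))

theorem c12_mem : c12 ∈ coeffRing := by
  unfold c12
  rw [div_eq_mul_inv, ← inv_pow]
  exact neg_mem (mul_mem (qi_mem _ _) (pow_mem qi10_inv _))

theorem c15_mem : c15 ∈ coeffRing := by
  unfold c15
  rw [div_eq_mul_inv, div_eq_mul_inv, mul_inv, ← inv_pow]
  exact neg_mem (sub_mem (mul_mem two_mem (mul_mem (qi_mem _ _) (pow_mem qi10_inv _)))
    (mul_mem (mul_mem (qi_mem _ _) (mul_mem (pow_mem qi10_inv _) qi30_inv))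
      (add_mem (pow_mem (qi_mem _ _) _) (one_mem _))))

/-! The constants as elements of the coefficient ring. -/

def kxi : kk := ⟨xi, xi_mem⟩
def kzeta : kk := ⟨zeta, zeta_mem⟩
def kzetas : kk := ⟨zetas, zetas_mem⟩
def kc1 : kk := ⟨c1, c1_mem⟩
def kc5 : kk := ⟨c5, c5_mem⟩
def kc7 : kk := ⟨c7, c7_mem⟩
def kc11 : kk := ⟨c11, c11_mem⟩
def kc12 : kk := ⟨c12, c12_mem⟩
def kc15 : kk := ⟨c15, c15_mem⟩

/-- The free algebra over the coefficient ring on two generators. -/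
abbrev FrT : Type := FreeAlgebra kk (Fin 2)

def tH (i : Fin 2) : FrT := FreeAlgebra.ι kk i

/-- The defining relations of `Â(3)`: the cubic relation for each generator and the
square-pentagon relation modulo diagrams of cut length at most `2`, in the form of three quartic
relations (the diagram which is not a word in the generators being eliminated between the four
rotated and reflected forms). -/
inductive RelT : FrT → FrT → Prop
  | cubic (i : Fin 2) :
      RelT ((tH i - algebraMap kk FrT kxi) * (tH i - algebraMap kk FrT kzeta)
        * (tH i - algebraMap kk FrT kzetas)) 0
  | quartic (i : Fin 2) :
      RelT (tH i ^ 2 * tH (i + 1) * tH i - tH i * tH (i + 1) * tH i ^ 2)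
        ((kc11 - kc12) • (tH (i + 1) * tH i ^ 2 - tH i ^ 2 * tH (i + 1))
          + (kc5 - kc7) • (tH (i + 1) * tH i - tH i * tH (i + 1)))
  | quartic' :
      RelT (tH 1 ^ 2 * tH 0 * tH 1 - tH 0 ^ 2 * tH 1 * tH 0)
        (kc15 • (tH 1 * tH 0 * tH 1 - tH 0 * tH 1 * tH 0)
          + kc11 • (tH 0 * tH 1 ^ 2 - tH 1 * tH 0 ^ 2)
          + kc12 • (tH 1 ^ 2 * tH 0 - tH 0 ^ 2 * tH 1)
          + (kc5 - kc7) • (tH 0 * tH 1 - tH 1 * tH 0)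
          + kc1 • (tH 0 - tH 1))

/-- The top algebra `Â(3)`. -/
def Atop : Type := RingQuot RelT

instance : Ring Atop := inferInstanceAs (Ring (RingQuot RelT))

instance : Algebra kk Atop := inferInstanceAs (Algebra kk (RingQuot RelT))

/-- The generators `H₁, H₂` of `Â(3)`. -/
def topH (i : Fin 2) : Atop := RingQuot.mkAlgHom kk RelT (tH i)

end ExcSeries

end

open ExcSeries

open scoped TensorProduct

noncomputable section

namespace ExcSeries

/-! ## Computable models of the coefficient field -/

/-- Integral polynomials in `p` over polynomials in `q`. -/
abbrev PP : Type := Polynomial (Polynomial ℤ)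

/-- Polynomials with natural coefficients, used as bounds. -/
abbrev NN : Type := Polynomial (Polynomial ℕ)

/-- Evaluation of an integral polynomial at `p = c`, `q = b`. -/
def ev {R : Type*} [CommRing R] (c b : R) : PP →+* R :=
  Polynomial.eval₂RingHom (Polynomial.eval₂RingHom (Int.castRingHom R) b) c

/-- Evaluation of a natural polynomial. -/
def evN (c b : ℕ) : NN →+* ℕ :=
  Polynomial.eval₂RingHom (Polynomial.eval₂RingHom (Nat.castRingHom ℕ) b) c

theorem ev_map {R S : Type*} [CommRing R] [CommRing S] (f : R →+* S) (c b : R) (F : PP) :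
    f (ev c b F) = ev (f c) (f b) F := by
  have : (f.comp (ev c b)) = ev (f c) (f b) := by
    apply Polynomial.ringHom_ext'
    · apply Polynomial.ringHom_ext'
      · exact RingHom.ext_int _ _
      · simp [ev]
    · simp [ev]
  exact congrArg (fun g => g F) this

/-- The polynomial `p`. -/
def polP : PP := Polynomial.X
/-- The polynomial `q`. -/
def polQ : PP := Polynomial.C Polynomial.X

@[simp] theorem ev_polP {R : Type*} [CommRing R] (c b : R) : ev c b polP = c := by
  simp [ev, polP]
@[simp] theorem ev_polQ {R : Type*} [CommRing R] (c b : R) : ev c b polQ = b := by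
  simp [ev, polQ]

/-- The bound `p`. -/
def natP : NN := Polynomial.X
/-- The bound `q`. -/
def natQ : NN := Polynomial.C Polynomial.X

@[simp] theorem evN_natP (c b : ℕ) : evN c b natP = c := by simp [evN, natP]
@[simp] theorem evN_natQ (c b : ℕ) : evN c b natQ = b := by simp [evN, natQ]

/-- The evaluation at the variables of the field. -/
def evK : PP →+* Kpq := ev p q

theorem evK_injective : Function.Injective evK := by
  let f : PP →+* MvPolynomial (Fin 2) ℚ := ev (MvPolynomial.X 0) (MvPolynomial.X 1)
  have h1 : ∀ F, evK F = algebraMap (MvPolynomial (Fin 2) ℚ) Kpq (f F) := fun F =>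
    (ev_map (algebraMap (MvPolynomial (Fin 2) ℚ) Kpq) _ _ F).symm
  -- a retraction of the polynomial ring in two variables
  let g : MvPolynomial (Fin 2) ℚ →+* Polynomial (Polynomial ℚ) :=
    MvPolynomial.eval₂Hom (Polynomial.C.comp Polynomial.C)
      ![Polynomial.X, Polynomial.C Polynomial.X]
  have h2 : g.comp f = Polynomial.mapRingHom (Polynomial.mapRingHom (Int.castRingHom ℚ)) := by
    apply Polynomial.ringHom_ext'
    · apply Polynomial.ringHom_ext'
      · exact RingHom.ext_int _ _
      · simp [f, g, ev]
    · simp [f, g, ev]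
  have h3 : Function.Injective f := by
    have : Function.Injective (g.comp f) := by
      rw [h2]
      apply Polynomial.map_injective
      apply Polynomial.map_injective
      exact Int.cast_injective
    intro x y h
    exact this (by simp [h])
  intro x y h
  rw [h1, h1] at h
  exact h3 (IsFractionRing.injective (MvPolynomial (Fin 2) ℚ) Kpq h)

/-- Coefficientwise domination. -/
def Dom (F : PP) (G : NN) : Prop :=
  ∀ i j, |(F.coeff i).coeff j| ≤ ((G.coeff i).coeff j : ℤ)

theorem Dom.add {F F' : PP} {G G' : NN} (h : Dom F G) (h' : Dom F' G') :
    Dom (F + F') (G + G') := by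
  intro i j
  simp only [Polynomial.coeff_add, Nat.cast_add]
  exact (abs_add_le _ _).trans (add_le_add (h i j) (h' i j))

theorem Dom.neg {F : PP} {G : NN} (h : Dom F G) : Dom (-F) G := by
  intro i j
  simpa using h i j

theorem Dom.mul {F F' : PP} {G G' : NN} (h : Dom F G) (h' : Dom F' G') :
    Dom (F * F') (G * G') := by
  intro i j
  simp only [Polynomial.coeff_mul, Polynomial.finsetSum_coeff, Nat.cast_sum, Nat.cast_mul]
  refine (Finset.abs_sum_le_sum_abs _ _).trans (Finset.sum_le_sum fun x _ => ?_)
  refine (Finset.abs_sum_le_sum_abs _ _).trans (Finset.sum_le_sum fun y _ => ?_)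
  rw [abs_mul]
  exact mul_le_mul (h _ _) (h' _ _) (abs_nonneg _) ((abs_nonneg _).trans (h _ _))

theorem Dom.int (n : ℤ) : Dom (n : PP) (n.natAbs : NN) := by
  intro i j
  have h1 : (n : PP) = Polynomial.C (Polynomial.C n) := by simp
  have h2 : (n.natAbs : NN) = Polynomial.C (Polynomial.C n.natAbs) := by simp
  rw [h1, h2, Polynomial.coeff_C, Polynomial.coeff_C]
  split_ifs
  · rw [Polynomial.coeff_C, Polynomial.coeff_C]
    split_ifs <;> simp
  · simp

theorem Dom.one : Dom 1 1 := by simpa using Dom.int 1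

theorem Dom.pow {F : PP} {G : NN} (h : Dom F G) (n : ℕ) : Dom (F ^ n) (G ^ n) := by
  induction n with
  | zero => simpa using Dom.one
  | succ n ih => rw [pow_succ, pow_succ]; exact ih.mul h

theorem Dom.polP : Dom polP natP := by
  intro i j
  simp only [ExcSeries.polP, natP, Polynomial.coeff_X]
  split_ifs
  · simp only [Polynomial.coeff_one]; split_ifs <;> simp
  · simp

theorem Dom.polQ : Dom polQ natQ := by
  intro i j
  simp only [ExcSeries.polQ, natQ, Polynomial.coeff_C]
  split_ifs
  · simp only [Polynomial.coeff_X]; split_ifs <;> simp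
  · simp

/-- An integral polynomial with coefficients less than `b` in absolute value vanishes if its
value at `b` does. -/
theorem poly_eq_zero_of_eval (b : ℕ) (f : Polynomial ℤ) (hb : ∀ j, |f.coeff j| < b)
    (h : f.eval (b : ℤ) = 0) : f = 0 := by
  have hb0 : (b : ℤ) ≠ 0 := by
    have := (abs_nonneg _).trans_lt (hb 0)
    omega
  have key : ∀ n : ℕ, ∀ f : Polynomial ℤ, f.natDegree < n → (∀ j, |f.coeff j| < b) →
      f.eval (b : ℤ) = 0 → f = 0 := by
    intro n
    induction n with
    | zero => intro f hf; omega
    | succ n ih =>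
      intro f hf hb h
      have hd : f.divX * Polynomial.X + Polynomial.C (f.coeff 0) = f := f.divX_mul_X_add
      have h0 : f.coeff 0 = 0 := by
        have h1 := h
        rw [← hd] at h1
        simp only [Polynomial.eval_add, Polynomial.eval_mul, Polynomial.eval_X,
          Polynomial.eval_C] at h1
        apply Int.eq_zero_of_abs_lt_dvd (m := (b : ℤ)) _ (hb 0)
        exact ⟨-(f.divX.eval (b : ℤ)), by linear_combination h1⟩
      rcases eq_or_ne f.divX 0 with hz | hz
      · rw [← hd, hz, h0]; simp
      · have hdiv : f.divX = 0 := by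
          apply ih
          · rw [Polynomial.natDegree_divX_eq_natDegree_tsub_one]
            by_contra hc
            have : f.natDegree = 0 := by omega
            apply hz
            rw [Polynomial.divX_eq_zero_iff]
            exact Polynomial.eq_C_of_natDegree_eq_zero this
          · intro j; rw [Polynomial.coeff_divX]; exact hb _
          · rw [← hd, h0] at h
            simp only [Polynomial.eval_add, Polynomial.eval_mul, Polynomial.eval_X,
              Polynomial.eval_C, add_zero] at h
            exact (mul_eq_zero.mp h).resolve_right hb0
        exact absurd hdiv hz
  exact key _ f (Nat.lt_succ_self _) hb h

theorem coeff_le_eval_one (g : Polynomial ℕ) (b : ℕ) (hb : 0 < b) (j : ℕ) :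
    g.coeff j ≤ g.eval b := by
  rw [Polynomial.eval_eq_sum, Polynomial.sum]
  by_cases hj : j ∈ g.support
  · calc g.coeff j ≤ g.coeff j * b ^ j := Nat.le_mul_of_pos_right _ (pow_pos hb _)
      _ ≤ _ := Finset.single_le_sum (f := fun j => g.coeff j * b ^ j)
        (fun _ _ => Nat.zero_le _) hj
  · rw [Polynomial.notMem_support_iff.mp hj]; exact Nat.zero_le _

theorem coeff_eval_le (G : NN) (b : ℕ) (i : ℕ) :
    (G.coeff i).eval b ≤ evN 1 b G := by
  have : evN 1 b G = (G.map (Polynomial.evalRingHom b)).eval 1 := by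
    simp only [evN, Polynomial.coe_eval₂RingHom, Polynomial.eval_map]
    congr 1
  rw [this]
  have h := coeff_le_eval_one (G.map (Polynomial.evalRingHom b)) 1 one_pos i
  simpa using h

/-- Kronecker substitution detects zero. -/
theorem eq_zero_of_ev {c b : ℕ} {F : PP} {G : NN} (hd : Dom F G) (h : ev (c : ℤ) (b : ℤ) F = 0)
    (h1 : evN 1 1 G < b) (h2 : evN 1 b G < c) : F = 0 := by
  have hbpos : 0 < b := by omega
  have hv : ev (c : ℤ) (b : ℤ) F = (F.map (Polynomial.evalRingHom (b : ℤ))).eval (c : ℤ) := by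
    simp only [ev, Polynomial.coe_eval₂RingHom, Polynomial.eval_map]
    congr 1
  have habs : ∀ i, |(F.coeff i).eval (b : ℤ)| ≤ (((G.coeff i).eval b : ℕ) : ℤ) := by
    intro i
    rw [Polynomial.eval_eq_sum_range' (n := max (F.coeff i).natDegree (G.coeff i).natDegree + 1)
      (by omega), Polynomial.eval_eq_sum_range'
      (n := max (F.coeff i).natDegree (G.coeff i).natDegree + 1) (by omega)]
    push_cast
    refine (Finset.abs_sum_le_sum_abs _ _).trans (Finset.sum_le_sum fun j _ => ?_)
    rw [abs_mul, abs_of_nonneg (a := (b : ℤ) ^ j) (by positivity)]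
    exact mul_le_mul_of_nonneg_right (hd i j) (by positivity)
  have hz := poly_eq_zero_of_eval c (F.map (Polynomial.evalRingHom (b : ℤ))) (by
    intro i
    rw [Polynomial.coeff_map, Polynomial.coe_evalRingHom]
    calc _ ≤ (((G.coeff i).eval b : ℕ) : ℤ) := habs i
      _ ≤ (evN 1 b G : ℤ) := by exact_mod_cast coeff_eval_le G b i
      _ < c := by exact_mod_cast h2) (by rw [← hv]; exact h)
  ext i : 1
  rw [Polynomial.coeff_zero]
  apply poly_eq_zero_of_eval b
  · intro j
    have e1 := coeff_le_eval_one (G.coeff i) 1 one_pos j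
    have e2 := coeff_eval_le G 1 i
    have e3 := hd i j
    omega
  · have := congrArg (fun P => P.coeff i) hz
    simpa using this

/-! ## Expressions for elements of the coefficient ring -/

/-- Expressions for elements of the coefficient ring. -/
inductive Ex : Type
  | int (n : ℤ)
  | lau (l : List (ℤ × ℤ × ℤ))
  | qi (r s : ℤ)
  | nui
  | nu1i
  | add (a b : Ex)
  | mul (a b : Ex)
  | neg (a : Ex)

instance : Add Ex := ⟨Ex.add⟩
instance : Mul Ex := ⟨Ex.mul⟩
instance : Neg Ex := ⟨Ex.neg⟩
instance : Sub Ex := ⟨fun a b => Ex.add a (Ex.neg b)⟩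
instance (n : ℕ) : OfNat Ex n := ⟨Ex.int n⟩

/-- The element of the field denoted by an expression. -/
def Ex.den : Ex → Kpq
  | int n => n
  | lau l => (l.map fun t => (t.1 : Kpq) * mon t.2.1 t.2.2).sum
  | qi r s => ExcSeries.qi r s
  | nui => (ExcSeries.qi 1 0)⁻¹
  | nu1i => (ExcSeries.qi 1 1)⁻¹
  | add a b => a.den + b.den
  | mul a b => a.den * b.den
  | neg a => -a.den

@[simp] theorem Ex.den_add (a b : Ex) : (a + b).den = a.den + b.den := rfl
@[simp] theorem Ex.den_mul (a b : Ex) : (a * b).den = a.den * b.den := rfl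
@[simp] theorem Ex.den_neg (a : Ex) : (-a).den = -a.den := rfl
@[simp] theorem Ex.den_sub (a b : Ex) : (a - b).den = a.den - b.den :=
  (sub_eq_add_neg a.den b.den).symm
@[simp] theorem Ex.den_ofNat (n : ℕ) : (OfNat.ofNat n : Ex).den = n := by
  change ((n : ℤ) : Kpq) = n
  simp

theorem qi11_inv : (qi 1 1)⁻¹ ∈ coeffRing := qi_inv_mem 1 1 (by decide)

theorem Ex.den_mem (e : Ex) : e.den ∈ coeffRing := by
  induction e with
  | int n => exact intCast_mem _ n
  | lau l =>
    apply list_sum_mem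
    intro x hx
    obtain ⟨t, _, rfl⟩ := List.mem_map.mp hx
    exact mul_mem (intCast_mem _ _) (mon_mem _ _)
  | qi r s => exact qi_mem r s
  | nui => exact qi10_inv
  | nu1i => exact qi11_inv
  | add a b ha hb => exact add_mem ha hb
  | mul a b ha hb => exact mul_mem ha hb
  | neg a ha => exact neg_mem ha

/-- The operations of a computable model of the field. -/
structure Mod (F : Type) where
  int : ℤ → F
  mon : ℤ → ℤ → F
  qi : ℤ → ℤ → F
  nui : F
  nu1i : F
  add : F → F → F
  mul : F → F → F
  neg : F → F

/-- The value of an expression in a model. -/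
def Mod.val {F : Type} (m : Mod F) : Ex → F
  | .int n => m.int n
  | .lau l => l.foldr (fun t s => m.add (m.mul (m.int t.1) (m.mon t.2.1 t.2.2)) s) (m.int 0)
  | .qi r s => m.qi r s
  | .nui => m.nui
  | .nu1i => m.nu1i
  | .add a b => m.add (m.val a) (m.val b)
  | .mul a b => m.mul (m.val a) (m.val b)
  | .neg a => m.neg (m.val a)

/-- A relation between the field and a model that is compatible with the operations. -/
structure Mod.Sound {F : Type} (m : Mod F) (R : Kpq → F → Prop) : Prop where
  int : ∀ n : ℤ, R n (m.int n)
  mon : ∀ a b, R (ExcSeries.mon a b) (m.mon a b)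
  qi : ∀ a b, R (ExcSeries.qi a b) (m.qi a b)
  nui : R (ExcSeries.qi 1 0)⁻¹ m.nui
  nu1i : R (ExcSeries.qi 1 1)⁻¹ m.nu1i
  add : ∀ {x y a b}, R x a → R y b → R (x + y) (m.add a b)
  mul : ∀ {x y a b}, R x a → R y b → R (x * y) (m.mul a b)
  neg : ∀ {x a}, R x a → R (-x) (m.neg a)

theorem Mod.Sound.val {F : Type} {m : Mod F} {R : Kpq → F → Prop} (h : m.Sound R) (e : Ex) :
    R e.den (m.val e) := by
  induction e with
  | int n => exact h.int n
  | lau l =>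
    simp only [Ex.den, Mod.val]
    induction l with
    | nil => simpa using h.int 0
    | cons t l ih =>
      simp only [List.map_cons, List.sum_cons, List.foldr_cons]
      exact h.add (h.mul (h.int _) (h.mon _ _)) ih
  | qi r s => exact h.qi r s
  | nui => exact h.nui
  | nu1i => exact h.nu1i
  | add a b ha hb => exact h.add ha hb
  | mul a b ha hb => exact h.mul ha hb
  | neg a ha => exact h.neg ha

/-! ### Exact arithmetic by Kronecker substitution -/

/-- A fraction `v / (p^i q^j (p²-1)^a (q²-1)^b (p²q²-1)^c)`, where the polynomial `v` is given by
its value at `p = kC`, `q = kB` and the values of a bound at `(1, 1)` and `(1, kB)`. -/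
structure Fc where
  v : ℤ
  n1 : ℕ
  n2 : ℕ
  i : ℕ
  j : ℕ
  a : ℕ
  b : ℕ
  c : ℕ

/-- The value substituted for `q`. -/
@[irreducible] def kB : ℕ := 2 ^ 60
/-- The value substituted for `p`. -/
@[irreducible] def kC : ℕ := 2 ^ 4800

theorem kB_pos : 0 < kB := by unfold kB; positivity
theorem kC_pos : 0 < kC := by unfold kC; positivity

/-- Denominators. -/
def dn (i j a b c : ℕ) : Kpq := p ^ i * q ^ j * (p ^ 2 - 1) ^ a * (q ^ 2 - 1) ^ b
  * (p ^ 2 * q ^ 2 - 1) ^ c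

theorem sub_one_ne (a b : ℕ) (h : a ≠ 0 ∨ b ≠ 0) : p ^ a * q ^ b - 1 ≠ 0 := by
  have := pow_ne a b 0 0 2 2 (by
    rw [pow_zero, ← pow_add]
    have h1 : (1 : ℚ) < 2 ^ (a + b) := one_lt_pow₀ (by norm_num) (by omega)
    simpa using h1.ne')
  rw [pow_zero, pow_zero, mul_one] at this
  exact sub_ne_zero.mpr this

theorem p2_ne : p ^ 2 - 1 ≠ 0 := by simpa using sub_one_ne 2 0 (by simp)
theorem q2_ne : q ^ 2 - 1 ≠ 0 := by simpa using sub_one_ne 0 2 (by simp)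
theorem pq2_ne : p ^ 2 * q ^ 2 - 1 ≠ 0 := sub_one_ne 2 2 (by simp)

theorem dn_ne (i j a b c : ℕ) : dn i j a b c ≠ 0 := by
  unfold dn
  have := p_ne; have := q_ne; have := p2_ne; have := q2_ne; have := pq2_ne
  positivity

theorem dn_add (i j a b c i' j' a' b' c' : ℕ) :
    dn (i + i') (j + j') (a + a') (b + b') (c + c') = dn i j a b c * dn i' j' a' b' c' := by
  unfold dn; ring

/-- The relation between elements of the field and fractions. -/
def KRep (x : Kpq) (f : Fc) : Prop :=
  ∃ F G, Dom F G ∧ ev (kC : ℤ) (kB : ℤ) F = f.v ∧ evN 1 1 G = f.n1 ∧ evN 1 kB G = f.n2 ∧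
    x * dn f.i f.j f.a f.b f.c = evK F

/-- Triples: the value of a polynomial and the two values of its bound. -/
def PRep (F : PP) (v : ℤ) (n1 n2 : ℕ) : Prop :=
  ev (kC : ℤ) (kB : ℤ) F = v ∧ ∃ G, Dom F G ∧ evN 1 1 G = n1 ∧ evN 1 kB G = n2

theorem PRep.mul {F F' v v' n1 n1' n2 n2'} (h : PRep F v n1 n2) (h' : PRep F' v' n1' n2') :
    PRep (F * F') (v * v') (n1 * n1') (n2 * n2') := by
  obtain ⟨h1, G, h2, h3, h4⟩ := h
  obtain ⟨h1', G', h2', h3', h4'⟩ := h'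
  exact ⟨by rw [map_mul, h1, h1'], G * G', h2.mul h2', by rw [map_mul, h3, h3'],
    by rw [map_mul, h4, h4']⟩

theorem PRep.add {F F' v v' n1 n1' n2 n2'} (h : PRep F v n1 n2) (h' : PRep F' v' n1' n2') :
    PRep (F + F') (v + v') (n1 + n1') (n2 + n2') := by
  obtain ⟨h1, G, h2, h3, h4⟩ := h
  obtain ⟨h1', G', h2', h3', h4'⟩ := h'
  exact ⟨by rw [map_add, h1, h1'], G + G', h2.add h2', by rw [map_add, h3, h3'],
    by rw [map_add, h4, h4']⟩

theorem PRep.neg {F v n1 n2} (h : PRep F v n1 n2) : PRep (-F) (-v) n1 n2 := by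
  obtain ⟨h1, G, h2, h3, h4⟩ := h
  exact ⟨by rw [map_neg, h1], G, h2.neg, h3, h4⟩

theorem PRep.pow {F v n1 n2} (h : PRep F v n1 n2) (n : ℕ) :
    PRep (F ^ n) (v ^ n) (n1 ^ n) (n2 ^ n) := by
  obtain ⟨h1, G, h2, h3, h4⟩ := h
  exact ⟨by rw [map_pow, h1], G ^ n, h2.pow n, by rw [map_pow, h3], by rw [map_pow, h4]⟩

theorem PRep.int (n : ℤ) : PRep n n n.natAbs n.natAbs :=
  ⟨by simp, _, Dom.int n, by simp, by simp⟩

theorem PRep.one : PRep 1 1 1 1 := by simpa using PRep.int 1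

theorem PRep.polP : PRep polP kC 1 1 := ⟨by simp, _, Dom.polP, by simp, by simp⟩
theorem PRep.polQ : PRep polQ kB 1 kB := ⟨by simp, _, Dom.polQ, by simp, by simp⟩

/-- The polynomials that occur as denominators. -/
def dnP (i j a b c : ℕ) : PP := polP ^ i * polQ ^ j * (polP ^ 2 + -1) ^ a * (polQ ^ 2 + -1) ^ b
  * (polP ^ 2 * polQ ^ 2 + -1) ^ c

theorem evK_dnP (i j a b c : ℕ) : evK (dnP i j a b c) = dn i j a b c := by
  simp [evK, dnP, dn, sub_eq_add_neg]

/-- The value of a denominator. -/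
def dv (i j a b c : ℕ) : ℤ := ((kC ^ i * kB ^ j * (kC ^ 2 - 1) ^ a * (kB ^ 2 - 1) ^ b
  * (kC ^ 2 * kB ^ 2 - 1) ^ c : ℕ) : ℤ)
/-- The first bound of a denominator. -/
def d1 (a b c : ℕ) : ℕ := 2 ^ (a + b + c)
/-- The second bound of a denominator. -/
def d2 (j a b c : ℕ) : ℕ := kB ^ j * 2 ^ a * (kB ^ 2 + 1) ^ (b + c)

theorem PRep.den (i j a b c : ℕ) : PRep (dnP i j a b c) (dv i j a b c) (d1 a b c) (d2 j a b c) := by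
  have hp := PRep.polP
  have hq := PRep.polQ
  have h1 := PRep.one.neg
  have h := ((((hp.pow i).mul (hq.pow j)).mul ((((hp.pow 2).add h1)).pow a)).mul
    ((((hq.pow 2).add h1)).pow b)).mul (((((hp.pow 2).mul (hq.pow 2))).add h1).pow c)
  have hC : 1 ≤ kC ^ 2 := Nat.one_le_pow _ _ kC_pos
  have hB : 1 ≤ kB ^ 2 := Nat.one_le_pow _ _ kB_pos
  have hCB : 1 ≤ kC ^ 2 * kB ^ 2 := Nat.mul_pos hC hB
  convert h using 1
  · rfl
  · unfold dv
    push_cast [hC, hB, hCB]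
    ring
  · unfold d1; ring
  · unfold d2; ring

theorem KRep.of {x : Kpq} {f : Fc} {F : PP} (h : PRep F f.v f.n1 f.n2)
    (hx : x * dn f.i f.j f.a f.b f.c = evK F) : KRep x f := by
  obtain ⟨h1, G, h2, h3, h4⟩ := h
  exact ⟨F, G, h2, h1, h3, h4, hx⟩

/-- Multiplication of fractions. -/
def Fc.mul (x y : Fc) : Fc :=
  ⟨x.v * y.v, x.n1 * y.n1, x.n2 * y.n2, x.i + y.i, x.j + y.j, x.a + y.a, x.b + y.b, x.c + y.c⟩

/-- Addition of fractions. -/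
def Fc.add (x y : Fc) : Fc :=
  let i := max x.i y.i
  let j := max x.j y.j
  let a := max x.a y.a
  let b := max x.b y.b
  let c := max x.c y.c
  ⟨x.v * dv (i - x.i) (j - x.j) (a - x.a) (b - x.b) (c - x.c)
      + y.v * dv (i - y.i) (j - y.j) (a - y.a) (b - y.b) (c - y.c),
    x.n1 * d1 (a - x.a) (b - x.b) (c - x.c) + y.n1 * d1 (a - y.a) (b - y.b) (c - y.c),
    x.n2 * d2 (j - x.j) (a - x.a) (b - x.b) (c - x.c)
      + y.n2 * d2 (j - y.j) (a - y.a) (b - y.b) (c - y.c), i, j, a, b, c⟩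

/-- Addition of fractions with shortcuts for zero. -/
def Fc.add' (x y : Fc) : Fc :=
  if x.n1 = 0 then y else if y.n1 = 0 then x else x.add y

/-- The model of fractions. -/
def modF : Mod Fc where
  int n := ⟨n, n.natAbs, n.natAbs, 0, 0, 0, 0, 0⟩
  mon a b := ⟨((kC ^ a.toNat * kB ^ b.toNat : ℕ) : ℤ), 1, kB ^ b.toNat,
    (-a).toNat, (-b).toNat, 0, 0, 0⟩
  qi r s := ⟨((kC ^ (2 * r.toNat) * kB ^ (2 * s.toNat) * kB : ℕ) : ℤ)
      - ((kC ^ (2 * (-r).toNat) * kB ^ (2 * (-s).toNat) * kB : ℕ) : ℤ), 2,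
    kB ^ (2 * s.toNat) * kB + kB ^ (2 * (-s).toNat) * kB, r.natAbs, s.natAbs, 0, 1, 0⟩
  nui := ⟨(((kB ^ 2 - 1) * kC : ℕ) : ℤ), 2, kB ^ 2 + 1, 0, 1, 1, 0, 0⟩
  nu1i := ⟨(((kB ^ 2 - 1) * kC : ℕ) : ℤ), 2, kB ^ 2 + 1, 0, 0, 0, 0, 1⟩
  add := Fc.add'
  mul := Fc.mul
  neg x := ⟨-x.v, x.n1, x.n2, x.i, x.j, x.a, x.b, x.c⟩

theorem KRep.add {x y : Kpq} {f g : Fc} (hx : KRep x f) (hy : KRep y g) :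
    KRep (x + y) (f.add g) := by
  obtain ⟨F, G, h1, h2, h3, h4, h5⟩ := hx
  obtain ⟨F', G', h1', h2', h3', h4', h5'⟩ := hy
  have e1 := (show PRep F f.v f.n1 f.n2 from ⟨h2, G, h1, h3, h4⟩).mul
    (PRep.den (max f.i g.i - f.i) (max f.j g.j - f.j) (max f.a g.a - f.a) (max f.b g.b - f.b)
      (max f.c g.c - f.c))
  have e2 := (show PRep F' g.v g.n1 g.n2 from ⟨h2', G', h1', h3', h4'⟩).mul
    (PRep.den (max f.i g.i - g.i) (max f.j g.j - g.j) (max f.a g.a - g.a) (max f.b g.b - g.b)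
      (max f.c g.c - g.c))
  refine KRep.of (e1.add e2) ?_
  simp only [Fc.add, map_add, map_mul, evK_dnP]
  rw [← h5, ← h5', mul_assoc, mul_assoc, ← dn_add, ← dn_add, add_mul]
  congr 4 <;> omega

theorem KRep.eq_zero {x : Kpq} {f : Fc} (hx : KRep x f) (h1 : f.v = 0) (h2 : f.n1 < kB)
    (h3 : f.n2 < kC) : x = 0 := by
  obtain ⟨F, G, g1, g2, g3, g4, g5⟩ := hx
  have : F = 0 := eq_zero_of_ev g1 (by rw [g2, h1]) (by rw [g3]; exact h2) (by rw [g4]; exact h3)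
  rw [this, map_zero] at g5
  exact (mul_eq_zero.mp g5).resolve_right (dn_ne _ _ _ _ _)

theorem Dom.eq_zero_of_one {F : PP} {G : NN} (h : Dom F G) (hG : evN 1 1 G = 0) : F = 0 := by
  ext i j
  have e1 := coeff_le_eval_one (G.coeff i) 1 one_pos j
  have e2 := coeff_eval_le G 1 i
  have e3 := h i j
  have : (F.coeff i).coeff j = 0 := by
    rw [← abs_nonpos_iff]
    omega
  simpa using this

theorem KRep.eq_zero' {x : Kpq} {f : Fc} (hx : KRep x f) (h : f.n1 = 0) : x = 0 := by
  obtain ⟨F, G, g1, g2, g3, g4, g5⟩ := hx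
  rw [g1.eq_zero_of_one (by rw [g3, h]), map_zero] at g5
  exact (mul_eq_zero.mp g5).resolve_right (dn_ne _ _ _ _ _)

theorem KRep.add' {x y : Kpq} {f g : Fc} (hx : KRep x f) (hy : KRep y g) :
    KRep (x + y) (f.add' g) := by
  unfold Fc.add'
  split_ifs with h h'
  · rw [hx.eq_zero' h, zero_add]; exact hy
  · rw [hy.eq_zero' h', add_zero]; exact hx
  · exact hx.add hy

theorem KRep.mul {x y : Kpq} {f g : Fc} (hx : KRep x f) (hy : KRep y g) :
    KRep (x * y) (f.mul g) := by
  obtain ⟨F, G, h1, h2, h3, h4, h5⟩ := hx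
  obtain ⟨F', G', h1', h2', h3', h4', h5'⟩ := hy
  have e1 := (show PRep F f.v f.n1 f.n2 from ⟨h2, G, h1, h3, h4⟩).mul
    (show PRep F' g.v g.n1 g.n2 from ⟨h2', G', h1', h3', h4'⟩)
  refine KRep.of e1 ?_
  simp only [Fc.mul, dn_add, map_mul]
  rw [← h5, ← h5']
  ring

theorem KRep.neg {x : Kpq} {f : Fc} (hx : KRep x f) :
    KRep (-x) (modF.neg f) := by
  obtain ⟨F, G, h1, h2, h3, h4, h5⟩ := hx
  refine KRep.of (show PRep F f.v f.n1 f.n2 from ⟨h2, G, h1, h3, h4⟩).neg ?_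
  simp only [modF, map_neg, ← h5, neg_mul]

theorem zpow_toNat {x : Kpq} (hx : x ≠ 0) (a : ℤ) : x ^ a * x ^ (-a).toNat = x ^ a.toNat := by
  rw [← zpow_natCast, ← zpow_natCast, ← zpow_add₀ hx]
  congr 1
  omega

theorem modF_sound : modF.Sound KRep where
  int n := KRep.of (PRep.int n) (by simp [modF, dn])
  mon a b := by
    refine KRep.of (F := polP ^ a.toNat * polQ ^ b.toNat) ?_ ?_
    · convert (PRep.polP.pow a.toNat).mul (PRep.polQ.pow b.toNat) using 1 <;> simp [modF]
    · have h1 := zpow_toNat p_ne a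
      have h2 := zpow_toNat q_ne b
      simp only [modF, dn, pow_zero, mul_one, mon, map_mul, map_pow, evK, ev_polP, ev_polQ]
      rw [← h1, ← h2]
      ring
  qi r s := by
    refine KRep.of (F := polP ^ (2 * r.toNat) * polQ ^ (2 * s.toNat) * polQ
      + -(polP ^ (2 * (-r).toNat) * polQ ^ (2 * (-s).toNat) * polQ)) ?_ ?_
    · convert (((PRep.polP.pow _).mul (PRep.polQ.pow _)).mul PRep.polQ).add
        (((PRep.polP.pow _).mul (PRep.polQ.pow _)).mul PRep.polQ).neg using 1 <;>
        simp [modF, sub_eq_add_neg]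
    · simp only [modF, dn, pow_zero, mul_one, qi, mon, map_mul, map_pow, map_add, map_neg, evK,
        ev_polP, ev_polQ, pow_one]
      have hq := q_ne
      have hq1 := q_sub_ne
      have e1 : q ^ 2 - 1 = (q - q⁻¹) * q := by field_simp
      rw [e1]
      have f1 : ∀ (x : Kpq) (hx : x ≠ 0) (a : ℤ), x ^ a * x ^ a.natAbs = x ^ (2 * a.toNat) := by
        intro x hx a
        rw [← zpow_natCast, ← zpow_natCast, ← zpow_add₀ hx]
        congr 1
        omega
      have f2 : ∀ (x : Kpq) (hx : x ≠ 0) (a : ℤ),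
          x ^ (-a) * x ^ a.natAbs = x ^ (2 * (-a).toNat) := by
        intro x hx a
        rw [← zpow_natCast, ← zpow_natCast, ← zpow_add₀ hx]
        congr 1
        omega
      rw [← f1 p p_ne r, ← f1 q q_ne s, ← f2 p p_ne r, ← f2 q q_ne s]
      rw [div_mul_eq_mul_div, div_eq_iff hq1]
      ring
  nui := by
    refine KRep.of (F := (polQ ^ 2 + -1) * polP) ?_ ?_
    · convert ((PRep.polQ.pow 2).add PRep.one.neg).mul PRep.polP using 1
      · have hB : 1 ≤ kB ^ 2 := Nat.one_le_pow _ _ kB_pos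
        simp only [modF]
        push_cast [hB]
        ring
      · simp [modF]
      · simp [modF]
    · have := p_ne; have := q_ne; have := q_sub_ne; have := p2_ne; have := q2_ne
      have hpp : p - p⁻¹ = (p ^ 2 - 1) / p := by field_simp
      have hqq : q - q⁻¹ = (q ^ 2 - 1) / q := by field_simp
      simp only [modF, dn, pow_zero, mul_one, qi, mon, map_mul, map_pow, map_add, map_neg, evK,
        ev_polP, ev_polQ, pow_one, map_one, one_mul, zpow_one, zpow_zero, neg_zero, zpow_neg]
      rw [inv_div]
      rw [hpp, hqq]
      field_simp
      ring
  nu1i := by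
    refine KRep.of (F := (polQ ^ 2 + -1) * polP) ?_ ?_
    · convert ((PRep.polQ.pow 2).add PRep.one.neg).mul PRep.polP using 1
      · have hB : 1 ≤ kB ^ 2 := Nat.one_le_pow _ _ kB_pos
        simp only [modF]
        push_cast [hB]
        ring
      · simp [modF]
      · simp [modF]
    · have := p_ne; have := q_ne; have := q_sub_ne; have := pq2_ne; have := q2_ne
      have hpp : p * q - p⁻¹ * q⁻¹ = (p ^ 2 * q ^ 2 - 1) / (p * q) := by field_simp
      have hqq : q - q⁻¹ = (q ^ 2 - 1) / q := by field_simp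
      simp only [modF, dn, pow_zero, mul_one, qi, mon, map_mul, map_pow, map_add, map_neg, evK,
        ev_polP, ev_polQ, pow_one, map_one, one_mul, zpow_one, zpow_neg]
      rw [inv_div]
      rw [hpp, hqq]
      generalize p ^ 2 * q ^ 2 - 1 = D at *
      field_simp
      ring
  add := KRep.add'
  mul := KRep.mul
  neg := KRep.neg

/-- The test whether a fraction is zero. -/
def Fc.isZero (f : Fc) : Bool := f.v == 0 && decide (f.n1 < kB) && decide (f.n2 < kC)

theorem KRep.isZero {x : Kpq} {f : Fc} (hx : KRep x f) (h : f.isZero = true) : x = 0 := by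
  simp only [Fc.isZero, Bool.and_eq_true, beq_iff_eq, decide_eq_true_eq] at h
  exact hx.eq_zero h.1.1 h.1.2 h.2

/-- Equality of expressions can be decided by computation. -/
theorem Ex.den_eq (a b : Ex) (h : (modF.val (a - b)).isZero = true) : a.den = b.den := by
  have := (modF_sound.val (a - b)).isZero h
  rw [Ex.den_sub] at this
  exact sub_eq_zero.mp this

/-- A Laurent polynomial. -/
abbrev lau : List (ℤ × ℤ × ℤ) → Ex := Ex.lau
/-- The inverse of `[ν]`. -/
abbrev nui : Ex := Ex.nui
/-- The inverse of `[ν+1]`. -/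
abbrev nu1i : Ex := Ex.nu1i

@[simp] theorem Ex.den_zero : (0 : Ex).den = 0 := Int.cast_zero
@[simp] theorem Ex.den_one : (1 : Ex).den = 1 := Int.cast_one

/-! ## Noncommutative expressions and their values in matrices -/

/-- Noncommutative expressions; the atoms are numbered `H₁, H₂, K₁, K₂, U₁, U₂, Z₀, …, Z₆`. -/
inductive NE : Type
  | atom (n : ℕ)
  | one
  | add (a b : NE)
  | mul (a b : NE)
  | smul (c : Ex) (a : NE)

instance : Add NE := ⟨NE.add⟩
instance : Mul NE := ⟨NE.mul⟩
instance : SMul Ex NE := ⟨NE.smul⟩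
instance : Sub NE := ⟨fun a b => NE.add a (NE.smul (-1) b)⟩
instance : One NE := ⟨NE.one⟩
instance : Zero NE := ⟨NE.smul 0 NE.one⟩

section
variable {A : Type*} [Ring A] [Algebra Kpq A]

/-- The value of an expression in an algebra. -/
def NE.den (g : ℕ → A) : NE → A
  | atom n => g n
  | one => 1
  | add a b => a.den g + b.den g
  | mul a b => a.den g * b.den g
  | smul c a => c.den • a.den g

variable (g : ℕ → A) (a b : NE) (c : Ex)

@[simp] theorem NE.den_atom (n : ℕ) : (NE.atom n).den g = g n := rfl
@[simp] theorem NE.den_one : (1 : NE).den g = 1 := rfl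
@[simp] theorem NE.den_add : (a + b).den g = a.den g + b.den g := rfl
@[simp] theorem NE.den_mul : (a * b).den g = a.den g * b.den g := rfl
@[simp] theorem NE.den_smul : (c • a).den g = c.den • a.den g := rfl
@[simp] theorem NE.den_sub : (a - b).den g = a.den g - b.den g := by
  change a.den g + ((-1 : Ex)).den • b.den g = _
  simp [sub_eq_add_neg]
@[simp] theorem NE.den_zero : (0 : NE).den g = 0 := by
  change ((0 : Ex)).den • (1 : A) = _
  simp

theorem NE.map_den {B : Type*} [Ring B] [Algebra Kpq B] (f : A →ₐ[Kpq] B) (e : NE) :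
    f (e.den g) = e.den (fun n => f (g n)) := by
  induction e with
  | atom n => rfl
  | one => exact map_one f
  | add a b ha hb => simp [NE.den, ha, hb]
  | mul a b ha hb => simp [NE.den, ha, hb]
  | smul c a ha => simp [NE.den, ha]

end

/-- An entry of a matrix given by lists. -/
def lget {F : Type} (z : F) (M : List (List F)) (i j : ℕ) : F := (M.getD i []).getD j z

/-- The matrix with given entries. -/
def ltab {F : Type} (n : ℕ) (f : ℕ → ℕ → F) : List (List F) :=
  (List.range n).map fun i => (List.range n).map fun j => f i j

theorem lget_ltab {F : Type} (z : F) (n : ℕ) (f : ℕ → ℕ → F) (i j : ℕ) (hi : i < n) (hj : j < n) :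
    lget z (ltab n f) i j = f i j := by
  simp [lget, ltab, List.getD_eq_getElem?_getD, hi, hj]

/-- A sum in a model. -/
def Mod.sum {F : Type} (m : Mod F) (f : ℕ → F) : ℕ → F
  | 0 => m.int 0
  | k + 1 => m.add (m.sum f k) (f k)

theorem Mod.Sound.sum {F : Type} {m : Mod F} {R : Kpq → F → Prop} (h : m.Sound R) {n : ℕ}
    (x : Fin n → Kpq) (f : ℕ → F) (hx : ∀ i : Fin n, R (x i) (f i)) : R (∑ i, x i) (m.sum f n) := by
  induction n with
  | zero => simpa [Mod.sum] using h.int 0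
  | succ n ih =>
    rw [Fin.sum_univ_castSucc]
    exact h.add (ih _ fun i => hx i.castSucc) (hx (Fin.last n))

/-- The value of an expression in the matrices over a model. -/
def Mod.mval {F : Type} (m : Mod F) (n : ℕ) (g : ℕ → List (List Ex)) : NE → List (List F)
  | .atom k => ltab n fun i j => m.val (lget 0 (g k) i j)
  | .one => ltab n fun i j => if i = j then m.int 1 else m.int 0
  | .add a b =>
    let x := m.mval n g a
    let y := m.mval n g b
    ltab n fun i j => m.add (lget (m.int 0) x i j) (lget (m.int 0) y i j)
  | .mul a b =>
    let x := m.mval n g a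
    let y := m.mval n g b
    ltab n fun i j => m.sum (fun k => m.mul (lget (m.int 0) x i k) (lget (m.int 0) y k j)) n
  | .smul c a =>
    let x := m.mval n g a
    ltab n fun i j => m.mul (m.val c) (lget (m.int 0) x i j)

/-- The matrix denoted by a list of lists of expressions. -/
def lmat (n : ℕ) (M : List (List Ex)) : Matrix (Fin n) (Fin n) Kpq :=
  Matrix.of fun i j => (lget 0 M i j).den

theorem Mod.Sound.mval {F : Type} {m : Mod F} {R : Kpq → F → Prop} (h : m.Sound R) (n : ℕ)
    (g : ℕ → List (List Ex)) (e : NE) (i j : Fin n) :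
    R (e.den (fun k => lmat n (g k)) i j) (lget (m.int 0) (m.mval n g e) i j) := by
  induction e generalizing i j with
  | atom k =>
    rw [Mod.mval, lget_ltab _ _ _ _ _ i.2 j.2]
    exact h.val _
  | one =>
    rw [Mod.mval, lget_ltab _ _ _ _ _ i.2 j.2]
    simp only [NE.den, Matrix.one_apply, Fin.ext_iff]
    split_ifs
    · simpa using h.int 1
    · simpa using h.int 0
  | add a b ha hb =>
    rw [Mod.mval, lget_ltab _ _ _ _ _ i.2 j.2]
    exact h.add (ha i j) (hb i j)
  | mul a b ha hb =>
    rw [Mod.mval, lget_ltab _ _ _ _ _ i.2 j.2]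
    exact h.sum _ _ fun k => h.mul (ha i k) (hb k j)
  | smul c a ha =>
    rw [Mod.mval, lget_ltab _ _ _ _ _ i.2 j.2]
    exact h.mul (h.val c) (ha i j)

/-- The test whether an expression vanishes in a representation. -/
def NE.check (n : ℕ) (g : ℕ → List (List Ex)) (e : NE) : Bool :=
  (modF.mval n g e).all fun r => r.all Fc.isZero

theorem NE.den_eq_zero {n : ℕ} {g : ℕ → List (List Ex)} {e : NE} (h : e.check n g = true) :
    e.den (fun k => lmat n (g k)) = 0 := by
  ext i j
  refine (modF_sound.mval n g e i j).isZero ?_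
  have key : ∀ L : List (List Fc), (L.all fun r => r.all Fc.isZero) = true →
      (lget (modF.int 0) L i j).isZero = true := by
    intro L hL
    have h0 : (modF.int 0).isZero = true := by decide +kernel
    simp only [List.all_eq_true] at hL
    unfold lget
    rcases lt_or_ge (i : ℕ) L.length with hi | hi
    · rw [List.getD_eq_getElem _ _ hi]
      rcases lt_or_ge (j : ℕ) L[(i : ℕ)].length with hj | hj
      · rw [List.getD_eq_getElem _ _ hj]
        exact hL _ (List.getElem_mem _) _ (List.getElem_mem _)
      · rw [List.getD_eq_default _ _ hj]
        exact h0
    · rw [List.getD_eq_default _ _ hi]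
      exact h0
  exact key _ h

/-! ## The constants as expressions -/

/-- `[ν+1]/[ν]` -/
def eV : Ex := lau [(1,0,1)] + lau [(1,-1,0)] * nui
/-- `[6ν]/([2ν][3ν])` -/
def eA : Ex := lau [(1,2,0),(-1,0,0),(1,-2,0)] * nui
def eDelta : Ex := Ex.qi 6 1 * Ex.qi 5 (-1) * lau [(1,2,0),(1,-2,0)] * nu1i
def ePhi : Ex := lau [(1,2,0),(1,0,0),(1,-2,0)] * lau [(1,3,1),(1,-3,-1)] * lau [(1,2,-1),(1,-2,1)]
def eTau : Ex := lau [(1,1,0),(1,-1,0)] * lau [(1,4,0),(1,2,2),(-1,2,0),(1,0,2),(-1,0,0),(1,0,-2),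
  (-1,-2,0),(1,-2,-2),(1,-4,0)]
def eXi : Ex := lau [(1,1,1),(-1,-1,-1)] * lau [(1,0,1),(-1,0,-1)]
def eZeta : Ex := -(lau [(1,2,-1),(1,-2,1)] * nui)
def eZetas : Ex := lau [(1,3,1),(1,-3,-1)] * eV
def eB0 : Ex := eXi * eZeta * eZetas
def eB1 : Ex :=
  lau [(1,-9,-2),(-1,-9,0),(3,-7,-2),(-4,-7,0),(1,-7,2),(2,-5,-4),(3,-5,-2),(-8,-5,0),(3,-5,2),
    (5,-3,-4),(-8,-3,0),(3,-3,2),(1,-1,-6),(7,-1,-4),(-3,-1,-2),(-7,-1,0),(2,-1,4),(2,1,-4),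
    (-7,1,0),(-3,1,2),(7,1,4),(1,1,6),(3,3,-2),(-8,3,0),(5,3,4),(3,5,-2),(-8,5,0),(3,5,2),(2,5,4),
    (1,7,-2),(-4,7,0),(3,7,2),(-1,9,0),(1,9,2)]
  + lau [(2,0,-5),(8,0,-3),(7,0,-1),(3,0,1),(3,0,3),(1,0,5)] * nui
  + lau [(1,1,-4),(6,1,-2),(10,1,0),(6,1,2),(1,1,4)] * nui * nui
def eB2 : Ex :=
  lau [(1,-8,0),(2,-6,-2),(-1,-6,0),(1,-4,-4),(1,-4,-2),(-3,-4,0),(2,-4,2),(2,-2,-4),(-5,-2,-2),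
    (4,-2,0),(1,-2,2),(-4,0,-2),(10,0,0),(-5,0,2),(1,0,4),(1,2,-2),(4,2,0),(-5,2,2),(2,2,4),
    (2,4,-2),(-3,4,0),(1,4,2),(1,4,4),(-1,6,0),(2,6,2),(1,8,0)]
  + lau [(-1,1,-3),(-1,1,3)] * nui + lau [(-1,0,-2),(-1,0,2)] * nui * nui
def eB3 : Ex := eXi * eZeta + eXi * eZetas + eZeta * eZetas
def eB4 : Ex := eXi + eZeta + eZetas
def eC1 : Ex := -(eV * eV * nui * nui * lau [(1,3,2),(-2,1,2),(-2,3,0),(1,-1,2),(1,1,0),(1,-1,0),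
  (1,1,-2),(-2,-3,0),(-2,-1,-2),(1,-3,-2)])
def eC2 : Ex := eA * eA * eV * eV * lau [(1,1,0),(1,-1,0)]
def eC5 : Ex := eV * nui * lau [(2,3,2),(1,5,0),(-1,1,2),(-2,3,0),(2,-1,2),(2,1,-2),(-2,-3,0),
  (-1,-1,-2),(1,-5,0),(2,-3,-2)]
def eC6 : Ex := eV * nui * lau [(2,1,2),(1,3,0),(-2,1,0),(-2,-1,0),(1,-3,0),(2,-1,-2)]
def eC7 : Ex := eV * nui * lau [(1,3,2),(1,5,0),(1,1,2),(-1,3,0),(1,-1,2),(-1,1,0),(-1,-1,0),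
  (1,1,-2),(-1,-3,0),(1,-1,-2),(1,-5,0),(1,-3,-2)]
def eC10 : Ex := lau [(1,3,0),(1,-3,0)] + lau [(1,2,1),(-1,0,-1)] * nui
  + lau [(-2,0,0),(1,-2,0)] * eV * nui
def eC11 : Ex := -(eA * eV)
def eC12 : Ex := -(eV * nui)
def eC15 : Ex := -(2 * (eV * nui) - lau [(1,3,0),(1,-3,0)] * (eV * eV + nui * nui))
def eC0 : Ex := eTau * eTau * eTau - (eC2 + eDelta * eC1 + ePhi * (eC6 + eC7) + eTau * eC6
  + ePhi * ePhi * (eC11 + eC12) + eTau * eTau * (eC10 + eC12) + eTau * ePhi * eC15)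

theorem qi_ne (a b : ℕ) (h : a ≠ 0 ∨ b ≠ 0) : qi a b ≠ 0 := by
  have h1 : qi a b * (dn a b 0 1 0) = (p ^ (2 * a) * q ^ (2 * b) - 1) * q := by
    unfold qi dn mon
    have := p_ne; have := q_ne; have := q_sub_ne; have := q2_ne
    simp only [zpow_natCast, zpow_neg, pow_zero, mul_one, pow_one]
    field_simp
    ring
  intro h2
  rw [h2, zero_mul] at h1
  exact mul_ne_zero (sub_one_ne (2 * a) (2 * b) (by omega)) q_ne h1.symm

theorem qi_ne' (a b : ℕ) (h : p ^ (2 * a) - q ^ (2 * b) ≠ 0) : qi a (-b) ≠ 0 := by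
  have h1 : qi a (-b) * (p ^ a * q ^ b * (q - q⁻¹)) = p ^ (2 * a) - q ^ (2 * b) := by
    unfold qi mon
    have := p_ne; have := q_ne; have := q_sub_ne; have := q2_ne
    simp only [zpow_natCast, zpow_neg, neg_neg]
    field_simp
    ring
  intro h2
  rw [h2, zero_mul] at h1
  exact h h1.symm

/-! ## The matrices of the generators -/

/-- The matrix of `H₁`. -/
def repH : Irr → List (List Ex)
  | .I =>
    [[eTau]]
  | .L =>
    [[eZeta, 0, 0, 0, 0],
     [(lau [(-1,-2,1),(-1,0,-1),(-1,2,-1)] + lau [(-1,1,0)] * nui), eTau, 0, 0, 0],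
     [-eZeta, (lau [(-1,-2,-1),(1,-2,1),(-1,0,-3),(1,0,-1),(1,2,-1),(-1,2,1)] + lau [(-1,1,-2),(-1,1,2)] * nui), eXi, 0, 0],
     [lau [(-1,-4,1),(-1,-2,1),(-1,0,-1),(-1,0,1),(-1,2,-1),(-1,4,-1)], lau [(1,-3,-2),(1,-1,-2),(-2,-1,0),(1,-1,2),(1,1,-2),(-2,1,0),(1,1,2),(1,3,2)], (lau [(1,-6,-1),(-1,-4,1),(1,0,-1),(-1,4,-1),(1,6,1)] + lau [(1,1,0)] * nui), eZetas, 0],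
     [0, 0, (lau [(1,-7,0),(1,-5,0),(1,-3,-2),(1,-3,0),(1,-1,-2),(1,-1,0),(1,1,0),(1,1,2),(1,3,0),(1,3,2),(1,5,0),(1,7,0)] + lau [(1,0,-1),(1,0,1)] * nui), (lau [(1,-4,-1),(-1,-4,1),(1,-2,-1),(-1,-2,1),(1,0,-3),(-1,0,1),(-1,2,-1),(1,2,1),(-1,4,-1),(1,4,1)] + lau [(1,1,-2),(2,1,0),(1,1,2)] * nui), ePhi]]
  | .X2 =>
    [[eXi, 0, 0, 0],
     [eA, eZeta, 0, 0],
     [eA, lau [(1,-3,0),(1,3,0)], eZetas, 0],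
     [eXi, (lau [(1,-3,-1),(1,-3,1),(1,-1,-1),(-1,-1,1),(-1,1,-1),(1,1,1),(1,3,-1),(1,3,1)] + lau [(1,0,0)] * nui), (lau [(-1,-5,-1),(1,-3,-1),(-1,-1,1),(-1,1,-1),(1,3,1),(-1,5,1)] + lau [(1,0,0)] * nui), eTau]]
  | .Y2 =>
    [[eZeta, 0, 0],
     [eA, eXi, 0],
     [eZeta, (lau [(1,-5,1),(1,-3,-1),(1,-1,-1),(-1,-1,1),(1,-1,3),(1,1,-3),(-1,1,-1),(1,1,1),(1,3,1),(1,5,-1)] + lau [(-1,0,-2),(-1,0,2)] * nui), eTau]]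
  | .Y2s =>
    [[eZetas, 0, 0],
     [(lau [(-1,-2,-1),(1,0,1),(-1,2,1)] + lau [(-1,1,0)] * nui), eXi, 0],
     [eZetas, (lau [(1,-6,-1),(1,-4,-3),(1,-2,-3),(-1,-2,-1),(1,-2,1),(1,0,-3),(1,0,1),(1,2,-1),(-1,2,1),(1,2,3),(1,4,3),(1,6,1)] + lau [(1,1,-2),(1,1,2)] * nui), eTau]]
  | .X3 =>
    [[eXi]]
  | .Y3 =>
    [[eZeta]]
  | .Y3s =>
    [[eZetas]]
  | .A =>
    [[eZeta, 0, 0],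
     [eA, eXi, 0],
     [0, (lau [(1,-3,-1),(1,-1,-1),(-1,-1,1),(-1,1,-1),(1,1,1),(1,3,1)] + lau [(2,0,0)] * nui), eZetas]]
  | .C =>
    [[eZeta, 0],
     [-eA, eXi]]
  | .Cs =>
    [[eZetas, 0],
     [(lau [(-1,-2,-1),(1,0,1),(-1,2,1)] + lau [(-1,1,0)] * nui), eXi]]

/-- The matrix of `K₁`. -/
def repK : Irr → List (List Ex)
  | .I =>
    [[ePhi]]
  | .L =>
    [[0, 0, 0, 0, 0],
     [lau [(-1,-4,1),(-1,-2,1),(-1,0,-1),(-1,0,1),(-1,2,-1),(-1,4,-1)], ePhi, 0, 0, 0],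
     [-eZeta, (lau [(-1,-4,-1),(1,-4,1),(-1,-2,-1),(1,-2,1),(-1,0,-3),(1,0,1),(1,2,-1),(-1,2,1),(1,4,-1),(-1,4,1)] + lau [(-1,1,-2),(-2,1,0),(-1,1,2)] * nui), 0, 0, 0],
     [(lau [(-1,-2,1),(-1,0,-1),(-1,2,-1)] + lau [(-1,1,0)] * nui), (lau [(1,-5,0),(1,-3,-2),(2,-1,-2),(-1,-1,0),(-1,1,0),(2,1,2),(1,3,2),(1,5,0)] + lau [(1,0,-1),(1,0,1)] * nui), 0, 0, 0],
     [eZeta, (lau [(1,-4,-1),(-1,-4,1),(1,-2,-1),(-1,-2,1),(1,0,-3),(-1,0,1),(-1,2,-1),(1,2,1),(-1,4,-1),(1,4,1)] + lau [(1,1,-2),(2,1,0),(1,1,2)] * nui), 0, 0, 0]]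
  | .X2 =>
    [[0, 0, 0, 0],
     [0, 0, 0, 0],
     [0, 0, 0, 0],
     [eXi, lau [(1,-5,1),(1,-3,-1),(1,-1,1),(1,1,-1),(1,3,1),(1,5,-1)], lau [(-1,-7,-1),(-1,-3,-1),(-1,-1,1),(-1,1,-1),(-1,3,1),(-1,7,1)], ePhi]]
  | .Y2 =>
    [[0, 0, 0],
     [0, 0, 0],
     [eZeta, (lau [(1,-7,1),(1,-5,1),(1,-3,-1),(1,-3,1),(1,-1,1),(1,-1,3),(1,1,-3),(1,1,-1),(1,3,-1),(1,3,1),(1,5,-1),(1,7,-1)] + lau [(-1,0,-2),(-2,0,0),(-1,0,2)] * nui), ePhi]]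
  | .Y2s =>
    [[0, 0, 0],
     [0, 0, 0],
     [eZetas, (lau [(1,-8,-1),(1,-6,-1),(1,-4,-3),(1,-4,-1),(1,-2,-3),(1,-2,-1),(1,-2,1),(1,0,-3),(1,0,-1),(1,2,-1),(1,2,1),(1,2,3),(1,4,1),(1,4,3),(1,6,1),(1,8,1)] + lau [(1,1,-2),(2,1,0),(1,1,2)] * nui), ePhi]]
  | _ => []

/-- The matrix of `U₁`. -/
def repU : Irr → List (List Ex)
  | .L =>
    [[0, 0, 0, 0, 0],
     [0, 0, 0, 0, 0],
     [0, 0, 0, 0, 0],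
     [0, 0, 0, 0, 0],
     [1, -((Ex.qi 8 0 + Ex.qi 4 2) * nu1i), Ex.qi 6 1 * (Ex.qi 7 (-1) + Ex.qi 3 1) * nu1i, (Ex.qi 10 0 + Ex.qi 6 2 + Ex.qi 6 0 + Ex.qi 2 2) * nu1i, eDelta]]
  | _ => []

/-- The matrix of `Z₃`. -/
def repZ : Irr → List (List Ex)
  | .I =>
    [[ePhi]]
  | .L =>
    [[eZeta, (lau [(1,-4,-1),(-1,-4,1),(1,-2,-1),(-1,-2,1),(1,0,-3),(-1,0,1),(-1,2,-1),(1,2,1),(-1,4,-1),(1,4,1)] + lau [(1,1,-2),(2,1,0),(1,1,2)] * nui), 0, 0, 0],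
     [(lau [(-1,-2,1),(-1,0,-1),(-1,2,-1)] + lau [(-1,1,0)] * nui), (lau [(1,-5,0),(1,-3,-2),(2,-1,-2),(-1,-1,0),(-1,1,0),(2,1,2),(1,3,2),(1,5,0)] + lau [(1,0,-1),(1,0,1)] * nui), 0, 0, 0],
     [-eZeta, (lau [(-1,-4,-1),(1,-4,1),(-1,-2,-1),(1,-2,1),(-1,0,-3),(1,0,1),(1,2,-1),(-1,2,1),(1,4,-1),(-1,4,1)] + lau [(-1,1,-2),(-2,1,0),(-1,1,2)] * nui), 0, 0, 0],
     [lau [(-1,-4,1),(-1,-2,1),(-1,0,-1),(-1,0,1),(-1,2,-1),(-1,4,-1)], ePhi, 0, 0, 0],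
     [0, 0, 0, 0, 0]]
  | .X2 =>
    [[eXi, lau [(1,-5,1),(1,-3,-1),(1,-1,1),(1,1,-1),(1,3,1),(1,5,-1)], lau [(-1,-7,-1),(-1,-3,-1),(-1,-1,1),(-1,1,-1),(-1,3,1),(-1,7,1)], ePhi],
     [0, 0, 0, 0],
     [0, 0, 0, 0],
     [0, 0, 0, 0]]
  | .Y2 =>
    [[eZeta, (lau [(1,-7,1),(1,-5,1),(1,-3,-1),(1,-3,1),(1,-1,1),(1,-1,3),(1,1,-3),(1,1,-1),(1,3,-1),(1,3,1),(1,5,-1),(1,7,-1)] + lau [(-1,0,-2),(-2,0,0),(-1,0,2)] * nui), ePhi],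
     [0, 0, 0],
     [0, 0, 0]]
  | .Y2s =>
    [[eZetas, (lau [(1,-8,-1),(1,-6,-1),(1,-4,-3),(1,-4,-1),(1,-2,-3),(1,-2,-1),(1,-2,1),(1,0,-3),(1,0,-1),(1,2,-1),(1,2,1),(1,2,3),(1,4,1),(1,4,3),(1,6,1),(1,8,1)] + lau [(1,1,-2),(2,1,0),(1,1,2)] * nui), ePhi],
     [0, 0, 0],
     [0, 0, 0]]
  | _ => []

theorem qi10_ne : qi 1 0 ≠ 0 := by exact_mod_cast qi_ne 1 0 (by simp)
theorem qi20_ne : qi 2 0 ≠ 0 := by exact_mod_cast qi_ne 2 0 (by simp)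
theorem qi30_ne : qi 3 0 ≠ 0 := by exact_mod_cast qi_ne 3 0 (by simp)
theorem qi40_ne : qi 4 0 ≠ 0 := by exact_mod_cast qi_ne 4 0 (by simp)
theorem qi60_ne : qi 6 0 ≠ 0 := by exact_mod_cast qi_ne 6 0 (by simp)
theorem qi11_ne : qi 1 1 ≠ 0 := by exact_mod_cast qi_ne 1 1 (by simp)
theorem qi31_ne : qi 3 1 ≠ 0 := by exact_mod_cast qi_ne 3 1 (by simp)

theorem pq_sub_ne (a b : ℕ) (h : (2 : ℚ) ^ a * 3 ^ 0 ≠ 2 ^ 0 * 3 ^ b) : p ^ a - q ^ b ≠ 0 := by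
  simpa using sub_ne_zero.mpr (pow_ne a 0 0 b 2 3 h)

theorem qi2m_ne : qi 2 (-1) ≠ 0 := by
  exact_mod_cast qi_ne' 2 1 (pq_sub_ne _ _ (by norm_num))
theorem qi1m_ne : qi 1 (-1) ≠ 0 := by
  exact_mod_cast qi_ne' 1 1 (pq_sub_ne _ _ (by norm_num))

theorem den_eV : eV.den = qi 1 1 / qi 1 0 := by
  rw [eq_div_iff qi10_ne]
  exact Ex.den_eq (eV * Ex.qi 1 0) (Ex.qi 1 1) (by decide +kernel)

theorem den_eA : eA.den = qi 6 0 / (qi 2 0 * qi 3 0) := by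
  rw [eq_div_iff (mul_ne_zero qi20_ne qi30_ne)]
  exact Ex.den_eq (eA * (Ex.qi 2 0 * Ex.qi 3 0)) (Ex.qi 6 0) (by decide +kernel)

theorem den_delta : eDelta.den = delta := by
  unfold delta
  rw [eq_div_iff (mul_ne_zero qi11_ne qi20_ne)]
  exact Ex.den_eq (eDelta * (Ex.qi 1 1 * Ex.qi 2 0)) (Ex.qi 6 1 * Ex.qi 5 (-1) * Ex.qi 4 0)
    (by decide +kernel)

theorem den_phi : ePhi.den = phi := by
  unfold phi
  rw [eq_div_iff (mul_ne_zero (mul_ne_zero qi10_ne qi31_ne) qi2m_ne)]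
  exact Ex.den_eq (ePhi * (Ex.qi 1 0 * Ex.qi 3 1 * Ex.qi 2 (-1)))
    (Ex.qi 3 0 * Ex.qi 6 2 * Ex.qi 4 (-2)) (by decide +kernel)

theorem den_p1 : (lau [(1,1,0),(1,-1,0)]).den = qi 2 0 / qi 1 0 := by
  rw [eq_div_iff qi10_ne]
  exact Ex.den_eq (lau [(1,1,0),(1,-1,0)] * Ex.qi 1 0) (Ex.qi 2 0) (by decide +kernel)

theorem den_p3 : (lau [(1,3,0),(1,-3,0)]).den = qi 6 0 / qi 3 0 := by
  rw [eq_div_iff qi30_ne]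
  exact Ex.den_eq (lau [(1,3,0),(1,-3,0)] * Ex.qi 3 0) (Ex.qi 6 0) (by decide +kernel)

theorem mon_zero : mon 0 0 = 1 := by simp [mon]

theorem den_tau : eTau.den = tau := by
  unfold tau eTau
  rw [Ex.den_mul, den_p1]
  simp [Ex.den, mon_zero]
  left
  ring

theorem den_xi : eXi.den = xi := by
  have h := Ex.den_eq eXi (lau [(1,0,1),(-1,0,-1)] * lau [(1,0,1),(-1,0,-1)] * Ex.qi 1 1)
    (by decide +kernel)
  rw [h]
  simp [Ex.den, xi, mon]
  left
  ring

theorem den_zeta : eZeta.den = zeta := by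
  unfold zeta
  rw [eq_neg_iff_add_eq_zero, ← eq_neg_iff_add_eq_zero, ← neg_div,
    eq_div_iff (mul_ne_zero qi2m_ne qi10_ne)]
  exact Ex.den_eq (eZeta * (Ex.qi 2 (-1) * Ex.qi 1 0)) (-Ex.qi 4 (-2)) (by decide +kernel)

theorem den_zetas : eZetas.den = zetas := by
  unfold zetas
  rw [eq_div_iff (mul_ne_zero qi31_ne qi10_ne)]
  exact Ex.den_eq (eZetas * (Ex.qi 3 1 * Ex.qi 1 0)) (Ex.qi 6 2 * Ex.qi 1 1) (by decide +kernel)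

theorem den_b0 : eB0.den = b0 := by
  simp [eB0, b0, den_xi, den_zeta, den_zetas]
theorem den_b3 : eB3.den = b3 := by
  simp [eB3, b3, den_xi, den_zeta, den_zetas]
theorem den_b4 : eB4.den = b4 := by
  simp [eB4, b4, den_xi, den_zeta, den_zetas]

theorem qi5m_ne : qi 5 (-1) ≠ 0 := by
  exact_mod_cast qi_ne' 5 1 (pq_sub_ne _ _ (by norm_num))
theorem qi4m_ne : qi 4 (-2) ≠ 0 := by
  exact_mod_cast qi_ne' 4 2 (pq_sub_ne _ _ (by norm_num))
theorem qi62_ne : qi 6 2 ≠ 0 := by exact_mod_cast qi_ne 6 2 (by simp)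
theorem qi61_ne : qi 6 1 ≠ 0 := by exact_mod_cast qi_ne 6 1 (by simp)

theorem delta_ne : delta ≠ 0 :=
  div_ne_zero (mul_ne_zero (mul_ne_zero qi61_ne qi5m_ne) qi40_ne) (mul_ne_zero qi11_ne qi20_ne)
theorem phi_ne : phi ≠ 0 :=
  div_ne_zero (mul_ne_zero (mul_ne_zero qi30_ne qi62_ne) qi4m_ne)
    (mul_ne_zero (mul_ne_zero qi10_ne qi31_ne) qi2m_ne)

theorem den_b1 : eB1.den = b1 := by
  unfold b1
  rw [eq_inv_mul_iff_mul_eq₀ delta_ne, ← den_delta, ← den_phi, ← den_xi, ← den_zeta, ← den_zetas]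
  exact Ex.den_eq (eDelta * eB1) ((ePhi - eXi) * (ePhi - eZeta) * (ePhi - eZetas))
    (by decide +kernel)

theorem den_b2 : eB2.den = b2 := by
  unfold b2
  rw [eq_inv_mul_iff_mul_eq₀ phi_ne, ← den_tau, ← den_phi, ← den_xi, ← den_zeta, ← den_zetas]
  exact Ex.den_eq (ePhi * eB2) ((eTau - eXi) * (eTau - eZeta) * (eTau - eZetas))
    (by decide +kernel)

theorem den_c1 : eC1.den = c1 := by
  simp [eC1, c1, den_eV, Ex.den]
  have := qi10_ne
  field_simp
  ring
theorem den_c2 : eC2.den = c2 := by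
  unfold eC2
  simp only [Ex.den_mul, den_eV, den_eA, den_p1, c2]
  have := qi10_ne; have := qi20_ne; have := qi30_ne
  field_simp
theorem den_c5 : eC5.den = c5 := by
  simp [eC5, c5, den_eV, Ex.den]
  have := qi10_ne
  field_simp
  ring
theorem den_c6 : eC6.den = c6 := by
  simp [eC6, c6, den_eV, Ex.den]
  have := qi10_ne
  field_simp
  ring
theorem den_c7 : eC7.den = c7 := by
  simp [eC7, c7, den_eV, Ex.den]
  have := qi10_ne
  field_simp
  ring
theorem den_c10 : eC10.den = c10 := by
  simp [eC10, c10, den_eV, Ex.den, mon_zero]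
  have := qi10_ne
  field_simp
  ring
theorem den_c11 : eC11.den = c11 := by
  simp [eC11, c11, den_eV, den_eA, Ex.den]
  have := qi10_ne; have := qi20_ne; have := qi30_ne
  field_simp
theorem den_c12 : eC12.den = c12 := by
  simp [eC12, c12, den_eV, Ex.den]
  have := qi10_ne
  field_simp
theorem den_c15 : eC15.den = c15 := by
  unfold eC15
  simp only [Ex.den_mul, Ex.den_neg, Ex.den_sub, Ex.den_add, den_eV, den_p3, c15]
  simp only [Ex.den]
  have := qi10_ne; have := qi30_ne
  push_cast
  field_simp
theorem den_c0 : eC0.den = c0 := by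
  simp only [eC0, c0, Ex.den_mul, Ex.den_sub, Ex.den_add, den_tau, den_phi, den_delta, den_c1,
    den_c2, den_c6, den_c7, den_c10, den_c11, den_c12, den_c15, c3, c4, c9, c13]
  ring

theorem den_w : (lau [(1,1,2),(1,3,0),(-1,1,0),(-1,-1,0),(1,-3,0),(1,-1,-2)]).den = w := by
  simp [w, Ex.den]
  ring

theorem lmat_repH (R : Irr) : lmat R.dim (repH R) = matH R := by
  have h1 := qi10_ne; have h2 := qi20_ne; have h3 := qi30_ne; have h4 := qi2m_ne
  have h5 := qi1m_ne; have h6 := qi31_ne; have h7 := qi40_ne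
  have key : ∀ (n : ℕ) (M : List (List Ex)) (N : Matrix (Fin n) (Fin n) Kpq),
      (∀ i j : Fin n, (lget 0 M i j).den = N i j) → lmat n M = N := fun n M N h => by
    ext i j; exact h i j
  apply key
  cases R
  case I => intro i j; fin_cases i; fin_cases j; exact den_tau
  case X3 => intro i j; fin_cases i; fin_cases j; exact den_xi
  case Y3 => intro i j; fin_cases i; fin_cases j; exact den_zeta
  case Y3s => intro i j; fin_cases i; fin_cases j; exact den_zetas
  case C =>
    intro i j
    fin_cases i <;> fin_cases j
    · exact den_zeta
    · exact Ex.den_zero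
    · exact (Ex.den_neg _).trans (congrArg _ den_eA)
    · exact den_xi
  case Cs =>
    intro i j
    fin_cases i <;> fin_cases j
    · exact den_zetas
    · exact Ex.den_zero
    · change Ex.den _ = -(qi 6 0 * qi 1 1 / (qi 2 0 * qi 3 0))
      rw [← neg_div, eq_div_iff (mul_ne_zero h2 h3)]
      exact Ex.den_eq (_ * (Ex.qi 2 0 * Ex.qi 3 0)) (-(Ex.qi 6 0 * Ex.qi 1 1)) (by decide +kernel)
    · exact den_xi
  case A =>
    intro i j
    fin_cases i <;> fin_cases j
    · exact den_zeta
    · exact Ex.den_zero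
    · exact Ex.den_zero
    · exact den_eA
    · exact den_xi
    · exact Ex.den_zero
    · exact Ex.den_zero
    · change Ex.den _ = qi 6 0 * qi 1 1 / (qi 3 0 * qi 1 0)
      rw [eq_div_iff (mul_ne_zero h3 h1)]
      exact Ex.den_eq (_ * (Ex.qi 3 0 * Ex.qi 1 0)) (Ex.qi 6 0 * Ex.qi 1 1) (by decide +kernel)
    · exact den_zetas
  case Y2 =>
    intro i j
    fin_cases i <;> fin_cases j
    · exact den_zeta
    · exact Ex.den_zero
    · exact Ex.den_zero
    · exact den_eA.trans (by rw [mul_comm]; rfl)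
    · exact den_xi
    · exact Ex.den_zero
    · exact den_zeta
    · change Ex.den _ = qi 3 (-1) * w / qi 1 0
      rw [eq_div_iff h1, ← den_w]
      exact Ex.den_eq (_ * Ex.qi 1 0) (Ex.qi 3 (-1) * lau _) (by decide +kernel)
    · exact den_tau
  case Y2s =>
    intro i j
    fin_cases i <;> fin_cases j
    · exact den_zetas
    · exact Ex.den_zero
    · exact Ex.den_zero
    · change Ex.den _ = -(qi 6 0 * qi 1 1 / (qi 3 0 * qi 2 0))
      rw [← neg_div, eq_div_iff (mul_ne_zero h3 h2)]
      exact Ex.den_eq (_ * (Ex.qi 3 0 * Ex.qi 2 0)) (-(Ex.qi 6 0 * Ex.qi 1 1)) (by decide +kernel)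
    · exact den_xi
    · exact Ex.den_zero
    · exact den_zetas
    · change Ex.den _ = qi 4 1 * w / qi 1 0
      rw [eq_div_iff h1, ← den_w]
      exact Ex.den_eq (_ * Ex.qi 1 0) (Ex.qi 4 1 * lau _) (by decide +kernel)
    · exact den_tau
  case X2 =>
    intro i j
    fin_cases i <;> fin_cases j
    · exact den_xi
    · exact Ex.den_zero
    · exact Ex.den_zero
    · exact Ex.den_zero
    · exact den_eA
    · exact den_zeta
    · exact Ex.den_zero
    · exact Ex.den_zero
    · exact den_eA
    · exact (Ex.den_eq _ (lau [(1,3,0),(1,-3,0)]) (by decide +kernel)).trans den_p3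
    · exact den_zetas
    · exact Ex.den_zero
    · exact den_xi
    · change Ex.den _ = qi 6 0 * (qi 2 0 * qi 0 2 + 1) / (qi 2 0 * qi 3 0)
      rw [eq_div_iff (mul_ne_zero h2 h3), ← Ex.den_one]
      exact Ex.den_eq (_ * (Ex.qi 2 0 * Ex.qi 3 0))
        (Ex.qi 6 0 * (Ex.qi 2 0 * Ex.qi 0 2 + 1)) (by decide +kernel)
    · change Ex.den _ = -(qi 6 0 * (qi 6 2 * qi 1 0 - qi 3 1) / (qi 2 0 * qi 3 0 * qi 3 1))
      rw [← neg_div, eq_div_iff (mul_ne_zero (mul_ne_zero h2 h3) h6)]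
      exact (Ex.den_eq (_ * (Ex.qi 2 0 * Ex.qi 3 0 * Ex.qi 3 1))
        (-(Ex.qi 6 0 * (Ex.qi 6 2 * Ex.qi 1 0 - Ex.qi 3 1))) (by decide +kernel)).trans
        (by simp [Ex.den])
    · exact den_tau
  case L =>
    intro i j
    fin_cases i <;> fin_cases j
    · exact den_zeta
    · exact Ex.den_zero
    · exact Ex.den_zero
    · exact Ex.den_zero
    · exact Ex.den_zero
    · change Ex.den _ = -((qi 2 (-2) * qi 2 0 - qi 1 (-1) ^ 2) / (qi 1 (-1) * qi 1 0))
      rw [← neg_div, eq_div_iff (mul_ne_zero h5 h1), pow_two]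
      exact (Ex.den_eq (_ * (Ex.qi 1 (-1) * Ex.qi 1 0))
        (-(Ex.qi 2 (-2) * Ex.qi 2 0 - Ex.qi 1 (-1) * Ex.qi 1 (-1))) (by decide +kernel)).trans
        (by simp [Ex.den])
    · exact den_tau
    · exact Ex.den_zero
    · exact Ex.den_zero
    · exact Ex.den_zero
    · change Ex.den _ = qi 4 (-2) / (qi 1 0 * qi 2 (-1))
      rw [eq_div_iff (mul_ne_zero h1 h4)]
      exact Ex.den_eq (_ * (Ex.qi 1 0 * Ex.qi 2 (-1))) (Ex.qi 4 (-2)) (by decide +kernel)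
    · change Ex.den _ = -(w / qi 1 0)
      rw [← neg_div, eq_div_iff h1, ← den_w]
      exact Ex.den_eq (_ * Ex.qi 1 0) (-lau _) (by decide +kernel)
    · exact den_xi
    · exact Ex.den_zero
    · exact Ex.den_zero
    · change Ex.den _ = -(qi 3 0 * qi 4 (-2) / (qi 1 0 * qi 2 (-1)))
      rw [← neg_div, eq_div_iff (mul_ne_zero h1 h4)]
      exact Ex.den_eq (_ * (Ex.qi 1 0 * Ex.qi 2 (-1))) (-(Ex.qi 3 0 * Ex.qi 4 (-2)))
        (by decide +kernel)
    · change Ex.den _ = mon 3 2 + mon 1 2 + mon (-1) 2 - 2 * mon 1 0 - 2 * mon (-1) 0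
        + mon 1 (-2) + mon (-1) (-2) + mon (-3) (-2)
      change Ex.den (lau [(1,-3,-2),(1,-1,-2),(-2,-1,0),(1,-1,2),(1,1,-2),(-2,1,0),(1,1,2),
        (1,3,2)]) = _
      simp [Ex.den]
      ring
    · change Ex.den _ = qi 1 1 * qi 12 0 / (qi 3 0 * qi 4 0)
      rw [eq_div_iff (mul_ne_zero h3 h7)]
      exact Ex.den_eq (_ * (Ex.qi 3 0 * Ex.qi 4 0)) (Ex.qi 1 1 * Ex.qi 12 0) (by decide +kernel)
    · exact den_zetas
    · exact Ex.den_zero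
    · exact Ex.den_zero
    · exact Ex.den_zero
    · change Ex.den _ = qi 4 (-2) * qi 6 1 / (qi 1 0 * qi 2 (-1))
      rw [eq_div_iff (mul_ne_zero h1 h4)]
      exact Ex.den_eq (_ * (Ex.qi 1 0 * Ex.qi 2 (-1))) (Ex.qi 4 (-2) * Ex.qi 6 1)
        (by decide +kernel)
    · change Ex.den _ = qi 4 (-2) * qi 6 2 / (qi 1 0 * qi 2 (-1) * qi 3 1)
      rw [eq_div_iff (mul_ne_zero (mul_ne_zero h1 h4) h6)]
      exact Ex.den_eq (_ * (Ex.qi 1 0 * Ex.qi 2 (-1) * Ex.qi 3 1)) (Ex.qi 4 (-2) * Ex.qi 6 2)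
        (by decide +kernel)
    · exact den_phi

/-! ## The representations -/

/-- Rotation of a list of lists. -/
def lrot {F : Type} (M : List (List F)) : List (List F) := (M.map List.reverse).reverse

/-- Multiplication of a list of lists by an expression. -/
def lscale (c : Ex) (M : List (List Ex)) : List (List Ex) := M.map fun r => r.map fun x => c * x

/-- The eigenvalue of the bigon algebra on a representation of cut length at most `2`. -/
def repLam : Irr → Ex
  | .I => ePhi
  | .L => eTau
  | .X2 => eXi
  | .Y2 => eZeta
  | .Y2s => eZetas
  | _ => 0

/-- The matrix of `Z₀`. -/
def repZ0 : Irr → List (List Ex)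
  | .I => [[ePhi * eDelta]]
  | _ => []

/-- The matrices of the atoms. -/
def atomsE (R : Irr) : ℕ → List (List Ex)
  | 0 => repH R
  | 1 => lrot (repH R)
  | 2 => repK R
  | 3 => lrot (repK R)
  | 4 => repU R
  | 5 => lrot (repU R)
  | 6 => repZ0 R
  | 7 => lscale (repLam R) (repK R)
  | 8 => lscale (repLam R) (lrot (repK R))
  | 9 => repZ R
  | 10 => lrot (repZ R)
  | 11 => lscale (repLam R * repLam R) (lrot (repZ R))
  | 12 => lscale (repLam R * repLam R) (repZ R)
  | _ => []

/-- The matrices of the atoms over the field. -/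
def atomsM (R : Irr) (k : ℕ) : Mat R Kpq := lmat R.dim (atomsE R k)

def nH (i : Fin 2) : NE := .atom i
def nK (i : Fin 2) : NE := .atom (2 + i)
def nU (i : Fin 2) : NE := .atom (4 + i)
def nZ (k : ℕ) : NE := .atom (6 + k)

/-- The quartic relation, the terms with `(c₂-c₁)/b₀` being collected in `Z₃-Z₄`. -/
def nQuartic : NE :=
  nH 1 * nH 1 * nH 0 * nH 1 - nH 0 * nH 0 * nH 1 * nH 0
  - (((eC2 - eC1) • (nZ 3 - nZ 4)
  + eC15 • (nH 1 * nH 0 * nH 1 - nH 0 * nH 1 * nH 0)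
  + eC11 • (nH 0 * nH 1 * nH 1 - nH 1 * nH 0 * nH 0)
  + eC12 • (nH 1 * nH 1 * nH 0 - nH 0 * nH 0 * nH 1)
  + eC10 • (nK 1 * nH 0 * nH 1 - nK 0 * nH 1 * nH 0)
  + eC12 • (nH 1 * nH 0 * nK 1 - nH 0 * nH 1 * nK 0)
  + eC6 • (nZ 2 - nZ 1)
  + eC6 • (nK 1 * nH 0 - nK 0 * nH 1)
  + eC7 • (nH 0 * nK 1 - nH 1 * nK 0)
  + eC0 • (nU 1 * nH 0 - nU 0 * nH 1)
  + (eC5 - eC7) • (nH 0 * nH 1 - nH 1 * nH 0)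
  + eC2 • (nH 0 * nU 1 - nH 1 * nU 0)
  + eC1 • (nH 0 - nH 1)))

/-- The relations with an index. -/
def relI (i j : Fin 2) : List NE :=
  [nH i * nK i - eTau • nK i,
   nK i * nH i - eTau • nK i,
   nH i * nU i - ePhi • nU i,
   nU i * nH i - ePhi • nU i,
   nK i * nK i - ePhi • nK i,
   nK i * nU i - 0,
   nU i * nK i - 0,
   nU i * nU i - eDelta • nU i,
   nK i * nU j * nK i - nH j * nU i * nH j,
   nK i * nU j * nH i - nH j * nU i * nK j,
   nK i * nU j * nU i - nH j * nU i,
   nU i * nU j * nK i - nU i * nH j,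
   nU i * nU j * nU i - nU i,
   (nH i - eXi • 1) * (nH i - eZeta • 1) * (nH i - eZetas • 1) - (eB2 • nK i + eB1 • nU i)]

/-- The relations that define `Z₁, Z₃, Z₅` or their rotations. -/
def relZ (i j : Fin 2) : List NE :=
  [eTau • nZ (1 + i) - nK i * nH j * nK i,
   eB0 • nZ (3 + i) - (nH i * nH i * nH j * nK i - eB4 • (nH i * nH j * nK i)
    + eB3 • (nH j * nK i) - eB2 • nZ (1 + i) - eB1 • (nU i * nH j)),
   eTau • nZ (5 + i) - nK i * nK j * nH i * nK j]

/-- The remaining relations. -/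
def relR : List NE :=
  [nH 0 * nK 1 * nH 0 - nH 1 * nK 0 * nH 1, nQuartic,
   eB1 • nZ 0 - (nZ 5 * nK 0 - eB4 • (nK 0 * nK 1 * nK 0) + eB3 • nZ 1 - eB0 • nK 0
    - eB2 • (nK 0 * nU 1 * nK 0))]

/-- All relations. -/
def relAll : List NE := relI 0 1 ++ relI 1 0 ++ relZ 0 1 ++ relZ 1 0 ++ relR

theorem relAll_check (R : Irr) : (relAll.all fun e => e.check R.dim (atomsE R)) = true := by
  cases R <;> decide +kernel

theorem relAll_atomsM (R : Irr) : ∀ e ∈ relAll, e.den (atomsM R) = 0 := by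
  intro e he
  exact NE.den_eq_zero (List.all_eq_true.mp (relAll_check R) e he)

section
variable {A : Type*} [Ring A] [Algebra Kpq A]

/-- The images of the generators. -/
def genMap (g : ℕ → A) : Gen → A
  | .H i => g i
  | .K i => g (2 + i)
  | .U i => g (4 + i)

theorem relI_of_relAll {g : ℕ → A} (h : ∀ e ∈ relAll, e.den g = 0) (i : Fin 2) :
    ∀ e ∈ relI i (i + 1), e.den g = 0 := by
  intro e he
  apply h
  fin_cases i
  · exact List.mem_append_left _ (List.mem_append_left _ (List.mem_append_left _
      (List.mem_append_left _ he)))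
  · exact List.mem_append_left _ (List.mem_append_left _ (List.mem_append_left _
      (List.mem_append_right _ he)))

theorem relZ_of_relAll {g : ℕ → A} (h : ∀ e ∈ relAll, e.den g = 0) (i : Fin 2) :
    ∀ e ∈ relZ i (i + 1), e.den g = 0 := by
  intro e he
  apply h
  fin_cases i
  · exact List.mem_append_left _ (List.mem_append_left _ (List.mem_append_right _ he))
  · exact List.mem_append_left _ (List.mem_append_right _ he)

theorem relR_of_relAll {g : ℕ → A} (h : ∀ e ∈ relAll, e.den g = 0) :
    ∀ e ∈ relR, e.den g = 0 := fun e he => h e (List.mem_append_right _ he)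

theorem getD_zero_of {g : ℕ → A} {l : List NE} (h : ∀ e ∈ l, e.den g = 0) (k : ℕ) :
    (l.getD k 0).den g = 0 := by
  rcases lt_or_ge k l.length with hk | hk
  · rw [List.getD_eq_getElem _ _ hk]; exact h _ (List.getElem_mem _)
  · rw [List.getD_eq_default _ _ hk]; exact NE.den_zero g

end

theorem zeta_ne : zeta ≠ 0 :=
  neg_ne_zero.mpr (div_ne_zero qi4m_ne (mul_ne_zero qi2m_ne qi10_ne))
theorem zetas_ne : zetas ≠ 0 :=
  div_ne_zero (mul_ne_zero qi62_ne qi11_ne) (mul_ne_zero qi31_ne qi10_ne)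
theorem xi_ne : xi ≠ 0 := mul_ne_zero (pow_ne_zero _ q_sub_ne) qi11_ne
theorem b0_ne : b0 ≠ 0 := mul_ne_zero (mul_ne_zero xi_ne zeta_ne) zetas_ne

/-! ### Specialisation at a point over a finite field -/

/-- The characteristic of the specialisation. -/
abbrev sP : ℕ := 10007

theorem sP_prime : Nat.Prime sP := by norm_num

instance : Fact (Nat.Prime sP) := ⟨sP_prime⟩

/-- `x` specialises to `n` at `p = 5`, `q = 7`. -/
def Sp (x : Kpq) (n : ZMod sP) : Prop :=
  ∃ F G : PP, x * evK G = evK F ∧ ev (5 : ZMod sP) 7 G ≠ 0 ∧ ev (5 : ZMod sP) 7 F = n * ev 5 7 G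

theorem evK_ne {G : PP} (h : ev (5 : ZMod sP) 7 G ≠ 0) : evK G ≠ 0 := by
  intro h0
  apply h
  rw [evK_injective (h0.trans (map_zero evK).symm), map_zero]

theorem Sp.of (F : PP) : Sp (evK F) (ev 5 7 F) := ⟨F, 1, by simp, by simp, by simp⟩

theorem Sp.add {x y : Kpq} {a b : ZMod sP} (hx : Sp x a) (hy : Sp y b) : Sp (x + y) (a + b) := by
  obtain ⟨F, G, h1, h2, h3⟩ := hx
  obtain ⟨F', G', h1', h2', h3'⟩ := hy
  refine ⟨F * G' + F' * G, G * G', ?_, ?_, ?_⟩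
  · rw [map_add, map_mul, map_mul, map_mul, ← h1, ← h1']; ring
  · rw [map_mul]; exact mul_ne_zero h2 h2'
  · rw [map_add, map_mul, map_mul, map_mul, h3, h3']; ring

theorem Sp.mul {x y : Kpq} {a b : ZMod sP} (hx : Sp x a) (hy : Sp y b) : Sp (x * y) (a * b) := by
  obtain ⟨F, G, h1, h2, h3⟩ := hx
  obtain ⟨F', G', h1', h2', h3'⟩ := hy
  refine ⟨F * F', G * G', ?_, ?_, ?_⟩
  · rw [map_mul, map_mul, ← h1, ← h1']; ring
  · rw [map_mul]; exact mul_ne_zero h2 h2'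
  · rw [map_mul, map_mul, h3, h3']; ring

theorem Sp.neg {x : Kpq} {a : ZMod sP} (hx : Sp x a) : Sp (-x) (-a) := by
  obtain ⟨F, G, h1, h2, h3⟩ := hx
  exact ⟨-F, G, by rw [map_neg, ← h1]; ring, h2, by rw [map_neg, h3]; ring⟩

theorem Sp.inv {x : Kpq} {a : ZMod sP} (hx : Sp x a) (ha : a ≠ 0) : Sp x⁻¹ a⁻¹ := by
  obtain ⟨F, G, h1, h2, h3⟩ := hx
  have hF : ev (5 : ZMod sP) 7 F ≠ 0 := by rw [h3]; exact mul_ne_zero ha h2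
  have hG := evK_ne h2
  have hx0 : x ≠ 0 := by
    rintro rfl
    rw [zero_mul] at h1
    exact evK_ne hF h1.symm
  refine ⟨G, F, ?_, hF, ?_⟩
  · rw [← h1]; field_simp
  · rw [h3]; field_simp

theorem Sp.zero_iff {a : ZMod sP} (h : Sp 0 a) : a = 0 := by
  obtain ⟨F, G, h1, h2, h3⟩ := h
  rw [zero_mul] at h1
  rw [evK_injective (h1.symm.trans (map_zero evK).symm), map_zero] at h3
  exact (mul_eq_zero.mp h3.symm).resolve_right h2

theorem Sp.int (n : ℤ) : Sp n n := by simpa using Sp.of (n : PP)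

theorem Sp.sub {x y : Kpq} {a b : ZMod sP} (hx : Sp x a) (hy : Sp y b) : Sp (x - y) (a - b) := by
  rw [sub_eq_add_neg, sub_eq_add_neg]; exact hx.add hy.neg

theorem Sp.p : Sp ExcSeries.p 5 := by simpa [evK] using Sp.of polP
theorem Sp.q : Sp ExcSeries.q 7 := by simpa [evK] using Sp.of polQ

theorem Sp.pow {x : Kpq} {a : ZMod sP} (hx : Sp x a) (n : ℕ) : Sp (x ^ n) (a ^ n) := by
  induction n with
  | zero => simpa using Sp.int 1
  | succ n ih => rw [pow_succ, pow_succ]; exact ih.mul hx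

theorem Sp.zpow {x : Kpq} {a : ZMod sP} (hx : Sp x a) (ha : a ≠ 0) (n : ℤ) :
    Sp (x ^ n) (a ^ n) := by
  cases n with
  | ofNat n => simpa using hx.pow n
  | negSucc n => rw [zpow_negSucc, zpow_negSucc]; exact (hx.pow _).inv (pow_ne_zero _ ha)

/-- Powers of `p` and `q` at the point. -/
def sPow (a ai : ℕ) (n : ℤ) : ℕ := (a ^ n.toNat * ai ^ (-n).toNat) % sP

/-- The inverses of `5` and `7`. -/
def sPi : ℕ := 4003
def sQi : ℕ := 7148
def sYi : ℕ := 6463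
def sNui : ℕ := 1431
def sNu1i : ℕ := 2551

/-- Arithmetic at the point. -/
def modP : Mod ℕ where
  int n := (n % sP).toNat
  mon a b := (sPow 5 sPi a * sPow 7 sQi b) % sP
  qi r s := ((sPow 5 sPi r * sPow 7 sQi s + (sP - 1) * (sPow 5 sPi (-r) * sPow 7 sQi (-s)))
    * sYi) % sP
  nui := sNui
  nu1i := sNu1i
  add a b := (a + b) % sP
  mul a b := (a * b) % sP
  neg a := ((sP - 1) * a) % sP

theorem cast_mod (a : ℕ) : ((a % sP : ℕ) : ZMod sP) = a := by simp

theorem sPow_cast (a ai : ℕ) (h : (a * ai) % sP = 1) (n : ℤ) :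
    ((sPow a ai n : ℕ) : ZMod sP) = (a : ZMod sP) ^ n := by
  have h1 : (a : ZMod sP) * ai = 1 := by
    rw [← Nat.cast_mul, ← cast_mod, h, Nat.cast_one]
  have h2 : (ai : ZMod sP) = (a : ZMod sP)⁻¹ := (inv_eq_of_mul_eq_one_right h1).symm
  unfold sPow
  rw [cast_mod]
  push_cast
  rw [h2]
  cases n with
  | ofNat n => simp
  | negSucc n =>
    simp only [zpow_negSucc, Int.toNat_negSucc, pow_zero, one_mul, Int.neg_negSucc]
    rw [inv_pow]
    congr

theorem sP_sub_one : (((sP - 1 : ℕ)) : ZMod sP) = -1 := by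
  rw [Nat.cast_sub (by norm_num), ZMod.natCast_self]; simp

theorem inv_of_mul {a b : ℕ} (h : (a * b) % sP = 1) : (b : ZMod sP) = (a : ZMod sP)⁻¹ := by
  have h1 : (a : ZMod sP) * b = 1 := by
    rw [← Nat.cast_mul, ← cast_mod, h, Nat.cast_one]
  exact (inv_eq_of_mul_eq_one_right h1).symm

theorem Sp.mon (a b : ℤ) : Sp (ExcSeries.mon a b) (modP.mon a b : ℕ) := by
  simp only [modP]
  rw [cast_mod, Nat.cast_mul, sPow_cast _ _ (by decide), sPow_cast _ _ (by decide)]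
  have h5 : ((5 : ℕ) : ZMod sP) ≠ 0 := by decide
  have h7 : ((7 : ℕ) : ZMod sP) ≠ 0 := by decide
  exact (Sp.p.zpow h5 a).mul (Sp.q.zpow h7 b)

theorem Sp.qi (r s : ℤ) : Sp (ExcSeries.qi r s) (modP.qi r s : ℕ) := by
  have h5 : ((5 : ℕ) : ZMod sP) ≠ 0 := by decide
  have h7 : ((7 : ℕ) : ZMod sP) ≠ 0 := by decide
  have hy : Sp (ExcSeries.q - ExcSeries.q⁻¹) ((7 + (sP - 1) * sQi : ℕ) : ZMod sP) := by
    rw [Nat.cast_add, Nat.cast_mul, sP_sub_one, inv_of_mul (a := 7) (b := sQi) (by decide)]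
    have := Sp.q.sub (Sp.q.inv h7)
    convert this using 1
    simp [sub_eq_add_neg]
  have hyi : ((sYi : ℕ) : ZMod sP) = ((7 + (sP - 1) * sQi : ℕ) : ZMod sP)⁻¹ :=
    inv_of_mul (by decide)
  have hne : ((7 + (sP - 1) * sQi : ℕ) : ZMod sP) ≠ 0 := by
    have : (sYi : ZMod sP) ≠ 0 := by decide
    intro h
    rw [h, inv_zero] at hyi
    exact this hyi
  simp only [modP]
  rw [cast_mod, Nat.cast_mul, hyi, Nat.cast_add, Nat.cast_mul, Nat.cast_mul, Nat.cast_mul,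
    sP_sub_one]
  have e1 := (Sp.p.zpow h5 r).mul (Sp.q.zpow h7 s)
  have e2 := (Sp.p.zpow h5 (-r)).mul (Sp.q.zpow h7 (-s))
  have := (e1.sub e2).mul (hy.inv hne)
  convert this using 1
  · rfl
  rw [sPow_cast _ _ (by decide), sPow_cast _ _ (by decide), sPow_cast _ _ (by decide),
    sPow_cast _ _ (by decide)]
  push_cast
  ring

theorem modP_sound : modP.Sound fun x n => Sp x (n : ZMod sP) where
  int n := by
    have h : ((modP.int n : ℕ) : ZMod sP) = n := by
      simp only [modP]
      have : (((n % (sP : ℤ)).toNat : ℤ) : ZMod sP) = n := by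
        rw [Int.toNat_of_nonneg (Int.emod_nonneg _ (by norm_num))]
        exact ZMod.intCast_mod n sP
      exact_mod_cast this
    rw [h]
    exact Sp.int n
  mon := Sp.mon
  qi := Sp.qi
  nui := by
    have h : (modP.qi 1 0 * sNui) % sP = 1 := by decide +kernel
    have := (Sp.qi 1 0).inv (a := (modP.qi 1 0 : ℕ)) (by
      intro h0
      have := congrArg (fun x : ℕ => (x : ZMod sP)) h
      simp only [cast_mod, Nat.cast_mul, h0, zero_mul] at this
      exact absurd this (by decide))
    rwa [← inv_of_mul h] at this
  nu1i := by
    have h : (modP.qi 1 1 * sNu1i) % sP = 1 := by decide +kernel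
    have := (Sp.qi 1 1).inv (a := (modP.qi 1 1 : ℕ)) (by
      intro h0
      have := congrArg (fun x : ℕ => (x : ZMod sP)) h
      simp only [cast_mod, Nat.cast_mul, h0, zero_mul] at this
      exact absurd this (by decide))
    rwa [← inv_of_mul h] at this
  add hx hy := by
    have := hx.add hy
    simp only [modP, cast_mod, Nat.cast_add]
    exact this
  mul hx hy := by
    have := hx.mul hy
    simp only [modP, cast_mod, Nat.cast_mul]
    exact this
  neg hx := by
    have := hx.neg
    simp only [modP, cast_mod, Nat.cast_mul, sP_sub_one, neg_one_mul]
    exact this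

/-- Nonvanishing can be tested at the point. -/
theorem Ex.den_ne (e : Ex) (h : modP.val e % sP ≠ 0) : e.den ≠ 0 := by
  intro h0
  have h1 := modP_sound.val e
  rw [h0] at h1
  have h2 := Sp.zero_iff h1
  rw [ZMod.natCast_eq_zero_iff] at h2
  exact h (Nat.mod_eq_zero_of_dvd h2)

theorem tau_ne : tau ≠ 0 := by rw [← den_tau]; exact Ex.den_ne _ (by decide +kernel)
theorem b1_ne : b1 ≠ 0 := by rw [← den_b1]; exact Ex.den_ne _ (by decide +kernel)

/-! ## Ranks by elimination over the finite field -/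

/-- Sparse vectors: lists of positions and coefficients, with decreasing positions. -/
inductive Row : Type
  | nil
  | cons (k c : ℕ) (r : Row)

/-- The vector given by a sparse row. -/
def Row.vec : Row → ℕ → ZMod sP
  | nil, _ => 0
  | cons k c r, x => (if k = x then (c : ZMod sP) else 0) + Row.vec r x

/-- Insertion of an entry that may vanish. -/
def Row.push (k c : ℕ) (r : Row) : Row :=
  Nat.rec (motive := fun _ => Row) r (fun d _ => cons k (Nat.succ d) r) (Nat.mod c (nat_lit 10007))

/-- Scalar multiplication. -/
def Row.scale (c : ℕ) (r : Row) : Row :=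
  Row.rec (motive := fun _ => Row) nil (fun k a _ ih => push k (Nat.mul c a) ih) r

/-- The combination `x + c y`. -/
def Row.comb (c : ℕ) (x : Row) : Row → Row :=
  Row.rec (motive := fun _ => Row → Row) (scale c)
    (fun k a x ih y => Row.rec (motive := fun _ => Row) (cons k a x)
      (fun l b y ihy => Bool.rec (motive := fun _ => Row)
        (Bool.rec (motive := fun _ => Row) (push l (Nat.mul c b) ihy)
          (push k (Nat.add a (Nat.mul c b)) (ih y)) (Nat.beq k l))
        (cons k a (ih (cons l b y))) (Nat.ble (Nat.succ l) k)) y) x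

/-- Evaluation of all entries before the row is used. -/
def Row.force {α : Type} (r : Row) : (Row → α) → α :=
  Row.rec (motive := fun _ => (Row → α) → α) (fun f => f nil)
    (fun k c _ ih f => ih fun r => f (cons k c r)) r

/-- Binary trees of rows. -/
inductive Tr : Type
  | nil
  | node (v : Row) (l r : Tr)

/-- Look up a row. -/
def Tr.get (t : Tr) : ℕ → Row :=
  Tr.rec (motive := fun _ => ℕ → Row) (fun _ => .nil)
    (fun v _ _ gl gr k => Nat.rec (motive := fun _ => Row) v
      (fun k _ => Bool.rec (motive := fun _ => Row) (gr (Nat.div k (nat_lit 2)))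
        (gl (Nat.div k (nat_lit 2))) (Nat.beq (Nat.mod k (nat_lit 2)) (nat_lit 0))) k) t

/-- Store a row. -/
def Tr.put {α : Type} (x : Row) (n : ℕ) : Tr → ℕ → (Tr → α) → α :=
  Nat.rec (motive := fun _ => Tr → ℕ → (Tr → α) → α) (fun t _ f => f t)
    (fun _ ih t k f => Tr.rec (motive := fun _ => α)
      (Nat.rec (motive := fun _ => α) (f (node x nil nil))
        (fun k _ => Bool.rec (motive := fun _ => α)
          (ih nil (Nat.div k (nat_lit 2)) fun r => f (node .nil nil r))
          (ih nil (Nat.div k (nat_lit 2)) fun l => f (node .nil l nil))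
          (Nat.beq (Nat.mod k (nat_lit 2)) (nat_lit 0))) k)
      (fun v l r _ _ => Nat.rec (motive := fun _ => α) (f (node x l r))
        (fun k _ => Bool.rec (motive := fun _ => α)
          (ih r (Nat.div k (nat_lit 2)) fun r => f (node v l r))
          (ih l (Nat.div k (nat_lit 2)) fun l => f (node v l r))
          (Nat.beq (Nat.mod k (nat_lit 2)) (nat_lit 0))) k) t) n

/-- Reduction of a row by the stored rows, followed by normalisation. -/
def Tr.red (t : Tr) (n : ℕ) : Row → Row :=
  Nat.rec (motive := fun _ => Row → Row) (fun _ => .nil)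
    (fun _ ih r => Row.rec (motive := fun _ => Row) .nil
      (fun k c r _ => Row.rec (motive := fun _ => Row)
        (Row.scale (Nat.mod (Nat.pow c (nat_lit 10005)) (nat_lit 10007)) (.cons k c r))
        (fun l b s _ => (Row.comb (Nat.sub (nat_lit 10007) c) (.cons k c r) (.cons l b s)).force ih)
        (t.get k)) r) n

/-- Elimination. -/
def Tr.elim (L : List Row) : Tr → Tr :=
  List.rec (motive := fun _ => Tr → Tr) (fun t => t)
    (fun r _ ih t => (t.red (nat_lit 2000) r).force fun r =>
      Row.rec (motive := fun _ => Tr) (ih t)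
        (fun k c s _ => t.put (.cons k c s) (nat_lit 12) k ih) r) L

/-- The length of a row. -/
def Row.len (r : Row) : ℕ := Row.rec (motive := fun _ => ℕ) 0 (fun _ _ _ n => Nat.succ n) r

/-- The rows paired with their lengths. -/
def withLen (l : List Row) : List (ℕ × Row) :=
  List.rec (motive := fun _ => List (ℕ × Row)) [] (fun r _ ih => Row.force r fun r =>
    Nat.rec (motive := fun _ => List (ℕ × Row)) ih (fun n _ => (Nat.succ n, r) :: ih) r.len) l

/-- Rows in the order of their lengths. -/
def sortRows (l : List Row) : List Row :=
  (fun m : List (ℕ × Row) => (List.range 60).flatMap fun n =>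
    List.rec (motive := fun _ => List Row) [] (fun x _ ih =>
      Bool.rec (motive := fun _ => List Row) ih (x.2 :: ih) (Nat.beq x.1 n)) m) (withLen l)

/-- The test whether all entries are before `k`. -/
def Row.isBelow (k : ℕ) (r : Row) : Bool :=
  Row.rec (motive := fun _ => Bool) true (fun l _ _ ih => Nat.ble (Nat.succ l) k && ih) r

/-- The test whether the row stored at `k` has its first entry at `k`. -/
def Row.pivot (k : ℕ) : Row → Bool
  | nil => false
  | cons l c r => Nat.beq l k && !(Nat.beq (c % sP) 0) && r.isBelow k

section
variable {Q : (ℕ → ZMod sP) → Prop}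

theorem Row.vec_push (k c : ℕ) (r : Row) (x : ℕ) :
    (Row.push k c r).vec x = (if k = x then (c : ZMod sP) else 0) + r.vec x := by
  have h : ((c % sP : ℕ) : ZMod sP) = c := by simp
  unfold Row.push
  change Row.vec (Nat.rec (motive := fun _ => Row) r _ (c % sP)) x = _
  rcases h0 : c % sP with _ | d
  · rw [h0] at h; simp [← h]
  · rw [h0] at h; simp only [Row.vec, h, Nat.succ_eq_add_one]

theorem Row.vec_scale (c : ℕ) (r : Row) (x : ℕ) : (Row.scale c r).vec x = c * r.vec x := by
  induction r with
  | nil => simp [Row.scale, Row.vec]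
  | cons k a r ih =>
    change (Row.push k (c * a) (Row.scale c r)).vec x = _
    rw [Row.vec_push, ih, Row.vec, mul_add]
    split_ifs <;> simp

theorem Row.vec_comb (c : ℕ) (r s : Row) (x : ℕ) :
    (Row.comb c r s).vec x = r.vec x + c * s.vec x := by
  induction r generalizing s with
  | nil =>
    change (Row.scale c s).vec x = _
    rw [Row.vec_scale, Row.vec, zero_add]
  | cons k a r ih =>
    induction s with
    | nil => change (Row.cons k a r).vec x = _; simp [Row.vec]
    | cons l b s ihs =>
      have e : Row.comb c (cons k a r) (cons l b s) = Bool.rec (motive := fun _ => Row)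
        (Bool.rec (motive := fun _ => Row) (push l (c * b) (Row.comb c (cons k a r) s))
          (push k (a + c * b) (Row.comb c r s)) (Nat.beq k l))
        (cons k a (Row.comb c r (cons l b s))) (Nat.ble (Nat.succ l) k) := rfl
      rw [e]
      cases Nat.ble (Nat.succ l) k
      · cases h : Nat.beq k l
        · simp only
          rw [Row.vec_push, ihs]
          simp only [Row.vec]
          split_ifs <;> push_cast <;> ring
        · simp only
          have h := Nat.eq_of_beq_eq_true h
          subst h
          rw [Row.vec_push, ih]
          simp only [Row.vec]
          split_ifs <;> push_cast <;> ring
      · simp only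
        rw [Row.vec, ih]
        simp only [Row.vec]
        ring

theorem Row.force_eq {α : Type} (r : Row) (f : Row → α) : r.force f = f r := by
  induction r generalizing f with
  | nil => rfl
  | cons k c r ih => exact ih _

theorem Tr.put_eq {α : Type} (x : Row) (n : ℕ) (t : Tr) (k : ℕ) (f : Tr → α) :
    t.put x n k f = f (t.put x n k id) := by
  induction n generalizing α t k f with
  | zero => rfl
  | succ n ih =>
    cases t with
    | nil =>
      cases k with
      | zero => rfl
      | succ k =>
        change Bool.rec (motive := fun _ => α) (Tr.put x n nil (k / 2) _)
          (Tr.put x n nil (k / 2) _) (Nat.beq (k % 2) 0) = f (Bool.rec (motive := fun _ => Tr)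
          (Tr.put x n nil (k / 2) _) (Tr.put x n nil (k / 2) _) (Nat.beq (k % 2) 0))
        cases Nat.beq (k % 2) 0
        · simp only; rw [ih, ih (α := Tr) _ _ fun r => id (node .nil nil r)]; rfl
        · simp only; rw [ih, ih (α := Tr) _ _ fun r => id (node .nil r nil)]; rfl
    | node v l r =>
      cases k with
      | zero => rfl
      | succ k =>
        change Bool.rec (motive := fun _ => α) (Tr.put x n r (k / 2) _)
          (Tr.put x n l (k / 2) _) (Nat.beq (k % 2) 0) = f (Bool.rec (motive := fun _ => Tr)
          (Tr.put x n r (k / 2) _) (Tr.put x n l (k / 2) _) (Nat.beq (k % 2) 0))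
        cases Nat.beq (k % 2) 0
        · simp only; rw [ih, ih (α := Tr) _ _ fun r => id (node v l r)]; rfl
        · simp only; rw [ih, ih (α := Tr) _ _ fun l => id (node v l r)]; rfl

theorem Tr.get_nil (k : ℕ) : Tr.nil.get k = .nil := rfl
theorem Tr.get_succ (v : Row) (l r : Tr) (k : ℕ) : (node v l r).get (k + 1) =
    bif Nat.beq (k % 2) 0 then l.get (k / 2) else r.get (k / 2) := by
  change Bool.rec (motive := fun _ => Row) (r.get (k / 2)) (l.get (k / 2)) (Nat.beq (k % 2) 0) = _
  cases Nat.beq (k % 2) 0 <;> rfl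

theorem Tr.put_succ_nil (x : Row) (n k : ℕ) : nil.put x (n + 1) (k + 1) id =
    bif Nat.beq (k % 2) 0 then node .nil (nil.put x n (k / 2) id) nil
    else node .nil nil (nil.put x n (k / 2) id) := by
  change Bool.rec (motive := fun _ => Tr) (nil.put x n (k / 2) fun r => node .nil nil r)
    (nil.put x n (k / 2) fun l => node .nil l nil) (Nat.beq (k % 2) 0) = _
  cases Nat.beq (k % 2) 0 <;> exact Tr.put_eq _ _ _ _ _

theorem Tr.put_succ_node (x : Row) (n k : ℕ) (v : Row) (l r : Tr) :
    (node v l r).put x (n + 1) (k + 1) id =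
    bif Nat.beq (k % 2) 0 then node v (l.put x n (k / 2) id) r
    else node v l (r.put x n (k / 2) id) := by
  change Bool.rec (motive := fun _ => Tr) (r.put x n (k / 2) fun r => node v l r)
    (l.put x n (k / 2) fun l => node v l r) (Nat.beq (k % 2) 0) = _
  cases Nat.beq (k % 2) 0 <;> exact Tr.put_eq _ _ _ _ _

theorem Tr.get_put (x : Row) (n : ℕ) (t : Tr) (k j : ℕ) :
    (t.put x n k id).get j = x ∨ (t.put x n k id).get j = t.get j ∨
      (t.put x n k id).get j = .nil := by
  induction n generalizing t k j with
  | zero => right; left; rfl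
  | succ n ih =>
    cases t with
    | nil =>
      cases k with
      | zero =>
        change (node x nil nil).get j = x ∨ (node x nil nil).get j = _ ∨ (node x nil nil).get j = _
        cases j with
        | zero => exact Or.inl rfl
        | succ j => rw [Tr.get_succ]; cases Nat.beq (j % 2) 0 <;> exact Or.inr (Or.inl rfl)
      | succ k =>
        rw [Tr.put_succ_nil]
        cases j with
        | zero => cases Nat.beq (k % 2) 0 <;> exact Or.inr (Or.inr rfl)
        | succ j =>
          have := ih Tr.nil (k / 2) (j / 2)
          cases Nat.beq (k % 2) 0 <;>
          simp only [cond_true, cond_false, Tr.get_succ, Tr.get_nil] at * <;>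
          cases Nat.beq (j % 2) 0 <;> simp_all
    | node v l r =>
      cases k with
      | zero =>
        change (node x l r).get j = x ∨ (node x l r).get j = _ ∨ (node x l r).get j = _
        cases j with
        | zero => exact Or.inl rfl
        | succ j => right; left; rw [Tr.get_succ, Tr.get_succ]
      | succ k =>
        rw [Tr.put_succ_node]
        cases j with
        | zero => cases Nat.beq (k % 2) 0 <;> exact Or.inr (Or.inl rfl)
        | succ j =>
          have h1 := ih l (k / 2) (j / 2)
          have h2 := ih r (k / 2) (j / 2)
          cases Nat.beq (k % 2) 0 <;>
          simp only [cond_true, cond_false, Tr.get_succ] at * <;>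
          cases Nat.beq (j % 2) 0 <;> simp_all

theorem Tr.red_mem (hz : Q 0) (hc : ∀ (c : ℕ) f, Q f → Q fun x => c * f x)
    (ha : ∀ f g, Q f → Q g → Q fun x => f x + g x) {t : Tr} (ht : ∀ k, Q (t.get k).vec) (n : ℕ)
    {r : Row} (hr : Q r.vec) : Q (t.red n r).vec := by
  induction n generalizing r with
  | zero => exact hz
  | succ n ih =>
    cases r with
    | nil => exact hz
    | cons k c r =>
      change Q (Row.vec (Row.rec (motive := fun _ => Row) (Row.scale _ (.cons k c r))
        (fun l b s _ => (Row.comb _ (.cons k c r) (.cons l b s)).force (t.red n)) (t.get k)))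
      rcases hb : t.get k with _ | ⟨l, b, s⟩
      · convert hc _ _ hr using 1
        funext x
        exact Row.vec_scale _ _ _
      · simp only [Row.force_eq]
        apply ih
        convert ha _ _ hr (hc _ _ (ht k)) using 1
        funext x
        rw [Row.vec_comb, hb]

theorem Tr.elim_mem (hz : Q 0) (hc : ∀ (c : ℕ) f, Q f → Q fun x => c * f x)
    (ha : ∀ f g, Q f → Q g → Q fun x => f x + g x) (l : List Row) (hl : ∀ r ∈ l, Q (Row.vec r))
    {t : Tr} (ht : ∀ k, Q (t.get k).vec) (k : ℕ) : Q ((Tr.elim l t).get k).vec := by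
  induction l generalizing t with
  | nil => exact ht k
  | cons r l ih =>
    have h1 := Tr.red_mem hz hc ha ht 2000 (hl r List.mem_cons_self)
    have h2 := fun r hr => hl r (List.mem_cons_of_mem _ hr)
    change Q (Row.vec (Tr.get ((t.red 2000 r).force fun r =>
      Row.rec (motive := fun _ => Tr) (Tr.elim l t)
        (fun k c s _ => t.put (.cons k c s) 12 k (Tr.elim l)) r) k))
    rw [Row.force_eq]
    rcases hs : t.red 2000 r with _ | ⟨a, b, s⟩
    · exact ih h2 ht
    · simp only
      rw [Tr.put_eq]
      refine ih h2 fun j => ?_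
      rw [hs] at h1
      rcases Tr.get_put (.cons a b s) 12 t a j with h | h | h
      · rw [h]; exact h1
      · rw [h]; exact ht j
      · rw [h]; exact hz

theorem mem_withLen {l : List Row} {x : ℕ × Row} (h : x ∈ withLen l) : x.2 ∈ l := by
  induction l with
  | nil => cases h
  | cons r l ih =>
    change x ∈ Row.force r fun r => Nat.rec (motive := fun _ => List (ℕ × Row)) (withLen l)
      (fun n _ => (Nat.succ n, r) :: withLen l) r.len at h
    rw [Row.force_eq] at h
    rcases hn : r.len with _ | n
    · rw [hn] at h; exact List.mem_cons_of_mem _ (ih h)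
    · rw [hn] at h
      rcases List.mem_cons.mp h with rfl | h
      · exact List.mem_cons_self
      · exact List.mem_cons_of_mem _ (ih h)

theorem mem_sortRows {l : List Row} {r : Row} (h : r ∈ sortRows l) : r ∈ l := by
  obtain ⟨n, -, h⟩ := List.mem_flatMap.mp h
  have key : ∀ m : List (ℕ × Row), r ∈ List.rec (motive := fun _ => List Row) [] (fun x _ ih =>
      Bool.rec (motive := fun _ => List Row) ih (x.2 :: ih) (Nat.beq x.1 n)) m →
      ∃ x ∈ m, r = x.2 := by
    intro m hm
    induction m with
    | nil => cases hm
    | cons x m ih =>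
      simp only at hm
      cases hb : Nat.beq x.1 n
      · rw [hb] at hm
        obtain ⟨y, hy, e⟩ := ih hm
        exact ⟨y, List.mem_cons_of_mem _ hy, e⟩
      · rw [hb] at hm
        rcases List.mem_cons.mp hm with e | hm
        · exact ⟨x, List.mem_cons_self, e⟩
        · obtain ⟨y, hy, e⟩ := ih hm
          exact ⟨y, List.mem_cons_of_mem _ hy, e⟩
  obtain ⟨x, hx, rfl⟩ := key _ h
  exact mem_withLen hx

theorem Row.vec_of_isBelow {k : ℕ} {r : Row} (h : r.isBelow k = true) (x : ℕ) (hx : k ≤ x) :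
    r.vec x = 0 := by
  induction r with
  | nil => rfl
  | cons l c r ih =>
    change (Nat.ble (Nat.succ l) k && r.isBelow k) = true at h
    rw [Bool.and_eq_true] at h
    have := Nat.le_of_ble_eq_true h.1
    rw [Row.vec, ih h.2, if_neg (by omega), add_zero]

theorem Row.pivot_ne {k : ℕ} {r : Row} (h : r.pivot k = true) :
    r.vec k ≠ 0 ∧ ∀ x, k < x → r.vec x = 0 := by
  cases r with
  | nil => cases h
  | cons l c r =>
    simp only [Row.pivot, Bool.and_eq_true, Bool.not_eq_true'] at h
    obtain ⟨⟨h1, h2⟩, h3⟩ := h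
    have h1 := Nat.eq_of_beq_eq_true h1
    constructor
    · rw [Row.vec, Row.vec_of_isBelow h3 k le_rfl, if_pos h1, add_zero]
      intro h0
      rw [ZMod.natCast_eq_zero_iff] at h0
      rw [Nat.mod_eq_zero_of_dvd h0] at h2
      cases h2
    · intro x hx
      rw [Row.vec, Row.vec_of_isBelow h3 x hx.le, if_neg (by omega), add_zero]

end

/-- A vector modulo `sP` lifts to a subspace. -/
def Lifts (V : Submodule Kpq (ℕ → Kpq)) (f : ℕ → ZMod sP) : Prop :=
  ∃ v ∈ V, ∀ k, Sp (v k) (f k)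

theorem Lifts.zero (V : Submodule Kpq (ℕ → Kpq)) : Lifts V 0 :=
  ⟨0, V.zero_mem, fun _ => by simpa using Sp.int 0⟩

theorem Lifts.add {V : Submodule Kpq (ℕ → Kpq)} {f g : ℕ → ZMod sP} (hf : Lifts V f)
    (hg : Lifts V g) : Lifts V fun x => f x + g x := by
  obtain ⟨v, hv, hv'⟩ := hf
  obtain ⟨w, hw, hw'⟩ := hg
  exact ⟨v + w, V.add_mem hv hw, fun k => (hv' k).add (hw' k)⟩

theorem Lifts.smul {V : Submodule Kpq (ℕ → Kpq)} (c : ℕ) {f : ℕ → ZMod sP} (hf : Lifts V f) :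
    Lifts V fun x => c * f x := by
  obtain ⟨v, hv, hv'⟩ := hf
  exact ⟨(c : Kpq) • v, V.smul_mem _ hv, fun k => Sp.mul (by simpa using Sp.int c) (hv' k)⟩

theorem Sp.sum {ι : Type*} (s : Finset ι) {x : ι → Kpq} {a : ι → ZMod sP}
    (h : ∀ i ∈ s, Sp (x i) (a i)) : Sp (∑ i ∈ s, x i) (∑ i ∈ s, a i) := by
  classical
  induction s using Finset.induction_on with
  | empty => simpa using Sp.int 0
  | insert i s hi ih =>
    rw [Finset.sum_insert hi, Finset.sum_insert hi]
    exact (h i (Finset.mem_insert_self _ _)).add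
      (ih fun j hj => h j (Finset.mem_insert_of_mem hj))

theorem Sp.prod {ι : Type*} (s : Finset ι) {x : ι → Kpq} {a : ι → ZMod sP}
    (h : ∀ i ∈ s, Sp (x i) (a i)) : Sp (∏ i ∈ s, x i) (∏ i ∈ s, a i) := by
  classical
  induction s using Finset.induction_on with
  | empty => simpa using Sp.int 1
  | insert i s hi ih =>
    rw [Finset.prod_insert hi, Finset.prod_insert hi]
    exact (h i (Finset.mem_insert_self _ _)).mul
      (ih fun j hj => h j (Finset.mem_insert_of_mem hj))

theorem Sp.det {n : Type*} [Fintype n] [DecidableEq n] {M : Matrix n n Kpq}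
    {N : Matrix n n (ZMod sP)} (h : ∀ i j, Sp (M i j) (N i j)) : Sp M.det N.det := by
  rw [Matrix.det_apply', Matrix.det_apply']
  exact Sp.sum _ fun σ _ => (Sp.int _).mul (Sp.prod _ fun i _ => h _ _)

theorem exists_unit_minor {V : Submodule Kpq (ℕ → Kpq)} (s : Finset ℕ) (f : ℕ → ℕ → ZMod sP)
    (hf : ∀ k ∈ s, Lifts V (f k)) (hd : ∀ k ∈ s, f k k ≠ 0)
    (hz : ∀ k ∈ s, ∀ x ∈ s, k < x → f k x = 0) :
    ∃ v : s → ℕ → Kpq, (∀ i, v i ∈ V) ∧ (Matrix.of fun i j : s => v i j).det ≠ 0 := by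
  choose v hv hv' using fun k : s => hf k k.2
  refine ⟨v, hv, fun h0 => ?_⟩
  have h1 := Sp.det (M := Matrix.of fun i j : s => v i j)
    (N := Matrix.of fun i j : s => f i j) fun i j => hv' i j
  rw [h0] at h1
  have h2 := Sp.zero_iff h1
  have h3 : (Matrix.of fun i j : s => f i j).BlockTriangular OrderDual.toDual :=
    fun i j hij => hz i i.2 j j.2 hij
  rw [Matrix.det_of_isLowerTriangular _ h3] at h2
  rw [Finset.prod_eq_zero_iff] at h2
  obtain ⟨i, -, hi⟩ := h2
  exact hd i i.2 hi

/-- The vectors that are modulo `sP` stored as pivots. -/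
theorem exists_unit_minor_of_elim {V : Submodule Kpq (ℕ → Kpq)} (l : List Row)
    (hl : ∀ r ∈ l, Lifts V (Row.vec r)) (s : Finset ℕ)
    (hs : ∀ k ∈ s, ((Tr.elim (sortRows l) .nil).get k).pivot k = true) :
    ∃ v : s → ℕ → Kpq, (∀ i, v i ∈ V) ∧ (Matrix.of fun i j : s => v i j).det ≠ 0 := by
  refine exists_unit_minor s (fun k => ((Tr.elim (sortRows l) .nil).get k).vec) ?_ ?_ ?_
  · intro k _
    exact Tr.elim_mem (Lifts.zero V) (fun c f hf => hf.smul c) (fun f g hf hg => hf.add hg) _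
      (fun r hr => hl r (mem_sortRows hr)) (t := .nil) (fun _ => Lifts.zero V) k
  · exact fun k hk => (Row.pivot_ne (hs k hk)).1
  · exact fun k hk x _ hx => (Row.pivot_ne (hs k hk)).2 x hx

/-- The relations between vectors `Φ k`, `k ∈ S`. -/
def relSpace {B : Type*} [AddCommGroup B] [Module Kpq B] (Φ : ℕ → B) (S : Finset ℕ) :
    Submodule Kpq (ℕ → Kpq) where
  carrier := {v | (∀ k ∉ S, v k = 0) ∧ ∑ k ∈ S, v k • Φ k = 0}
  zero_mem' := by simp
  add_mem' := by
    rintro v w ⟨h1, h2⟩ ⟨h3, h4⟩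
    refine ⟨fun k hk => by simp [h1 k hk, h3 k hk], ?_⟩
    simp [add_smul, Finset.sum_add_distrib, h2, h4]
  smul_mem' := by
    rintro c v ⟨h1, h2⟩
    refine ⟨fun k hk => by simp [h1 k hk], ?_⟩
    simp [mul_smul, ← Finset.smul_sum, h2]

theorem mem_span_of_minor {B : Type*} [AddCommGroup B] [Module Kpq B] {Φ : ℕ → B} {S s : Finset ℕ}
    (hs : s ⊆ S) {v : s → ℕ → Kpq} (hv : ∀ i, v i ∈ relSpace Φ S)
    (hd : (Matrix.of fun i j : s => v i j).det ≠ 0) :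
    ∀ k ∈ S, Φ k ∈ Submodule.span Kpq (Φ '' (S \ s : Finset ℕ)) := by
  set W := Submodule.span Kpq (Φ '' (S \ s : Finset ℕ))
  set M := Matrix.of fun i j : s => v i j
  have hN : ∀ k ∈ S \ s, Φ k ∈ W := fun k hk => Submodule.subset_span ⟨k, by simpa using hk, rfl⟩
  have h1 : ∀ i : s, ∑ j : s, M i j • Φ j ∈ W := by
    intro i
    have h2 := (hv i).2
    rw [← Finset.sum_sdiff hs] at h2
    have h3 : ∑ j : s, M i j • Φ j = ∑ k ∈ s, v i k • Φ k :=
      Finset.sum_coe_sort s fun k => v i k • Φ k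
    rw [h3, eq_neg_of_add_eq_zero_right h2]
    exact W.neg_mem (W.sum_mem fun k hk => W.smul_mem _ (hN k hk))
  intro k hk
  by_cases hks : k ∈ s
  · have h4 : Φ k = ∑ i : s, M⁻¹ ⟨k, hks⟩ i • ∑ j : s, M i j • Φ j := by
      simp only [Finset.smul_sum, smul_smul]
      rw [Finset.sum_comm]
      simp only [← Finset.sum_smul]
      have h5 : ∀ j, ∑ i, M⁻¹ ⟨k, hks⟩ i * M i j = (1 : Matrix s s Kpq) ⟨k, hks⟩ j := by
        intro j
        rw [← Matrix.nonsing_inv_mul M (isUnit_iff_ne_zero.mpr hd), Matrix.mul_apply]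
      simp only [h5, Matrix.one_apply, ite_smul, one_smul, zero_smul]
      simp
    rw [h4]
    exact W.sum_mem fun i _ => W.smul_mem _ (h1 i)
  · exact hN k (by simp [hk, hks])

theorem linearIndependent_of_minor {m : ℕ} {r : Fin m → ℕ → Kpq} {s : Finset ℕ} (hs : m ≤ s.card)
    {v : s → ℕ → Kpq} (hv : ∀ i, v i ∈ Submodule.span Kpq (Set.range r))
    (hd : (Matrix.of fun i j : s => v i j).det ≠ 0) : LinearIndependent Kpq r := by
  have h1 : LinearIndependent Kpq v := by
    have h2 := Matrix.linearIndependent_rows_of_det_ne_zero hd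
    exact LinearIndependent.of_comp (LinearMap.funLeft Kpq Kpq fun j : s => (j : ℕ)) h2
  rw [linearIndependent_iff_card_le_finrank_span]
  set W := Submodule.span Kpq (Set.range r)
  have : FiniteDimensional Kpq W := FiniteDimensional.span_of_finite _ (Set.finite_range r)
  have h3 : LinearIndependent Kpq (fun i => (⟨v i, hv i⟩ : W)) :=
    LinearIndependent.of_comp W.subtype h1
  have h4 := h3.fintype_card_le_finrank
  rw [Fintype.card_coe] at h4
  rw [Fintype.card_fin]
  exact hs.trans h4

/-! ## Words in the generators

A word is a list of blocks `1, 2, 3`, standing for `h, h², k`, where the generators with index `0`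
(`false`) and `1` (`true`) alternate and the last block has index `1`. -/

/-- Combinations of words. -/
inductive Cmb : Type
  | nil
  | cons (c : ℕ) (w : List ℕ) (L : Cmb)

/-- Concatenation. -/
def Cmb.app (L M : Cmb) : Cmb :=
  Cmb.rec (motive := fun _ => Cmb) M (fun c w _ ih => cons c w ih) L

/-- The index of the first block. -/
def headIx (w : List ℕ) : Bool :=
  List.rec (motive := fun _ => Bool) false
    (fun _ _ ih => Bool.rec (motive := fun _ => Bool) true false ih) w

/-- Products of two blocks with the same index; the block `0` stands for `1`. -/
def mulBlk : ℕ → ℕ → List (ℕ × ℕ)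
  | 1, 1 => [(1, 2)]
  | 1, 2 => [(3394, 2), (8348, 1), (7534, 0), (6622, 3)]
  | 2, 1 => [(3394, 2), (8348, 1), (7534, 0), (6622, 3)]
  | 2, 2 => [(9527, 2), (822, 1), (2511, 0), (3355, 3)]
  | 1, 3 => [(5666, 3)]
  | 3, 1 => [(5666, 3)]
  | 2, 3 => [(1100, 3)]
  | 3, 2 => [(1100, 3)]
  | 3, 3 => [(1557, 3)]
  | _, _ => []

/-- The values of the blocks on the eigenspaces. -/
def eigBlk : ℕ → ℕ → ℕ
  | 0, 1 => 3875
  | 0, 2 => 5125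
  | 1, 1 => 1179
  | 1, 2 => 9075
  | 2, 1 => 8347
  | 2, 2 => 3675
  | 3, 1 => 5666
  | 3, 2 => 1100
  | 3, 3 => 1557
  | _, _ => 0

/-- The eigenvalues of `h`. -/
def eigH : ℕ → Ex
  | 0 => eXi
  | 1 => eZeta
  | 2 => eZetas
  | 3 => eTau
  | _ => 0

/-- The eigenvalues of `k`. -/
def eigK : ℕ → Ex
  | 3 => ePhi
  | _ => 0

/-- Add the word `w`, with a block in front, to a combination. -/
def Cmb.push (c k : ℕ) (w : List ℕ) (L : Cmb) : Cmb :=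
  Nat.rec (motive := fun _ => Cmb) (cons c w L) (fun k _ => cons c (Nat.succ k :: w) L) k

/-- Multiply a word by a block from the left, and add it to a combination. -/
def lmul (t : ℕ) (sd : Bool) (b c : ℕ) (w : List ℕ) (L : Cmb) : Cmb :=
  Bool.rec (motive := fun _ => Cmb) (Cmb.cons c (b :: w) L)
    (List.rec (motive := fun _ => Cmb) (Cmb.cons (Nat.mul c (eigBlk t b)) [] L)
      (fun a w _ => List.rec (motive := fun _ => Cmb) L
        (fun x _ ih => Cmb.push (Nat.mod (Nat.mul c x.1) (nat_lit 10007)) x.2 w ih) (mulBlk b a)) w)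
    (Bool.rec (motive := fun _ => Bool) (!sd) sd (headIx w))

/-- Multiply a combination by a block from the left. -/
def lmulL (t : ℕ) (x : Bool × ℕ) (L : Cmb) : Cmb :=
  Cmb.rec (motive := fun _ => Cmb) .nil (fun c w _ ih => lmul t x.1 x.2 c w ih) L

/-- Multiply a combination by several blocks. -/
def lmulW (t : ℕ) (u : List (Bool × ℕ)) (L : Cmb) : Cmb :=
  List.rec (motive := fun _ => Cmb) L (fun x _ ih => lmulL t x ih) u

/-- The number of a word. -/
def encW (w : List ℕ) : ℕ → ℕ :=
  List.rec (motive := fun _ => ℕ → ℕ) (fun n => n)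
    (fun k _ ih n => ih (Nat.add (Nat.mul (nat_lit 4) n) k)) w

/-- The word with a given number. -/
def decW (f : ℕ) : ℕ → List ℕ → List ℕ :=
  Nat.rec (motive := fun _ => ℕ → List ℕ → List ℕ) (fun _ w => w)
    (fun _ ih n w => Bool.rec (motive := fun _ => List ℕ)
      (ih (Nat.div n (nat_lit 4)) (Nat.mod n (nat_lit 4) :: w)) w (Nat.beq n (nat_lit 0))) f

/-- Equality of words. -/
def eqW (w : List ℕ) : List ℕ → Bool :=
  List.rec (motive := fun _ => List ℕ → Bool)
    (fun v => List.rec (motive := fun _ => Bool) true (fun _ _ _ => false) v)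
    (fun a _ ih v => List.rec (motive := fun _ => Bool) false
      (fun b v _ => Bool.rec (motive := fun _ => Bool) false (ih v) (Nat.beq a b)) v) w

/-- Whether a block `k` occurs. -/
def hasK (w : List ℕ) : Bool :=
  List.rec (motive := fun _ => Bool) false
    (fun a _ ih => Bool.rec (motive := fun _ => Bool) ih true (Nat.beq a (nat_lit 3))) w

/-- Whether a word vanishes because of the end factors. -/
def dropW (st dK : Bool) (w : List ℕ) : Bool :=
  List.rec (motive := fun _ => Bool) (!st) (fun _ _ _ => dK && hasK w) w

/-- Add the entry of a word. -/
def addW (st dK : Bool) (S c : ℕ) (w : List ℕ) (o : Option (List Row)) : Option (List Row) :=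
  Bool.rec (motive := fun _ => Option (List Row))
    ((fun k => Bool.rec (motive := fun _ => Option (List Row)) none
      (o.map fun l => Row.push k c .nil :: l)
      (Nat.testBit S k && Nat.ble k 1023 && eqW (decW 6 k []) w)) (encW w 0))
    o (dropW st dK w)

/-- The entries of a combination of words. -/
def finL (s : ℕ) (st dK : Bool) (S : ℕ) (L : Cmb) : Option (List Row) :=
  Cmb.rec (motive := fun _ => Option (List Row)) (some [])
    (fun c w _ ih => List.rec (motive := fun _ => Option (List Row)) (addW st dK S c w ih)
      (fun b v _ => Bool.rec (motive := fun _ => Option (List Row)) (addW st dK S c w ih)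
        (addW st dK S (Nat.mod (Nat.mul c (eigBlk s b)) (nat_lit 10007)) v ih) (headIx v)) w) L

/-- Sums of consecutive rows. -/
def pairUp (l : List Row) : Row → List Row :=
  List.rec (motive := fun _ => Row → List Row) (fun p => [p])
    (fun a _ ih p => Row.rec (motive := fun _ => List Row) (ih a)
      (fun k c r _ => Row.comb 1 (.cons k c r) a :: ih .nil) p) l

/-- The sum of rows. -/
def sumRows (n : ℕ) : List Row → Row :=
  Nat.rec (motive := fun _ => List Row → Row)
    (fun l => List.rec (motive := fun _ => Row) .nil (fun a _ ih => Row.comb 1 a ih) l)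
    (fun _ ih l => ih (pairUp l .nil)) n

/-- The product of a relation and a word. -/
def relMul (t : ℕ) (rel : List (ℕ × List (Bool × ℕ))) (v : List ℕ) : Cmb :=
  List.rec (motive := fun _ => Cmb) .nil
    (fun x _ ih => (lmulW t x.2 (.cons x.1 v .nil)).app ih) rel

/-- The product of a word, a relation and a word. -/
def mkRow (s t : ℕ) (dK : Bool) (S : ℕ) (rel : List (ℕ × List (Bool × ℕ))) (u : List (Bool × ℕ))
    (v : List ℕ) : Row :=
  ((finL s (Nat.beq s t) dK S (lmulW t u (relMul t rel v))).map (sumRows 6)).getD .nil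

/-- All words of a given length. -/
def words (letters : List ℕ) : ℕ → List (List ℕ)
  | 0 => [[]]
  | n + 1 => letters.flatMap fun b => (words letters n).map fun w => b :: w

/-- Blocks with alternating indices, beginning with the index `1`. -/
def sided : Bool → List ℕ → List (Bool × ℕ)
  | _, [] => []
  | i, b :: w => (i, b) :: sided (!i) w

/-- The relations multiplied with words. -/
def mkRows (s t : ℕ) (dK : Bool) (S : ℕ) (rels : List (List (ℕ × List (Bool × ℕ))))
    (letters : List ℕ) : List Row :=
  [(0, 0), (0, 1), (0, 2), (0, 3), (1, 0), (1, 1), (1, 2), (2, 0), (2, 1), (3, 0)].flatMap fun n =>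
    (words letters n.1).flatMap fun u => (words letters n.2).flatMap fun v =>
      rels.map fun rel => mkRow s t dK S rel (sided true u) v

/-- The test whether elimination leaves only the words in `N`. -/
def wordCheck (s t : ℕ) (dK : Bool) (S : ℕ) (rels : List (List (ℕ × List (Bool × ℕ))))
    (letters : List ℕ) (N : List ℕ) : Bool :=
  (fun T : Tr => (List.range 1024).all fun k =>
    !(S.testBit k) || N.contains k || (T.get k).pivot k)
    (Tr.elim (sortRows (mkRows s t dK S rels letters)) .nil)

/-- The quartic relation, multiplied by `b₀τ`, without the terms that contain `U`. -/
def quarticPairs : List (Ex × List (Bool × ℕ) × List (Bool × ℕ)) :=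
  [(eB0 * eTau, [(true, 1), (true, 1), (false, 1), (true, 1)], [(false, 1), (false, 1), (true, 1), (false, 1)]),
   (-(eTau * (eC2 - eC1)), [(false, 1), (false, 1), (true, 1), (false, 3)], [(true, 1), (true, 1), (false, 1), (true, 3)]),
   (-(eB0 * eTau * eC15), [(true, 1), (false, 1), (true, 1)], [(false, 1), (true, 1), (false, 1)]),
   (-(eB0 * eTau * eC11), [(false, 1), (true, 1), (true, 1)], [(true, 1), (false, 1), (false, 1)]),
   (-(eB0 * eTau * eC12), [(true, 1), (true, 1), (false, 1)], [(false, 1), (false, 1), (true, 1)]),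
   (-(eB0 * eTau * eC10), [(true, 3), (false, 1), (true, 1)], [(false, 3), (true, 1), (false, 1)]),
   (-(eTau * (eB0 * eC12 + (eC2 - eC1) * eB4)), [(true, 1), (false, 1), (true, 3)], [(false, 1), (true, 1), (false, 3)]),
   (-(eB0 * eC6 + (eC2 - eC1) * eB2), [(true, 3), (false, 1), (true, 3)], [(false, 3), (true, 1), (false, 3)]),
   (-(eB0 * eTau * eC6), [(true, 3), (false, 1)], [(false, 3), (true, 1)]),
   (-(eTau * (eB0 * eC7 - (eC2 - eC1) * eB3)), [(false, 1), (true, 3)], [(true, 1), (false, 3)]),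
   (-(eB0 * eTau * (eC5 - eC7)), [(false, 1), (true, 1)], [(true, 1), (false, 1)]),
   (-(eB0 * eTau * eC1), [(false, 1)], [(true, 1)])]

/-- The quartic relation as a combination of words. -/
def quarticE : List (Ex × List (Bool × ℕ)) :=
  quarticPairs.flatMap fun x => [(x.1, x.2.1), (-x.1, x.2.2)]

/-- The coefficients of the quartic relation modulo `sP`. -/
def quarticN : List ℕ := [7789, 2218, 6588, 3419, 2402, 7605, 5748, 4259, 4485, 5522, 6378, 3629,
  8519, 1488, 4122, 5885, 3698, 6309, 3008, 6999, 9305, 702, 3977, 6030]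

/-- The relation `H₁K₂H₁ = H₂K₁H₂`. -/
def hkhE : List (Ex × List (Bool × ℕ)) :=
  [(1, [(false, 1), (true, 3), (false, 1)]), (-1, [(true, 1), (false, 3), (true, 1)])]

/-- The reversed relation. -/
def revE {α : Type} (L : List (α × List (Bool × ℕ))) : List (α × List (Bool × ℕ)) :=
  L.map fun x => (x.1, x.2.reverse)

/-- The relations modulo `sP`. -/
def relsN : List (List (ℕ × List (Bool × ℕ))) :=
  [quarticN.zip (quarticE.map Prod.snd), [1, 10006].zip (hkhE.map Prod.snd)]

/-- The occurring words. -/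
def wordSet : ℕ := 0x22e022e0eee0000022e022e0eee00000eee0eee0eee00000000000000000000022e022e0eee0000022e022e0eee00000eee0eee0eee000000000000000000000eee0eee0eee00000eee0eee0eee00000eee0eee0eee000000000000000000000000000000000000000000000000000000000000000000000eee0eee0eee0000e
def wordSetT : ℕ := 0x260066000000000066006600000000000000000000000000000000000000000066006600000000006600660000000000000000000000000000000000000000000000000000000000000000000000000066006600006

/-! ### Correctness -/

section
variable {B : Type*} [Ring B] [Algebra Kpq B]

theorem Sp.of_val (e : Ex) (n : ℕ) (h : modP.val e % sP = n) : Sp e.den (n : ZMod sP) := by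
  rw [← h, cast_mod]
  exact modP_sound.val e

/-- The generators with a given index. -/
def gH (g : ℕ → B) (sd : Bool) : B := g (bif sd then 1 else 0)
def gK (g : ℕ → B) (sd : Bool) : B := g (bif sd then 3 else 2)

/-- The relations in the subalgebra generated by `h` and `k`. -/
structure BlockRel (g : ℕ → B) : Prop where
  hk : ∀ sd, gH g sd * gK g sd = eTau.den • gK g sd
  kh : ∀ sd, gK g sd * gH g sd = eTau.den • gK g sd
  kk : ∀ sd, gK g sd * gK g sd = ePhi.den • gK g sd
  cub : ∀ sd, gH g sd * gH g sd * gH g sd = eB4.den • (gH g sd * gH g sd) - eB3.den • gH g sd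
    + eB0.den • (1 : B) + eB2.den • gK g sd

/-- The value of a block. -/
def blk (g : ℕ → B) (sd : Bool) : ℕ → B
  | 1 => gH g sd
  | 2 => gH g sd * gH g sd
  | 3 => gK g sd
  | _ => 0

/-- The value of a block, the block `0` standing for `1`. -/
def blk1 (g : ℕ → B) (sd : Bool) : ℕ → B
  | 0 => 1
  | k + 1 => blk g sd (k + 1)

/-- The value of a word. -/
def wordVal (g : ℕ → B) : List ℕ → B
  | [] => 1
  | b :: w => blk g (!headIx w) b * wordVal g w

/-- The value of a list of blocks. -/
def blks (g : ℕ → B) (u : List (Bool × ℕ)) : B := (u.map fun x => blk g x.1 x.2).prod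

/-- The value of a combination of lists of blocks. -/
def relVal (g : ℕ → B) (L : List (Ex × List (Bool × ℕ))) : B :=
  (L.map fun x => x.1.den • blks g x.2).sum

theorem headIx_cons (b : ℕ) (w : List ℕ) : headIx (b :: w) = !headIx w := by
  change Bool.rec (motive := fun _ => Bool) true false (headIx w) = _
  cases headIx w <;> rfl

theorem mulBlk_val {g : ℕ → B} (hg : BlockRel g) (sd : Bool) (b a : ℕ) :
    ∃ xs : List (Kpq × ℕ), List.Forall₂ (fun x c => Sp x.1 (c.1 : ℕ) ∧ x.2 = c.2) xs (mulBlk b a) ∧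
      blk g sd b * blk g sd a = (xs.map fun x => x.1 • blk1 g sd x.2).sum := by
  have hk := hg.hk sd
  have kh := hg.kh sd
  have kk := hg.kk sd
  have cub := hg.cub sd
  set h := gH g sd
  set k := gK g sd
  have n0 := Sp.of_val eB0 7534 (by decide +kernel)
  have n2 := Sp.of_val eB2 6622 (by decide +kernel)
  have n3 := Sp.of_val (-eB3) 8348 (by decide +kernel)
  have n4 := Sp.of_val eB4 3394 (by decide +kernel)
  have nt := Sp.of_val eTau 5666 (by decide +kernel)
  have nt2 := Sp.of_val (eTau * eTau) 1100 (by decide +kernel)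
  have np := Sp.of_val ePhi 1557 (by decide +kernel)
  have m2 := Sp.of_val (eB4 * eB4 - eB3) 9527 (by decide +kernel)
  have m1 := Sp.of_val (eB0 - eB4 * eB3) 822 (by decide +kernel)
  have m0 := Sp.of_val (eB4 * eB0) 2511 (by decide +kernel)
  have m3 := Sp.of_val (eB4 * eB2 + eB2 * eTau) 3355 (by decide +kernel)
  have o1 : Sp 1 ((1 : ℕ) : ZMod sP) := by simpa using Sp.int 1
  have c21 : h * h * h = eB4.den • (h * h) + ((-eB3).den • h + (eB0.den • (1 : B) + eB2.den • k)) := by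
    rw [cub, Ex.den_neg, neg_smul]; abel
  have hhk : h * h * k = (eTau * eTau).den • k := by
    rw [mul_assoc, hk, mul_smul_comm, hk, smul_smul, Ex.den_mul]
  have khh : k * (h * h) = (eTau * eTau).den • k := by
    rw [← mul_assoc, kh, smul_mul_assoc, kh, smul_smul, Ex.den_mul]
  have c22 : h * h * (h * h) = (eB4 * eB4 - eB3).den • (h * h)
      + ((eB0 - eB4 * eB3).den • h + ((eB4 * eB0).den • (1 : B) + (eB4 * eB2 + eB2 * eTau).den • k)) := by
    rw [← mul_assoc, cub, add_mul, add_mul, sub_mul, smul_mul_assoc, cub, smul_mul_assoc,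
      smul_mul_assoc, smul_mul_assoc, kh, one_mul]
    simp only [Ex.den_add, Ex.den_mul, Ex.den_sub, smul_add, smul_sub, smul_smul, add_smul,
      sub_smul]
    abel
  match b, a with
  | 0, _ => exact ⟨[], .nil, by simp [blk]⟩
  | (n + 4), _ => exact ⟨[], .nil, by simp [blk]⟩
  | 1, 0 => exact ⟨[], .nil, by simp [blk]⟩
  | 2, 0 => exact ⟨[], .nil, by simp [blk]⟩
  | 3, 0 => exact ⟨[], .nil, by simp [blk]⟩
  | 1, (n + 4) => exact ⟨[], .nil, by simp [blk]⟩
  | 2, (n + 4) => exact ⟨[], .nil, by simp [blk]⟩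
  | 3, (n + 4) => exact ⟨[], .nil, by simp [blk]⟩
  | 1, 1 => exact ⟨[(1, 2)], .cons ⟨o1, rfl⟩ .nil, by simp [blk, blk1]⟩
  | 2, 1 =>
    refine ⟨[(eB4.den, 2), ((-eB3).den, 1), (eB0.den, 0), (eB2.den, 3)],
      .cons ⟨n4, rfl⟩ (.cons ⟨n3, rfl⟩ (.cons ⟨n0, rfl⟩ (.cons ⟨n2, rfl⟩ .nil))), ?_⟩
    simpa only [List.map_cons, List.map_nil, List.sum_cons, List.sum_nil, add_zero, blk, blk1]
      using c21
  | 1, 2 =>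
    refine ⟨[(eB4.den, 2), ((-eB3).den, 1), (eB0.den, 0), (eB2.den, 3)],
      .cons ⟨n4, rfl⟩ (.cons ⟨n3, rfl⟩ (.cons ⟨n0, rfl⟩ (.cons ⟨n2, rfl⟩ .nil))), ?_⟩
    simpa only [List.map_cons, List.map_nil, List.sum_cons, List.sum_nil, add_zero, blk, blk1,
      mul_assoc] using c21
  | 2, 2 =>
    refine ⟨[((eB4 * eB4 - eB3).den, 2), ((eB0 - eB4 * eB3).den, 1), ((eB4 * eB0).den, 0),
      ((eB4 * eB2 + eB2 * eTau).den, 3)], .cons ⟨m2, rfl⟩ (.cons ⟨m1, rfl⟩ (.cons ⟨m0, rfl⟩ (.cons ⟨m3, rfl⟩ .nil))), ?_⟩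
    simpa only [List.map_cons, List.map_nil, List.sum_cons, List.sum_nil, add_zero, blk, blk1]
      using c22
  | 1, 3 => exact ⟨[(eTau.den, 3)], .cons ⟨nt, rfl⟩ .nil, hk.trans (add_zero _).symm⟩
  | 3, 1 => exact ⟨[(eTau.den, 3)], .cons ⟨nt, rfl⟩ .nil, kh.trans (add_zero _).symm⟩
  | 2, 3 => exact ⟨[((eTau * eTau).den, 3)], .cons ⟨nt2, rfl⟩ .nil, hhk.trans (add_zero _).symm⟩
  | 3, 2 => exact ⟨[((eTau * eTau).den, 3)], .cons ⟨nt2, rfl⟩ .nil, khh.trans (add_zero _).symm⟩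
  | 3, 3 => exact ⟨[(ePhi.den, 3)], .cons ⟨np, rfl⟩ .nil, kk.trans (add_zero _).symm⟩

theorem eigBlk_val (t b : ℕ) : ∃ x : Kpq, Sp x (eigBlk t b : ℕ) ∧
    x = match b with
      | 1 => (eigH t).den | 2 => (eigH t).den * (eigH t).den | 3 => (eigK t).den | _ => 0 := by
  have z0 : Sp 0 ((0 : ℕ) : ZMod sP) := by simpa using Sp.int 0
  have e1 := Sp.of_val eXi 3875 (by decide +kernel)
  have e2 := Sp.of_val (eXi * eXi) 5125 (by decide +kernel)
  have e3 := Sp.of_val eZeta 1179 (by decide +kernel)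
  have e4 := Sp.of_val (eZeta * eZeta) 9075 (by decide +kernel)
  have e5 := Sp.of_val eZetas 8347 (by decide +kernel)
  have e6 := Sp.of_val (eZetas * eZetas) 3675 (by decide +kernel)
  have e7 := Sp.of_val eTau 5666 (by decide +kernel)
  have e8 := Sp.of_val (eTau * eTau) 1100 (by decide +kernel)
  have e9 := Sp.of_val ePhi 1557 (by decide +kernel)
  refine ⟨_, ?_, rfl⟩
  match t, b with
  | 0, 0 | 1, 0 | 2, 0 | 3, 0 | (n + 4), 0 => exact z0
  | 0, (m + 4) | 1, (m + 4) | 2, (m + 4) | 3, (m + 4) | (n + 4), (m + 4) => exact z0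
  | 0, 1 => exact e1
  | 0, 2 => exact e2
  | 0, 3 => simpa [eigK, eigBlk] using z0
  | 1, 1 => exact e3
  | 1, 2 => exact e4
  | 1, 3 => simpa [eigK, eigBlk] using z0
  | 2, 1 => exact e5
  | 2, 2 => exact e6
  | 2, 3 => simpa [eigK, eigBlk] using z0
  | 3, 1 => exact e7
  | 3, 2 => exact e8
  | 3, 3 => exact e9
  | (n + 4), 1 => simpa [eigH, eigBlk] using z0
  | (n + 4), 2 => simpa [eigH, eigBlk] using z0
  | (n + 4), 3 => simpa [eigK, eigBlk] using z0

/-- `z` is a combination of the `Φ w` with coefficients that reduce to those of `L`. -/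
inductive Cmb.Rep (Φ : List ℕ → B) : Cmb → B → Prop
  | nil : Rep Φ .nil 0
  | cons {x : Kpq} {c : ℕ} {L : Cmb} {z : B} (w : List ℕ) (h : Sp x (c : ZMod sP))
      (hL : Rep Φ L z) : Rep Φ (.cons c w L) (x • Φ w + z)

theorem Cmb.Rep.app {Φ : List ℕ → B} {L M : Cmb} {z z' : B} (h : L.Rep Φ z) (h' : M.Rep Φ z') :
    (L.app M).Rep Φ (z + z') := by
  induction h with
  | nil => rw [zero_add]; exact h'
  | cons w h _ ih => rw [add_assoc]; exact Rep.cons w h ih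

theorem Sp.mod {x : Kpq} {c : ℕ} (h : Sp x (c : ZMod sP)) :
    Sp x ((Nat.mod c (nat_lit 10007) : ℕ) : ZMod sP) := by
  change Sp x ((c % sP : ℕ) : ZMod sP)
  rwa [cast_mod]

theorem Sp.natMul {x y : Kpq} {c d : ℕ} (h : Sp x (c : ZMod sP)) (h' : Sp y (d : ZMod sP)) :
    Sp (x * y) ((Nat.mul c d : ℕ) : ZMod sP) := by
  change Sp _ ((c * d : ℕ) : ZMod sP)
  rw [Nat.cast_mul]
  exact h.mul h'

/-- `y` is an eigenvector for the generators with index `0`. -/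
structure EigR (g : ℕ → B) (t : ℕ) (y : B) : Prop where
  h : gH g false * y = (eigH t).den • y
  k : gK g false * y = (eigK t).den • y

/-- `x` is an eigenvector for right multiplication by the generators with index `0`. -/
structure EigL (g : ℕ → B) (s : ℕ) (x : B) : Prop where
  h : x * gH g false = (eigH s).den • x
  k : x * gK g false = (eigK s).den • x

theorem EigR.blk {g : ℕ → B} {t : ℕ} {y : B} (h : EigR g t y) (b : ℕ) :
    ∃ x : Kpq, Sp x (eigBlk t b : ℕ) ∧ blk g false b * y = x • y := by
  obtain ⟨x, hx, e⟩ := eigBlk_val t b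
  refine ⟨x, hx, ?_⟩
  rw [e]
  match b with
  | 0 => simp [ExcSeries.blk]
  | 1 => exact h.h
  | 2 => simp only [ExcSeries.blk]; rw [mul_assoc, h.h, mul_smul_comm, h.h, smul_smul]
  | 3 => exact h.k
  | (n + 4) => simp [ExcSeries.blk]

theorem EigL.blk {g : ℕ → B} {s : ℕ} {x : B} (h : EigL g s x) (b : ℕ) :
    ∃ c : Kpq, Sp c (eigBlk s b : ℕ) ∧ x * blk g false b = c • x := by
  obtain ⟨c, hc, e⟩ := eigBlk_val s b
  refine ⟨c, hc, ?_⟩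
  rw [e]
  match b with
  | 0 => simp [ExcSeries.blk]
  | 1 => exact h.h
  | 2 => simp only [ExcSeries.blk]; rw [← mul_assoc, h.h, smul_mul_assoc, h.h, smul_smul]
  | 3 => exact h.k
  | (n + 4) => simp [ExcSeries.blk]

variable {g : ℕ → B} {t : ℕ} {y : B}

theorem Cmb.Rep.push {L : Cmb} {z : B} {x : Kpq} {c : ℕ} (hx : Sp x (c : ZMod sP)) (k : ℕ)
    (w : List ℕ) (h : L.Rep (fun w => wordVal g w * y) z) :
    (Cmb.push c k w L).Rep (fun w => wordVal g w * y)
      (x • (blk1 g (!headIx w) k * (wordVal g w * y)) + z) := by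
  cases k with
  | zero =>
    have := Rep.cons w hx h
    simp only [blk1, one_mul]
    exact this
  | succ k =>
    have := Rep.cons ((k + 1) :: w) hx h
    simp only [wordVal, mul_assoc] at this
    exact this

theorem lmul_rep (hg : BlockRel g) (hy : EigR g t y) (sd : Bool) (b : ℕ) {c : ℕ} {x : Kpq}
    (hx : Sp x (c : ZMod sP)) (w : List ℕ) {L : Cmb} {z : B}
    (h : L.Rep (fun w => wordVal g w * y) z) :
    (lmul t sd b c w L).Rep (fun w => wordVal g w * y)
      (x • (blk g sd b * (wordVal g w * y)) + z) := by
  by_cases hsd : sd = headIx w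
  · subst hsd
    have e : Bool.rec (motive := fun _ => Bool) (!headIx w) (headIx w) (headIx w) = true := by
      cases headIx w <;> rfl
    unfold lmul
    rw [e]
    cases w with
    | nil =>
      obtain ⟨d, hd, e⟩ := hy.blk b
      have := Cmb.Rep.cons (Φ := fun w => wordVal g w * y) [] (hx.natMul hd) h
      convert this using 2
      change x • (blk g false b * (1 * y)) = _
      simp only [wordVal, one_mul]
      rw [e, smul_smul]
    | cons a w =>
      simp only
      obtain ⟨xs, h1, h2⟩ := mulBlk_val hg (!headIx w) b a
      have e2 : blk g (headIx (a :: w)) b * (wordVal g (a :: w) * y)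
          = (xs.map fun x => x.1 • blk1 g (!headIx w) x.2).sum * (wordVal g w * y) := by
        rw [← h2, headIx_cons, wordVal]; simp only [mul_assoc]
      rw [e2]
      clear e2 h2 e
      generalize mulBlk b a = l at h1
      induction h1 with
      | nil => simpa using h
      | @cons d e l1 l2 hd _ ih =>
        have := Cmb.Rep.push (Sp.mod (hx.natMul hd.1)) e.2 w ih
        simp only [List.map_cons, List.sum_cons]
        rw [hd.2]
        convert this using 1
        rw [add_mul, smul_add, smul_mul_assoc, smul_smul, add_assoc]
  · have e : Bool.rec (motive := fun _ => Bool) (!sd) sd (headIx w) = false := by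
      cases sd <;> cases hw : headIx w <;> simp_all
    unfold lmul
    rw [e]
    have e3 : sd = !headIx w := by cases sd <;> cases hw : headIx w <;> simp_all
    have := Cmb.Rep.cons (Φ := fun w => wordVal g w * y) (b :: w) hx h
    simp only [wordVal, mul_assoc] at this
    rw [e3]
    exact this

theorem lmulL_rep (hg : BlockRel g) (hy : EigR g t y) (u : Bool × ℕ) {L : Cmb} {z : B}
    (h : L.Rep (fun w => wordVal g w * y) z) :
    (lmulL t u L).Rep (fun w => wordVal g w * y) (blk g u.1 u.2 * z) := by
  induction h with
  | nil => rw [mul_zero]; exact .nil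
  | cons w hx _ ih =>
    rw [mul_add, mul_smul_comm]
    exact lmul_rep hg hy u.1 u.2 hx w ih

theorem lmulW_rep (hg : BlockRel g) (hy : EigR g t y) (u : List (Bool × ℕ)) {L : Cmb} {z : B}
    (h : L.Rep (fun w => wordVal g w * y) z) :
    (lmulW t u L).Rep (fun w => wordVal g w * y) (blks g u * z) := by
  induction u with
  | nil => simp only [blks, List.map_nil, List.prod_nil, one_mul]; exact h
  | cons b u ih =>
    have := lmulL_rep hg hy b ih
    simp only [blks, List.map_cons, List.prod_cons, mul_assoc] at this ⊢
    exact this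

theorem relMul_rep (hg : BlockRel g) (hy : EigR g t y) {rel : List (ℕ × List (Bool × ℕ))}
    {relE : List (Ex × List (Bool × ℕ))}
    (hr : List.Forall₂ (fun a b => Sp a.1.den (b.1 : ℕ) ∧ a.2 = b.2) relE rel) (v : List ℕ) :
    (relMul t rel v).Rep (fun w => wordVal g w * y) (relVal g relE * (wordVal g v * y)) := by
  induction hr with
  | nil => simp only [relVal, List.map_nil, List.sum_nil, zero_mul]; exact .nil
  | @cons a b l1 l2 hab _ ih =>
    have h1 : (Cmb.cons b.1 v .nil).Rep (fun w => wordVal g w * y)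
        (a.1.den • (wordVal g v * y) + 0) := .cons v hab.1 .nil
    have := (lmulW_rep hg hy b.2 h1).app ih
    rw [← hab.2] at this
    simp only [relVal, List.map_cons, List.sum_cons, add_mul, smul_mul_assoc] at this ⊢
    rw [add_zero, mul_smul_comm] at this
    have e : (relMul t (b :: l2) v) = (lmulW t b.2 (.cons b.1 v .nil)).app (relMul t l2 v) := rfl
    rw [e, ← hab.2]
    exact this

end

section
variable {B : Type*} [Ring B] [Algebra Kpq B]

theorem eq_of_eqW {w v : List ℕ} (h : eqW w v = true) : w = v := by
  induction w generalizing v with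
  | nil => cases v with
    | nil => rfl
    | cons b v => cases h
  | cons a w ih => cases v with
    | nil => cases h
    | cons b v =>
      change Bool.rec (motive := fun _ => Bool) false (eqW w v) (Nat.beq a b) = true at h
      cases hab : Nat.beq a b
      · rw [hab] at h; cases h
      · rw [hab] at h; rw [Nat.eq_of_beq_eq_true hab, ih h]

theorem wordVal_of_hasK {g : ℕ → B} (hk : ∀ sd, gK g sd = 0) {w : List ℕ} (h : hasK w = true) :
    wordVal g w = 0 := by
  induction w with
  | nil => cases h
  | cons a w ih =>
    change Bool.rec (motive := fun _ => Bool) (hasK w) true (Nat.beq a 3) = true at h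
    rw [wordVal]
    cases ha : Nat.beq a 3
    · rw [ha] at h; rw [ih h, mul_zero]
    · rw [Nat.eq_of_beq_eq_true ha, blk, hk, zero_mul]

/-- The set of numbers given by a bit mask. -/
def bits (S : ℕ) : Finset ℕ := (Finset.range 1024).filter fun k => S.testBit k

/-- The element given by a numbered word between the end factors. -/
def numVal (g : ℕ → B) (x y : B) (k : ℕ) : B := x * (wordVal g (decW 6 k []) * y)

/-- The sum of rows. -/
def rowSum (l : List Row) (k : ℕ) : ZMod sP := (l.map fun r => r.vec k).sum

/-- `z` is a combination of the `Φ k`, `k ∈ S`, with coefficients that reduce to `f`. -/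
def IsComb (Φ : ℕ → B) (S : Finset ℕ) (f : ℕ → ZMod sP) (z : B) : Prop :=
  ∃ v : ℕ → Kpq, (∀ k ∉ S, v k = 0) ∧ ∑ k ∈ S, v k • Φ k = z ∧ ∀ k, Sp (v k) (f k)

theorem IsComb.zero (Φ : ℕ → B) (S : Finset ℕ) : IsComb Φ S (rowSum []) 0 :=
  ⟨0, by simp, by simp, fun k => by simpa [rowSum] using Sp.int 0⟩

theorem IsComb.push {Φ : ℕ → B} {S : Finset ℕ} {l : List Row} {z : B} (h : IsComb Φ S (rowSum l) z)
    {k : ℕ} (hk : k ∈ S) {a : Kpq} {c : ℕ} (ha : Sp a (c : ZMod sP)) :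
    IsComb Φ S (rowSum (Row.push k c .nil :: l)) (a • Φ k + z) := by
  obtain ⟨v, h1, h2, h3⟩ := h
  refine ⟨v + Pi.single k a, fun j hj => ?_, ?_, fun j => ?_⟩
  · rw [Pi.add_apply, h1 j hj, Pi.single_eq_of_ne (by rintro rfl; exact hj hk), add_zero]
  · simp only [Pi.add_apply, add_smul, Finset.sum_add_distrib, h2]
    rw [Finset.sum_eq_single k]
    · simp [add_comm]
    · intro j _ hj; simp [Pi.single_eq_of_ne hj]
    · intro hk'; exact absurd hk hk'
  · have e : rowSum (Row.push k c .nil :: l) j = rowSum l j + if k = j then (c : ZMod sP) else 0 := by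
      simp [rowSum, Row.vec_push, Row.vec, add_comm]
    rw [e]
    refine (h3 j).add ?_
    split_ifs with hkj
    · subst hkj; simpa using ha
    · rw [Pi.single_eq_of_ne (Ne.symm hkj)]; simpa using Sp.int 0

theorem rowSum_pairUp (l : List Row) (p : Row) (k : ℕ) :
    rowSum (pairUp l p) k = p.vec k + rowSum l k := by
  induction l generalizing p with
  | nil => simp [pairUp, rowSum]
  | cons a l ih =>
    cases p with
    | nil =>
      change rowSum (pairUp l a) k = _
      rw [ih]; simp [rowSum, Row.vec]
    | cons j c r =>
      change rowSum (Row.comb 1 (.cons j c r) a :: pairUp l .nil) k = _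
      have := ih .nil
      simp only [rowSum, List.map_cons, List.sum_cons, Row.vec_comb, Row.vec] at this ⊢
      rw [this]; push_cast; ring

theorem vec_sumRows (n : ℕ) (l : List Row) (k : ℕ) : (sumRows n l).vec k = rowSum l k := by
  induction n generalizing l with
  | zero =>
    induction l with
    | nil => rfl
    | cons a l ih =>
      change (Row.comb 1 a (sumRows 0 l)).vec k = _
      rw [Row.vec_comb, ih]; simp [rowSum]
  | succ n ih =>
    change (sumRows n (pairUp l .nil)).vec k = _
    rw [ih, rowSum_pairUp]; simp [Row.vec]

variable {g : ℕ → B} {x y : B} {st dK : Bool} {S : ℕ}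

theorem addW_comb (hst : st = false → x * y = 0) (hdK : dK = true → ∀ sd, gK g sd = 0)
    {a : Kpq} {c : ℕ} (ha : Sp a (c : ZMod sP)) (w : List ℕ) {o : Option (List Row)} {z : B}
    (ho : ∀ l, o = some l → IsComb (numVal g x y) (bits S) (rowSum l) (x * z)) (l : List Row)
    (hl : addW st dK S c w o = some l) :
    IsComb (numVal g x y) (bits S) (rowSum l) (x * (a • (wordVal g w * y) + z)) := by
  unfold addW at hl
  rw [mul_add, mul_smul_comm]
  cases hd : dropW st dK w
  · rw [hd] at hl
    simp only at hl
    cases hb : (Nat.testBit S (encW w 0) && Nat.ble (encW w 0) 1023 && eqW (decW 6 (encW w 0) []) w)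
    · rw [hb] at hl; cases hl
    · rw [hb] at hl
      simp only [Option.map_eq_some_iff] at hl
      obtain ⟨l', hl', rfl⟩ := hl
      simp only [Bool.and_eq_true] at hb
      obtain ⟨⟨h1, h2⟩, h3⟩ := hb
      have h2 := Nat.le_of_ble_eq_true h2
      have h3 := eq_of_eqW h3
      have := (ho l' hl').push (k := encW w 0)
        (by simp only [bits, Finset.mem_filter, Finset.mem_range]; exact ⟨by omega, h1⟩) ha
      unfold numVal at this
      rw [h3] at this
      exact this
  · rw [hd] at hl
    have h0 : x * (wordVal g w * y) = 0 := by
      cases w with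
      | nil =>
        simp only [dropW, Bool.not_eq_true'] at hd
        rw [wordVal, one_mul, hst hd]
      | cons b w =>
        simp only [dropW, Bool.and_eq_true] at hd
        rw [wordVal_of_hasK (hdK hd.1) hd.2, zero_mul, mul_zero]
    rw [h0, smul_zero, zero_add]
    exact ho l hl

theorem finL_comb (hst : st = false → x * y = 0) (hdK : dK = true → ∀ sd, gK g sd = 0) {s : ℕ}
    (hx : EigL g s x) {L : Cmb} {z : B} (hL : L.Rep (fun w => wordVal g w * y) z) :
    ∀ l, finL s st dK S L = some l → IsComb (numVal g x y) (bits S) (rowSum l) (x * z) := by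
  induction hL with
  | nil =>
    intro l hl
    obtain rfl := (Option.some.inj hl)
    rw [mul_zero]
    exact IsComb.zero _ _
  | @cons a c L z w ha hL ih =>
    cases w with
    | nil => exact addW_comb hst hdK ha [] ih
    | cons b v =>
      intro l hl
      change Bool.rec (motive := fun _ => Option (List Row))
        (addW st dK S c (b :: v) (finL s st dK S L))
        (addW st dK S (Nat.mod (Nat.mul c (eigBlk s b)) 10007) v (finL s st dK S L))
        (headIx v) = some l at hl
      cases hv : headIx v
      · rw [hv] at hl
        exact addW_comb hst hdK ha (b :: v) ih l hl
      · rw [hv] at hl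
        obtain ⟨d, hd, e⟩ := hx.blk b
        have := addW_comb hst hdK (Sp.mod (ha.natMul hd)) v ih l hl
        convert this using 1
        rw [mul_add, mul_add, mul_smul_comm, mul_smul_comm, wordVal, hv]
        simp only [← mul_assoc]
        rw [Bool.not_true, e, smul_mul_assoc, smul_mul_assoc, smul_smul]

theorem mkRow_lifts (hg : BlockRel g) {s t : ℕ} (hst : Nat.beq s t = false → x * y = 0)
    (hdK : dK = true → ∀ sd, gK g sd = 0) (hx : EigL g s x) (hy : EigR g t y)
    {rel : List (ℕ × List (Bool × ℕ))} {relE : List (Ex × List (Bool × ℕ))}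
    (hr : List.Forall₂ (fun a b => Sp a.1.den (b.1 : ℕ) ∧ a.2 = b.2) relE rel)
    (h0 : relVal g relE = 0) (u : List (Bool × ℕ)) (v : List ℕ) :
    Lifts (relSpace (numVal g x y) (bits S)) (mkRow s t dK S rel u v).vec := by
  have h1 := lmulW_rep hg hy u (relMul_rep hg hy hr v)
  rw [h0, zero_mul, mul_zero] at h1
  have h2 := finL_comb (S := S) hst hdK hx h1
  unfold mkRow
  rcases h3 : finL s (Nat.beq s t) dK S (lmulW t u (relMul t rel v)) with _ | l
  · exact Lifts.zero _
  · obtain ⟨w, hw1, hw2, hw3⟩ := h2 l h3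
    rw [mul_zero] at hw2
    refine ⟨w, ⟨hw1, hw2⟩, fun k => ?_⟩
    simp only [Option.map_some, Option.getD_some]
    rw [vec_sumRows]
    exact hw3 k

theorem wordCheck_span (hg : BlockRel g) {s t : ℕ} (hst : Nat.beq s t = false → x * y = 0)
    (hdK : dK = true → ∀ sd, gK g sd = 0) (hx : EigL g s x) (hy : EigR g t y)
    {rels : List (List (ℕ × List (Bool × ℕ)))} {relsE : List (List (Ex × List (Bool × ℕ)))}
    (hr : List.Forall₂ (fun E N => List.Forall₂ (fun a b => Sp a.1.den (b.1 : ℕ) ∧ a.2 = b.2) E N)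
      relsE rels)
    (h0 : ∀ r ∈ relsE, relVal g r = 0) {letters N : List ℕ}
    (hc : wordCheck s t dK S rels letters N = true) :
    ∀ k ∈ bits S, numVal g x y k ∈ Submodule.span Kpq (numVal g x y '' {k | k ∈ N}) := by
  unfold wordCheck at hc
  simp only [List.all_eq_true, List.mem_range] at hc
  have h1 : ∀ r ∈ mkRows s t dK S rels letters,
      Lifts (relSpace (numVal g x y) (bits S)) r.vec := by
    intro r hr'
    unfold mkRows at hr'
    simp only [List.mem_flatMap, List.mem_map] at hr'
    obtain ⟨n, -, u, -, v, -, rel, hrel, rfl⟩ := hr'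
    have key : ∃ E ∈ relsE,
        List.Forall₂ (fun a b => Sp a.1.den (b.1 : ℕ) ∧ a.2 = b.2) E rel := by
      clear hc h0
      induction hr with
      | nil => cases hrel
      | cons h _ ih =>
        rcases List.mem_cons.mp hrel with rfl | h'
        · exact ⟨_, List.mem_cons_self, h⟩
        · obtain ⟨E, hE, h''⟩ := ih h'
          exact ⟨E, List.mem_cons_of_mem _ hE, h''⟩
    obtain ⟨E, hE, hE'⟩ := key
    exact mkRow_lifts hg hst hdK hx hy hE' (h0 E hE) _ _
  obtain ⟨w, hw, hd⟩ := exists_unit_minor_of_elim (mkRows s t dK S rels letters) h1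
    ((bits S).filter fun k => k ∉ N) (by
      intro k hk
      simp only [Finset.mem_filter, bits, Finset.mem_range] at hk
      have := hc k hk.1.1
      simpa [hk.1.2, hk.2] using this)
  intro k hk
  have := mem_span_of_minor (Finset.filter_subset _ _) hw hd k hk
  refine Submodule.span_mono (Set.image_mono ?_) this
  intro j hj
  simp only [Finset.coe_sdiff, Finset.coe_filter, Set.mem_diff, Finset.mem_coe, Set.mem_setOf_eq,
    not_and, not_not] at hj
  exact hj.2 hj.1

end

/-- The relations of the word systems. -/
def relsE : List (List (Ex × List (Bool × ℕ))) := [quarticE, hkhE]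

theorem relsE_relsN : List.Forall₂
    (fun E N => List.Forall₂ (fun (a : Ex × List (Bool × ℕ)) (b : ℕ × List (Bool × ℕ)) =>
      Sp a.1.den (b.1 : ℕ) ∧ a.2 = b.2) E N) relsE relsN := by
  have key : ∀ (E : List (Ex × List (Bool × ℕ))) (N : List ℕ),
      N = E.map (fun a => modP.val a.1 % sP) →
      List.Forall₂ (fun (a : Ex × List (Bool × ℕ)) (b : ℕ × List (Bool × ℕ)) =>
        Sp a.1.den (b.1 : ℕ) ∧ a.2 = b.2) E (N.zip (E.map Prod.snd)) := by
    rintro E N rfl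
    induction E with
    | nil => exact .nil
    | cons a E ih => exact .cons ⟨Sp.of_val _ _ rfl, rfl⟩ ih
  exact .cons (key _ _ (by decide +kernel)) (.cons (key _ _ (by decide +kernel)) .nil)

theorem revE_relsN : List.Forall₂
    (fun E N => List.Forall₂ (fun (a : Ex × List (Bool × ℕ)) (b : ℕ × List (Bool × ℕ)) =>
      Sp a.1.den (b.1 : ℕ) ∧ a.2 = b.2) E N) (relsE.map revE) (relsN.map revE) := by
  rw [List.forall₂_map_left_iff, List.forall₂_map_right_iff]
  refine relsE_relsN.imp fun E N h => ?_
  unfold revE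
  rw [List.forall₂_map_left_iff, List.forall₂_map_right_iff]
  exact h.imp fun a b hab => ⟨hab.1, by rw [hab.2]⟩

set_option maxRecDepth 100000

theorem wordCheck_0 : wordCheck 0 3 false wordSet relsN [1, 2, 3] [1, 2, 3] = true := by
  decide +kernel
theorem wordCheck_1 : wordCheck 1 3 false wordSet relsN [1, 2, 3] [1, 2] = true := by
  decide +kernel
theorem wordCheck_2 : wordCheck 2 3 false wordSet relsN [1, 2, 3] [1, 2] = true := by
  decide +kernel
theorem wordCheck_3 : wordCheck 3 3 false (wordSet + 1) relsN [1, 2, 3] [0, 1, 2, 3] = true := by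
  decide +kernel
theorem wordCheck_rev_0 :
    wordCheck 0 3 false wordSet (relsN.map revE) [1, 2, 3] [1, 2, 3] = true := by
  decide +kernel
theorem wordCheck_rev_1 :
    wordCheck 1 3 false wordSet (relsN.map revE) [1, 2, 3] [1, 2] = true := by
  decide +kernel
theorem wordCheck_rev_2 :
    wordCheck 2 3 false wordSet (relsN.map revE) [1, 2, 3] [1, 2] = true := by
  decide +kernel
theorem wordCheck_rev_3 :
    wordCheck 3 3 false (wordSet + 1) (relsN.map revE) [1, 2, 3] [0, 1, 2, 3] = true := by
  decide +kernel
theorem wordCheck_top_1 : wordCheck 1 2 true wordSetT relsN [1, 2] [2] = true := by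
  decide +kernel
theorem wordCheck_top_2 : wordCheck 2 1 true wordSetT relsN [1, 2] [2] = true := by
  decide +kernel

/-! ## The representations of `A(3)_loc` -/

theorem quartic_aux {K M : Type*} [Field K] [AddCommGroup M] [Module K M]
    (c0 c1 c2 c6 c7 c12 b b1 b2 b3 b4 t : K) (x x' y y' z z' r r' u u' : M) :
    (c2 - c1) • (b • (x - b4 • y + b3 • z - b2 • (t • r) - b1 • u)
        - b • (x' - b4 • y' + b3 • z' - b2 • (t • r') - b1 • u'))
      + c12 • (y' - y) + c6 • (t • r' - t • r) + c7 • (z' - z) + c0 • (u' - u)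
    = ((c2 - c1) * b) • (x - x') + (c12 + (c2 - c1) * b * b4) • (y' - y)
      + ((c6 + (c2 - c1) * b * b2) * t) • (r' - r) + (c7 - (c2 - c1) * b * b3) • (z' - z)
      + (c0 + (c2 - c1) * b * b1) • (u' - u) := by
  module

section
variable {A : Type*} [Ring A] [Algebra Kpq A] {g : ℕ → A}

theorem sub_eq_zero_of_getD {l : List NE} (h : ∀ e ∈ l, e.den g = 0) (k : ℕ) {a b : NE}
    (hk : l.getD k 0 = a - b) : a.den g = b.den g := by
  have := getD_zero_of h k
  rw [hk, NE.den_sub] at this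
  exact sub_eq_zero.mp this

/-- `lift` of the generators. -/
def liftGen (g : ℕ → A) : Fr →ₐ[Kpq] A := FreeAlgebra.lift Kpq (genMap g)

@[simp] theorem liftGen_H (i : Fin 2) : liftGen g (fH i) = g i := FreeAlgebra.lift_ι_apply _ _
@[simp] theorem liftGen_K (i : Fin 2) : liftGen g (fK i) = g (2 + i) := FreeAlgebra.lift_ι_apply _ _
@[simp] theorem liftGen_U (i : Fin 2) : liftGen g (fU i) = g (4 + i) := FreeAlgebra.lift_ι_apply _ _

theorem Z3_eq (h : ∀ e ∈ relAll, e.den g = 0) (i : Fin 2) :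
    b0 • g (6 + (3 + i)) = g i * g i * g (i + 1 : Fin 2) * g (2 + i)
      - b4 • (g i * g (i + 1 : Fin 2) * g (2 + i)) + b3 • (g (i + 1 : Fin 2) * g (2 + i))
      - b2 • (tau⁻¹ • (g (2 + i) * g (i + 1 : Fin 2) * g (2 + i)))
      - b1 • (g (4 + i) * g (i + 1 : Fin 2)) := by
  have h1 := sub_eq_zero_of_getD (relZ_of_relAll h i) 0 rfl
  have h3 := sub_eq_zero_of_getD (relZ_of_relAll h i) 1 rfl
  simp only [NE.den_sub, NE.den_add, NE.den_smul, NE.den_mul, nH, nK, nU, nZ, NE.den_atom, den_tau,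
    den_b0, den_b1, den_b2, den_b3, den_b4] at h1 h3
  have h1' : g (6 + (1 + i)) = tau⁻¹ • (g (2 + i) * g (i + 1 : Fin 2) * g (2 + i)) := by
    rw [← h1, smul_smul, inv_mul_cancel₀ tau_ne, one_smul]
  rw [h3, h1']

theorem liftGen_rel (h : ∀ e ∈ relAll, e.den g = 0) {x y : Fr} (hxy : Rel x y) :
    liftGen g x = liftGen g y := by
  have hI := fun i => relI_of_relAll h i
  have e1 : ∀ i : Fin 2, i + 1 + 1 = i := by decide
  induction hxy with
  | HK i => simpa [nH, nK, nU, den_tau] using sub_eq_zero_of_getD (hI i) 0 rfl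
  | KH i => simpa [nH, nK, nU, den_tau] using sub_eq_zero_of_getD (hI i) 1 rfl
  | HU i => simpa [nH, nK, nU, den_phi] using sub_eq_zero_of_getD (hI i) 2 rfl
  | UH i => simpa [nH, nK, nU, den_phi] using sub_eq_zero_of_getD (hI i) 3 rfl
  | KK i => simpa [nH, nK, nU, den_phi, pow_two] using sub_eq_zero_of_getD (hI i) 4 rfl
  | KU i => simpa [nH, nK, nU] using sub_eq_zero_of_getD (hI i) 5 rfl
  | UK i => simpa [nH, nK, nU] using sub_eq_zero_of_getD (hI i) 6 rfl
  | UU i => simpa [nH, nK, nU, den_delta, pow_two] using sub_eq_zero_of_getD (hI i) 7 rfl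
  | HKH =>
    simpa [nH, nK, nU] using sub_eq_zero_of_getD (relR_of_relAll h) 0 rfl
  | KUK i => simpa [nH, nK, nU] using sub_eq_zero_of_getD (hI i) 8 rfl
  | KUH i => simpa [nH, nK, nU] using sub_eq_zero_of_getD (hI i) 9 rfl
  | KUU i => simpa [nH, nK, nU] using sub_eq_zero_of_getD (hI i) 10 rfl
  | UUK i => simpa [nH, nK, nU] using sub_eq_zero_of_getD (hI i) 11 rfl
  | UUU i => simpa [nH, nK, nU] using sub_eq_zero_of_getD (hI i) 12 rfl
  | cubic i =>
    have := sub_eq_zero_of_getD (hI i) 13 rfl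
    simpa [nH, nK, nU, den_xi, den_zeta, den_zetas, den_b1, den_b2, Algebra.algebraMap_eq_smul_one]
      using this
  | quartic =>
    have h1 := sub_eq_zero_of_getD (relR_of_relAll h) 1 rfl
    have hz0 := Z3_eq h 0
    have hz1 := Z3_eq h 1
    have hy0 := sub_eq_zero_of_getD (relZ_of_relAll h 0) 0 rfl
    have hy1 := sub_eq_zero_of_getD (relZ_of_relAll h 1) 0 rfl
    simp only [NE.den_sub, NE.den_add, NE.den_smul, NE.den_mul, nH, nK, nU, nZ, NE.den_atom,
      den_tau, den_c0, den_c1, den_c2, den_c5, den_c6, den_c7, den_c10, den_c11, den_c12, den_c15,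
      Ex.den_sub] at h1 hy0 hy1
    have hc : ∀ {x y : A}, b0 • x = y → x = b0⁻¹ • y := by
      rintro x y rfl
      rw [smul_smul, inv_mul_cancel₀ b0_ne, one_smul]
    have hc' : ∀ {x y : A}, tau • x = y → x = tau⁻¹ • y := by
      rintro x y rfl
      rw [smul_smul, inv_mul_cancel₀ tau_ne, one_smul]
    have hz0 := hc hz0
    have hz1 := hc hz1
    have hy0 := hc' hy0
    have hy1 := hc' hy1
    simp only [quarticRHS, map_sub, map_add, map_mul, map_smul, map_pow, liftGen_H, liftGen_K,
      liftGen_U]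
    have e2 : (1 + 1 : Fin 2) = 0 := rfl
    simp only [e2, Fin.isValue, Fin.val_zero, Fin.val_one, add_zero, zero_add, Nat.reduceAdd,
      pow_two] at h1 hz0 hz1 hy0 hy1 ⊢
    rw [h1, hz0, hz1, hy0, hy1]
    have key := quartic_aux c0 c1 c2 c6 c7 c12 b0⁻¹ b1 b2 b3 b4 tau⁻¹
      (g 0 * g 0 * g 1 * g 2) (g 1 * g 1 * g 0 * g 3) (g 0 * g 1 * g 2) (g 1 * g 0 * g 3)
      (g 1 * g 2) (g 0 * g 3) (g 2 * g 1 * g 2) (g 3 * g 0 * g 3) (g 4 * g 1) (g 5 * g 0)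
    rw [← sub_eq_zero] at key ⊢
    rw [← key]
    simp only [mul_assoc]
    abel

/-- The homomorphism from `A(3)_loc` given by elements that satisfy the relations. -/
def locLift (h : ∀ e ∈ relAll, e.den g = 0) : Aloc →ₐ[Kpq] A :=
  RingQuot.liftAlgHom Kpq ⟨liftGen g, fun _ _ hxy => liftGen_rel h hxy⟩

theorem locLift_mk (h : ∀ e ∈ relAll, e.den g = 0) (x : Fr) :
    locLift h (mkLoc x) = liftGen g x :=
  RingQuot.liftAlgHom_mkAlgHom_apply Kpq _ _ x

theorem mkLoc_surjective : Function.Surjective mkLoc := RingQuot.mkAlgHom_surjective Kpq Rel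

end

/-- The atoms in `A(3)_loc`. -/
def gl : ℕ → Aloc
  | 0 => H1
  | 1 => H2
  | 2 => K1
  | 3 => K2
  | 4 => U1
  | 5 => U2
  | 6 => Z0
  | 7 => Z1
  | 8 => Z2
  | 9 => Z3
  | 10 => Z4
  | 11 => Z5
  | 12 => Z6
  | _ => 0

theorem mkLoc_fH (i : Fin 2) : mkLoc (fH i) = gl i := by fin_cases i <;> rfl
theorem mkLoc_fK (i : Fin 2) : mkLoc (fK i) = gl (2 + i) := by fin_cases i <;> rfl
theorem mkLoc_fU (i : Fin 2) : mkLoc (fU i) = gl (4 + i) := by fin_cases i <;> rfl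

theorem mkLoc_rel {x y : Fr} (h : Rel x y) : mkLoc x = mkLoc y := RingQuot.mkAlgHom_rel Kpq h

theorem smul_inv_smul_eq {c : Kpq} (h : c ≠ 0) (x : Aloc) : c • (c⁻¹ • x) = x := by
  rw [smul_smul, mul_inv_cancel₀ h, one_smul]

theorem relI_gl (i : Fin 2) : ∀ e ∈ relI i (i + 1), e.den gl = 0 := by
  have key : ∀ {x y : Fr} {a b : NE}, Rel x y → mkLoc x = a.den gl → mkLoc y = b.den gl →
      (a - b).den gl = 0 := by
    intro x y a b h h1 h2
    rw [NE.den_sub, ← h1, ← h2, mkLoc_rel h, sub_self]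
  simp only [relI, List.mem_cons, List.not_mem_nil, or_false]
  rintro e (rfl | rfl | rfl | rfl | rfl | rfl | rfl | rfl | rfl | rfl | rfl | rfl | rfl | rfl)
  · exact key (Rel.HK i) (by simp [nH, nK, mkLoc_fH, mkLoc_fK])
      (by simp [nH, nK, mkLoc_fH, mkLoc_fK, den_tau])
  · exact key (Rel.KH i) (by simp [nH, nK, mkLoc_fH, mkLoc_fK])
      (by simp [nH, nK, mkLoc_fH, mkLoc_fK, den_tau])
  · exact key (Rel.HU i) (by simp [nH, nU, mkLoc_fH, mkLoc_fU])
      (by simp [nH, nU, mkLoc_fH, mkLoc_fU, den_phi])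
  · exact key (Rel.UH i) (by simp [nH, nU, mkLoc_fH, mkLoc_fU])
      (by simp [nH, nU, mkLoc_fH, mkLoc_fU, den_phi])
  · exact key (Rel.KK i) (by simp [nK, mkLoc_fK, pow_two]) (by simp [nK, mkLoc_fK, den_phi])
  · exact key (Rel.KU i) (by simp [nK, nU, mkLoc_fK, mkLoc_fU]) (by simp)
  · exact key (Rel.UK i) (by simp [nK, nU, mkLoc_fK, mkLoc_fU]) (by simp)
  · exact key (Rel.UU i) (by simp [nU, mkLoc_fU, pow_two]) (by simp [nU, mkLoc_fU, den_delta])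
  · exact key (Rel.KUK i) (by simp [nK, nU, mkLoc_fK, mkLoc_fU])
      (by simp [nH, nU, mkLoc_fH, mkLoc_fU])
  · exact key (Rel.KUH i) (by simp [nH, nK, nU, mkLoc_fH, mkLoc_fK, mkLoc_fU])
      (by simp [nH, nK, nU, mkLoc_fH, mkLoc_fK, mkLoc_fU])
  · exact key (Rel.KUU i) (by simp [nK, nU, mkLoc_fK, mkLoc_fU])
      (by simp [nH, nU, mkLoc_fH, mkLoc_fU])
  · exact key (Rel.UUK i) (by simp [nK, nU, mkLoc_fK, mkLoc_fU])
      (by simp [nH, nU, mkLoc_fH, mkLoc_fU])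
  · exact key (Rel.UUU i) (by simp [nU, mkLoc_fU]) (by simp [nU, mkLoc_fU])
  · exact key (Rel.cubic i) (by simp [nH, mkLoc_fH, den_xi, den_zeta, den_zetas,
      Algebra.algebraMap_eq_smul_one])
      (by simp [nK, nU, mkLoc_fK, mkLoc_fU, den_b1, den_b2])

theorem relZ_gl (i : Fin 2) : ∀ e ∈ relZ i (i + 1), e.den gl = 0 := by
  have ht := tau_ne
  have h0 := b0_ne
  fin_cases i
  · simp only [relZ, List.mem_cons, List.not_mem_nil, or_false]
    rintro e (rfl | rfl | rfl)
    · simp [nZ, nK, nH, gl, Z1, den_tau, smul_inv_smul_eq ht]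
    · simp [nZ, nK, nH, nU, gl, Z3, den_b0, den_b1, den_b2, den_b3, den_b4, smul_inv_smul_eq h0,
        pow_two]
    · simp [nZ, nK, nH, gl, Z5, den_tau, smul_inv_smul_eq ht]
  · simp only [relZ, List.mem_cons, List.not_mem_nil, or_false]
    rintro e (rfl | rfl | rfl)
    · simp [nZ, nK, nH, gl, Z2, den_tau, smul_inv_smul_eq ht]
    · simp [nZ, nK, nH, nU, gl, Z4, den_b0, den_b1, den_b2, den_b3, den_b4, smul_inv_smul_eq h0,
        pow_two]
    · simp [nZ, nK, nH, gl, Z6, den_tau, smul_inv_smul_eq ht]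

theorem relR_gl : ∀ e ∈ relR, e.den gl = 0 := by
  simp only [relR, List.mem_cons, List.not_mem_nil, or_false]
  rintro e (rfl | rfl | rfl)
  · have := mkLoc_rel Rel.HKH
    simp only [map_mul, mkLoc_fH, mkLoc_fK] at this
    simp only [NE.den_sub, NE.den_mul, nH, nK, NE.den_atom]
    exact sub_eq_zero.mpr this
  · have h1 := mkLoc_rel Rel.quartic
    simp only [quarticRHS, map_sub, map_add, map_mul, map_smul, map_pow, mkLoc_fH, mkLoc_fK,
      mkLoc_fU] at h1
    simp only [nQuartic, NE.den_sub, NE.den_add, NE.den_smul, NE.den_mul, nH, nK, nU, nZ,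
      NE.den_atom, den_tau, den_c0, den_c1, den_c2, den_c5, den_c6, den_c7, den_c10, den_c11,
      den_c12, den_c15, Ex.den_sub]
    simp only [Fin.isValue, Fin.val_zero, Fin.val_one, add_zero, Nat.reduceAdd, pow_two] at h1 ⊢
    have e9 : gl 9 = b0⁻¹ • (gl 0 * gl 0 * gl 1 * gl 2 - b4 • (gl 0 * gl 1 * gl 2)
        + b3 • (gl 1 * gl 2) - b2 • (tau⁻¹ • (gl 2 * gl 1 * gl 2)) - b1 • (gl 4 * gl 1)) := by
      simp only [gl, Z3, Z1, pow_two]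
    have e10 : gl 10 = b0⁻¹ • (gl 1 * gl 1 * gl 0 * gl 3 - b4 • (gl 1 * gl 0 * gl 3)
        + b3 • (gl 0 * gl 3) - b2 • (tau⁻¹ • (gl 3 * gl 0 * gl 3)) - b1 • (gl 5 * gl 0)) := by
      simp only [gl, Z4, Z2, pow_two]
    have e7 : gl 7 = tau⁻¹ • (gl 2 * gl 1 * gl 2) := rfl
    have e8 : gl 8 = tau⁻¹ • (gl 3 * gl 0 * gl 3) := rfl
    rw [e9, e10, e7, e8]
    have key := quartic_aux c0 c1 c2 c6 c7 c12 b0⁻¹ b1 b2 b3 b4 tau⁻¹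
      (gl 0 * gl 0 * gl 1 * gl 2) (gl 1 * gl 1 * gl 0 * gl 3) (gl 0 * gl 1 * gl 2)
      (gl 1 * gl 0 * gl 3) (gl 1 * gl 2) (gl 0 * gl 3) (gl 2 * gl 1 * gl 2) (gl 3 * gl 0 * gl 3)
      (gl 4 * gl 1) (gl 5 * gl 0)
    rw [← sub_eq_zero] at key h1
    have h2 := congrArg₂ (· - ·) h1 key
    simp only [sub_zero] at h2
    rw [← h2]
    simp only [mul_assoc]
    abel
  · simp only [NE.den_sub, NE.den_add, NE.den_smul, NE.den_mul, nH, nK, nU, nZ, NE.den_atom,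
      den_b0, den_b1, den_b2, den_b3, den_b4]
    change b1 • Z0 - (Z5 * K1 - b4 • (K1 * K2 * K1) + b3 • Z1 - b0 • K1 - b2 • (K1 * U2 * K1)) = 0
    rw [Z0, smul_inv_smul_eq b1_ne, Z5, smul_mul_assoc, sub_self]

/-- The atoms of `A(3)_loc` satisfy all relations. -/
theorem relAll_gl : ∀ e ∈ relAll, e.den gl = 0 := by
  intro e he
  simp only [relAll, List.mem_append] at he
  rcases he with (((he | he) | he) | he) | he
  · exact relI_gl 0 e he
  · exact relI_gl 1 e he
  · exact relZ_gl 0 e he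
  · exact relZ_gl 1 e he
  · exact relR_gl e he

/-- The atoms `Z₀, …, Z₆` are determined by the generators. -/
theorem atoms_ext {A : Type*} [Ring A] [Algebra Kpq A] {g g' : ℕ → A}
    (h : ∀ e ∈ relAll, e.den g = 0) (h' : ∀ e ∈ relAll, e.den g' = 0)
    (hg : ∀ k < 6, g k = g' k) : ∀ k < 13, g k = g' k := by
  have inj : ∀ {c : Kpq} {x y : A}, c ≠ 0 → c • x = c • y → x = y := by
    intro c x y hc hxy
    simpa [smul_smul, hc] using congrArg (c⁻¹ • ·) hxy
  have a := fun k hk => hg k hk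
  have z : ∀ (g : ℕ → A), (∀ e ∈ relAll, e.den g = 0) → ∀ i : Fin 2,
      tau • g (6 + (1 + i)) = g (2 + i) * g (i + 1 : Fin 2) * g (2 + i) ∧
      tau • g (6 + (5 + i)) = g (2 + i) * g (2 + (i + 1 : Fin 2)) * g i *
        g (2 + (i + 1 : Fin 2)) := by
    intro g h i
    have h1 := sub_eq_zero_of_getD (relZ_of_relAll h i) 0 rfl
    have h3 := sub_eq_zero_of_getD (relZ_of_relAll h i) 2 rfl
    simp only [NE.den_smul, NE.den_mul, nH, nK, nZ, NE.den_atom, den_tau] at h1 h3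
    exact ⟨h1, h3⟩
  have b := sub_eq_zero_of_getD (relR_of_relAll h) 2 rfl
  have b' := sub_eq_zero_of_getD (relR_of_relAll h') 2 rfl
  have e7 : g 7 = g' 7 := inj tau_ne (((z g h 0).1).trans (by
    simpa [a] using (z g' h' 0).1.symm))
  have e8 : g 8 = g' 8 := inj tau_ne (((z g h 1).1).trans (by
    simpa [a] using (z g' h' 1).1.symm))
  have e9 : g 9 = g' 9 := inj b0_ne ((Z3_eq h 0).trans (by
    simpa [a] using (Z3_eq h' 0).symm))
  have e10 : g 10 = g' 10 := inj b0_ne ((Z3_eq h 1).trans (by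
    simpa [a] using (Z3_eq h' 1).symm))
  have e11 : g 11 = g' 11 := inj tau_ne (((z g h 0).2).trans (by
    simpa [a] using (z g' h' 0).2.symm))
  have e12 : g 12 = g' 12 := inj tau_ne (((z g h 1).2).trans (by
    simpa [a] using (z g' h' 1).2.symm))
  have e6 : g 6 = g' 6 := by
    simp only [NE.den_sub, NE.den_add, NE.den_smul, NE.den_mul, nK, nU, nZ, NE.den_atom,
      den_b0, den_b1, den_b2, den_b3, den_b4] at b b'
    refine inj b1_ne (b.trans ?_)
    simpa [a, e7, e11] using b'.symm
  intro k hk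
  interval_cases k
  all_goals first | assumption | exact a _ (by norm_num)

/-- The irreducible representations of `A(3)_loc`. -/
def rhoK (R : Irr) : Aloc →ₐ[Kpq] Mat R Kpq := locLift (relAll_atomsM R)

theorem rhoK_gl (R : Irr) : ∀ k < 13, rhoK R (gl k) = atomsM R k := by
  refine atoms_ext (g := fun k => rhoK R (gl k)) (fun e he => ?_) (relAll_atomsM R) fun k hk => ?_
  · rw [← NE.map_den, relAll_gl e he, map_zero]
  · have h0 : ∀ x, rhoK R (mkLoc x) = liftGen (atomsM R) x := locLift_mk _
    have hH := fun i => (h0 (fH i)).trans (liftGen_H i)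
    have hK := fun i => (h0 (fK i)).trans (liftGen_K i)
    have hU := fun i => (h0 (fU i)).trans (liftGen_U i)
    interval_cases k
    · exact hH 0
    · exact hH 1
    · exact hK 0
    · exact hK 1
    · exact hU 0
    · exact hU 1

theorem rhoK_H1 (R : Irr) : rhoK R H1 = matH R := (rhoK_gl R 0 (by norm_num)).trans (lmat_repH R)

theorem rhoK_H2 (R : Irr) : rhoK R H2 = rot180 (matH R) := by
  refine (rhoK_gl R 1 (by norm_num)).trans ?_
  rw [← lmat_repH R]
  cases R <;> ext i j <;> fin_cases i <;> fin_cases j <;> rfl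

/-! ## Linear independence of elements in the representations -/

/-- The entries of the matrices in some representations. -/
def entIx (Rs : List Irr) : List (Σ R : Irr, Fin R.dim × Fin R.dim) :=
  Rs.flatMap fun R => (List.finRange R.dim).flatMap fun i =>
    (List.finRange R.dim).map fun j => ⟨R, i, j⟩

/-- An entry of the matrix of an expression. -/
def entVal (e : NE) (x : Σ R : Irr, Fin R.dim × Fin R.dim) : Kpq :=
  e.den (atomsM x.1) x.2.1 x.2.2

/-- The entries modulo `sP`. -/
def flatP (Rs : List Irr) (e : NE) : List ℕ :=
  Rs.flatMap fun R => (modP.mval R.dim (atomsE R) e).flatten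

/-- The row with given entries. -/
def toRow : List ℕ → Row
  | [] => .nil
  | c :: l => Row.push l.length c (toRow l)

/-- The test of linear independence. -/
def indepCheck (Rs : List Irr) (es : List NE) : Bool :=
  (fun T : Tr => Nat.ble es.length ((List.range 64).filter fun k => (T.get k).pivot k).length)
    (Tr.elim (sortRows (es.map fun e => toRow (flatP Rs e))) .nil)

theorem Mod.mval_eq_ltab {F : Type} (m : Mod F) (n : ℕ) (g : ℕ → List (List Ex)) (e : NE) :
    ∃ f, m.mval n g e = ltab n f := by
  cases e <;> exact ⟨_, rfl⟩

theorem entVal_flatP (Rs : List Irr) (e : NE) :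
    List.Forall₂ (fun (x : Kpq) (n : ℕ) => Sp x (n : ZMod sP)) ((entIx Rs).map (entVal e))
      (flatP Rs e) := by
  unfold entIx flatP
  induction Rs with
  | nil => exact .nil
  | cons R Rs ih =>
    simp only [List.flatMap_cons, List.map_append]
    refine List.rel_append ?_ ih
    have h := modP_sound.mval R.dim (atomsE R) e
    obtain ⟨f, hf⟩ := modP.mval_eq_ltab R.dim (atomsE R) e
    rw [hf] at h ⊢
    have h' : ∀ i j : Fin R.dim, Sp (e.den (atomsM R) i j) (f i j : ZMod sP) := by
      intro i j
      have := h i j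
      rwa [lget_ltab _ _ _ _ _ i.2 j.2] at this
    rw [ltab, ← List.map_coe_finRange_eq_range, List.map_flatMap, ← List.flatMap_def,
      List.flatMap_map]
    clear h hf ih
    generalize List.finRange R.dim = l
    have key : ∀ l' : List (Fin R.dim), List.Forall₂ (fun (x : Kpq) (n : ℕ) => Sp x (n : ZMod sP))
        (List.flatMap (fun a => List.map (entVal e)
          (List.map (fun j => (⟨R, a, j⟩ : Σ R : Irr, Fin R.dim × Fin R.dim)) l)) l')
        (List.flatMap (fun a : Fin R.dim => List.map (fun j => f a j)
          (List.map (fun j : Fin R.dim => (j : ℕ)) l)) l') := by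
      intro l'
      induction l' with
      | nil => exact .nil
      | cons a l' ih =>
        simp only [List.flatMap_cons]
        refine List.rel_append ?_ ih
        rw [List.map_map, List.map_map, List.forall₂_map_left_iff, List.forall₂_map_right_iff,
          List.forall₂_same]
        exact fun j _ => h' a j
    exact key l

/-- The vector of the entries of an expression. -/
def entVec (Rs : List Irr) (e : NE) (k : ℕ) : Kpq := ((entIx Rs).reverse.map (entVal e)).getD k 0

theorem toRow_vec {xs : List Kpq} {l : List ℕ}
    (h : List.Forall₂ (fun (x : Kpq) (n : ℕ) => Sp x (n : ZMod sP)) xs l) (k : ℕ) :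
    Sp (xs.reverse.getD k 0) ((toRow l).vec k) := by
  induction h with
  | nil => simpa [toRow, Row.vec] using Sp.int 0
  | @cons x n xs l hx hl ih =>
    rw [toRow, Row.vec_push, List.reverse_cons]
    have hlen : xs.reverse.length = l.length := by rw [List.length_reverse, hl.length_eq]
    by_cases hk : l.length = k
    · subst hk
      rw [if_pos rfl]
      rw [List.getD_eq_default _ _ hlen.le] at ih
      rw [List.getD_append_right _ _ _ _ hlen.le, hlen, Nat.sub_self]
      simpa using hx.add ih
    · rw [if_neg hk, zero_add]
      rcases lt_or_gt_of_ne hk with h1 | h1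
      · rw [List.getD_eq_default _ _ (by omega)] at ih
        rw [List.getD_eq_default _ _ (by simp at hlen ⊢; omega)]
        exact ih
      · rw [List.getD_append _ _ _ _ (by omega)]
        exact ih

theorem linearIndependent_entVec {Rs : List Irr} {es : List NE} (h : indepCheck Rs es = true) :
    LinearIndependent Kpq fun i : Fin es.length => entVec Rs (es.get i) := by
  unfold indepCheck at h
  have h := Nat.le_of_ble_eq_true h
  set T := Tr.elim (sortRows (es.map fun e => toRow (flatP Rs e))) .nil with hT
  set W := Submodule.span Kpq (Set.range fun i : Fin es.length => entVec Rs (es.get i))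
  set s := (Finset.range 64).filter fun k => (T.get k).pivot k = true
  obtain ⟨v, hv, hd⟩ := exists_unit_minor_of_elim (V := W)
    (es.map fun e => toRow (flatP Rs e)) (by
      intro r hr
      obtain ⟨e, he, rfl⟩ := List.mem_map.mp hr
      obtain ⟨i, rfl⟩ := List.get_of_mem he
      refine ⟨_, Submodule.subset_span ⟨i, rfl⟩, fun k => ?_⟩
      have := toRow_vec (entVal_flatP Rs (es.get i)) k
      rw [← List.map_reverse] at this
      exact this) s (fun k hk => (Finset.mem_filter.mp hk).2)
  refine linearIndependent_of_minor ?_ hv hd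
  refine h.trans_eq ?_
  rw [Finset.card_def, Finset.filter_val, Finset.range_val, Multiset.range, Multiset.filter_coe,
    Multiset.coe_card]
  congr 1
  congr 1
  funext k
  simp

/-- Elements with independent images in representations. -/
theorem linearIndependent_reps {Rs : List Irr} {es : List NE} (h : indepCheck Rs es = true)
    (P : Irr → Prop) (hP : ∀ R ∈ Rs, P R) :
    LinearIndependent Kpq fun i : Fin es.length =>
      (fun R => (es.get i).den (atomsM R.1) : ∀ R : {R : Irr // P R}, Mat R.1 Kpq) := by
  have h1 := linearIndependent_entVec h
  rw [Fintype.linearIndependent_iff] at h1 ⊢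
  intro c hc
  apply h1 c
  funext k
  rw [Finset.sum_apply]
  simp only [Pi.smul_apply, entVec, Pi.zero_apply]
  rcases lt_or_ge k (entIx Rs).reverse.length with hk | hk
  · simp only [List.getD_eq_getElem?_getD, List.getElem?_map, List.getElem?_eq_getElem hk,
      Option.map_some, Option.getD_some]
    have hmem : (entIx Rs).reverse[k] ∈ entIx Rs := by
      rw [← List.mem_reverse]; exact List.getElem_mem hk
    set x := (entIx Rs).reverse[k]
    have hR : x.1 ∈ Rs := by
      unfold entIx at hmem
      simp only [List.mem_flatMap, List.mem_map] at hmem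
      obtain ⟨R, hR, i, -, j, -, e⟩ := hmem
      rw [← e]; exact hR
    have := congrFun (congrFun (congrFun hc ⟨x.1, hP _ hR⟩) x.2.1) x.2.2
    simp only [Finset.sum_apply, Pi.smul_apply, Matrix.sum_apply, Matrix.smul_apply,
      Pi.zero_apply, Matrix.zero_apply] at this
    exact this
  · refine Finset.sum_eq_zero fun i _ => ?_
    rw [List.getD_eq_default _ _ (by simpa using hk), smul_zero]

/-! ## Layers -/

instance : DecidableEq Irr := fun a b => by
  cases a <;> cases b <;> first | exact isTrue rfl | exact isFalse (fun h => by cases h)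

instance : Fintype Irr :=
  ⟨{.I, .L, .X2, .Y2, .Y2s, .X3, .Y3, .Y3s, .A, .C, .Cs}, fun R => by cases R <;> decide⟩

/-- The product of the representations with a property. -/
abbrev MatP (P : Irr → Prop) : Type := ∀ R : {R : Irr // P R}, Mat R.1 Kpq

/-- The map to a product of representations. -/
def rhoP (P : Irr → Prop) : Aloc →ₐ[Kpq] MatP P :=
  AlgHom.pi (R := Kpq) fun R : {R : Irr // P R} => rhoK R.1

theorem rhoK_den (R : Irr) (e : NE) : rhoK R (e.den gl) = e.den (atomsM R) := by
  rw [NE.map_den]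
  congr 1
  funext k
  rcases lt_or_ge k 13 with hk | hk
  · exact rhoK_gl R k hk
  · obtain ⟨m, rfl⟩ := Nat.exists_eq_add_of_le' hk
    change rhoK R 0 = lmat R.dim []
    rw [map_zero]
    ext i j
    simp [lmat, lget]

theorem rhoP_den (P : Irr → Prop) (e : NE) :
    rhoP P (e.den gl) = fun R : {R : Irr // P R} => e.den (atomsM R.1) := by
  funext R
  exact rhoK_den R.1 e

theorem eq_zero_of_indep {B : Type*} [Ring B] [Algebra Kpq B] {Rs : List Irr} {es : List NE}
    (h : indepCheck Rs es = true) (P : Irr → Prop) (hP : ∀ R ∈ Rs, P R) (π : Aloc →ₐ[Kpq] B)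
    (hN : ∀ x, π x = 0 → rhoP P x = 0) {x : Aloc}
    (hx : π x ∈ Submodule.span Kpq (Set.range fun i : Fin es.length => π ((es.get i).den gl)))
    (h0 : rhoP P x = 0) : π x = 0 := by
  obtain ⟨c, hc⟩ := (Submodule.mem_span_range_iff_exists_fun Kpq).mp hx
  have h1 := linearIndependent_reps h P hP
  rw [Fintype.linearIndependent_iff] at h1
  have h2 : rhoP P (x - ∑ i, c i • (es.get i).den gl) = 0 := by
    apply hN
    rw [map_sub, map_sum, ← hc]
    simp
  rw [map_sub, h0, zero_sub, neg_eq_zero, map_sum] at h2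
  have h3 := h1 c (by
    rw [← h2]
    refine Finset.sum_congr rfl fun i _ => ?_
    rw [map_smul, rhoP_den])
  rw [← hc]
  simp [h3]

theorem exists_rhoP_eq_one {Rs : List Irr} {es : List NE} (h : indepCheck Rs es = true)
    (P : Irr → Prop) [DecidablePred P] (hP : ∀ R ∈ Rs, P R)
    (hd : ∑ R : {R : Irr // P R}, R.1.dim * R.1.dim = es.length) (I : Set Aloc)
    (hadd : ∀ x ∈ I, ∀ y ∈ I, x + y ∈ I) (h0 : 0 ∈ I) (hs : ∀ (c : Kpq), ∀ x ∈ I, c • x ∈ I)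
    (he : ∀ e ∈ es, e.den gl ∈ I) : ∃ e ∈ I, rhoP P e = 1 := by
  have h1 := linearIndependent_reps h P hP
  have h2 := h1.span_eq_top_of_card_eq_finrank' (by
    rw [Fintype.card_fin, Module.finrank_pi_fintype, ← hd]
    refine Finset.sum_congr rfl fun R _ => ?_
    rw [Module.finrank_matrix, Fintype.card_fin, Module.finrank_self, mul_one])
  have h3 : (1 : MatP P) ∈ Submodule.span Kpq _ := h2 ▸ Submodule.mem_top
  obtain ⟨c, hc⟩ := (Submodule.mem_span_range_iff_exists_fun Kpq).mp h3
  refine ⟨∑ i, c i • (es.get i).den gl, ?_, ?_⟩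
  · have key : ∀ s : Finset (Fin es.length), ∑ i ∈ s, c i • (es.get i).den gl ∈ I := by
      intro s
      induction s using Finset.induction_on with
      | empty => simpa using h0
      | insert i s hi ih =>
        rw [Finset.sum_insert hi]
        exact hadd _ (hs _ _ (he _ (List.get_mem _ _))) _ ih
    exact key _
  · rw [map_sum, ← hc]
    refine Finset.sum_congr rfl fun i _ => ?_
    rw [map_smul, rhoP_den]

/-- A two-sided ideal generated by `k` modulo `N` is detected by a homomorphism that is injective
modulo `N` on the one-sided ideals generated by `k` and has `1` in the image of the ideal. -/
theorem mem_of_layer {A C : Type*} [Ring A] [Ring C] (ρ : A →+* C) (N : TwoSidedIdeal A) (k : A)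
    (hl : ∀ a, ρ (a * k) = 0 → a * k ∈ N) (hr : ∀ a, ρ (k * a) = 0 → k * a ∈ N) {e : A}
    (he : e ∈ TwoSidedIdeal.span (insert k (N : Set A))) (he1 : ρ e = 1) {x : A}
    (hx : x ∈ TwoSidedIdeal.span (insert k (N : Set A))) (h0 : ρ x = 0) : x ∈ N := by
  have h1 : e * x - x ∈ N := by
    rw [TwoSidedIdeal.mem_span_iff_mem_addSubgroup_closure] at hx
    clear h0
    induction hx using AddSubgroup.closure_induction with
    | mem y hy =>
      obtain ⟨_, ⟨a, -, s, hs, rfl⟩, c, -, rfl⟩ := hy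
      rcases hs with rfl | hs
      · have := hl (e * a - a) (by simp [sub_mul, he1])
        have := N.mul_mem_right _ c this
        convert this using 1
        simp only [sub_mul, mul_assoc]
      · have : a * s * c ∈ N := N.mul_mem_right _ _ (N.mul_mem_left _ _ hs)
        exact N.sub_mem (N.mul_mem_left _ _ this) this
    | zero => simpa using N.zero_mem
    | add y z _ _ hy hz =>
      have := N.add_mem hy hz
      convert this using 1
      simp only [mul_add]; abel
    | neg y _ hy =>
      have := N.neg_mem hy
      convert this using 1
      simp only [mul_neg]; abel
  have h2 : e * x ∈ N := by
    rw [TwoSidedIdeal.mem_span_iff_mem_addSubgroup_closure] at he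
    clear he1 h1 hx
    induction he using AddSubgroup.closure_induction with
    | mem y hy =>
      obtain ⟨_, ⟨a, -, s, hs, rfl⟩, c, -, rfl⟩ := hy
      rcases hs with rfl | hs
      · have := hr (c * x) (by simp [h0])
        have := N.mul_mem_left a _ this
        simpa only [mul_assoc] using this
      · exact N.mul_mem_right _ _ (N.mul_mem_right _ _ (N.mul_mem_left _ _ hs))
    | zero => simpa using N.zero_mem
    | add y z _ _ hy hz => rw [add_mul]; exact N.add_mem hy hz
    | neg y _ hy => rw [neg_mul]; exact N.neg_mem hy
  have := N.sub_mem h2 h1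
  rwa [sub_sub_cancel] at this

theorem loc_induction {P : Aloc → Prop} (hc : ∀ c : Kpq, P (c • 1)) (hg : ∀ k < 6, P (gl k))
    (ha : ∀ x y, P x → P y → P (x + y)) (hm : ∀ x y, P x → P y → P (x * y)) (x : Aloc) : P x := by
  obtain ⟨y, rfl⟩ := mkLoc_surjective x
  induction y using FreeAlgebra.induction with
  | grade0 r =>
    rw [AlgHom.commutes, Algebra.algebraMap_eq_smul_one]
    exact hc r
  | grade1 s =>
    cases s with
    | H i => exact mkLoc_fH i ▸ hg i (by omega)
    | K i => exact mkLoc_fK i ▸ hg _ (by omega)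
    | U i => exact mkLoc_fU i ▸ hg _ (by omega)
  | mul a b h1 h2 => rw [map_mul]; exact hm _ _ h1 h2
  | add a b h1 h2 => rw [map_add]; exact ha _ _ h1 h2

/-! ### Cut length one -/

section
variable {A : Type*} [Ring A] [Algebra Kpq A]

/-- Relations among `H, K, U` that are preserved by reversal. -/
structure URel (g : ℕ → A) : Prop where
  HK : ∀ i : Fin 2, g i * g (2 + i) = tau • g (2 + i)
  KH : ∀ i : Fin 2, g (2 + i) * g i = tau • g (2 + i)
  HU : ∀ i : Fin 2, g i * g (4 + i) = phi • g (4 + i)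
  UH : ∀ i : Fin 2, g (4 + i) * g i = phi • g (4 + i)
  KK : ∀ i : Fin 2, g (2 + i) * g (2 + i) = phi • g (2 + i)
  KU : ∀ i : Fin 2, g (2 + i) * g (4 + i) = 0
  UK : ∀ i : Fin 2, g (4 + i) * g (2 + i) = 0
  UU : ∀ i : Fin 2, g (4 + i) * g (4 + i) = delta • g (4 + i)
  KUU : ∀ i : Fin 2, g (2 + i) * (g (4 + (i + 1 : Fin 2)) * g (4 + i))
    = g (i + 1 : Fin 2) * g (4 + i)
  UUU : ∀ i : Fin 2, g (4 + i) * (g (4 + (i + 1 : Fin 2)) * g (4 + i)) = g (4 + i)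
  HKH : g 0 * (g 3 * g 0) = g 1 * (g 2 * g 1)
  cub : ∀ i : Fin 2, g i * (g i * g i) = b4 • (g i * g i) - b3 • g i + b0 • 1 + b2 • g (2 + i)
    + b1 • g (4 + i)

/-- Multiples of `U₁` that span the left ideal generated by `U₁`. -/
def leftU (g : ℕ → A) : List A :=
  [g 4, g 1 * g 4, g 5 * g 4, g 3 * g 4, g 0 * (g 3 * g 4)]

theorem URel.stable {g : ℕ → A} (h : URel g) (k : ℕ) (hk : k < 6) :
    ∀ x ∈ leftU g, g k * x ∈ Submodule.span Kpq {y | y ∈ leftU g} := by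
  obtain ⟨a, ha⟩ : ∃ a, a = g 0 := ⟨_, rfl⟩
  obtain ⟨b, hb⟩ : ∃ a, a = g 1 := ⟨_, rfl⟩
  obtain ⟨c, hc⟩ : ∃ a, a = g 2 := ⟨_, rfl⟩
  obtain ⟨l, hl⟩ : ∃ a, a = g 3 := ⟨_, rfl⟩
  obtain ⟨u, hu⟩ : ∃ a, a = g 4 := ⟨_, rfl⟩
  obtain ⟨v, hv⟩ : ∃ a, a = g 5 := ⟨_, rfl⟩
  have bl : b * l = tau • l := by subst hb hl; exact h.HK 1
  have ac : a * c = tau • c := by subst ha hc; exact h.HK 0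
  have lb : l * b = tau • l := by subst hb hl; exact h.KH 1
  have ca : c * a = tau • c := by subst ha hc; exact h.KH 0
  have au : a * u = phi • u := by subst ha hu; exact h.HU 0
  have bv : b * v = phi • v := by subst hb hv; exact h.HU 1
  have ua : u * a = phi • u := by subst ha hu; exact h.UH 0
  have vb : v * b = phi • v := by subst hb hv; exact h.UH 1
  have cc : c * c = phi • c := by subst hc; exact h.KK 0
  have ll : l * l = phi • l := by subst hl; exact h.KK 1
  have cu : c * u = 0 := by subst hc hu; exact h.KU 0
  have lv : l * v = 0 := by subst hl hv; exact h.KU 1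
  have uc : u * c = 0 := by subst hc hu; exact h.UK 0
  have vl : v * l = 0 := by subst hl hv; exact h.UK 1
  have uu : u * u = delta • u := by subst hu; exact h.UU 0
  have vv : v * v = delta • v := by subst hv; exact h.UU 1
  have cvu : c * (v * u) = b * u := by subst hb hc hu hv; exact h.KUU 0
  have luv : l * (u * v) = a * v := by subst ha hl hu hv; exact h.KUU 1
  have uvu : u * (v * u) = u := by subst hu hv; exact h.UUU 0
  have hkh : a * (l * a) = b * (c * b) := by subst ha hb hc hl; exact h.HKH
  have cua : a * (a * a) = b4 • (a * a) - b3 • a + b0 • 1 + b2 • c + b1 • u := by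
    subst ha hc hu; exact h.cub 0
  have cub : b * (b * b) = b4 • (b * b) - b3 • b + b0 • 1 + b2 • l + b1 • v := by
    subst hb hl hv; exact h.cub 1
  have e1 : ∀ {x y z : A} {c : Kpq}, x * y = c • y → x * (y * z) = c • (y * z) := by
    intro x y z c h; rw [← mul_assoc, h, smul_mul_assoc]
  have e2 : ∀ {x y z : A} {c : Kpq}, x * y = c • x → x * (y * z) = c • (x * z) := by
    intro x y z c h; rw [← mul_assoc, h, smul_mul_assoc]
  have e0 : ∀ {x y z : A}, x * y = 0 → x * (y * z) = 0 := by
    intro x y z h; rw [← mul_assoc, h, zero_mul]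
  have avu : a * (v * u) = l * u := by
    rw [← mul_assoc, ← luv, mul_assoc, mul_assoc, uvu]
  have bbu : b * (b * u) = a * (l * u) := by
    have h1 : a * (l * (a * (v * u))) = b * (c * (b * (v * u))) := by
      simpa only [mul_assoc] using congrArg (· * (v * u)) hkh
    rw [avu, e2 ll, e1 bv] at h1
    simp only [mul_smul_comm, cvu] at h1
    have := congrArg (phi⁻¹ • ·) h1
    simpa [smul_smul, phi_ne] using this.symm
  have abu : a * (b * u) = tau • (b * u) := by rw [← cvu, e1 ac]
  have cbu : c * (b * u) = phi • (b * u) := by rw [← cvu, e2 cc]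
  have ubu : u * (b * u) = 0 := by rw [← cvu, e0 uc]
  have clu : c * (l * u) = tau • (b * u) := by rw [← avu, e2 ca, cvu]
  have ulu : u * (l * u) = phi • u := by rw [← avu, e2 ua, uvu]
  have aalu : a * (a * (l * u)) = b4 • (a * (l * u)) - b3 • (l * u) + b0 • (v * u)
      + b2 • (b * u) + b1 • u := by
    have := congrArg (· * (v * u)) cua
    simp only [mul_assoc, add_mul, sub_mul, smul_mul_assoc, one_mul, avu, cvu, uvu] at this
    exact this
  have balu : b * (a * (l * u)) = b4 • (a * (l * u)) - b3 • (b * u) + b0 • u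
      + b2 • (l * u) + b1 • (v * u) := by
    have := congrArg (· * u) cub
    simp only [mul_assoc, add_mul, sub_mul, smul_mul_assoc, one_mul, bbu] at this
    exact this
  have calu : c * (a * (l * u)) = (tau * tau) • (b * u) := by rw [e2 ca, clu, smul_smul]
  have lalu : l * (a * (l * u)) = (tau * tau) • (l * u) := by
    rw [← bbu, e2 lb, e2 lb, smul_smul]
  have ualu : u * (a * (l * u)) = (phi * phi) • u := by rw [e2 ua, ulu, smul_smul]
  have valu : v * (a * (l * u)) = (phi * phi) • (v * u) := by
    rw [← bbu, e2 vb, e2 vb, smul_smul]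
  unfold leftU
  rw [← ha, ← hb, ← hl, ← hu, ← hv]
  set V := Submodule.span Kpq {y | y ∈ [u, b * u, v * u, l * u, a * (l * u)]} with hV
  have m0 : u ∈ V := Submodule.subset_span (by simp)
  have m1 : b * u ∈ V := Submodule.subset_span (by simp)
  have m2 : v * u ∈ V := Submodule.subset_span (by simp)
  have m3 : l * u ∈ V := Submodule.subset_span (by simp)
  have m4 : a * (l * u) ∈ V := Submodule.subset_span (by simp)
  have ms : ∀ {x : A} (c : Kpq), x ∈ V → c • x ∈ V := fun c h => V.smul_mem c h
  simp only [List.mem_cons, List.not_mem_nil, or_false]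
  interval_cases k
  · rw [← ha]
    rintro x (rfl | rfl | rfl | rfl | rfl)
    · rw [au]; exact ms _ m0
    · rw [abu]; exact ms _ m1
    · rw [avu]; exact m3
    · exact m4
    · rw [aalu]
      exact V.add_mem (V.add_mem (V.add_mem (V.sub_mem (ms _ m4) (ms _ m3)) (ms _ m2)) (ms _ m1))
        (ms _ m0)
  · rw [← hb]
    rintro x (rfl | rfl | rfl | rfl | rfl)
    · exact m1
    · rw [bbu]; exact m4
    · rw [e1 bv]; exact ms _ m2
    · rw [e1 bl]; exact ms _ m3
    · rw [balu]
      exact V.add_mem (V.add_mem (V.add_mem (V.sub_mem (ms _ m4) (ms _ m1)) (ms _ m0)) (ms _ m3))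
        (ms _ m2)
  · rw [← hc]
    rintro x (rfl | rfl | rfl | rfl | rfl)
    · rw [cu]; exact V.zero_mem
    · rw [cbu]; exact ms _ m1
    · rw [cvu]; exact m1
    · rw [clu]; exact ms _ m1
    · rw [calu]; exact ms _ m1
  · rw [← hl]
    rintro x (rfl | rfl | rfl | rfl | rfl)
    · exact m3
    · rw [e2 lb]; exact ms _ m3
    · rw [e0 lv]; exact V.zero_mem
    · rw [e2 ll]; exact ms _ m3
    · rw [lalu]; exact ms _ m3
  · rw [← hu]
    rintro x (rfl | rfl | rfl | rfl | rfl)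
    · rw [uu]; exact ms _ m0
    · rw [ubu]; exact V.zero_mem
    · rw [uvu]; exact m0
    · rw [ulu]; exact ms _ m0
    · rw [ualu]; exact ms _ m0
  · rw [← hv]
    rintro x (rfl | rfl | rfl | rfl | rfl)
    · exact m2
    · rw [e2 vb]; exact ms _ m2
    · rw [e2 vv]; exact ms _ m2
    · rw [e0 vl]; exact V.zero_mem
    · rw [valu]; exact ms _ m2

end

theorem uRel_gl : URel gl where
  HK i := by simpa [nH, nK, den_tau] using sub_eq_zero_of_getD (relI_gl i) 0 rfl
  KH i := by simpa [nH, nK, den_tau] using sub_eq_zero_of_getD (relI_gl i) 1 rfl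
  HU i := by simpa [nH, nU, den_phi] using sub_eq_zero_of_getD (relI_gl i) 2 rfl
  UH i := by simpa [nH, nU, den_phi] using sub_eq_zero_of_getD (relI_gl i) 3 rfl
  KK i := by simpa [nK, den_phi] using sub_eq_zero_of_getD (relI_gl i) 4 rfl
  KU i := by simpa [nK, nU] using sub_eq_zero_of_getD (relI_gl i) 5 rfl
  UK i := by simpa [nK, nU] using sub_eq_zero_of_getD (relI_gl i) 6 rfl
  UU i := by simpa [nU, den_delta] using sub_eq_zero_of_getD (relI_gl i) 7 rfl
  KUU i := by simpa [nH, nK, nU, mul_assoc] using sub_eq_zero_of_getD (relI_gl i) 10 rfl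
  UUU i := by simpa [nU, mul_assoc] using sub_eq_zero_of_getD (relI_gl i) 12 rfl
  HKH := by simpa [nH, nK, mul_assoc] using sub_eq_zero_of_getD relR_gl 0 rfl
  cub i := by
    have := sub_eq_zero_of_getD (relI_gl i) 13 rfl
    simp only [NE.den_sub, NE.den_add, NE.den_smul, NE.den_mul, nH, nK, nU, NE.den_atom, den_xi,
      den_zeta, den_zetas, den_b1, den_b2, NE.den_one] at this
    have e : (gl i - xi • 1) * (gl i - zeta • 1) * (gl i - zetas • 1)
        = gl i * (gl i * gl i) - b4 • (gl i * gl i) + b3 • gl i - b0 • 1 := by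
      simp only [b4, b3, b0, sub_mul, mul_sub, add_smul, mul_smul_comm, smul_mul_assoc, mul_one,
        one_mul, smul_smul, smul_sub, mul_assoc, mul_comm zetas, mul_comm zeta xi]
      abel
    rw [e] at this
    have h2 : gl i * (gl i * gl i) = (gl i * (gl i * gl i) - b4 • (gl i * gl i) + b3 • gl i
      - b0 • 1) + b4 • (gl i * gl i) - b3 • gl i + b0 • 1 := by abel
    rw [h2, this]
    abel

open MulOpposite in
theorem uRel_op : URel fun k => op (gl k) where
  HK i := congrArg op (uRel_gl.KH i)
  KH i := congrArg op (uRel_gl.HK i)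
  HU i := congrArg op (uRel_gl.UH i)
  UH i := congrArg op (uRel_gl.HU i)
  KK i := congrArg op (uRel_gl.KK i)
  KU i := congrArg op (uRel_gl.UK i)
  UK i := congrArg op (uRel_gl.KU i)
  UU i := congrArg op (uRel_gl.UU i)
  KUU i := by
    have := sub_eq_zero_of_getD (relI_gl i) 11 rfl
    simp only [nH, nK, nU, NE.den_mul, NE.den_atom] at this
    exact congrArg op this
  UUU i := by
    have := uRel_gl.UUU i
    rw [← mul_assoc] at this
    exact congrArg op this
  HKH := by
    have := uRel_gl.HKH
    rw [← mul_assoc, ← mul_assoc] at this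
    exact congrArg op this
  cub i := by
    have := uRel_gl.cub i
    rw [← mul_assoc] at this
    exact congrArg op this

/-- The product of the atoms in a list. -/
def nw : List ℕ → NE
  | [] => 1
  | k :: w => w.foldl (fun e k => e * NE.atom k) (NE.atom k)

theorem den_nw {A : Type*} [Ring A] [Algebra Kpq A] (g : ℕ → A) (w : List ℕ) :
    (nw w).den g = (w.map g).prod := by
  cases w with
  | nil => simp [nw]
  | cons k w =>
    have key : ∀ (w : List ℕ) (e : NE), (w.foldl (fun e k => e * NE.atom k) e).den g
        = e.den g * (w.map g).prod := by
      intro w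
      induction w with
      | nil => simp
      | cons k w ih => intro e; simp [ih, mul_assoc]
    simp [nw, key]

/-- The words of the basis diagrams. -/
def basisW : ℕ → List (List ℕ)
  | 0 => [[6]]
  | 1 => [[4], [4, 1], [4, 5], [4, 3], [4, 3, 0], [1, 4], [2, 5, 2], [2, 5], [2, 5, 0], [2, 5, 2, 1],
      [5, 4], [5, 2], [5], [5, 0], [5, 2, 1], [3, 4], [3, 4, 1], [0, 5], [3, 4, 3], [3, 4, 3, 0],
      [0, 3, 4], [0, 3, 4, 1], [0, 0, 5], [0, 3, 4, 3], [0, 3, 4, 3, 0]]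
  | 2 => [[1, 1, 2], [1, 0, 3], [1, 2], [1, 2, 3], [0, 1, 2], [0, 0, 3], [0, 0, 3, 0],
      [0, 0, 3, 0, 0], [0, 3], [0, 3, 0], [0, 3, 0, 1], [0, 3, 0, 0], [0, 3, 2], [0, 3, 2, 1], [3],
      [3, 0], [3, 0, 1], [3, 0, 0], [3, 2], [3, 2, 1], [3, 2, 3], [2], [2, 1], [2, 1, 1], [2, 1, 0],
      [2, 3], [2, 3, 0], [2, 3, 2], [7], [8], [9], [10], [11], [12]]
  | 3 => [[], [0], [1], [0, 0], [0, 1], [1, 0], [1, 1], [0, 0, 1], [0, 1, 0], [0, 1, 1], [1, 0, 0],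
      [1, 0, 1], [1, 1, 0], [0, 0, 1, 1], [0, 1, 0, 1], [0, 1, 1, 0], [1, 0, 1, 0], [1, 1, 0, 0],
      [0, 1, 0, 1, 0]]
  | _ => []

theorem basis_eq (j : ℕ) (hj : j ≠ 3) : basis j = (basisW j).map fun w => (w.map gl).prod := by
  match j, hj with
  | 0, _ => simp [basis, basisW]; rfl
  | 1, _ => simp only [basis, basisW, pow_two, mul_assoc, List.map_cons, List.map_nil, List.prod_cons,
              List.prod_nil, mul_one]; rfl
  | 2, _ => simp only [basis, basisW, pow_two, mul_assoc, List.map_cons, List.map_nil, List.prod_cons,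
              List.prod_nil, mul_one]; rfl
  | (n + 4), _ => rfl

theorem basis_eq_three : basis 3 = ((basisW 3).map fun w => (w.map gl).prod) ++ [Z7] := by
  simp only [basis, basisW, pow_two, mul_assoc, List.map_cons, List.map_nil, List.prod_cons,
    List.prod_nil, mul_one]
  rfl

theorem TwoSidedIdeal.ksmul_mem {A : Type*} [Ring A] [Algebra Kpq A] (I : TwoSidedIdeal A) (c : Kpq)
    {x : A} (h : x ∈ I) : c • x ∈ I := by
  rw [← one_mul x, ← smul_mul_assoc]
  exact I.mul_mem_left _ _ h

theorem prod_mem_of_mem {A : Type*} [Ring A] (I : TwoSidedIdeal A) {g : ℕ → A} {k : ℕ} {w : List ℕ}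
    (hk : k ∈ w) (h : g k ∈ I) : (w.map g).prod ∈ I := by
  obtain ⟨u, v, rfl⟩ := List.append_of_mem hk
  simp only [List.map_append, List.map_cons, List.prod_append, List.prod_cons]
  exact I.mul_mem_left _ _ (I.mul_mem_right _ _ h)

section
variable {B : Type*} [Ring B] [Algebra Kpq B]

theorem mul_mem_of_gens (π : Aloc →ₐ[Kpq] B) {V : Submodule Kpq B}
    (h : ∀ k < 6, ∀ x ∈ V, π (gl k) * x ∈ V) (a : Aloc) : ∀ x ∈ V, π a * x ∈ V := by
  induction a using loc_induction with
  | hc c => intro x hx; rw [map_smul, map_one, smul_mul_assoc, one_mul]; exact V.smul_mem c hx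
  | hg k hk => exact h k hk
  | ha a b ha hb => intro x hx; rw [map_add, add_mul]; exact V.add_mem (ha x hx) (hb x hx)
  | hm a b ha hb => intro x hx; rw [map_mul, mul_assoc]; exact ha _ (hb x hx)

theorem mem_mul_of_gens (π : Aloc →ₐ[Kpq] B) {V : Submodule Kpq B}
    (h : ∀ k < 6, ∀ x ∈ V, x * π (gl k) ∈ V) (a : Aloc) : ∀ x ∈ V, x * π a ∈ V := by
  induction a using loc_induction with
  | hc c => intro x hx; rw [map_smul, map_one, mul_smul_comm, mul_one]; exact V.smul_mem c hx
  | hg k hk => exact h k hk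
  | ha a b ha hb => intro x hx; rw [map_add, mul_add]; exact V.add_mem (ha x hx) (hb x hx)
  | hm a b ha hb => intro x hx; rw [map_mul, ← mul_assoc]; exact hb _ (ha x hx)

theorem span_stable {V : Submodule Kpq B} {S : Set B} (hV : V = Submodule.span Kpq S) (b : B)
    (h : ∀ x ∈ S, b * x ∈ V) : ∀ x ∈ V, b * x ∈ V := by
  subst hV
  intro x hx
  induction hx using Submodule.span_induction with
  | mem x hx => exact h x hx
  | zero => rw [mul_zero]; exact zero_mem _
  | add x y _ _ h1 h2 => rw [mul_add]; exact add_mem h1 h2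
  | smul c x _ h1 => rw [mul_smul_comm]; exact Submodule.smul_mem _ _ h1

end

/-- The ideal generated by the `U`. -/
def IU : TwoSidedIdeal Aloc := TwoSidedIdeal.span (insert (gl 4) ((⊥ : TwoSidedIdeal Aloc) : Set Aloc))

/-- The ideal generated by the `K` and the `U`. -/
def IK : TwoSidedIdeal Aloc := TwoSidedIdeal.span (insert (gl 2) (IU : Set Aloc))

theorem U1_mem : gl 4 ∈ IU := TwoSidedIdeal.subset_span (Set.mem_insert _ _)

theorem U2_mem : gl 5 ∈ IU := by
  have h : gl 5 * (gl 4 * gl 5) = gl 5 := uRel_gl.UUU 1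
  rw [← h]
  exact IU.mul_mem_left _ _ (IU.mul_mem_right _ _ U1_mem)

theorem IU_le {x : Aloc} (h : x ∈ IU) : x ∈ IK := TwoSidedIdeal.subset_span (Set.mem_insert_of_mem _ h)

theorem K1_mem : gl 2 ∈ IK := TwoSidedIdeal.subset_span (Set.mem_insert _ _)

theorem b0_smul_eq (x : Aloc) : b0 • x = gl 0 * (gl 0 * (gl 0 * x)) - b4 • (gl 0 * (gl 0 * x))
    + b3 • (gl 0 * x) - b2 • (gl 2 * x) - b1 • (gl 4 * x) := by
  have h := congrArg (· * x) (uRel_gl.cub 0)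
  simp only [mul_assoc, add_mul, sub_mul, smul_mul_assoc, one_mul] at h
  change gl 0 * (gl 0 * (gl 0 * x)) = b4 • (gl 0 * (gl 0 * x)) - b3 • (gl 0 * x) + b0 • x
    + b2 • (gl 2 * x) + b1 • (gl 4 * x) at h
  rw [h]; abel

theorem b0_smul_eq' (x : Aloc) : b0 • x = x * gl 0 * gl 0 * gl 0 - b4 • (x * gl 0 * gl 0)
    + b3 • (x * gl 0) - b2 • (x * gl 2) - b1 • (x * gl 4) := by
  have h := congrArg (x * ·) (uRel_gl.cub 0)
  simp only [← mul_assoc, mul_add, mul_sub, mul_smul_comm, mul_one] at h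
  change x * gl 0 * gl 0 * gl 0 = b4 • (x * gl 0 * gl 0) - b3 • (x * gl 0) + b0 • x
    + b2 • (x * gl 2) + b1 • (x * gl 4) at h
  rw [h]; abel

theorem K2_mem : gl 3 ∈ IK := by
  have key : ∀ x, gl 0 * x ∈ IK → x ∈ IK := by
    intro x hx
    have h : b0 • x ∈ IK := by
      rw [b0_smul_eq]
      exact IK.sub_mem (IK.sub_mem (IK.add_mem (IK.sub_mem (IK.mul_mem_left _ _ (IK.mul_mem_left _ _ hx))
        (TwoSidedIdeal.ksmul_mem _ _ (IK.mul_mem_left _ _ hx))) (TwoSidedIdeal.ksmul_mem _ _ hx))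
        (TwoSidedIdeal.ksmul_mem _ _ (IK.mul_mem_right _ _ K1_mem)))
        (TwoSidedIdeal.ksmul_mem _ _ (IK.mul_mem_right _ _ (IU_le U1_mem)))
    have := TwoSidedIdeal.ksmul_mem IK b0⁻¹ h
    rwa [smul_smul, inv_mul_cancel₀ b0_ne, one_smul] at this
  have key' : ∀ x, x * gl 0 ∈ IK → x ∈ IK := by
    intro x hx
    have h : b0 • x ∈ IK := by
      rw [b0_smul_eq']
      exact IK.sub_mem (IK.sub_mem (IK.add_mem (IK.sub_mem (IK.mul_mem_right _ _ (IK.mul_mem_right _ _ hx))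
        (TwoSidedIdeal.ksmul_mem _ _ (IK.mul_mem_right _ _ hx))) (TwoSidedIdeal.ksmul_mem _ _ hx))
        (TwoSidedIdeal.ksmul_mem _ _ (IK.mul_mem_left _ _ K1_mem)))
        (TwoSidedIdeal.ksmul_mem _ _ (IK.mul_mem_left _ _ (IU_le U1_mem)))
    have := TwoSidedIdeal.ksmul_mem IK b0⁻¹ h
    rwa [smul_smul, inv_mul_cancel₀ b0_ne, one_smul] at this
  apply key'
  apply key
  have h : gl 0 * (gl 3 * gl 0) = gl 1 * (gl 2 * gl 1) := uRel_gl.HKH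
  rw [h]
  exact IK.mul_mem_left _ _ (IK.mul_mem_right _ _ K1_mem)

theorem range_nw_map {B : Type*} (f : Aloc → B) (W : List (List ℕ)) :
    (Set.range fun i : Fin (W.map nw).length => f (((W.map nw).get i).den gl))
      = {y | ∃ w ∈ W, y = f (w.map gl).prod} := by
  ext y
  constructor
  · rintro ⟨i, rfl⟩
    obtain ⟨w, hw, e⟩ := List.mem_map.mp (List.get_mem (W.map nw) i)
    exact ⟨w, hw, by simp only; rw [← e, den_nw]⟩
  · rintro ⟨w, hw, rfl⟩
    obtain ⟨i, hi⟩ := List.get_of_mem (List.mem_map_of_mem (f := nw) hw)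
    exact ⟨i, by simp only; rw [hi, den_nw]⟩

theorem leftU_check : indepCheck [.L] ([[4], [1, 4], [5, 4], [3, 4], [0, 3, 4]].map nw) = true := by
  decide +kernel
theorem rightU_check : indepCheck [.L] ([[4], [4, 1], [4, 5], [4, 3], [4, 3, 0]].map nw) = true := by
  decide +kernel
theorem basis1_check : indepCheck [.L] ((basisW 1).map nw) = true := by decide +kernel

theorem leftU_inj (a : Aloc) (h : rhoP (· = .L) (a * gl 4) = 0) : a * gl 4 = 0 := by
  refine eq_zero_of_indep (π := AlgHom.id Kpq Aloc) leftU_check (· = .L) (by simp)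
    (fun x hx => by rw [show x = 0 from hx, map_zero]) ?_ h
  have := mul_mem_of_gens (AlgHom.id Kpq Aloc) (V := Submodule.span Kpq {y | y ∈ leftU gl})
    (fun k hk => span_stable rfl _ (uRel_gl.stable k hk)) a (gl 4)
    (Submodule.subset_span (by simp [leftU]))
  rw [range_nw_map]
  refine Submodule.span_mono ?_ this
  intro y hy
  simp only [leftU, Set.mem_ofPred_eq, List.mem_cons, List.not_mem_nil, or_false] at hy
  simpa [mul_assoc] using hy

open MulOpposite in
theorem rightU_inj (a : Aloc) (h : rhoP (· = .L) (gl 4 * a) = 0) : gl 4 * a = 0 := by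
  refine eq_zero_of_indep (π := AlgHom.id Kpq Aloc) rightU_check (· = .L) (by simp)
    (fun x hx => by rw [show x = 0 from hx, map_zero]) ?_ h
  rw [range_nw_map]
  set V := Submodule.span Kpq {y | y ∈ leftU fun k => op (gl k)} with hV
  have := mem_mul_of_gens (AlgHom.id Kpq Aloc) (V := V.comap (opLinearEquiv Kpq).toLinearMap)
    (fun k hk x hx => span_stable hV (op (gl k)) (uRel_op.stable k hk) (op x) hx) a (gl 4)
    (Submodule.subset_span (by simp [leftU]))
  rw [hV] at this
  have h2 : Submodule.comap (opLinearEquiv Kpq).toLinearMap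
      (Submodule.span Kpq {y | y ∈ leftU fun k => op (gl k)})
      = Submodule.span Kpq (unop '' {y | y ∈ leftU fun k => op (gl k)}) := by
    rw [Submodule.comap_equiv_eq_map_symm, Submodule.map_span]
    rfl
  rw [h2] at this
  refine Submodule.span_mono ?_ this
  rintro _ ⟨y, hy, rfl⟩
  simp only [leftU, Set.mem_ofPred_eq, List.mem_cons, List.not_mem_nil, or_false] at hy
  rcases hy with rfl | rfl | rfl | rfl | rfl <;> simp [mul_assoc]

theorem nw_mem {I : TwoSidedIdeal Aloc} {W : List (List ℕ)} {S : List ℕ}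
    (h : (W.all fun w => w.any fun k => S.contains k) = true) (hS : ∀ k ∈ S, gl k ∈ I) :
    ∀ e ∈ W.map nw, e.den gl ∈ I := by
  intro e he
  obtain ⟨w, hw, rfl⟩ := List.mem_map.mp he
  rw [den_nw]
  have := List.all_eq_true.mp h w hw
  obtain ⟨k, hk, hk'⟩ := List.any_eq_true.mp this
  exact prod_mem_of_mem I hk (hS k (by simpa using hk'))

/-- The ideal generated by the `U` is detected by the representation `L`. -/
theorem eq_zero_of_mem_IU {x : Aloc} (hx : x ∈ IU) (h : rhoP (· = .L) x = 0) : x = 0 := by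
  obtain ⟨e, he, he1⟩ := exists_rhoP_eq_one basis1_check (· = .L) (by simp) (by decide +kernel)
    {x | x ∈ IU} (fun x hx y hy => IU.add_mem hx hy) IU.zero_mem
    (fun c x hx => TwoSidedIdeal.ksmul_mem IU c hx)
    (nw_mem (I := IU) (W := basisW 1) (S := [4, 5]) (by decide) (by simp [U1_mem, U2_mem]))
  have := mem_of_layer (rhoP (· = .L)).toRingHom ⊥ (gl 4)
    (fun a ha => (TwoSidedIdeal.mem_bot _).mpr (leftU_inj a ha))
    (fun a ha => (TwoSidedIdeal.mem_bot _).mpr (rightU_inj a ha)) he he1 hx h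
  exact (TwoSidedIdeal.mem_bot _).mp this

/-! ### Cut length two -/

open Polynomial in
/-- A vector belongs to a submodule if its eigencomponents do. -/
theorem mem_of_eigencomponents {K B : Type*} [Field K] [Ring B] [Algebra K B] (M : Submodule K B)
    (h z : B) (a b c d : K) (hab : a ≠ b) (hac : a ≠ c) (hbc : b ≠ c) (hda : d ≠ a) (hdb : d ≠ b)
    (hdc : d ≠ c)
    (h0 : (h - b • 1) * ((h - c • 1) * (h - d • 1)) * z ∈ M)
    (h1 : (h - a • 1) * ((h - c • 1) * (h - d • 1)) * z ∈ M)
    (h2 : (h - a • 1) * ((h - b • 1) * (h - d • 1)) * z ∈ M)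
    (h3 : (h - a • 1) * ((h - b • 1) * (h - c • 1)) * z ∈ M) : z ∈ M := by
  have key : ∀ (p p1 p2 : K[X]) (s t : K), s ≠ t → aeval h p1 * z ∈ M → aeval h p2 * z ∈ M →
      p1 = (X - C s) * p → p2 = (X - C t) * p → aeval h p * z ∈ M := by
    rintro p _ _ s t hst h1 h2 rfl rfl
    have h3 := M.smul_mem (t - s)⁻¹ (M.sub_mem h1 h2)
    have e : (t - s)⁻¹ • (aeval h ((X - C s) * p) * z - aeval h ((X - C t) * p) * z)
        = aeval h p * z := by
      rw [← sub_mul, ← map_sub, ← sub_mul, ← smul_mul_assoc, ← map_smul, sub_sub_sub_cancel_left,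
        ← C_sub, ← smul_eq_C_mul, smul_smul, inv_mul_cancel₀ (sub_ne_zero.mpr hst.symm), one_smul]
    rwa [e] at h3
  have conv : ∀ s t u : K, (h - s • 1) * ((h - t • 1) * (h - u • 1)) * z ∈ M →
      aeval h ((X - C s) * ((X - C t) * (X - C u))) * z ∈ M := by
    intro s t u h
    simpa [Algebra.algebraMap_eq_smul_one] using h
  replace h0 := conv _ _ _ h0
  replace h1 := conv _ _ _ h1
  replace h2 := conv _ _ _ h2
  replace h3 := conv _ _ _ h3
  have e1 := key ((X - C c) * (X - C d)) _ _ b a hab.symm h0 h1 (by ring) (by ring)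
  have e2 := key ((X - C b) * (X - C d)) _ _ c a hac.symm h0 h2 (by ring) (by ring)
  have e3 := key ((X - C b) * (X - C c)) _ _ d a hda h0 h3 (by ring) (by ring)
  have e4 := key ((X - C a) * (X - C c)) _ _ d b hdb h1 h3 (by ring) (by ring)
  have e5 := key (X - C d) _ _ c b hbc.symm e1 e2 (by ring) (by ring)
  have e6 := key (X - C c) _ _ b a hab.symm e3 e4 (by ring) (by ring)
  have e7 := key 1 _ _ d c hdc e5 e6 (by ring) (by ring)
  simpa using e7

/-- Elements that separate the eigenspaces of `H₁` modulo `U₁`. -/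
def eX : ℕ → NE
  | 0 => (.atom 0 - eZeta • 1) * ((.atom 0 - eZetas • 1) * (.atom 0 - eTau • 1))
  | 1 => (.atom 0 - eXi • 1) * ((.atom 0 - eZetas • 1) * (.atom 0 - eTau • 1))
  | 2 => (.atom 0 - eXi • 1) * ((.atom 0 - eZeta • 1) * (.atom 0 - eTau • 1))
  | 3 => .atom 2
  | _ => 0

/-- The blocks with index `1`. -/
def eBlk : ℕ → NE
  | 0 => 1
  | 1 => .atom 1
  | 2 => .atom 1 * .atom 1
  | 3 => .atom 3
  | _ => 0

/-- The exponents that occur between the end factors. -/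
def midW : ℕ → List ℕ
  | 0 => [1, 2, 3]
  | 1 => [1, 2]
  | 2 => [1, 2]
  | 3 => [0, 1, 2, 3]
  | _ => []

/-- The expressions that span the left ideal of `K₁` modulo the `U`. -/
def leftK : List NE := (List.range 4).flatMap fun s => (midW s).map fun c => eX s * (eBlk c * .atom 2)

theorem xi_ne_zeta : xi ≠ zeta := by
  rw [← sub_ne_zero, ← den_xi, ← den_zeta, ← Ex.den_sub]; exact Ex.den_ne _ (by decide +kernel)
theorem xi_ne_zetas : xi ≠ zetas := by
  rw [← sub_ne_zero, ← den_xi, ← den_zetas, ← Ex.den_sub]; exact Ex.den_ne _ (by decide +kernel)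
theorem zeta_ne_zetas : zeta ≠ zetas := by
  rw [← sub_ne_zero, ← den_zeta, ← den_zetas, ← Ex.den_sub]; exact Ex.den_ne _ (by decide +kernel)
theorem tau_ne_xi : tau ≠ xi := by
  rw [← sub_ne_zero, ← den_xi, ← den_tau, ← Ex.den_sub]; exact Ex.den_ne _ (by decide +kernel)
theorem tau_ne_zeta : tau ≠ zeta := by
  rw [← sub_ne_zero, ← den_tau, ← den_zeta, ← Ex.den_sub]; exact Ex.den_ne _ (by decide +kernel)
theorem tau_ne_zetas : tau ≠ zetas := by
  rw [← sub_ne_zero, ← den_tau, ← den_zetas, ← Ex.den_sub]; exact Ex.den_ne _ (by decide +kernel)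

section
variable {B : Type*} [Ring B] [Algebra Kpq B] {g : ℕ → B}

theorem BlockRel.factor (hg : BlockRel g) : (g 0 - xi • 1) * ((g 0 - zeta • 1) * (g 0 - zetas • 1))
    = b2 • g 2 := by
  have h : g 0 * g 0 * g 0 = b4 • (g 0 * g 0) - b3 • g 0 + b0 • (1 : B) + b2 • g 2 := by
    have := hg.cub false
    rwa [den_b4, den_b3, den_b0, den_b2] at this
  have e : (g 0 - xi • 1) * ((g 0 - zeta • 1) * (g 0 - zetas • 1))
      = g 0 * g 0 * g 0 - b4 • (g 0 * g 0) + b3 • g 0 - b0 • 1 := by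
    simp only [b4, b3, b0, sub_mul, mul_sub, add_smul, mul_smul_comm, smul_mul_assoc, mul_one,
      one_mul, smul_smul, smul_sub, mul_assoc, mul_comm zetas, mul_comm zeta xi,
      mul_left_comm zeta xi]
    abel
  rw [e, h]; abel

theorem BlockRel.eigL (hg : BlockRel g) (s : ℕ) (hs : s < 4) : EigL g s ((eX s).den g) := by
  have hk : g 0 * g 2 = tau • g 2 := by have := hg.hk false; rwa [den_tau] at this
  have kh : g 2 * g 0 = tau • g 2 := by have := hg.kh false; rwa [den_tau] at this
  have kk : g 2 * g 2 = phi • g 2 := by have := hg.kk false; rwa [den_phi] at this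
  have f := hg.factor
  have hk' : (g 0 - tau • 1) * g 2 = 0 := by simp [sub_mul, hk]
  have c : ∀ s t : Kpq, (g 0 - s • 1) * (g 0 - t • 1) = (g 0 - t • 1) * (g 0 - s • 1) := by
    intro s t
    simp only [sub_mul, mul_sub, smul_sub, mul_smul_comm, smul_mul_assoc, mul_one, one_mul,
      smul_smul, mul_comm t s]
    abel
  have c' : ∀ (s t : Kpq) (z : B), (g 0 - s • 1) * ((g 0 - t • 1) * z)
      = (g 0 - t • 1) * ((g 0 - s • 1) * z) := by
    intro s t z
    rw [← mul_assoc, c, mul_assoc]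
  have f' : (g 0 - xi • 1) * ((g 0 - zeta • 1) * ((g 0 - zetas • 1) * (g 0 - tau • 1))) = 0 := by
    rw [c zetas tau, c' zeta tau, c' xi tau, f, mul_smul_comm, hk', smul_zero]
  have fin : ∀ (x : B) (t : Kpq), x * (g 0 - t • 1) = 0 → x * g 0 = t • x := by
    intro x t h
    rw [mul_sub, mul_smul_comm, mul_one, sub_eq_zero] at h
    exact h
  interval_cases s
  · refine ⟨fin _ _ ?_, ?_⟩
    · simp only [eX, NE.den_mul, NE.den_sub, NE.den_atom, NE.den_smul, NE.den_one, den_xi, den_zeta,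
        den_zetas, den_tau, eigH, mul_assoc]
      rw [c tau xi, c' zetas xi, c' zeta xi, f']
    · simp only [eX, NE.den_mul, NE.den_sub, NE.den_atom, NE.den_smul, NE.den_one, den_xi, den_zeta,
        den_zetas, den_tau, eigK, mul_assoc]
      change _ * (_ * (_ * g 2)) = _
      rw [hk']; simp
  · refine ⟨fin _ _ ?_, ?_⟩
    · simp only [eX, NE.den_mul, NE.den_sub, NE.den_atom, NE.den_smul, NE.den_one, den_xi, den_zeta,
        den_zetas, den_tau, eigH, mul_assoc]
      rw [c tau zeta, c' zetas zeta, f']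
    · simp only [eX, NE.den_mul, NE.den_sub, NE.den_atom, NE.den_smul, NE.den_one, den_xi, den_zeta,
        den_zetas, den_tau, eigK, mul_assoc]
      change _ * (_ * (_ * g 2)) = _
      rw [hk']; simp
  · refine ⟨fin _ _ ?_, ?_⟩
    · simp only [eX, NE.den_mul, NE.den_sub, NE.den_atom, NE.den_smul, NE.den_one, den_xi, den_zeta,
        den_zetas, den_tau, eigH, mul_assoc]
      rw [c tau zetas, f']
    · simp only [eX, NE.den_mul, NE.den_sub, NE.den_atom, NE.den_smul, NE.den_one, den_xi, den_zeta,
        den_zetas, den_tau, eigK, mul_assoc]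
      change _ * (_ * (_ * g 2)) = _
      rw [hk']; simp
  · exact ⟨hg.kh false, hg.kk false⟩

/-- Combinations of the blocks with one index. -/
def blkSpan (g : ℕ → B) (sd : Bool) : Submodule Kpq B :=
  Submodule.span Kpq {1, gH g sd, gH g sd * gH g sd, gK g sd}

theorem BlockRel.mul_mem_blkSpan (hg : BlockRel g) (sd : Bool) :
    ∀ x ∈ blkSpan g sd, gH g sd * x ∈ blkSpan g sd ∧ gK g sd * x ∈ blkSpan g sd := by
  have m0 : (1 : B) ∈ blkSpan g sd := Submodule.subset_span (by simp)
  have m1 : gH g sd ∈ blkSpan g sd := Submodule.subset_span (by simp)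
  have m2 : gH g sd * gH g sd ∈ blkSpan g sd := Submodule.subset_span (by simp)
  have m3 : gK g sd ∈ blkSpan g sd := Submodule.subset_span (by simp)
  have ms : ∀ (c : Kpq) {x : B}, x ∈ blkSpan g sd → c • x ∈ blkSpan g sd :=
    fun c _ h => (blkSpan g sd).smul_mem c h
  intro x hx
  refine ⟨span_stable rfl _ ?_ x hx, span_stable rfl _ ?_ x hx⟩
  · simp only [Set.mem_insert_iff, Set.mem_singleton_iff]
    rintro x (rfl | rfl | rfl | rfl)
    · rwa [mul_one]
    · exact m2
    · rw [← mul_assoc, hg.cub]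
      exact add_mem (add_mem (sub_mem (ms _ m2) (ms _ m1)) (ms _ m0)) (ms _ m3)
    · rw [hg.hk]; exact ms _ m3
  · simp only [Set.mem_insert_iff, Set.mem_singleton_iff]
    rintro x (rfl | rfl | rfl | rfl)
    · rwa [mul_one]
    · rw [hg.kh]; exact ms _ m3
    · rw [← mul_assoc, hg.kh, smul_mul_assoc, hg.kh]; exact ms _ (ms _ m3)
    · rw [hg.kk]; exact ms _ m3

theorem BlockRel.eX_mem (hg : BlockRel g) (s : ℕ) : (eX s).den g ∈ blkSpan g false := by
  have m0 : (1 : B) ∈ blkSpan g false := Submodule.subset_span (by simp)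
  have key : ∀ (c : Ex) {x : B}, x ∈ blkSpan g false → (g 0 - c.den • 1) * x ∈ blkSpan g false := by
    intro c x hx
    rw [sub_mul, smul_mul_assoc, one_mul]
    exact sub_mem (hg.mul_mem_blkSpan false x hx).1 (Submodule.smul_mem _ _ hx)
  have key1 : ∀ (c : Ex), g 0 - c.den • 1 ∈ blkSpan g false := by
    intro c
    have := key c m0
    rwa [mul_one] at this
  match s with
  | 0 | 1 | 2 =>
    simp only [eX, NE.den_mul, NE.den_sub, NE.den_atom, NE.den_smul, NE.den_one]
    exact key _ (key _ (key1 _))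
  | 3 => exact Submodule.subset_span (by simp [eX, gK])
  | (n + 4) => simp [eX]

theorem blk_mem (sd : Bool) (c : ℕ) : blk g sd c ∈ blkSpan g sd := by
  match c with
  | 1 => exact Submodule.subset_span (by simp [blk])
  | 2 => exact Submodule.subset_span (by simp [blk])
  | 3 => exact Submodule.subset_span (by simp [blk])
  | 0 | (n + 4) => simp [blk]

theorem eBlk_den (c : ℕ) : (eBlk c).den g = if c = 0 then 1 else blk g true c := by
  match c with
  | 0 => simp [eBlk]
  | 1 => rfl
  | 2 => rfl
  | 3 => rfl
  | (n + 4) => simp [eBlk, blk]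

theorem midW_subset : ∀ s < 4, ∀ c ∈ midW s, c < 4 := by decide

set_option maxHeartbeats 1000000 in
/-- The left ideal of `K₁` is spanned by the elements with few blocks. -/
theorem BlockRel.leftK_stable (hg : BlockRel g)
    (hs : ∀ s < 4, ∀ c ∈ bits (if s = 3 then wordSet + 1 else wordSet),
      numVal g ((eX s).den g) (gK g false) c
        ∈ Submodule.span Kpq (numVal g ((eX s).den g) (gK g false) '' {c | c ∈ midW s})) :
    g 2 ∈ Submodule.span Kpq {y | ∃ e ∈ leftK, y = e.den g} ∧
    ∀ k < 4, ∀ x ∈ Submodule.span Kpq {y | ∃ e ∈ leftK, y = e.den g},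
      g k * x ∈ Submodule.span Kpq {y | ∃ e ∈ leftK, y = e.den g} := by
  set M := Submodule.span Kpq {y | ∃ e ∈ leftK, y = e.den g} with hM
  have hV : ∀ s < 4, Submodule.span Kpq
      (numVal g ((eX s).den g) (gK g false) '' {c | c ∈ midW s}) ≤ M := by
    intro s hs
    rw [Submodule.span_le]
    rintro _ ⟨c, hc, rfl⟩
    refine Submodule.subset_span ⟨eX s * (eBlk c * .atom 2), ?_, ?_⟩
    · exact List.mem_flatMap.mpr ⟨s, List.mem_range.mpr hs, List.mem_map.mpr ⟨c, hc, rfl⟩⟩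
    · rw [NE.den_mul, NE.den_mul, eBlk_den, numVal]
      have hc4 : c < 4 := midW_subset s hs c hc
      interval_cases c <;> simp [decW, wordVal, gK, headIx, Nat.beq] <;> rfl
  have xk : ∀ s < 4, s ≠ 3 → (eX s).den g * gK g false = 0 := by
    intro s h4 h3
    have := (hg.eigL s h4).k
    rw [this]
    interval_cases s <;> simp_all [eigK]
  -- the words between the end factors
  let F : Submodule Kpq B :=
    { carrier := {z | ∀ s < 4, (eX s).den g * (z * gK g false) ∈ M}
      add_mem' := fun ha hb s h => by rw [add_mul, mul_add]; exact M.add_mem (ha s h) (hb s h)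
      zero_mem' := fun s _ => by simp
      smul_mem' := fun c x hx s h => by
        rw [smul_mul_assoc, mul_smul_comm]; exact M.smul_mem c (hx s h) }
  have hF : ∀ z, z ∈ F ↔ ∀ s < 4, (eX s).den g * (z * gK g false) ∈ M := fun _ => Iff.rfl
  have F1 : (1 : B) ∈ F := by
    intro s h4
    rw [one_mul]
    by_cases h3 : s = 3
    · subst h3
      apply hV 3 h4
      exact Submodule.subset_span ⟨0, by simp [midW], by simp [numVal, decW, wordVal, Nat.beq]⟩
    · rw [xk s h4 h3]; exact zero_mem _
  have word : ∀ w : List ℕ, (∃ c ∈ bits wordSet, decW 6 c [] = w) → wordVal g w ∈ F := by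
    rintro w ⟨c, hc, rfl⟩ s h4
    refine hV s h4 (hs s h4 c ?_)
    split_ifs
    · have : ∀ c ∈ bits wordSet, c ∈ bits (wordSet + 1) := by decide +kernel
      exact this c hc
    · exact hc
  have Fb : ∀ b ∈ [1, 2, 3], blk g true b ∈ F := by
    intro b hb
    have := word [b] (by revert b; decide +kernel)
    simpa [wordVal, headIx] using this
  have Fb3 : ∀ b ∈ [1, 2, 3], ∀ c ∈ [1, 2, 3], ∀ d ∈ [1, 2, 3],
      blk g true b * (blk g false c * blk g true d) ∈ F := by
    intro b hb c hc d hd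
    have := word [b, c, d] (by revert b c d; decide +kernel)
    simpa [wordVal, headIx] using this
  have Ft : blkSpan g true ≤ F := by
    rw [blkSpan, Submodule.span_le]
    rintro z (rfl | rfl | rfl | rfl)
    · exact F1
    · exact Fb 1 (by simp)
    · exact Fb 2 (by simp)
    · exact Fb 3 (by simp)
  have Fq : ∀ b ∈ [1, 3], ∀ q ∈ blkSpan g false, ∀ c < 4,
      blk g true b * (q * (eBlk c).den g) ∈ F := by
    intro b hb q hq c hc
    have hb' : b ∈ [1, 2, 3] := by revert b; decide
    rw [blkSpan] at hq
    induction hq using Submodule.span_induction with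
    | zero => simp
    | add x y _ _ h1 h2 => rw [add_mul, mul_add]; exact add_mem h1 h2
    | smul a x _ h1 => rw [smul_mul_assoc, mul_smul_comm]; exact F.smul_mem a h1
    | mem x hx =>
      by_cases h0 : c = 0
      · subst h0
        simp only [eBlk, NE.den_one, mul_one]
        have sc : ∀ a : ℕ, ∃ r : Kpq, blk g false a * gK g false = r • gK g false := by
          have e : EigR g 3 (gK g false) := ⟨hg.hk false, hg.kk false⟩
          intro a
          obtain ⟨r, -, hr⟩ := e.blk a
          exact ⟨r, hr⟩
        have fin : ∀ a, blk g true b * blk g false a ∈ F := by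
          intro a s h4
          obtain ⟨r, hr⟩ := sc a
          rw [mul_assoc, hr, mul_smul_comm, mul_smul_comm]
          exact M.smul_mem r (Fb b hb' s h4)
        rcases hx with rfl | rfl | rfl | rfl
        · rw [mul_one]; exact Fb b hb'
        · exact fin 1
        · exact fin 2
        · exact fin 3
      · have ec : (eBlk c).den g = blk g true c := by rw [eBlk_den, if_neg h0]
        have hc' : c ∈ [1, 2, 3] := by
          have : ∀ c < 4, c ≠ 0 → c ∈ [1, 2, 3] := by decide
          exact this c hc h0
        rw [ec]
        rcases hx with rfl | rfl | rfl | rfl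
        · rw [one_mul]
          apply Ft
          have hcm : blk g true c ∈ blkSpan g true := blk_mem true c
          simp only [List.mem_cons, List.not_mem_nil, or_false] at hb
          rcases hb with rfl | rfl
          · exact (hg.mul_mem_blkSpan true _ hcm).1
          · exact (hg.mul_mem_blkSpan true _ hcm).2
        · exact Fb3 b hb' 1 (by simp) c hc'
        · exact Fb3 b hb' 2 (by simp) c hc'
        · exact Fb3 b hb' 3 (by simp) c hc'
  have toM : ∀ z ∈ F, z * gK g false ∈ M := by
    intro z hz
    refine mem_of_eigencomponents M (g 0) _ xi zeta zetas tau xi_ne_zeta xi_ne_zetas zeta_ne_zetas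
      tau_ne_xi tau_ne_zeta tau_ne_zetas ?_ ?_ ?_ ?_
    · have := hz 0 (by norm_num)
      simpa only [eX, NE.den_mul, NE.den_sub, NE.den_atom, NE.den_smul, NE.den_one, den_xi, den_zeta,
        den_zetas, den_tau] using this
    · have := hz 1 (by norm_num)
      simpa only [eX, NE.den_mul, NE.den_sub, NE.den_atom, NE.den_smul, NE.den_one, den_xi, den_zeta,
        den_zetas, den_tau] using this
    · have := hz 2 (by norm_num)
      simpa only [eX, NE.den_mul, NE.den_sub, NE.den_atom, NE.den_smul, NE.den_one, den_xi, den_zeta,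
        den_zetas, den_tau] using this
    · rw [hg.factor, smul_mul_assoc]
      exact M.smul_mem _ (hz 3 (by norm_num))
  refine ⟨?_, ?_⟩
  · have := toM 1 F1
    rwa [one_mul] at this
  · intro k hk
    refine span_stable hM _ ?_
    rintro _ ⟨e, he, rfl⟩
    obtain ⟨s, hs4, he⟩ := List.mem_flatMap.mp he
    obtain ⟨c, hc, rfl⟩ := List.mem_map.mp he
    rw [List.mem_range] at hs4
    have hc4 := midW_subset s hs4 c hc
    have hmem : (eX s * (eBlk c * .atom 2)).den g ∈ M := Submodule.subset_span
      ⟨_, List.mem_flatMap.mpr ⟨s, List.mem_range.mpr hs4, List.mem_map.mpr ⟨c, hc, rfl⟩⟩, rfl⟩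
    have q := hg.eX_mem s
    have hl := hg.eigL s hs4
    have comm : ∀ x ∈ blkSpan g false, gH g false * x = x * gH g false ∧ gK g false * x = x * gK g false := by
      intro x hx
      rw [blkSpan] at hx
      induction hx using Submodule.span_induction with
      | zero => simp
      | add x y _ _ h1 h2 => simp only [mul_add, add_mul, h1.1, h1.2, h2.1, h2.2, and_self]
      | smul a x _ h1 => simp only [mul_smul_comm, smul_mul_assoc, h1.1, h1.2, and_self]
      | mem x hx =>
        rcases hx with rfl | rfl | rfl | rfl
        · simp
        · simp [hg.kh, hg.hk]
        · refine ⟨by rw [mul_assoc], ?_⟩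
          rw [← mul_assoc, hg.kh, smul_mul_assoc, hg.kh, mul_assoc, hg.hk, mul_smul_comm, hg.hk]
        · simp [hg.kh, hg.hk]
    rw [NE.den_mul, ← mul_assoc] at *
    interval_cases k
    · change gH g false * _ * _ ∈ M
      rw [(comm _ q).1, hl.h, smul_mul_assoc]
      exact M.smul_mem _ hmem
    · have := toM _ (Fq 1 (by simp) _ q c hc4)
      simp only [NE.den_mul, mul_assoc] at this ⊢
      exact this
    · change gK g false * _ * _ ∈ M
      rw [(comm _ q).2, hl.k, smul_mul_assoc]
      exact M.smul_mem _ hmem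
    · have := toM _ (Fq 3 (by simp) _ q c hc4)
      simp only [NE.den_mul, mul_assoc] at this ⊢
      exact this

end

theorem quartic_words_aux {K M : Type*} [Field K] [AddCommGroup M] [Module K M]
    (c1 c2 c5 c6 c7 c10 c11 c12 c15 b b2 b3 b4 t : K) (hb : b ≠ 0) (ht : t ≠ 0)
    (x1 x2 x3 x4 x5 x6 x7 x8 x9 x10 x11 x12 y1 y2 y3 y4 y5 y6 y7 y8 y9 y10 y11 y12 : M)
    (h : x1 - y1 = ((c2 - c1) * b⁻¹) • (x2 - y2) + c15 • (x3 - y3) + c11 • (x4 - y4)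
      + c12 • (x5 - y5) + c10 • (x6 - y6) + (c12 + (c2 - c1) * b⁻¹ * b4) • (x7 - y7)
      + ((c6 + (c2 - c1) * b⁻¹ * b2) * t⁻¹) • (x8 - y8) + c6 • (x9 - y9)
      + (c7 - (c2 - c1) * b⁻¹ * b3) • (x10 - y10) + (c5 - c7) • (x11 - y11) + c1 • (x12 - y12)) :
    (b * t) • (x1 - y1) + (-(t * (c2 - c1))) • (x2 - y2) + (-(b * t * c15)) • (x3 - y3)
      + (-(b * t * c11)) • (x4 - y4) + (-(b * t * c12)) • (x5 - y5) + (-(b * t * c10)) • (x6 - y6)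
      + (-(t * (b * c12 + (c2 - c1) * b4))) • (x7 - y7) + (-(b * c6 + (c2 - c1) * b2)) • (x8 - y8)
      + (-(b * t * c6)) • (x9 - y9) + (-(t * (b * c7 - (c2 - c1) * b3))) • (x10 - y10)
      + (-(b * t * (c5 - c7))) • (x11 - y11) + (-(b * t * c1)) • (x12 - y12) = 0 := by
  rw [h]
  match_scalars <;> field_simp <;> ring

section
variable {B : Type*} [Ring B] [Algebra Kpq B]

/-- The relations of the words hold in a quotient in which the `U` vanish. -/
theorem relVal_quarticE (π : Aloc →ₐ[Kpq] B) (h4 : π (gl 4) = 0) (h5 : π (gl 5) = 0) :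
    relVal (fun k => π (gl k)) quarticE = 0 := by
  have h1 := congrArg π (mkLoc_rel Rel.quartic)
  simp only [quarticRHS, map_sub, map_add, map_mul, map_smul, map_pow, mkLoc_fH, mkLoc_fK,
    mkLoc_fU] at h1
  simp only [Fin.isValue, Fin.val_zero, Fin.val_one, add_zero, Nat.reduceAdd, pow_two, h4, h5,
    zero_mul, mul_zero, sub_self, smul_zero] at h1
  have key := quartic_words_aux c1 c2 c5 c6 c7 c10 c11 c12 c15 b0 b2 b3 b4 tau b0_ne tau_ne
    _ _ _ _ _ _ _ _ _ _ _ _ _ _ _ _ _ _ _ _ _ _ _ _ h1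
  have e : ∀ (x : Ex) (u v : List (Bool × ℕ)) (L : List (Ex × List (Bool × ℕ))),
      relVal (fun k => π (gl k)) ([(x, u), (-x, v)] ++ L)
        = x.den • (blks (fun k => π (gl k)) u - blks (fun k => π (gl k)) v)
          + relVal (fun k => π (gl k)) L := by
    intro x u v L
    simp only [relVal, List.cons_append, List.nil_append, List.map_cons, List.sum_cons, Ex.den_neg,
      neg_smul, smul_sub]
    abel
  simp only [quarticE, quarticPairs, List.flatMap_cons, List.flatMap_nil, e]
  rw [← key]
  simp only [relVal, List.map_nil, List.sum_nil, blks, List.map_cons, List.prod_cons, List.prod_nil,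
    blk, gH, gK, cond_true, cond_false, mul_one, Ex.den_mul, Ex.den_neg, Ex.den_sub, Ex.den_add,
    den_b0, den_b2, den_b3, den_b4, den_tau, den_c1, den_c2, den_c5, den_c6, den_c7, den_c10,
    den_c11, den_c12, den_c15, mul_assoc, add_zero]
  abel

theorem relVal_hkhE (π : Aloc →ₐ[Kpq] B) : relVal (fun k => π (gl k)) hkhE = 0 := by
  have h := congrArg π uRel_gl.HKH
  simp only [map_mul] at h
  simp [hkhE, relVal, blks, blk, gH, gK, h]

theorem blockRel_map (π : Aloc →ₐ[Kpq] B) (h4 : π (gl 4) = 0) (h5 : π (gl 5) = 0) :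
    BlockRel fun k => π (gl k) := by
  have key : ∀ sd : Bool, gH (fun k => π (gl k)) sd = π (gl ((bif sd then 1 else 0 : Fin 2) : ℕ))
      ∧ gK (fun k => π (gl k)) sd = π (gl (2 + ((bif sd then 1 else 0 : Fin 2) : ℕ)))
      ∧ π (gl (4 + ((bif sd then 1 else 0 : Fin 2) : ℕ))) = 0 := by
    rintro (_ | _)
    · exact ⟨rfl, rfl, h4⟩
    · exact ⟨rfl, rfl, h5⟩
  refine ⟨fun sd => ?_, fun sd => ?_, fun sd => ?_, fun sd => ?_⟩
  all_goals
    obtain ⟨e1, e2, e3⟩ := key sd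
    simp only [e1, e2, ← map_mul, den_tau, den_phi, den_b4, den_b3, den_b0, den_b2]
  · rw [uRel_gl.HK, map_smul]
  · rw [uRel_gl.KH, map_smul]
  · rw [uRel_gl.KK, map_smul]
  · rw [mul_assoc, uRel_gl.cub]
    simp only [map_add, map_sub, map_smul, map_one, e3, smul_zero, add_zero]

open MulOpposite

theorem BlockRel.op {g : ℕ → B} (h : BlockRel g) : BlockRel fun k => op (g k) where
  hk sd := congrArg MulOpposite.op (h.kh sd)
  kh sd := congrArg MulOpposite.op (h.hk sd)
  kk sd := congrArg MulOpposite.op (h.kk sd)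
  cub sd := by
    have := h.cub sd
    rw [mul_assoc] at this
    exact congrArg MulOpposite.op this

theorem relVal_op (g : ℕ → B) (L : List (Ex × List (Bool × ℕ))) :
    relVal (fun k => op (g k)) (revE L) = op (relVal g L) := by
  have hb : ∀ sd b, blk (fun k => op (g k)) sd b = op (blk g sd b) := by
    intro sd b
    match b with
    | 1 => rfl
    | 2 => rfl
    | 3 => rfl
    | 0 | (n + 4) => rfl
  have hw : ∀ u, blks (fun k => op (g k)) u.reverse = op (blks g u) := by
    intro u
    induction u with
    | nil => rfl
    | cons a u ih =>
      rw [List.reverse_cons]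
      simp only [blks, List.map_append, List.prod_append, List.map_cons, List.prod_cons,
        List.map_nil, List.prod_nil, mul_one, op_mul, hb] at ih ⊢
      rw [ih]
  induction L with
  | nil => rfl
  | cons a L ih =>
    simp only [relVal, revE, List.map_cons, List.sum_cons, op_add, op_smul, hw] at ih ⊢
    rw [ih]

/-- The reversed expression. -/
def NE.rev : NE → NE
  | .atom k => .atom k
  | .one => .one
  | .add a b => .add a.rev b.rev
  | .mul a b => .mul b.rev a.rev
  | .smul c a => .smul c a.rev

theorem NE.den_op (g : ℕ → B) (e : NE) : e.den (fun k => op (g k)) = op (e.rev.den g) := by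
  induction e with
  | atom k => rfl
  | one => rfl
  | add a b h1 h2 => simp only [NE.den, NE.rev, h1, h2, op_add]
  | mul a b h1 h2 => simp only [NE.den, NE.rev, h1, h2, op_mul]
  | smul c a h => simp only [NE.den, NE.rev, h, op_smul]

end

section
variable {B : Type*} [Ring B] [Algebra Kpq B]

theorem leftK_hyp {g : ℕ → B} (hg : BlockRel g) {rels : List (List (ℕ × List (Bool × ℕ)))}
    {relsE : List (List (Ex × List (Bool × ℕ)))}
    (hr : List.Forall₂ (fun E N => List.Forall₂ (fun a b => Sp a.1.den (b.1 : ℕ) ∧ a.2 = b.2) E N)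
      relsE rels)
    (h0 : ∀ r ∈ relsE, relVal g r = 0)
    (hc : ∀ s < 4, wordCheck s 3 false (if s = 3 then wordSet + 1 else wordSet) rels [1, 2, 3]
      (midW s) = true) :
    ∀ s < 4, ∀ c ∈ bits (if s = 3 then wordSet + 1 else wordSet),
      numVal g ((eX s).den g) (gK g false) c
        ∈ Submodule.span Kpq (numVal g ((eX s).den g) (gK g false) '' {c | c ∈ midW s}) := by
  intro s h4
  refine wordCheck_span (t := 3) hg ?_ (by simp) (hg.eigL s h4) ⟨hg.hk false, hg.kk false⟩ hr h0
    (hc s h4)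
  intro h3
  have := (hg.eigL s h4).k
  rw [this]
  interval_cases s <;> first | exact absurd h3 (by decide) | simp [eigK]

end

theorem wordCheck_left : ∀ s < 4, wordCheck s 3 false (if s = 3 then wordSet + 1 else wordSet)
    relsN [1, 2, 3] (midW s) = true := by
  intro s hs
  interval_cases s
  exacts [wordCheck_0, wordCheck_1, wordCheck_2, wordCheck_3]

theorem wordCheck_right : ∀ s < 4, wordCheck s 3 false (if s = 3 then wordSet + 1 else wordSet)
    (relsN.map revE) [1, 2, 3] (midW s) = true := by
  intro s hs
  interval_cases s
  exacts [wordCheck_rev_0, wordCheck_rev_1, wordCheck_rev_2, wordCheck_rev_3]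

/-- The projection modulo the ideal generated by the `U`. -/
def mkU : Aloc →ₐ[Kpq] IU.ringCon.Quotient := RingCon.mkₐ Kpq IU.ringCon

theorem mkU_eq_zero {x : Aloc} : mkU x = 0 ↔ x ∈ IU := by
  rw [TwoSidedIdeal.mem_iff, ← RingCon.eq]
  rfl

/-- The representations of level two, and `I`. -/
def isMid (R : Irr) : Prop := R ∈ [Irr.I, .X2, .Y2, .Y2s]

instance : DecidablePred isMid := fun R => inferInstanceAs (Decidable (R ∈ _))

theorem leftK_check : indepCheck [.I, .X2, .Y2, .Y2s] leftK = true := by decide +kernel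
theorem rightK_check : indepCheck [.I, .X2, .Y2, .Y2s] (leftK.map NE.rev) = true := by
  decide +kernel
theorem basis2_check : indepCheck [.I, .X2, .Y2, .Y2s] ((basisW 0 ++ basisW 2).map nw) = true := by
  decide +kernel

theorem rhoK_U (R : Irr) (hR : R ≠ .L) (x : Aloc) (hx : x ∈ IU) : rhoK R x = 0 := by
  have h : rhoK R (gl 4) = 0 := by
    rw [rhoK_gl R 4 (by norm_num)]
    have : (NE.atom 4).check R.dim (atomsE R) = true := by
      revert hR; cases R <;> first | (intro h; exact absurd rfl h) | (intro _; decide +kernel)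
    exact NE.den_eq_zero this
  have h2 : IU ≤ TwoSidedIdeal.ker (rhoK R) := by
    refine TwoSidedIdeal.span_le.mpr ?_
    rintro y (rfl | hy)
    · exact (TwoSidedIdeal.mem_ker _).mpr h
    · rw [show y = 0 from (TwoSidedIdeal.mem_bot _).mp hy]
      exact zero_mem _
  exact (TwoSidedIdeal.mem_ker _).mp (h2 hx)

theorem rhoP_U (P : Irr → Prop) (hP : ¬ P .L) (x : Aloc) (hx : x ∈ IU) : rhoP P x = 0 := by
  funext R
  exact rhoK_U R.1 (fun h => hP (h ▸ R.2)) x hx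

theorem range_den {B : Type*} (f : Aloc → B) (es : List NE) :
    (Set.range fun i : Fin es.length => f ((es.get i).den gl)) = {y | ∃ e ∈ es, y = f (e.den gl)} := by
  ext y
  constructor
  · rintro ⟨i, rfl⟩
    exact ⟨_, List.get_mem es i, rfl⟩
  · rintro ⟨e, he, rfl⟩
    obtain ⟨i, rfl⟩ := List.get_of_mem he
    exact ⟨i, rfl⟩

theorem relsE_map {B : Type*} [Ring B] [Algebra Kpq B] (π : Aloc →ₐ[Kpq] B) (h4 : π (gl 4) = 0)
    (h5 : π (gl 5) = 0) : ∀ r ∈ relsE, relVal (fun k => π (gl k)) r = 0 := by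
  simp only [relsE, List.mem_cons, List.not_mem_nil, or_false]
  rintro r (rfl | rfl)
  · exact relVal_quarticE π h4 h5
  · exact relVal_hkhE π

theorem leftK_inj (a : Aloc) (h : rhoP isMid (a * gl 2) = 0) : a * gl 2 ∈ IU := by
  have h4 := mkU_eq_zero.mpr U1_mem
  have h5 := mkU_eq_zero.mpr U2_mem
  rw [← mkU_eq_zero]
  refine eq_zero_of_indep leftK_check isMid (fun R h => h) mkU
    (fun x hx => rhoP_U _ (by decide) x (mkU_eq_zero.mp hx)) ?_ h
  rw [range_den]
  have hg := blockRel_map mkU h4 h5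
  obtain ⟨h2, hst⟩ := hg.leftK_stable (leftK_hyp hg relsE_relsN (relsE_map mkU h4 h5) wordCheck_left)
  rw [map_mul]
  have := mul_mem_of_gens mkU (fun k hk x hx => by
    by_cases hk4 : k < 4
    · exact hst k hk4 x hx
    · have : mkU (gl k) = 0 := by
        have : k = 4 ∨ k = 5 := by omega
        rcases this with rfl | rfl
        exacts [h4, h5]
      rw [this, zero_mul]; exact zero_mem _) a _ h2
  simpa only [← NE.map_den] using this

open MulOpposite in
theorem rightK_inj (a : Aloc) (h : rhoP isMid (gl 2 * a) = 0) : gl 2 * a ∈ IU := by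
  have h4 := mkU_eq_zero.mpr U1_mem
  have h5 := mkU_eq_zero.mpr U2_mem
  rw [← mkU_eq_zero]
  refine eq_zero_of_indep rightK_check isMid (fun R h => h) mkU
    (fun x hx => rhoP_U _ (by decide) x (mkU_eq_zero.mp hx)) ?_ h
  rw [range_den]
  have hg := (blockRel_map mkU h4 h5).op
  obtain ⟨h2, hst⟩ := hg.leftK_stable (leftK_hyp hg revE_relsN (by
    intro r hr
    obtain ⟨r', hr', rfl⟩ := List.mem_map.mp hr
    rw [relVal_op, relsE_map mkU h4 h5 r' hr', op_zero]) wordCheck_right)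
  set V := Submodule.span Kpq {y | ∃ e ∈ leftK, y = e.den fun k => op (mkU (gl k))} with hV
  rw [map_mul]
  have := mem_mul_of_gens mkU (V := V.comap (opLinearEquiv Kpq).toLinearMap) (fun k hk x hx => by
    by_cases hk4 : k < 4
    · exact hst k hk4 (op x) hx
    · have : mkU (gl k) = 0 := by
        have : k = 4 ∨ k = 5 := by omega
        rcases this with rfl | rfl
        exacts [h4, h5]
      rw [this, mul_zero]; exact zero_mem _) a _ h2
  have e2 : V.comap (opLinearEquiv Kpq).toLinearMap
      = Submodule.span Kpq (unop '' {y | ∃ e ∈ leftK, y = e.den fun k => op (mkU (gl k))}) := by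
    rw [Submodule.comap_equiv_eq_map_symm, hV, Submodule.map_span]
    rfl
  rw [e2] at this
  refine Submodule.span_mono ?_ this
  rintro _ ⟨_, ⟨e, he, rfl⟩, rfl⟩
  refine ⟨e.rev, List.mem_map_of_mem he, ?_⟩
  rw [NE.den_op, unop_op, NE.map_den]

theorem Z_mem (k : ℕ) (h : 6 ≤ k) (h' : k < 13) : gl k ∈ IK := by
  have l := fun (x : Aloc) {y : Aloc} (h : y ∈ IK) => IK.mul_mem_left x y h
  have r := fun (y : Aloc) {x : Aloc} (h : x ∈ IK) => IK.mul_mem_right x y h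
  have s := fun (c : Kpq) {x : Aloc} (h : x ∈ IK) => TwoSidedIdeal.ksmul_mem IK c h
  have k1 : K1 ∈ IK := K1_mem
  have k2 : K2 ∈ IK := K2_mem
  have u1 : U1 ∈ IK := IU_le U1_mem
  have u2 : U2 ∈ IK := IU_le U2_mem
  have z1 : Z1 ∈ IK := s _ (l _ k1)
  have z2 : Z2 ∈ IK := s _ (l _ k2)
  have sub := fun {x y : Aloc} (h : x ∈ IK) (h' : y ∈ IK) => IK.sub_mem h h'
  have add := fun {x y : Aloc} (h : x ∈ IK) (h' : y ∈ IK) => IK.add_mem h h'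
  interval_cases k
  · exact s _ (sub (sub (add (sub (s _ (l _ k1)) (s _ (l _ k1))) (s _ z1)) (s _ k1)) (s _ (l _ k1)))
  · exact z1
  · exact z2
  · exact s _ (sub (sub (add (sub (l _ k1) (s _ (l _ k1))) (s _ (l _ k1))) (s _ z1)) (s _ (r _ u1)))
  · exact s _ (sub (sub (add (sub (l _ k2) (s _ (l _ k2))) (s _ (l _ k2))) (s _ z2)) (s _ (r _ u2)))
  · exact s _ (l _ k2)
  · exact s _ (l _ k1)

/-- The ideal generated by the `K` modulo the `U` is detected by the representations of level two
and `I`. -/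
theorem mem_IU_of_mem_IK {x : Aloc} (hx : x ∈ IK) (h : rhoP isMid x = 0) : x ∈ IU := by
  obtain ⟨e, he, he1⟩ := exists_rhoP_eq_one basis2_check isMid (fun R h => h) (by decide +kernel)
    {x | x ∈ IK} (fun x hx y hy => IK.add_mem hx hy) IK.zero_mem
    (fun c x hx => TwoSidedIdeal.ksmul_mem IK c hx)
    (nw_mem (I := IK) (W := basisW 0 ++ basisW 2) (S := [2, 3, 6, 7, 8, 9, 10, 11, 12]) (by decide)
      (by
        intro k hk
        have : k = 2 ∨ k = 3 ∨ (6 ≤ k ∧ k < 13) := by revert k; decide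
        rcases this with rfl | rfl | ⟨h1, h2⟩
        exacts [K1_mem, K2_mem, Z_mem k h1 h2]))
  exact mem_of_layer (rhoP isMid).toRingHom IU (gl 2) leftK_inj rightK_inj he he1 hx h

/-- The relations of the top algebra in terms of `A = H₁ - ξ`, `B = H₂ - ξ`. -/
structure TopRel {R S : Type*} [CommRing R] [Ring S] [Algebra R S] (σ π s : R) (A B : S) :
    Prop where
  AAA : A * (A * A) = σ • (A * A) - π • A
  BBB : B * (B * B) = σ • (B * B) - π • B
  ABAA : A * (B * (A * A)) = A * (A * (B * A))
  BABB : B * (A * (B * B)) = B * (B * (A * B))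
  BBAB : B * (B * (A * B)) = A * (A * (B * A)) + (σ - 2 * s) • (B * (A * B) - A * (B * A))
    + s • (A * (B * B) + B * (B * A) - B * (A * A) - A * (A * B)) + (s * (s * σ - π)) • (B - A)

/-- Twenty words in two letters. -/
def words20 {S : Type*} [Mul S] [One S] (A B : S) : List S :=
  [1, A, B, A * A, A * B, B * A, B * B, A * (A * B), A * (B * A), A * (B * B), B * (A * A),
    B * (A * B), B * (B * A), A * (A * (B * B)), A * (B * (A * B)), A * (B * (B * A)),
    B * (A * (B * A)), B * (B * (A * A)), A * (B * (A * (B * A))), A * (A * (B * A))]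

namespace TopRel
variable {R S : Type*} [CommRing R] [Ring S] [Algebra R S] {σ π s : R} {A B : S}

theorem swap (h : TopRel σ π s A B) : TopRel σ π s B A where
  AAA := h.BBB
  BBB := h.AAA
  ABAA := h.BABB
  BABB := h.ABAA
  BBAB := by rw [h.BBAB]; module

theorem op (h : TopRel σ π s A B) : TopRel σ π s (MulOpposite.op A) (MulOpposite.op B) := by
  constructor <;> apply MulOpposite.unop_injective <;>
    simp only [MulOpposite.unop_mul, MulOpposite.unop_op, MulOpposite.unop_add,
      MulOpposite.unop_sub, MulOpposite.unop_smul, mul_assoc]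
  · exact h.AAA
  · exact h.BBB
  · exact h.ABAA.symm
  · exact h.BABB.symm
  · rw [h.BABB, h.BBAB, h.ABAA]; module

theorem right {l r : S} (h : l = r) (x : S) : l * x = r * x := by rw [h]

theorem AABAB (h : TopRel σ π s A B) : A * (A * (B * (A * B))) = (σ - 2 * s) • (A * (B * (A * B)))
    + s • (B * (A * (A * B)) + A * (A * (B * B)) + B * (B * (A * B))) - π • (B * (A * B))
    - (s * σ) • (A * (B * B)) + (s * s * σ) • (A * B) - (s * (s * σ - π)) • (B * B) := by
  have h1 := right h.BBAB B
  have h2 : B * (B * (B * (A * B))) = σ • (B * (B * (A * B))) - π • (B * (A * B)) := by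
    have := right h.BBB (A * B)
    simpa only [sub_mul, smul_mul_assoc, mul_assoc] using this
  simp only [sub_mul, add_mul, smul_mul_assoc, mul_assoc, h.BABB, h.BBB, mul_sub,
    mul_smul_comm] at h1
  rw [h2] at h1
  linear_combination (norm := module) -(1:R) • h1

theorem sAABAB (h : TopRel σ π s A B) : s • (A * (A * (B * (A * B)))) =
    s • (A * (B * (A * (B * B)))) + (s * s * σ) • (A * (A * B) - A * (B * B)) := by
  have h1 := congrArg (A * ·) h.AABAB
  have h2 := right h.AAA (B * (A * B))
  have h3 := right h.AAA (B * B)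
  have h4 := right h.ABAA B
  simp only [mul_sub, mul_add, sub_mul, smul_mul_assoc, mul_smul_comm, mul_assoc, h.BABB]
    at h1 h2 h3 h4 ⊢
  rw [h2, h3, h4] at h1
  linear_combination (norm := module) (1:R) • h1

theorem smul_cancel {s' : R} (hs : s' * s = 1) {x y : S} (h : s • x = s • y) : x = y := by
  have := congrArg (s' • ·) h
  simpa only [smul_smul, hs, one_smul] using this

theorem ABABB {s' : R} (hs : s' * s = 1) (h : TopRel σ π s A B) : A * (B * (A * (B * B))) =
    A * (A * (B * (A * B))) - (s * σ) • (A * (A * B) - A * (B * B)) := by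
  apply smul_cancel hs
  rw [smul_sub, h.sAABAB]
  module

theorem BAAB {s' : R} (hs : s' * s = 1) (h : TopRel σ π s A B) : B * (A * (A * B)) =
    A * (B * (B * A)) + (s' * π) • (B * (A * B) - A * (B * A)) + (s * σ - π) • (B * B - A * A)
      - B * (B * (A * B)) + A * (A * (B * A)) := by
  have h1 := h.AABAB
  have h2 := congrArg MulOpposite.unop h.op.swap.AABAB
  simp only [MulOpposite.unop_mul, MulOpposite.unop_op, MulOpposite.unop_add,
      MulOpposite.unop_sub, MulOpposite.unop_smul, mul_assoc] at h2
  rw [h.ABAA] at h2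
  have h3 := h.ABABB hs
  have h4 : s • (s' * π) • (B * (A * B) - A * (B * A)) = π • (B * (A * B) - A * (B * A)) := by
    rw [smul_smul, ← mul_assoc, mul_comm s, hs, one_mul]
  apply smul_cancel hs
  linear_combination (norm := module) h2 - h1 - h3 - h4

theorem AABBA {s' : R} (hs : s' * s = 1) (h : TopRel σ π s A B) : A * (A * (B * (B * A))) =
    A * (A * (B * (A * B))) - (s' * π) • (A * (B * (A * B)) - A * (A * (B * A)))
      - (s * σ - π) • (A * (B * B) - A * (A * A)) + A * (B * (B * (A * B)))
      - A * (A * (A * (B * A))) := by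
  have h1 := congrArg (A * ·) (h.BAAB hs)
  have h4 := right h.ABAA B
  simp only [mul_sub, mul_add, mul_smul_comm, mul_assoc] at h1 h4
  rw [h4] at h1
  linear_combination (norm := module) -h1

theorem BABAA (h : TopRel σ π s A B) : B * (A * (B * (A * A))) = (σ - 2 * s) • (B * (A * (B * A)))
    + s • (B * (A * (A * B)) + B * (B * (A * A)) + B * (B * (A * B))) - π • (B * (A * B))
    - (s * σ) • (B * (B * A)) + (s * s * σ) • (B * A) - (s * (s * σ - π)) • (B * B) := by
  have h2 := congrArg MulOpposite.unop h.op.AABAB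
  simp only [MulOpposite.unop_mul, MulOpposite.unop_op, MulOpposite.unop_add,
      MulOpposite.unop_sub, MulOpposite.unop_smul, mul_assoc, h.BABB] at h2
  rw [h2]
  module

theorem ABBAA {s' : R} (hs : s' * s = 1) (h : TopRel σ π s A B) : A * (B * (B * (A * A))) =
    B * (A * (B * (A * A))) - (s' * π) • (B * (A * (B * A)) - A * (A * (B * A)))
      - (s * σ - π) • (B * (B * A) - A * (A * A)) + B * (B * (A * (B * A)))
      - A * (B * (A * (A * A))) := by
  have h2 := congrArg MulOpposite.unop (h.op.AABBA hs)
  have h3 := right h.BABB A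
  simp only [MulOpposite.unop_mul, MulOpposite.unop_op, MulOpposite.unop_add,
      MulOpposite.unop_sub, MulOpposite.unop_smul, mul_assoc] at h2 h3
  rw [h2, h3, h.ABAA]

/-- The words of length at most four lie in a submodule. -/
structure Low (V : Submodule R S) (A B : S) : Prop where
  e : 1 ∈ V
  a : A ∈ V
  b : B ∈ V
  aa : A * A ∈ V
  ab : A * B ∈ V
  ba : B * A ∈ V
  bb : B * B ∈ V
  aab : A * (A * B) ∈ V
  aba : A * (B * A) ∈ V
  abb : A * (B * B) ∈ V
  baa : B * (A * A) ∈ V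
  bab : B * (A * B) ∈ V
  bba : B * (B * A) ∈ V
  aaba : A * (A * (B * A)) ∈ V
  aabb : A * (A * (B * B)) ∈ V
  abab : A * (B * (A * B)) ∈ V
  abba : A * (B * (B * A)) ∈ V
  baab : B * (A * (A * B)) ∈ V
  baba : B * (A * (B * A)) ∈ V
  bbaa : B * (B * (A * A)) ∈ V
  bbab : B * (B * (A * B)) ∈ V

theorem Low.swap {V : Submodule R S} (h : Low V A B) : Low V B A :=
  ⟨h.e, h.b, h.a, h.bb, h.ba, h.ab, h.aa, h.bba, h.bab, h.baa, h.abb, h.aba, h.aab, h.bbab,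
    h.bbaa, h.baba, h.baab, h.abba, h.abab, h.aabb, h.aaba⟩

variable {V : Submodule R S} {s' η' : R}

theorem mem_aaa (h : TopRel σ π s A B) (l : Low V A B) : A * (A * A) ∈ V := by
  rw [h.AAA]
  exact sub_mem (V.smul_mem _ l.aa) (V.smul_mem _ l.a)

theorem mem_cube (h : TopRel σ π s A B) {x : S} (h1 : A * x ∈ V) (h2 : A * (A * x) ∈ V) :
    A * (A * (A * x)) ∈ V := by
  have := right h.AAA x
  simp only [sub_mul, smul_mul_assoc, mul_assoc] at this
  rw [this]
  exact sub_mem (V.smul_mem _ h2) (V.smul_mem _ h1)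

theorem mem_aabab (h : TopRel σ π s A B) (l : Low V A B) : A * (A * (B * (A * B))) ∈ V := by
  rw [h.AABAB]
  have := l.e; have := l.a; have := l.b; have := l.aa; have := l.ab; have := l.ba; have := l.bb
  have := l.aab; have := l.aba; have := l.abb; have := l.baa; have := l.bab; have := l.bba
  have := l.aaba; have := l.aabb; have := l.abab; have := l.abba; have := l.baab
  have := l.baba; have := l.bbaa; have := l.bbab
  repeat' first | assumption | apply add_mem | apply sub_mem | apply Submodule.smul_mem

theorem mem_babaa (h : TopRel σ π s A B) (l : Low V A B) : B * (A * (B * (A * A))) ∈ V := by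
  rw [h.BABAA]
  have := l.ba; have := l.bb; have := l.bab; have := l.bba
  have := l.baab; have := l.baba; have := l.bbaa; have := l.bbab
  repeat' first | assumption | apply add_mem | apply sub_mem | apply Submodule.smul_mem

theorem mem_ababb (hs : s' * s = 1) (h : TopRel σ π s A B) (l : Low V A B) :
    A * (B * (A * (B * B))) ∈ V := by
  rw [h.ABABB hs]
  have := h.mem_aabab l; have := l.aab; have := l.abb
  repeat' first | assumption | apply add_mem | apply sub_mem | apply Submodule.smul_mem

theorem mem_abbab (hs : s' * s = 1) (h : TopRel σ π s A B) (l : Low V A B) :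
    A * (B * (B * (A * B))) ∈ V := by
  rw [← h.BABB]
  exact h.mem_ababb hs l

theorem mem_aabba (hs : s' * s = 1) (h : TopRel σ π s A B) (l : Low V A B) :
    A * (A * (B * (B * A))) ∈ V := by
  rw [h.AABBA hs]
  have := h.mem_aabab l; have := l.abab; have := l.aaba; have := l.abb; have := h.mem_aaa l
  have := h.mem_abbab hs l; have := h.mem_cube l.aba l.aaba
  repeat' first | assumption | apply add_mem | apply sub_mem | apply Submodule.smul_mem

theorem mem_bbaba (h : TopRel σ π s A B) (l : Low V A B) : B * (B * (A * (B * A))) ∈ V :=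
  h.swap.mem_aabab l.swap

theorem mem_abaaa (h : TopRel σ π s A B) (l : Low V A B) : A * (B * (A * (A * A))) ∈ V := by
  rw [h.AAA]
  simp only [mul_sub, mul_smul_comm]
  rw [h.ABAA]
  exact sub_mem (V.smul_mem _ l.aaba) (V.smul_mem _ l.aba)

theorem mem_abbaa (hs : s' * s = 1) (h : TopRel σ π s A B) (l : Low V A B) :
    A * (B * (B * (A * A))) ∈ V := by
  rw [h.ABBAA hs]
  have := h.mem_babaa l; have := l.baba; have := l.aaba; have := l.bba; have := h.mem_aaa l
  have := h.mem_bbaba l; have := h.mem_abaaa l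
  repeat' first | assumption | apply add_mem | apply sub_mem | apply Submodule.smul_mem

theorem mem_baaba (h : TopRel σ π s A B) (l : Low V A B) : B * (A * (A * (B * A))) ∈ V := by
  rw [← h.ABAA]
  exact h.mem_babaa l

theorem mem_aababa (hs : s' * s = 1) (h : TopRel σ π s A B) (l : Low V A B) :
    A * (A * (B * (A * (B * A)))) - (σ - 2 * s) • (A * (B * (A * (B * A)))) ∈ V := by
  have h1 := right h.AABAB A
  simp only [add_mul, sub_mul, smul_mul_assoc, mul_assoc] at h1
  rw [h1]
  have := h.mem_baaba l; have := h.mem_aabba hs l; have := h.mem_bbaba l; have := l.baba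
  have := l.abba; have := l.aba; have := l.bba
  simp only [add_sub_right_comm _ _ ((σ - 2 * s) • (A * (B * (A * (B * A))))),
    sub_right_comm _ _ ((σ - 2 * s) • (A * (B * (A * (B * A))))), sub_self, zero_add]
  repeat' first | assumption | apply add_mem | apply sub_mem | apply Submodule.smul_mem

theorem mem_babab_sub (hs : s' * s = 1) (hη : η' * (2 * (σ - 2 * s) - s' * π) = 1)
    (h : TopRel σ π s A B) (l : Low V A B) :
    B * (A * (B * (A * B))) - A * (B * (A * (B * A))) ∈ V := by
  have hv := h.mem_aababa hs l
  have hw := h.swap.mem_aababa hs l.swap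
  have habab2 : A * (B * (A * (B * (B * A)))) - (σ - 2 * s) • (A * (B * (A * (B * A)))) ∈ V := by
    have h5 := right (h.ABABB hs) A
    simp only [sub_mul, smul_mul_assoc, mul_assoc] at h5
    rw [h5, sub_right_comm]
    exact sub_mem hv (V.smul_mem _ (sub_mem l.aaba l.abba))
  have habaaba : A * (B * (A * (A * (B * A)))) - (σ - 2 * s) • (A * (B * (A * (B * A)))) ∈ V := by
    have h4 := right h.ABAA (B * A)
    simp only [mul_assoc] at h4
    rwa [h4]
  have habaab : A * (B * (A * (A * B))) ∈ V := by
    have h3 := right h.ABAA B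
    simp only [mul_assoc] at h3
    rw [h3]
    exact h.mem_aabab l
  have habbb : A * (B * (B * B)) ∈ V := by
    rw [h.BBB, mul_sub, mul_smul_comm, mul_smul_comm]
    exact sub_mem (V.smul_mem _ l.abb) (V.smul_mem _ l.ab)
  have habbbab : A * (B * (B * (B * (A * B)))) ∈ V := by
    have h3 := right h.BBB (A * B)
    simp only [mul_assoc, sub_mul, smul_mul_assoc] at h3
    rw [h3, mul_sub, mul_smul_comm, mul_smul_comm]
    exact sub_mem (V.smul_mem _ (h.mem_abbab hs l)) (V.smul_mem _ l.abab)
  have habaaab : A * (B * (A * (A * (A * B)))) ∈ V := by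
    have h3 := right h.AAA B
    simp only [mul_assoc, sub_mul, smul_mul_assoc] at h3
    rw [h3, mul_sub, mul_sub, mul_smul_comm, mul_smul_comm, mul_smul_comm, mul_smul_comm]
    exact sub_mem (V.smul_mem _ habaab) (V.smul_mem _ l.abab)
  have haaab : A * (A * (A * B)) ∈ V := h.mem_cube l.ab l.aab
  have hbbabb : B * (B * (A * (B * B))) ∈ V := by
    rw [h.BABB]
    exact h.swap.mem_cube l.bab l.bbab
  have hbabb : B * (A * (B * B)) ∈ V := by
    rw [h.BABB]
    exact l.bbab
  have hX : A * (B * (B * (A * (A * B)))) -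
      (2 * (σ - 2 * s) - s' * π) • (A * (B * (A * (B * A)))) ∈ V := by
    have h1 := congrArg (fun x => A * (B * x)) (h.BAAB hs)
    simp only [mul_add, mul_sub, mul_smul_comm] at h1
    have h0 : A * (B * (B * (A * (A * B)))) -
        (2 * (σ - 2 * s) - s' * π) • (A * (B * (A * (B * A)))) =
        (A * (B * (A * (B * (B * A)))) - (σ - 2 * s) • (A * (B * (A * (B * A)))))
        + (s' * π) • (A * (B * (B * (A * B))))
        + (s * σ - π) • (A * (B * (B * B)) - A * (B * (A * A))) - A * (B * (B * (B * (A * B))))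
        + (A * (B * (A * (A * (B * A)))) - (σ - 2 * s) • (A * (B * (A * (B * A))))) := by
      rw [h1]
      module
    rw [h0, h.ABAA]
    have := h.mem_abbab hs l; have := l.aaba
    repeat' first | assumption | apply add_mem | apply sub_mem | apply Submodule.smul_mem
  have h2 := right (h.ABBAA hs) B
  have h9 := right h.BABAA B
  simp only [add_mul, sub_mul, smul_mul_assoc, mul_assoc] at h2 h9
  have h0 : (2 * (σ - 2 * s) - s' * π) • (B * (A * (B * (A * B))) - A * (B * (A * (B * A)))) =
      (A * (B * (B * (A * (A * B)))) - (2 * (σ - 2 * s) - s' * π) • (A * (B * (A * (B * A)))))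
      - (B * (B * (A * (B * (A * B)))) - (σ - 2 * s) • (B * (A * (B * (A * B)))))
      - (s' * π) • (A * (A * (B * (A * B)))) + (s * σ - π) • (B * (B * (A * B)) - A * (A * (A * B)))
      + A * (B * (A * (A * (A * B))))
      - (B * (A * (B * (A * (A * B)))) - (σ - 2 * s) • (B * (A * (B * (A * B))))) := by
    rw [h2]
    module
  have h10 : B * (A * (B * (A * (A * B)))) - (σ - 2 * s) • (B * (A * (B * (A * B)))) ∈ V := by
    rw [h9]
    have := h.swap.mem_abbaa hs l.swap; have := h.swap.mem_aabba hs l.swap; have := l.bbab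
    have := l.bab; have := h.swap.mem_aaa l.swap
    simp only [add_sub_right_comm _ _ ((σ - 2 * s) • (B * (A * (B * (A * B))))),
      sub_right_comm _ _ ((σ - 2 * s) • (B * (A * (B * (A * B))))), sub_self, zero_add]
    repeat' first | assumption | apply add_mem | apply sub_mem | apply Submodule.smul_mem
  have hs0 : (2 * (σ - 2 * s) - s' * π) • (B * (A * (B * (A * B)))
      - A * (B * (A * (B * A)))) ∈ V := by
    rw [h0]
    have := h.mem_aabab l; have := l.bbab
    repeat' first | assumption | apply add_mem | apply sub_mem | apply Submodule.smul_mem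
  have := V.smul_mem η' hs0
  rwa [smul_smul, hη, one_smul] at this

theorem low_of_words (hs : s' * s = 1) (h : TopRel σ π s A B)
    (hV : ∀ x ∈ words20 A B, x ∈ V) : Low V A B ∧ A * (B * (A * (B * A))) ∈ V := by
  simp only [words20, List.forall_mem_cons, List.not_mem_nil, false_implies, implies_true,
    and_true] at hV
  obtain ⟨e, a, b, aa, ab, ba, bb, aab, aba, abb, baa, bab, bba, aabb, abab, abba, baba, bbaa,
    ababa, aaba⟩ := hV
  have bbab : B * (B * (A * B)) ∈ V := by
    rw [h.BBAB]
    repeat' first | assumption | apply add_mem | apply sub_mem | apply Submodule.smul_mem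
  have baab : B * (A * (A * B)) ∈ V := by
    rw [h.BAAB hs]
    repeat' first | assumption | apply add_mem | apply sub_mem | apply Submodule.smul_mem
  exact ⟨⟨e, a, b, aa, ab, ba, bb, aab, aba, abb, baa, bab, bba, aaba, aabb, abab, abba, baab,
    baba, bbaa, bbab⟩, ababa⟩

/-- The span of the twenty words is stable under left multiplication. -/
theorem mul_mem_span (hs : s' * s = 1) (hη : η' * (2 * (σ - 2 * s) - s' * π) = 1)
    (h : TopRel σ π s A B) {x : S} (hx : x ∈ Submodule.span R {y | y ∈ words20 A B}) :
    A * x ∈ Submodule.span R {y | y ∈ words20 A B} ∧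
      B * x ∈ Submodule.span R {y | y ∈ words20 A B} := by
  set V := Submodule.span R {y | y ∈ words20 A B}
  obtain ⟨l, hm⟩ := low_of_words (V := V) hs h fun x hx => Submodule.subset_span hx
  have hm' : B * (A * (B * (A * B))) ∈ V := by simpa using add_mem (h.mem_babab_sub hs hη l) hm
  have haababa : A * (A * (B * (A * (B * A)))) ∈ V := by
    simpa using add_mem (h.mem_aababa hs l) (V.smul_mem (σ - 2 * s) hm)
  have hbabba : B * (A * (B * (B * A))) ∈ V := by
    have := right h.BABB A
    simp only [mul_assoc] at this
    rw [this]
    exact h.mem_bbaba l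
  have l' : Low (V.comap (LinearMap.mulRight R A)) A B := by
    constructor <;> simp only [Submodule.mem_comap, LinearMap.mulRight_apply, mul_assoc, one_mul,
      h.ABAA]
    exacts [l.a, l.aa, l.ba, h.mem_aaa l, l.aba, l.baa, l.bba, l.aaba, l.aaba, l.abba,
      by rw [h.AAA, mul_sub, mul_smul_comm, mul_smul_comm]
         exact sub_mem (V.smul_mem _ l.baa) (V.smul_mem _ l.ba), l.baba, l.bbaa,
      h.mem_cube l.aba l.aaba, h.mem_aabba hs l, hm, h.mem_abbaa hs l, h.mem_baaba l,
      h.mem_baaba l,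
      by rw [h.AAA, mul_sub, mul_smul_comm, mul_smul_comm, mul_sub, mul_smul_comm, mul_smul_comm]
         exact sub_mem (V.smul_mem _ l.bbaa) (V.smul_mem _ l.bba), h.mem_bbaba l]
  have hbababa : B * (A * (B * (A * (B * A)))) ∈ V := by
    have h1 := h.mem_babab_sub hs hη l'
    simp only [Submodule.mem_comap, LinearMap.mulRight_apply, sub_mul, mul_assoc, h.ABAA] at h1
    have h4 := right h.ABAA (B * A)
    simp only [mul_assoc] at h4
    rw [h4] at h1
    simpa using add_mem h1 haababa
  suffices ∀ y ∈ words20 A B, A * y ∈ V ∧ B * y ∈ V by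
    induction hx using Submodule.span_induction with
    | mem y hy => exact this y hy
    | zero => simp
    | add y z _ _ hy hz => exact ⟨by rw [mul_add]; exact add_mem hy.1 hz.1,
        by rw [mul_add]; exact add_mem hy.2 hz.2⟩
    | smul c y _ hy => exact ⟨by rw [mul_smul_comm]; exact V.smul_mem c hy.1,
        by rw [mul_smul_comm]; exact V.smul_mem c hy.2⟩
  simp only [words20, List.forall_mem_cons, List.not_mem_nil, false_implies, implies_true,
    and_true, mul_one]
  refine ⟨⟨l.a, l.b⟩, ⟨l.aa, l.ba⟩, ⟨l.ab, l.bb⟩, ⟨h.mem_aaa l, l.baa⟩, ⟨l.aab, l.bab⟩,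
    ⟨l.aba, l.bba⟩, ⟨l.abb, h.swap.mem_aaa l.swap⟩, ⟨h.mem_cube l.ab l.aab, l.baab⟩,
    ⟨l.aaba, l.baba⟩, ⟨l.aabb, h.BABB ▸ l.bbab⟩, ⟨h.ABAA ▸ l.aaba, l.bbaa⟩, ⟨l.abab, l.bbab⟩,
    ⟨l.abba, h.swap.mem_cube l.ba l.bba⟩, ⟨h.mem_cube l.abb l.aabb, h.swap.mem_abbaa hs l.swap⟩,
    ⟨h.mem_aabab l, hm'⟩, ⟨h.mem_aabba hs l, hbabba⟩, ⟨hm, h.mem_bbaba l⟩,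
    ⟨h.mem_abbaa hs l, h.swap.mem_cube l.baa l.bbaa⟩, ⟨haababa, hbababa⟩,
    ⟨h.mem_cube l.aba l.aaba, h.mem_baaba l⟩⟩

theorem of_cubic {x y z : R} {a : S} (h : (a - algebraMap R S x) * (a - algebraMap R S y)
      * (a - algebraMap R S z) = 0) :
    a * (a * a) = (x + y + z) • (a * a) - (x * y + x * z + y * z) • a + (x * y * z) • (1 : S) := by
  simp only [Algebra.algebraMap_eq_smul_one, sub_mul, mul_sub, smul_mul_assoc, mul_smul_comm,
    one_mul, mul_one, mul_assoc] at h
  linear_combination (norm := module) h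

theorem of_rel {x y z s t c15 c1 d : R} {a b : S}
    (ha : (a - algebraMap R S x) * (a - algebraMap R S y) * (a - algebraMap R S z) = 0)
    (hb : (b - algebraMap R S x) * (b - algebraMap R S y) * (b - algebraMap R S z) = 0)
    (hq1 : a ^ 2 * b * a - a * b * a ^ 2 = (s - t) • (b * a ^ 2 - a ^ 2 * b) + d • (b * a - a * b))
    (hq2 : b ^ 2 * a * b - b * a * b ^ 2 = (s - t) • (a * b ^ 2 - b ^ 2 * a) + d • (a * b - b * a))
    (hE : b ^ 2 * a * b - a ^ 2 * b * a = c15 • (b * a * b - a * b * a)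
      + s • (a * b ^ 2 - b * a ^ 2) + t • (b ^ 2 * a - a ^ 2 * b) + d • (a * b - b * a)
      + c1 • (a - b))
    (ht : t = s + x) (hd : d = x ^ 2) (h15 : c15 = (y + z - 2 * x) - 2 * s + 2 * x)
    (h1 : c1 = x ^ 3 + (y + z - 2 * x) * x ^ 2 + (y - x) * (z - x) * x
      - s * (s * (y + z - 2 * x) - (y - x) * (z - x))) :
    TopRel (y + z - 2 * x) ((y - x) * (z - x)) s (a - algebraMap R S x)
      (b - algebraMap R S x) := by
  have ca := of_cubic ha
  have cb := of_cubic hb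
  subst ht hd h15 h1
  simp only [pow_two, mul_assoc] at hq1 hq2 hE
  constructor <;> simp only [Algebra.algebraMap_eq_smul_one, sub_mul, mul_sub, smul_mul_assoc,
    mul_smul_comm, one_mul, mul_one]
  · linear_combination (norm := module) ca
  · linear_combination (norm := module) cb
  · linear_combination (norm := module) -hq1
  · linear_combination (norm := module) -hq2
  · linear_combination (norm := module) hE - x • cb + x • ca

end TopRel

/-! ## The top layer -/

/-- The exchange of the two indices of the generators. -/
def sw : ℕ → ℕ
  | 0 => 1
  | 1 => 0
  | 2 => 3
  | 3 => 2
  | 4 => 5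
  | 5 => 4
  | k => k

theorem gH_sw {B : Type*} (g : ℕ → B) (sd : Bool) : gH (fun k => g (sw k)) sd = gH g (!sd) := by
  cases sd <;> rfl

theorem gK_sw {B : Type*} (g : ℕ → B) (sd : Bool) : gK (fun k => g (sw k)) sd = gK g (!sd) := by
  cases sd <;> rfl

section
variable {B : Type*} [Ring B] [Algebra Kpq B]

theorem blk_sw (g : ℕ → B) (sd : Bool) (b : ℕ) :
    blk (fun k => g (sw k)) sd b = blk g (!sd) b := by
  match b with
  | 1 | 2 | 3 => simp [blk, gH_sw, gK_sw]
  | 0 | (n + 4) => rfl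

theorem BlockRel.sw {g : ℕ → B} (h : BlockRel g) : BlockRel fun k => g (sw k) := by
  constructor <;> intro sd <;> simp only [gH_sw, gK_sw]
  exacts [h.hk _, h.kh _, h.kk _, h.cub _]

theorem relVal_quarticE_sw (g : ℕ → B) :
    relVal (fun k => g (sw k)) quarticE = -relVal g quarticE := by
  have hb : ∀ u : List (Bool × ℕ), blks (fun k => g (sw k)) u
      = blks g (u.map fun x => (!x.1, x.2)) := by
    intro u
    simp only [blks, List.map_map, blk_sw]
    rfl
  have hp : ∀ x ∈ quarticPairs, (x.2.1.map fun x => (!x.1, x.2)) = x.2.2 ∧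
      (x.2.2.map fun x => (!x.1, x.2)) = x.2.1 := by decide
  unfold quarticE
  revert hp
  generalize quarticPairs = L
  intro hp
  induction L with
  | nil => simp [relVal]
  | cons x L ih =>
    have h1 := hp x List.mem_cons_self
    have h2 := ih fun y hy => hp y (List.mem_cons_of_mem _ hy)
    simp only [relVal, List.flatMap_cons, List.map_append, List.sum_append, List.map_cons,
      List.map_nil, List.sum_cons, List.sum_nil, hb, h1, Ex.den_neg, neg_smul] at h2 ⊢
    rw [h2]
    abel

theorem relVal_hkhE_sw (g : ℕ → B) (h : relVal g hkhE = 0) :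
    relVal (fun k => g (sw k)) hkhE = 0 := by
  simp only [hkhE, relVal, blks, blk, gH_sw, gK_sw, List.map_cons, List.map_nil, List.sum_cons,
    List.prod_cons, List.prod_nil, List.sum_nil, Ex.den_neg, neg_smul, Bool.not_true,
    Bool.not_false, add_zero, mul_one] at h ⊢
  rw [← neg_eq_zero, ← h]
  abel

theorem relsE_sw (g : ℕ → B) (h : ∀ r ∈ relsE, relVal g r = 0) :
    ∀ r ∈ relsE, relVal (fun k => g (sw k)) r = 0 := by
  simp only [relsE, List.mem_cons, List.not_mem_nil, or_false, forall_eq_or_imp, forall_eq] at h ⊢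
  exact ⟨by rw [relVal_quarticE_sw, h.1, neg_zero], relVal_hkhE_sw g h.2⟩

end

/-- Products of two linear factors of the cubic polynomial. -/
def eT : ℕ → NE
  | 1 => (.atom 0 - eXi • 1) * (.atom 0 - eZetas • 1)
  | 2 => (.atom 0 - eXi • 1) * (.atom 0 - eZeta • 1)
  | _ => 0

section
variable {B : Type*} [Ring B] [Algebra Kpq B] {g : ℕ → B}

theorem eT_eig (hg : BlockRel g) (hK : g 2 = 0) (s : ℕ) (hs : s = 1 ∨ s = 2) :
    EigL g s ((eT s).den g) ∧ EigR g s ((eT s).den g) := by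
  have f := hg.factor
  rw [hK, smul_zero] at f
  have c : ∀ s t : Kpq, (g 0 - s • 1) * (g 0 - t • 1) = (g 0 - t • 1) * (g 0 - s • 1) := by
    intro s t
    simp only [sub_mul, mul_sub, smul_sub, mul_smul_comm, smul_mul_assoc, mul_one, one_mul,
      smul_smul, mul_comm t s]
    abel
  have c' : ∀ (s t : Kpq) (z : B), (g 0 - s • 1) * ((g 0 - t • 1) * z)
      = (g 0 - t • 1) * ((g 0 - s • 1) * z) := by
    intro s t z
    rw [← mul_assoc, c, mul_assoc]
  have k : gK g false = 0 := hK
  have fin : ∀ (x : B) (t : Kpq), x * (g 0 - t • 1) = 0 → x * gH g false = t • x := by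
    intro x t h
    rw [mul_sub, mul_smul_comm, mul_one, sub_eq_zero] at h
    exact h
  have fin' : ∀ (x : B) (t : Kpq), (g 0 - t • 1) * x = 0 → gH g false * x = t • x := by
    intro x t h
    rw [sub_mul, smul_mul_assoc, one_mul, sub_eq_zero] at h
    exact h
  rcases hs with rfl | rfl <;>
  refine ⟨⟨fin _ _ ?_, by simp [k, eigK]⟩, ⟨fin' _ _ ?_, by simp [k, eigK]⟩⟩ <;>
    simp only [eT, NE.den_mul, NE.den_sub, NE.den_atom, NE.den_smul, NE.den_one, den_xi, den_zeta,
        den_zetas, eigH, mul_assoc]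
  · rw [c zetas zeta, f]
  · rw [c' zeta xi, f]
  · rw [f]
  · rw [c' zetas xi, c zetas zeta, f]

theorem eT_mul (hg : BlockRel g) (hK : g 2 = 0) :
    (eT 1).den g * (eT 2).den g = 0 ∧ (eT 2).den g * (eT 1).den g = 0 := by
  have f := hg.factor
  rw [hK, smul_zero] at f
  have h1 := (eT_eig hg hK 1 (by simp)).1.h
  have h2 := (eT_eig hg hK 2 (by simp)).1.h
  have e : ∀ (x : B) (t r s : Kpq), x * gH g false = t • x →
      x * ((g 0 - r • 1) * (g 0 - s • 1)) = ((t - r) * (t - s)) • x := by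
    intro x t r s h
    rw [← mul_assoc, mul_sub x, mul_smul_comm, mul_one, show g 0 = gH g false from rfl, h,
      ← sub_smul, smul_mul_assoc, mul_sub, mul_smul_comm, mul_one, h, ← sub_smul, smul_smul]
  constructor
  · simp only [eigH, den_zeta] at h1
    simp only [eT, NE.den_mul, NE.den_sub, NE.den_atom, NE.den_smul, NE.den_one, den_xi, den_zeta,
      den_zetas] at h1 ⊢
    rw [e _ _ _ _ h1, sub_self, mul_zero, zero_smul]
  · simp only [eigH, den_zetas] at h2
    simp only [eT, NE.den_mul, NE.den_sub, NE.den_atom, NE.den_smul, NE.den_one, den_xi, den_zeta,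
      den_zetas] at h2 ⊢
    rw [e _ _ _ _ h2, sub_self, mul_zero, zero_smul]

/-- A product with an inner power of the second generator. -/
def eTop (s t : ℕ) (n : NE) : NE := eT s * (n * eT t)

theorem eTop_smul (hg : BlockRel g) (hK : g 2 = 0) (hK' : g 3 = 0)
    (h0 : ∀ r ∈ relsE, relVal g r = 0) (s t : ℕ) (h : s = 1 ∧ t = 2 ∨ s = 2 ∧ t = 1) :
    ∃ c : Kpq, (eTop s t (.atom 1)).den g = c • (eTop s t (.atom 1 * .atom 1)).den g := by
  have hd : true = true → ∀ sd, gK g sd = 0 := by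
    rintro - (_ | _)
    exacts [hK, hK']
  have hc : wordCheck s t true wordSetT relsN [1, 2] [2] = true := by
    rcases h with ⟨rfl, rfl⟩ | ⟨rfl, rfl⟩
    exacts [wordCheck_top_1, wordCheck_top_2]
  have h1 := wordCheck_span hg (x := (eT s).den g) (y := (eT t).den g) (s := s) (t := t)
    (fun _ => by
      rcases h with ⟨rfl, rfl⟩ | ⟨rfl, rfl⟩
      exacts [(eT_mul hg hK).1, (eT_mul hg hK).2]) hd
    (eT_eig hg hK s (by omega)).1 (eT_eig hg hK t (by omega)).2 relsE_relsN h0 hc 1 (by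
      decide +kernel)
  have e1 : numVal g ((eT s).den g) ((eT t).den g) 1 = (eTop s t (.atom 1)).den g := by
    change _ * (g 1 * 1 * _) = _
    rw [mul_one]; rfl
  have e2 : numVal g ((eT s).den g) ((eT t).den g) 2 = (eTop s t (.atom 1 * .atom 1)).den g := by
    change _ * (g 1 * g 1 * 1 * _) = _
    rw [mul_one]; rfl
  have e3 : {k | k ∈ [2]} = ({2} : Set ℕ) := by ext; simp
  rw [e3, Set.image_singleton, e1, e2, Submodule.mem_span_singleton] at h1
  obtain ⟨c, hc⟩ := h1
  exact ⟨c, hc.symm⟩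

end

/-- Exchange of the indices in an expression. -/
def NE.swp : NE → NE
  | .atom k => .atom (sw k)
  | .one => .one
  | .add a b => .add a.swp b.swp
  | .mul a b => .mul a.swp b.swp
  | .smul c a => .smul c a.swp

theorem NE.den_swp {B : Type*} [Ring B] [Algebra Kpq B] (g : ℕ → B) (e : NE) :
    e.swp.den g = e.den fun k => g (sw k) := by
  induction e with
  | atom k => rfl
  | one => rfl
  | add a b h1 h2 => simp only [NE.den, NE.swp, h1, h2]
  | mul a b h1 h2 => simp only [NE.den, NE.swp, h1, h2]
  | smul c a h => simp only [NE.den, NE.swp, h]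

/-- The representations of level three. -/
def isTop (R : Irr) : Prop := R ∈ [Irr.X3, .Y3, .Y3s, .A, .C, .Cs]

instance : DecidablePred isTop := fun R => inferInstanceAs (Decidable (R ∈ _))

theorem top_K (R : Irr) (hR : isTop R) (x : Aloc) (hx : x ∈ IK) : rhoK R x = 0 := by
  have h : rhoK R (gl 2) = 0 := by
    rw [rhoK_gl R 2 (by norm_num)]
    have : (NE.atom 2).check R.dim (atomsE R) = true := by
      revert hR; cases R <;> first | (intro h; exact absurd h (by decide)) | (intro _; decide +kernel)
    exact NE.den_eq_zero this
  have h2 : IK ≤ TwoSidedIdeal.ker (rhoK R) := by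
    refine TwoSidedIdeal.span_le.mpr ?_
    rintro y (rfl | hy)
    · exact (TwoSidedIdeal.mem_ker _).mpr h
    · exact (TwoSidedIdeal.mem_ker _).mpr (rhoK_U R (by rintro rfl; exact absurd hR (by decide)) y hy)
  exact (TwoSidedIdeal.mem_ker _).mp (h2 hx)

theorem rhoP_top (P : Irr → Prop) (hP : ∀ R, P R → isTop R) (x : Aloc) (hx : x ∈ IK) :
    rhoP P x = 0 := by
  funext R
  exact top_K R.1 (hP _ R.2) x hx

/-- The projection modulo the ideal generated by the `K`. -/
def mkK : Aloc →ₐ[Kpq] IK.ringCon.Quotient := RingCon.mkₐ Kpq IK.ringCon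

theorem mkK_eq_zero {x : Aloc} : mkK x = 0 ↔ x ∈ IK := by
  rw [TwoSidedIdeal.mem_iff, ← RingCon.eq]
  rfl

theorem eTop_indep (s t : ℕ) (h : s = 1 ∧ t = 2 ∨ s = 2 ∧ t = 1) (b : Bool) :
    indepCheck [.A] [(fun e : NE => bif b then e.swp else e) (eTop s t (.atom 1 * .atom 1))] = true
    ∧ ((fun e : NE => bif b then e.swp else e) (eTop s t (.atom 1))).check 3 (atomsE .A)
      = true := by
  rcases h with ⟨rfl, rfl⟩ | ⟨rfl, rfl⟩ <;> cases b <;> decide +kernel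

theorem eTop_zero (s t : ℕ) (h : s = 1 ∧ t = 2 ∨ s = 2 ∧ t = 1) (b : Bool) :
    ((fun e : NE => bif b then e.swp else e) (eTop s t (.atom 1))).den (fun k => mkK (gl k))
      = 0 := by
  have h2 := mkK_eq_zero.mpr K1_mem
  have h3 := mkK_eq_zero.mpr K2_mem
  have h4 := mkK_eq_zero.mpr (IU_le U1_mem)
  have h5 := mkK_eq_zero.mpr (IU_le U2_mem)
  have hg := blockRel_map mkK h4 h5
  have h0 := relsE_map mkK h4 h5
  obtain ⟨i1, i2⟩ := eTop_indep s t h b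
  set f : NE → NE := fun e => bif b then e.swp else e with hf
  obtain ⟨c, hc⟩ : ∃ c : Kpq, (f (eTop s t (.atom 1))).den (fun k => mkK (gl k))
      = c • (f (eTop s t (.atom 1 * .atom 1))).den (fun k => mkK (gl k)) := by
    cases b
    · exact eTop_smul hg h2 h3 h0 s t h
    · simp only [hf, cond_true, NE.den_swp]
      exact eTop_smul hg.sw h3 h2 (relsE_sw _ h0) s t h
  rw [← NE.map_den, ← NE.map_den] at hc
  have h6 : rhoP (· = .A) ((f (eTop s t (.atom 1))).den gl
      - c • (f (eTop s t (.atom 1 * .atom 1))).den gl) = 0 := by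
    apply rhoP_top _ (by rintro R rfl; decide)
    rw [← mkK_eq_zero, map_sub, map_smul, hc, sub_self]
  have h7 : rhoP (· = .A) ((f (eTop s t (.atom 1))).den gl) = 0 := by
    funext R
    obtain ⟨R, rfl⟩ := R
    change rhoK .A _ = 0
    rw [rhoK_den]
    exact NE.den_eq_zero i2
  rw [map_sub, h7, zero_sub, neg_eq_zero, map_smul, rhoP_den] at h6
  have h8 := linearIndependent_reps i1 (· = .A) (by simp)
  rw [Fintype.linearIndependent_iff] at h8
  have h9 : c = 0 := h8 (fun _ => c) (by simpa using h6) ⟨0, by simp⟩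
  rw [← NE.map_den, hc, h9, zero_smul]

theorem commute_aux {K S : Type*} [Field K] [Ring S] [Algebra K S] {x y z : K} (hyz : y ≠ z)
    {a b : S}
    (h1 : (a - x • 1) * (a - z • 1) * (b * ((a - x • 1) * (a - y • 1))) = 0)
    (h2 : (a - x • 1) * (a - y • 1) * (b * ((a - x • 1) * (a - z • 1))) = 0) :
    a ^ 2 * b * a - a * b * a ^ 2 = (-x) • (b * a ^ 2 - a ^ 2 * b) + x ^ 2 • (b * a - a * b) := by
  have h3 : (z - y) • (a ^ 2 * b * a - a * b * a ^ 2) = (z - y) •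
      ((-x) • (b * a ^ 2 - a ^ 2 * b) + x ^ 2 • (b * a - a * b)) := by
    simp only [sub_mul, mul_sub, smul_mul_assoc, mul_smul_comm, one_mul, mul_one, mul_assoc] at h1 h2
    simp only [pow_two, mul_assoc]
    linear_combination (norm := module) h1 - h2
  exact smul_right_injective S (sub_ne_zero.mpr hyz.symm) h3

theorem c11_sub_c12 : c11 - c12 = -xi := by
  rw [← den_c11, ← den_c12, ← den_xi, ← Ex.den_neg, ← Ex.den_sub]
  exact Ex.den_eq _ _ (by decide +kernel)

theorem c5_sub_c7 : c5 - c7 = xi ^ 2 := by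
  rw [← den_c5, ← den_c7, ← den_xi, pow_two, ← Ex.den_mul, ← Ex.den_sub]
  exact Ex.den_eq _ _ (by decide +kernel)

theorem c15_eq : c15 = (zeta + zetas - 2 * xi) - 2 * c11 + 2 * xi := by
  have : (eC15).den = (eZeta + eZetas - (eXi + eXi) - (eC11 + eC11) + (eXi + eXi)).den :=
    Ex.den_eq _ _ (by decide +kernel)
  simp only [Ex.den_add, Ex.den_sub, den_c11, den_c15, den_xi, den_zeta, den_zetas] at this
  rw [this]; ring

theorem c1_eq : c1 = xi ^ 3 + (zeta + zetas - 2 * xi) * xi ^ 2 + (zeta - xi) * (zetas - xi) * xi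
    - c11 * (c11 * (zeta + zetas - 2 * xi) - (zeta - xi) * (zetas - xi)) := by
  have : (eC1).den = (eXi * eXi * eXi + (eZeta + eZetas - (eXi + eXi)) * eXi * eXi
      + (eZeta - eXi) * (eZetas - eXi) * eXi
      - eC11 * (eC11 * (eZeta + eZetas - (eXi + eXi)) - (eZeta - eXi) * (eZetas - eXi))).den :=
    Ex.den_eq _ _ (by decide +kernel)
  simp only [Ex.den_add, Ex.den_sub, Ex.den_mul, den_c11, den_c1, den_xi, den_zeta, den_zetas]
    at this
  rw [this]; ring

theorem u_eq : (2 * c11 - (zeta - xi)) * (qi 1 0 ^ 2 * qi 3 0) = -qi 6 0 := by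
  have : ((eC11 + eC11 - (eZeta - eXi)) * (Ex.qi 1 0 * Ex.qi 1 0 * Ex.qi 3 0)).den
    = (-Ex.qi 6 0).den := Ex.den_eq _ _ (by decide +kernel)
  simp only [Ex.den_sub, den_c11, den_xi, den_zeta, Ex.den] at this
  rw [← this]; ring

theorem v_eq : (2 * c11 - (zetas - xi)) * (qi 1 0 ^ 2 * qi 3 0) = -(qi 6 0 * qi 1 1 ^ 2) := by
  have : ((eC11 + eC11 - (eZetas - eXi)) * (Ex.qi 1 0 * Ex.qi 1 0 * Ex.qi 3 0)).den
    = (-(Ex.qi 6 0 * (Ex.qi 1 1 * Ex.qi 1 1))).den := Ex.den_eq _ _ (by decide +kernel)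
  simp only [Ex.den_sub, den_c11, den_xi, den_zetas, Ex.den] at this
  rw [pow_two (qi 1 1), ← this]; ring

theorem qi60_inv : (qi 6 0)⁻¹ ∈ coeffRing := qi_inv_mem 6 0 (by decide)

theorem c11_inv_mem : c11⁻¹ ∈ coeffRing := by
  have : c11⁻¹ = -((qi 1 0 * qi 2 0 * qi 3 0) * ((qi 6 0)⁻¹ * (qi 1 1)⁻¹)) := by
    unfold c11
    rw [inv_neg, inv_div, div_eq_mul_inv, mul_inv]
  rw [this]
  exact neg_mem (mul_mem (mul_mem (mul_mem (qi_mem _ _) (qi_mem _ _)) (qi_mem _ _))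
    (mul_mem qi60_inv qi11_inv))

theorem c11_ne : c11 ≠ 0 :=
  neg_ne_zero.mpr (div_ne_zero (mul_ne_zero qi60_ne qi11_ne)
    (mul_ne_zero (mul_ne_zero qi10_ne qi20_ne) qi30_ne))

/-- The leading coefficient of the reduction of words of length six is a unit. -/
theorem eta_inv : ∃ η' ∈ coeffRing, η' * (2 * ((zeta + zetas - 2 * xi) - 2 * c11)
    - c11⁻¹ * ((zeta - xi) * (zetas - xi))) = 1 := by
  have hu := u_eq
  have hv := v_eq
  have h1 := qi10_ne
  have h3 := qi30_ne
  have h6 := qi60_ne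
  have h11 := qi11_ne
  have hc := c11_ne
  refine ⟨-(c11 * ((qi 1 0 ^ 2 * qi 3 0) * (qi 1 0 ^ 2 * qi 3 0)
    * ((qi 6 0)⁻¹ * ((qi 6 0)⁻¹ * (qi 1 1)⁻¹ ^ 2)))), ?_, ?_⟩
  · refine neg_mem (mul_mem c11_mem (mul_mem (mul_mem ?_ ?_)
      (mul_mem qi60_inv (mul_mem qi60_inv (pow_mem qi11_inv 2)))))
    all_goals exact mul_mem (pow_mem (qi_mem _ _) _) (qi_mem _ _)
  · have e : 2 * ((zeta + zetas - 2 * xi) - 2 * c11) - c11⁻¹ * ((zeta - xi) * (zetas - xi))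
        = -(c11⁻¹ * ((2 * c11 - (zeta - xi)) * (2 * c11 - (zetas - xi)))) := by
      field_simp
      ring
    rw [e]
    have e2 : (2 * c11 - (zeta - xi)) * (2 * c11 - (zetas - xi))
        * ((qi 1 0 ^ 2 * qi 3 0) * (qi 1 0 ^ 2 * qi 3 0)) = qi 6 0 * (qi 6 0 * qi 1 1 ^ 2) := by
      rw [mul_mul_mul_comm, hu, hv]; ring
    generalize (2 * c11 - (zeta - xi)) * (2 * c11 - (zetas - xi)) = X at e2 ⊢
    have : -(c11 * ((qi 1 0 ^ 2 * qi 3 0) * (qi 1 0 ^ 2 * qi 3 0)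
        * ((qi 6 0)⁻¹ * ((qi 6 0)⁻¹ * (qi 1 1)⁻¹ ^ 2)))) * -(c11⁻¹ * X)
        = c11 * c11⁻¹ * (X * ((qi 1 0 ^ 2 * qi 3 0) * (qi 1 0 ^ 2 * qi 3 0)))
          * ((qi 6 0)⁻¹ * ((qi 6 0)⁻¹ * (qi 1 1)⁻¹ ^ 2)) := by ring
    rw [this, e2]
    field_simp

/-- The relations of the top algebra hold modulo the `K`. -/
theorem mkK_topRel : TopRel (zeta + zetas - 2 * xi) ((zeta - xi) * (zetas - xi)) c11
    (mkK H1 - algebraMap Kpq _ xi) (mkK H2 - algebraMap Kpq _ xi) := by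
  have h2 : mkK (gl 2) = 0 := mkK_eq_zero.mpr K1_mem
  have h3 : mkK (gl 3) = 0 := mkK_eq_zero.mpr K2_mem
  have h4 : mkK (gl 4) = 0 := mkK_eq_zero.mpr (IU_le U1_mem)
  have h5 : mkK (gl 5) = 0 := mkK_eq_zero.mpr (IU_le U2_mem)
  have hg := blockRel_map mkK h4 h5
  have f1 := hg.factor
  have f2 := hg.sw.factor
  simp only [sw, h2, h3, smul_zero] at f1 f2
  have q := fun b => (⟨eTop_zero 1 2 (by simp) b, eTop_zero 2 1 (by simp) b⟩ :
    _ = (0 : IK.ringCon.Quotient) ∧ _ = (0 : IK.ringCon.Quotient))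
  have q1 := q false
  have q2 := q true
  simp only [cond_true, cond_false, NE.den_swp, eTop, eT, NE.den_mul, NE.den_sub, NE.den_atom,
    NE.den_smul, NE.den_one, den_xi, den_zeta, den_zetas, sw] at q1 q2
  have hE := congrArg mkK (mkLoc_rel Rel.quartic)
  simp only [quarticRHS, map_sub, map_add, map_mul, map_smul, map_pow, mkLoc_fH, mkLoc_fK,
    mkLoc_fU] at hE
  simp only [Fin.isValue, Fin.val_zero, Fin.val_one, add_zero, Nat.reduceAdd, h2, h3, h4, h5,
    zero_mul, mul_zero, sub_self, smul_zero, zero_add] at hE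
  refine TopRel.of_rel (t := c12) (c15 := c15) (c1 := c1) (d := c5 - c7) ?_ ?_ ?_ ?_ hE ?_
    c5_sub_c7 c15_eq c1_eq
  · rw [Algebra.algebraMap_eq_smul_one, Algebra.algebraMap_eq_smul_one,
      Algebra.algebraMap_eq_smul_one, mul_assoc]
    exact f1
  · rw [Algebra.algebraMap_eq_smul_one, Algebra.algebraMap_eq_smul_one,
      Algebra.algebraMap_eq_smul_one, mul_assoc]
    exact f2
  · rw [c11_sub_c12, c5_sub_c7]
    exact commute_aux zeta_ne_zetas q1.1 q1.2
  · rw [c11_sub_c12, c5_sub_c7]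
    exact commute_aux zeta_ne_zetas q2.1 q2.2
  · linear_combination -c11_sub_c12

/-- The twenty words in `H₁ - ξ`, `H₂ - ξ`. -/
def topW : List NE := words20 (.atom 0 - eXi • 1) (.atom 1 - eXi • 1)

theorem topW_check : indepCheck [.X3, .Y3, .Y3s, .A, .C, .Cs] topW = true := by decide +kernel

theorem words20_map {S T : Type*} [Mul S] [One S] [Mul T] [One T] (f : S → T)
    (h1 : f 1 = 1) (hm : ∀ x y, f (x * y) = f x * f y) (A B : S) :
    (words20 A B).map f = words20 (f A) (f B) := by
  simp only [words20, List.map_cons, List.map_nil, hm, h1]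

theorem topW_den {B : Type*} [Ring B] [Algebra Kpq B] (g : ℕ → B) :
    topW.map (fun e => e.den g)
      = words20 (g 0 - algebraMap Kpq B xi) (g 1 - algebraMap Kpq B xi) := by
  rw [topW, words20_map _ (NE.den_one g) (fun x y => NE.den_mul g x y)]
  simp only [NE.den_sub, NE.den_atom, NE.den_smul, NE.den_one, den_xi,
    Algebra.algebraMap_eq_smul_one]

theorem mem_IK_of_top {x : Aloc} (h : rhoP isTop x = 0) : x ∈ IK := by
  rw [← mkK_eq_zero]
  refine eq_zero_of_indep topW_check isTop (fun R h => h) mkK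
    (fun x hx => rhoP_top _ (fun _ h => h) x (mkK_eq_zero.mp hx)) ?_ h
  rw [range_den]
  obtain ⟨η', -, hη⟩ := eta_inv
  have key : {y | ∃ e ∈ topW, y = mkK (e.den gl)}
      = {y | y ∈ words20 (mkK H1 - algebraMap Kpq _ xi) (mkK H2 - algebraMap Kpq _ xi)} := by
    have := topW_den fun k => mkK (gl k)
    ext y
    simp only [Set.mem_setOf_eq]
    rw [show mkK H1 = mkK (gl 0) from rfl, show mkK H2 = mkK (gl 1) from rfl, ← this,
      List.mem_map]
    simp only [NE.map_den, Function.comp_def, eq_comm]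
  rw [key]
  set V := Submodule.span Kpq
    {y | y ∈ words20 (mkK H1 - algebraMap Kpq _ xi) (mkK H2 - algebraMap Kpq _ xi)} with hV
  have st := fun y (hy : y ∈ V) => mkK_topRel.mul_mem_span (s' := c11⁻¹) (η' := η')
    (inv_mul_cancel₀ c11_ne) hη hy
  have key2 : ∀ z : IK.ringCon.Quotient, ∀ y ∈ V, (z - algebraMap Kpq _ xi) * y ∈ V → z * y ∈ V := by
    intro z y hy h
    have := add_mem h (V.smul_mem xi hy)
    rwa [sub_mul, Algebra.algebraMap_eq_smul_one, smul_mul_assoc, one_mul, sub_add_cancel] at this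
  have := mul_mem_of_gens mkK (V := V) (fun k hk y hy => by
    interval_cases k
    · exact key2 _ y hy (st y hy).1
    · exact key2 _ y hy (st y hy).2
    · rw [mkK_eq_zero.mpr K1_mem, zero_mul]; exact zero_mem _
    · rw [mkK_eq_zero.mpr K2_mem, zero_mul]; exact zero_mem _
    · rw [mkK_eq_zero.mpr (IU_le U1_mem), zero_mul]; exact zero_mem _
    · rw [mkK_eq_zero.mpr (IU_le U2_mem), zero_mul]; exact zero_mem _) x 1 (Submodule.subset_span (by simp [words20]))
  rwa [mul_one] at this

/-- The representations are jointly faithful. -/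
theorem eq_zero_of_rhoK {x : Aloc} (h : ∀ R, rhoK R x = 0) : x = 0 :=
  eq_zero_of_mem_IU (mem_IU_of_mem_IK (mem_IK_of_top (funext fun R => h R.1))
    (funext fun R => h R.1)) (funext fun R => h R.1)

open MulOpposite

theorem eq_zero_of_check {e : NE} (h : ∀ R : Irr, e.check R.dim (atomsE R) = true) :
    e.den gl = 0 :=
  eq_zero_of_rhoK fun R => by rw [rhoK_den]; exact NE.den_eq_zero (h R)

/-- The product of the atoms in a list. -/
def W (w : List ℕ) : Aloc := (w.map gl).prod

theorem W_cons (k : ℕ) (w : List ℕ) : W (k :: w) = gl k * W w := by simp [W]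

theorem W_append (v w : List ℕ) : W (v ++ w) = W v * W w := by simp [W]

theorem W_nil : W [] = 1 := by simp [W]

theorem W_single (k : ℕ) : W [k] = gl k := by simp [W]

/-! ### Reversal -/

/-- The reversal of an atom. -/
def rv : ℕ → ℕ
  | 9 => 10
  | 10 => 9
  | 11 => 12
  | 12 => 11
  | k => k

theorem relAll_rev_check (R : Irr) :
    (relAll.all fun e => e.rev.check R.dim (fun k => atomsE R (rv k))) = true := by
  cases R <;> decide +kernel

theorem relAll_op : ∀ e ∈ relAll, e.den (fun k => op (gl (rv k))) = 0 := by
  intro e he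
  rw [NE.den_op (fun k => gl (rv k)), op_eq_zero_iff]
  refine eq_zero_of_rhoK fun R => ?_
  have h := NE.den_eq_zero (List.all_eq_true.mp (relAll_rev_check R) e he)
  rw [NE.map_den]
  have h1 : ∀ k, rhoK R (gl k) = atomsM R k := fun k => by simpa using rhoK_den R (.atom k)
  exact (congrArg (fun g => e.rev.den g) (funext fun k => h1 (rv k))).trans h

/-- The reversal of `A(3)_loc`. -/
def revHom : Aloc →ₐ[Kpq] Alocᵐᵒᵖ := locLift relAll_op

theorem revHom_gl : ∀ k < 13, revHom (gl k) = op (gl (rv k)) := by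
  refine atoms_ext (g := fun k => revHom (gl k)) (g' := fun k => op (gl (rv k)))
    (fun e he => ?_) relAll_op fun k hk => ?_
  · rw [← NE.map_den, relAll_gl e he, map_zero]
  · have h0 : ∀ x, revHom (mkLoc x) = liftGen _ x := locLift_mk _
    have hH := fun i => (h0 (fH i)).trans (liftGen_H i)
    have hK := fun i => (h0 (fK i)).trans (liftGen_K i)
    have hU := fun i => (h0 (fU i)).trans (liftGen_U i)
    interval_cases k
    · exact hH 0
    · exact hH 1
    · exact hK 0
    · exact hK 1
    · exact hU 0
    · exact hU 1

/-- The reversal of an element. -/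
def bt (x : Aloc) : Aloc := (revHom x).unop

theorem bt_gl (k : ℕ) : bt (gl k) = gl (rv k) := by
  rcases lt_or_ge k 13 with h | h
  · rw [bt, revHom_gl k h, unop_op]
  · obtain ⟨n, rfl⟩ := Nat.exists_eq_add_of_le' h
    exact congrArg unop (map_zero revHom)

theorem bt_mul (x y : Aloc) : bt (x * y) = bt y * bt x := by simp [bt]

theorem bt_add (x y : Aloc) : bt (x + y) = bt x + bt y := by simp [bt]

theorem bt_zero : bt 0 = 0 := by simp [bt]

theorem bt_one : bt 1 = 1 := by simp [bt]

theorem bt_smul (c : Kpq) (x : Aloc) : bt (c • x) = c • bt x := by simp [bt]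

theorem bt_ksmul (c : kk) (x : Aloc) : bt (c • x) = c • bt x := bt_smul c x

/-- The reversal of a word. -/
def rvw (w : List ℕ) : List ℕ := (w.map rv).reverse

theorem bt_W (w : List ℕ) : bt (W w) = W (rvw w) := by
  induction w with
  | nil => exact bt_one
  | cons k w ih => simp only [W_cons, bt_mul, ih, bt_gl, rvw, List.map_cons, List.reverse_cons,
      W_append, W_nil, mul_one]

theorem rv_rv (k : ℕ) : rv (rv k) = k := by
  rcases lt_or_ge k 13 with h | h
  · interval_cases k <;> rfl
  · obtain ⟨n, rfl⟩ := Nat.exists_eq_add_of_le' h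
    rfl

theorem bt_bt (x : Aloc) : bt (bt x) = x := by
  refine loc_induction (P := fun x => bt (bt x) = x) (fun c => ?_) (fun k _ => ?_)
    (fun x y hx hy => ?_) (fun x y hx hy => ?_) x
  · rw [bt_smul, bt_one, bt_smul, bt_one]
  · rw [bt_gl, bt_gl, rv_rv]
  · rw [bt_add, bt_add, hx, hy]
  · rw [bt_mul, bt_mul, hx, hy]

/-- The span over the coefficient ring of the words in a list. -/
def spn (N : List (List ℕ)) : Submodule kk Aloc := Submodule.span kk {x | ∃ w ∈ N, x = W w}

theorem W_mem {N : List (List ℕ)} {w : List ℕ} (h : w ∈ N) : W w ∈ spn N :=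
  Submodule.subset_span ⟨w, h, rfl⟩

theorem den_smul_mem {V : Submodule kk Aloc} (e : Ex) {x : Aloc} (h : x ∈ V) : e.den • x ∈ V :=
  V.smul_mem (⟨e.den, e.den_mem⟩ : kk) h

/-- Left multiplication by `a` maps `V` to `V'`. -/
def Maps (a : Aloc) (V V' : Submodule kk Aloc) : Prop := ∀ x ∈ V, a * x ∈ V'

theorem Maps.mul {a b : Aloc} {V V' V'' : Submodule kk Aloc} (hb : Maps b V' V'')
    (ha : Maps a V V') : Maps (b * a) V V'' := fun x hx => by
  rw [mul_assoc]; exact hb _ (ha x hx)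

theorem Maps.mono {a : Aloc} {V V' V'' : Submodule kk Aloc} (ha : Maps a V V') (h : V' ≤ V'') :
    Maps a V V'' := fun x hx => h (ha x hx)

theorem maps_span {a : Aloc} {S : Set Aloc} {V : Submodule kk Aloc} (h : ∀ x ∈ S, a * x ∈ V) :
    Maps a (Submodule.span kk S) V := by
  intro x hx
  induction hx using Submodule.span_induction with
  | mem x hx => exact h x hx
  | zero => rw [mul_zero]; exact V.zero_mem
  | add x y _ _ hx hy => rw [mul_add]; exact V.add_mem hx hy
  | smul c x _ hx => rw [mul_smul_comm]; exact V.smul_mem c hx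

theorem maps_spn {a : Aloc} {N : List (List ℕ)} {V : Submodule kk Aloc}
    (h : ∀ w ∈ N, a * W w ∈ V) : Maps a (spn N) V :=
  maps_span (by rintro _ ⟨w, hw, rfl⟩; exact h w hw)

theorem span_mul_mem {S : Set Aloc} {y : Aloc} {V : Submodule kk Aloc} (h : ∀ x ∈ S, x * y ∈ V)
    {x : Aloc} (hx : x ∈ Submodule.span kk S) : x * y ∈ V := by
  induction hx using Submodule.span_induction with
  | mem x hx => exact h x hx
  | zero => rw [zero_mul]; exact V.zero_mem
  | add x y _ _ hx hy => rw [add_mul]; exact V.add_mem hx hy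
  | smul c x _ hx => rw [smul_mul_assoc]; exact V.smul_mem c hx

theorem spn_mul_mem {N : List (List ℕ)} {y : Aloc} {V : Submodule kk Aloc}
    (h : ∀ w ∈ N, W w * y ∈ V) {x : Aloc} (hx : x ∈ spn N) : x * y ∈ V :=
  span_mul_mem (by rintro _ ⟨w, hw, rfl⟩; exact h w hw) hx

theorem bt_mem {S : Set Aloc} {V : Submodule kk Aloc} (h : ∀ x ∈ S, bt x ∈ V) {x : Aloc}
    (hx : x ∈ Submodule.span kk S) : bt x ∈ V := by
  induction hx using Submodule.span_induction with
  | mem x hx => exact h x hx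
  | zero => rw [bt_zero]; exact V.zero_mem
  | add x y _ _ hx hy => rw [bt_add]; exact V.add_mem hx hy
  | smul c x _ hx => rw [bt_ksmul]; exact V.smul_mem c hx

theorem bt_spn {N : List (List ℕ)} {V : Submodule kk Aloc} (h : ∀ w ∈ N, W (rvw w) ∈ V) {x : Aloc}
    (hx : x ∈ spn N) : bt x ∈ V :=
  bt_mem (by rintro _ ⟨w, hw, rfl⟩; rw [bt_W]; exact h w hw) hx

/-! ### Tables -/

/-- A word, and a linear combination of words. -/
abbrev Row1 : Type := List ℕ × List (Ex × List ℕ)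

/-- A linear combination of words. -/
def combNE (l : List (Ex × List ℕ)) : NE := l.foldr (fun t e => t.1 • nw t.2 + e) 0

def combVal (l : List (Ex × List ℕ)) : Aloc := (l.map fun t => t.1.den • W t.2).sum

theorem combNE_den (l : List (Ex × List ℕ)) : (combNE l).den gl = combVal l := by
  induction l with
  | nil => simp [combNE, combVal]
  | cons t l ih =>
    simp only [combNE, combVal, List.foldr_cons, List.map_cons, List.sum_cons, NE.den_add,
      NE.den_smul, den_nw] at ih ⊢
    rw [ih]
    rfl

theorem combVal_mem {l : List (Ex × List ℕ)} {V : Submodule kk Aloc} (h : ∀ t ∈ l, W t.2 ∈ V) :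
    combVal l ∈ V :=
  list_sum_mem fun x hx => by
    obtain ⟨t, ht, rfl⟩ := List.mem_map.mp hx
    exact den_smul_mem _ (h t ht)

/-- The test that a row holds, up to the factor `c`, in a representation. -/
def rowCheck (c : Ex) (rows : List Row1) (R : Irr) : Bool :=
  rows.all fun s => (nw s.1 - c • combNE s.2).check R.dim (atomsE R)

theorem row_eq {c : Ex} {rows : List Row1} (h : ∀ R, rowCheck c rows R = true) {s : Row1}
    (hs : s ∈ rows) : W s.1 = c.den • combVal s.2 := by
  have := eq_zero_of_check fun R => List.all_eq_true.mp (h R) s hs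
  rw [NE.den_sub, NE.den_smul, den_nw, combNE_den] at this
  exact sub_eq_zero.mp this

/-- The test that every word in `N`, after appending `g` on the left, is expressed through `N'`. -/
def cover (rows : List Row1) (g : ℕ) (N N' : List (List ℕ)) : Bool :=
  N.all fun w => rows.any fun s => s.1 == g :: w && s.2.all fun t => N'.contains t.2

theorem maps_of_cover {c : Ex} {rows : List Row1} (h : ∀ R, rowCheck c rows R = true)
    (hc : c.den ≠ 0) {g : ℕ} {N N' : List (List ℕ)} (hN : cover rows g N N' = true) :
    Maps (c.den⁻¹ • gl g) (spn N) (spn N') := by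
  refine maps_spn fun w hw => ?_
  obtain ⟨s, hs, h1⟩ := List.any_eq_true.mp (List.all_eq_true.mp hN w hw)
  rw [Bool.and_eq_true, beq_iff_eq] at h1
  have h2 := row_eq h hs
  rw [h1.1, W_cons] at h2
  rw [smul_mul_assoc, h2, inv_smul_smul₀ hc]
  refine combVal_mem fun t ht => W_mem ?_
  simpa using List.all_eq_true.mp h1.2 t ht

theorem maps_of_cover_one {rows : List Row1} (h : ∀ R, rowCheck 1 rows R = true)
    {g : ℕ} {N N' : List (List ℕ)} (hN : cover rows g N N' = true) :
    Maps (gl g) (spn N) (spn N') := by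
  have := maps_of_cover h (by simp) hN
  simpa using this

set_option maxRecDepth 10000

/-- The action of the atoms on the words that end in `U₁`. -/
def rowsU : List Row1 := [
  ([0, 4], [(ePhi, [4])]), ([0, 1, 4], [(eTau, [1, 4])]), ([0, 5, 4], [(1, [3, 4])]),
    ([0, 3, 4], [(1, [0, 3, 4])]), ([0, 0, 3, 4], [(eB1, [4]), (eB2, [1, 4]), (eB0, [5, 4]),
    (-eB3, [3, 4]), (eB4, [0, 3, 4])]), ([1, 4], [(1, [1, 4])]), ([1, 1, 4], [(1, [0, 3, 4])]),
    ([1, 5, 4], [(ePhi, [5, 4])]), ([1, 3, 4], [(eTau, [3, 4])]), ([1, 0, 3, 4], [(eB0, [4]),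
    (-eB3, [1, 4]), (eB1, [5, 4]), (eB2, [3, 4]), (eB4, [0, 3, 4])]), ([2, 4], []),
    ([2, 1, 4], [(ePhi, [1, 4])]), ([2, 5, 4], [(1, [1, 4])]), ([2, 3, 4], [(eTau, [1, 4])]),
    ([2, 0, 3, 4], [(eTau * eTau, [1, 4])]), ([3, 4], [(1, [3, 4])]),
    ([3, 1, 4], [(eTau, [3, 4])]), ([3, 5, 4], []), ([3, 3, 4], [(ePhi, [3, 4])]),
    ([3, 0, 3, 4], [(eTau * eTau, [3, 4])]), ([4, 4], [(eDelta, [4])]), ([4, 1, 4], []),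
    ([4, 5, 4], [(1, [4])]), ([4, 3, 4], [(ePhi, [4])]), ([4, 0, 3, 4], [(ePhi * ePhi, [4])]),
    ([5, 4], [(1, [5, 4])]), ([5, 1, 4], [(ePhi, [5, 4])]), ([5, 5, 4], [(eDelta, [5, 4])]),
    ([5, 3, 4], []), ([5, 0, 3, 4], [(ePhi * ePhi, [5, 4])]), ([6, 4], []), ([6, 1, 4], []),
    ([6, 5, 4], []), ([6, 3, 4], []), ([6, 0, 3, 4], []), ([7, 4], []),
    ([7, 1, 4], [(eTau * ePhi, [1, 4])]), ([7, 5, 4], [(eTau, [1, 4])]),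
    ([7, 3, 4], [(eTau * eTau, [1, 4])]), ([7, 0, 3, 4], [(eTau * eTau * eTau, [1, 4])]),
    ([8, 4], [(eTau, [3, 4])]), ([8, 1, 4], [(eTau * eTau, [3, 4])]), ([8, 5, 4], []),
    ([8, 3, 4], [(eTau * ePhi, [3, 4])]), ([8, 0, 3, 4], [(eTau * eTau * eTau, [3, 4])]),
    ([9, 4], []), ([9, 1, 4], [(ePhi, [3, 4])]), ([9, 5, 4], [(1, [3, 4])]),
    ([9, 3, 4], [(eTau, [3, 4])]), ([9, 0, 3, 4], [(eTau * eTau, [3, 4])]),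
    ([10, 4], [(1, [1, 4])]), ([10, 1, 4], [(eTau, [1, 4])]), ([10, 5, 4], []),
    ([10, 3, 4], [(ePhi, [1, 4])]), ([10, 0, 3, 4], [(eTau * eTau, [1, 4])]),
    ([11, 4], [(eTau * eTau, [1, 4])]), ([11, 1, 4], [(eTau * eTau * eTau, [1, 4])]),
    ([11, 5, 4], []), ([11, 3, 4], [(eTau * eTau * ePhi, [1, 4])]),
    ([11, 0, 3, 4], [(eTau * eTau * eTau * eTau, [1, 4])]), ([12, 4], []),
    ([12, 1, 4], [(eTau * eTau * ePhi, [3, 4])]), ([12, 5, 4], [(eTau * eTau, [3, 4])]),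
    ([12, 3, 4], [(eTau * eTau * eTau, [3, 4])]),
    ([12, 0, 3, 4], [(eTau * eTau * eTau * eTau, [3, 4])]), ([0, 6], [(eTau, [6])]),
    ([1, 6], [(eTau, [6])]), ([2, 6], [(ePhi, [6])]), ([3, 6], [(ePhi, [6])]), ([4, 6], []),
    ([5, 6], []), ([6, 6], [(ePhi * eDelta, [6])]), ([7, 6], [(ePhi * ePhi, [6])]),
    ([8, 6], [(ePhi * ePhi, [6])]), ([9, 6], [(ePhi, [6])]), ([10, 6], [(ePhi, [6])]),
    ([11, 6], [(ePhi * ePhi * ePhi, [6])]), ([12, 6], [(ePhi * ePhi * ePhi, [6])])]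

def rowA : Row1 := ([0, 12], [(eC1, [2]), (eC7, [7]),
    (eC12, [2, 3, 2]), (eC1, [9]), (eC7, [3, 2]), (eC12, [12]), (eC5, [1, 2]), (eC15, [0, 3, 2]),
    (eC11, [0, 1, 2]), (eC11, [1, 1, 2]), (eC2, [4, 1]), (eC6, [2, 5, 2]), (eC2, [5, 2]),
    (eC6, [3, 4, 1]), (eC10, [0, 3, 4, 1]), (eC0, [6])])

def rowB : Row1 := ([0, 0, 3, 2], [(eC2, [2]), (eC6, [7]), (eC10, [2, 3, 2]), (eC1, [9]), (eC5, [3, 2]),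
    (eC11, [12]), (eC7, [1, 2]), (eC15, [0, 3, 2]), (eC12, [0, 1, 2]), (eC11, [1, 1, 2]),
    (eC0, [4, 1]), (eC6, [2, 5, 2]), (eC1, [5, 2]), (eC7, [3, 4, 1]), (eC12, [0, 3, 4, 1]),
    (eC2, [6])])

/-- The action of the atoms on the words that end in `M₁*`. -/
def rowsK : List Row1 := [rowA, rowB,
  ([0, 2], [(eTau, [2])]), ([0, 7], [(eTau, [7])]), ([0, 2, 3, 2], [(eTau, [2, 3, 2])]),
    ([0, 9], [(1, [1, 2])]), ([0, 3, 2], [(1, [0, 3, 2])]), ([0, 1, 2], [(1, [0, 1, 2])]),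
    ([0, 0, 1, 2], [(eB2, [7]), (eB0, [9]), (-eB3, [1, 2]), (eB4, [0, 1, 2]),
    (eB1, [4, 1])]), ([0, 1, 1, 2], [(eC0, [2]), (eC6, [7]), (eC12, [2, 3, 2]), (eC2, [9]),
    (eC7, [3, 2]), (eC11, [12]), (eC6, [1, 2]), (eC15, [0, 3, 2]), (eC10, [0, 1, 2]),
    (eC12, [1, 1, 2]), (eC2, [4, 1]), (eC7, [2, 5, 2]), (eC1, [5, 2]), (eC5, [3, 4, 1]),
    (eC11, [0, 3, 4, 1]), (eC1, [6])]), ([1, 2], [(1, [1, 2])]), ([1, 7], [(1, [0, 3, 2])]),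
    ([1, 2, 3, 2], [(eC1, [2]), (eC7, [7]), (eC12, [2, 3, 2]), (eC1, [9]), (eC7, [3, 2]),
    (eC12, [12]), (eC5, [1, 2]), (eC15, [0, 3, 2]), (eC11, [0, 1, 2]), (eC11, [1, 1, 2]),
    (eC2, [4, 1]), (eC6, [2, 5, 2]), (eC2, [5, 2]), (eC6, [3, 4, 1]), (eC10, [0, 3, 4, 1]),
    (eC0, [6])]), ([1, 9], [(eTau, [9])]), ([1, 3, 2], [(eTau, [3, 2])]),
    ([1, 12], [(eTau, [12])]), ([1, 1, 2], [(1, [1, 1, 2])]), ([1, 0, 3, 2], [(eC1, [2]),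
    (eC5, [7]), (eC11, [2, 3, 2]), (eC2, [9]), (eC6, [3, 2]), (eC10, [12]), (eC7, [1, 2]),
    (eC15, [0, 3, 2]), (eC11, [0, 1, 2]), (eC12, [1, 1, 2]), (eC1, [4, 1]), (eC7, [2, 5, 2]),
    (eC0, [5, 2]), (eC6, [3, 4, 1]), (eC12, [0, 3, 4, 1]), (eC2, [6])]),
    ([1, 0, 1, 2], [(eC2, [2]), (eC7, [7]), (eC11, [2, 3, 2]), (eC0, [9]), (eC6, [3, 2]),
    (eC12, [12]), (eC6, [1, 2]), (eC15, [0, 3, 2]), (eC12, [0, 1, 2]), (eC10, [1, 1, 2]),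
    (eC1, [4, 1]), (eC5, [2, 5, 2]), (eC2, [5, 2]), (eC7, [3, 4, 1]), (eC11, [0, 3, 4, 1]),
    (eC1, [6])]), ([1, 1, 1, 2], [(eB0, [2]), (eB2, [3, 2]), (-eB3, [1, 2]), (eB4, [1, 1, 2]),
    (eB1, [5, 2])]), ([4, 2], []), ([4, 7], []), ([4, 2, 3, 2], []), ([4, 9], [(1, [4, 1])]),
    ([4, 3, 2], [(eTau, [4, 1])]), ([4, 12], [(eTau * eTau, [4, 1])]),
    ([4, 1, 2], [(ePhi, [4, 1])]), ([4, 0, 3, 2], [(eTau * ePhi, [4, 1])]),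
    ([4, 0, 1, 2], [(ePhi * ePhi, [4, 1])]), ([4, 1, 1, 2], [(eTau * eTau, [4, 1])]),
    ([5, 2], [(1, [5, 2])]), ([5, 7], [(eTau, [5, 2])]), ([5, 2, 3, 2], [(eTau * eTau, [5, 2])]),
    ([5, 9], []), ([5, 3, 2], []), ([5, 12], []), ([5, 1, 2], [(ePhi, [5, 2])]),
    ([5, 0, 3, 2], [(eTau * ePhi, [5, 2])]), ([5, 0, 1, 2], [(eTau * eTau, [5, 2])]),
    ([5, 1, 1, 2], [(ePhi * ePhi, [5, 2])]), ([6, 2], [(ePhi, [6])]),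
    ([6, 7], [(ePhi * ePhi, [6])]), ([6, 2, 3, 2], [(ePhi * ePhi * ePhi, [6])]),
    ([6, 9], [(ePhi, [6])]), ([6, 3, 2], [(ePhi * ePhi, [6])]),
    ([6, 12], [(ePhi * ePhi * ePhi, [6])]), ([6, 1, 2], [(eTau * ePhi, [6])]),
    ([6, 0, 3, 2], [(eTau * ePhi * ePhi, [6])]), ([6, 0, 1, 2], [(eTau * eTau * ePhi, [6])]),
    ([6, 1, 1, 2], [(eTau * eTau * ePhi, [6])]), ([2, 2], [(ePhi, [2])]),
    ([2, 7], [(ePhi, [7])]), ([2, 2, 3, 2], [(ePhi, [2, 3, 2])]), ([2, 9], [(1, [7])]),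
    ([2, 3, 2], [(1, [2, 3, 2])]), ([2, 12], [(eB0, [2]), (-eB3, [7]), (eB4, [2, 3, 2]),
    (eB2, [2, 5, 2]), (eB1, [6])]), ([2, 1, 2], [(eTau, [7])]),
    ([2, 0, 3, 2], [(eTau, [2, 3, 2])]), ([2, 0, 1, 2], [(eTau * eTau, [7])]),
    ([2, 1, 1, 2], [(eB1, [2]), (eB2, [7]), (eB4, [2, 3, 2]), (-eB3, [2, 5, 2]), (eB0, [6])]),
    ([3, 2], [(1, [3, 2])]), ([3, 7], [(1, [12])]), ([3, 2, 3, 2], [(eB0, [9]), (-eB3, [3, 2]),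
    (eB4, [12]), (eB2, [3, 4, 1]), (eB1, [6])]), ([3, 9], [(ePhi, [9])]),
    ([3, 3, 2], [(ePhi, [3, 2])]), ([3, 12], [(ePhi, [12])]), ([3, 1, 2], [(eTau, [3, 2])]),
    ([3, 0, 3, 2], [(eTau, [12])]), ([3, 0, 1, 2], [(eB1, [9]), (eB2, [3, 2]), (eB4, [12]),
    (-eB3, [3, 4, 1]), (eB0, [6])]), ([3, 1, 1, 2], [(eTau * eTau, [3, 2])])]

/-- The action of `φ⁻¹ Z₁, φ⁻¹ Z₂, φ⁻¹ Z₃, φ⁻¹ Z₄` on the images of `K₁` and `K₂`. -/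
def rowsP : List Row1 := [
  ([7, 2], [(1, [7])]), ([7, 7], [(1, [2, 3, 2])]), ([7, 2, 3, 2], [(eB0, [2]), (-eB3, [7]),
    (eB4, [2, 3, 2]), (eB2, [2, 5, 2]), (eB1, [6])]), ([7, 2, 5, 2], [(eTau, [2, 5, 2])]),
    ([7, 6], [(ePhi, [6])]), ([9, 2], [(1, [9])]), ([9, 7], [(1, [3, 2])]),
    ([9, 2, 3, 2], [(1, [12])]), ([9, 2, 5, 2], [(1, [3, 4, 1])]), ([9, 6], [(1, [6])]),
    ([8, 9], [(1, [3, 2])]), ([8, 3, 2], [(1, [12])]), ([8, 12], [(eB0, [9]), (-eB3, [3, 2]),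
    (eB4, [12]), (eB2, [3, 4, 1]), (eB1, [6])]), ([8, 3, 4, 1], [(eTau, [3, 4, 1])]),
    ([8, 6], [(ePhi, [6])]), ([10, 9], [(1, [2])]), ([10, 3, 2], [(1, [7])]),
    ([10, 12], [(1, [2, 3, 2])]), ([10, 3, 4, 1], [(1, [2, 5, 2])]), ([10, 6], [(1, [6])])]

/-- Words that end in `U₁`. -/
def wU : List (List ℕ) := [[4], [1, 4], [5, 4], [3, 4], [0, 3, 4]]

/-- The right factors of the basis diagrams of cut length one. -/
def wUr : List (List ℕ) := [[], [1], [5], [3], [3, 0]]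

/-- Words that end in `M₁*` and represent diagrams of cut length two. -/
def wM : List (List ℕ) := [[2], [7], [2, 3, 2], [9], [3, 2], [12], [1, 2], [0, 3, 2], [0, 1, 2], [1, 1, 2]]

/-- The products of the words in `wM` with `φ⁻¹ Z₄`. -/
def wN : List (List ℕ) := [[10], [2, 3], [11], [3], [8], [3, 2, 3], [0, 3], [1, 2, 3], [0, 0, 3], [1, 0, 3]]

/-- The words in `wU` continued by `H₂`. -/
def wM1 : List (List ℕ) := [[4, 1], [2, 5, 2], [5, 2], [3, 4, 1], [0, 3, 4, 1]]

/-- Words that end in `M₁*`. -/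
def wMM : List (List ℕ) := wM ++ wM1 ++ [[6]]

/-- The words in the image of `K₁`. -/
def wP1 : List (List ℕ) := [[2], [7], [2, 3, 2], [2, 5, 2], [6]]

/-- The words in the image of `K₂`. -/
def wP2 : List (List ℕ) := [[9], [3, 2], [12], [3, 4, 1], [6]]

/-- Basis diagrams of cut length two that end in `M₁* H₂`, `M₁* H₂²` or `M₁* H₂ H₁`. -/
def rowsY : List (List ℕ × List ℕ × List ℕ) := [([2, 1], [2], [1]), ([2, 3, 0], [7], [1]),
  ([3, 0], [9], [1]), ([3, 2, 1], [3, 2], [1]), ([0, 3, 0], [1, 2], [1]),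
  ([0, 3, 2, 1], [0, 3, 2], [1]), ([0, 0, 3, 0], [0, 1, 2], [1]), ([2, 1, 1], [2], [1, 1]),
  ([3, 0, 1], [9], [1, 1]), ([0, 3, 0, 1], [1, 2], [1, 1]), ([3, 0, 0], [9], [1, 0]),
  ([2, 1, 0], [2], [1, 0]), ([0, 3, 0, 0], [1, 2], [1, 0]), ([0, 0, 3, 0, 0], [0, 1, 2], [1, 0])]

/-- Identities between words. -/
def rowsE0 : List Row1 := [
  ([7, 2], [(ePhi, [7])]), ([9, 2], [(ePhi, [9])]), ([8, 3], [(ePhi, [8])]),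
  ([10, 3], [(ePhi, [10])]), ([9, 7, 7, 2], [(ePhi * ePhi * ePhi, [12])]),
  ([10, 8, 8, 3], [(ePhi * ePhi * ePhi, [11])]),
  ([1, 2, 3, 0], [(1, [0, 3, 2, 1])]),
  ([0, 12], [(1, [1, 2, 3, 2])]), ([0, 3, 2], [(1, [1, 7])]), ([6, 10], [(ePhi, [6])])]

/-- Identities between words, including those for the basis diagrams. -/
def rowsE : List Row1 := rowsE0
  ++ (wU.map fun v => (v ++ [1, 10], [(ePhi, v ++ [3])]))
  ++ ((wU.zip wM1).map fun s => (s.1 ++ [1], [(1, s.2)]))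
  ++ (rowsY.map fun s => (s.1, [(1, s.2.1 ++ s.2.2)]))
  ++ (((basisW 1).zip (wU.flatMap fun v => wUr.map fun y => v ++ y)).map fun s => (s.1, [(1, s.2)]))
  ++ ((wM.zip wN).map fun s => (s.1 ++ [10], [(ePhi, s.2)]))

set_option maxHeartbeats 1000000 in
theorem rowsU_check (R : Irr) : rowCheck 1 rowsU R = true := by cases R <;> decide +kernel

set_option maxHeartbeats 1000000 in
theorem rowsK_check (R : Irr) : rowCheck 1 rowsK R = true := by cases R <;> decide +kernel

set_option maxHeartbeats 1000000 in
theorem rowsP_check (R : Irr) : rowCheck ePhi rowsP R = true := by cases R <;> decide +kernel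

set_option maxHeartbeats 1000000 in
theorem rowsE_check (R : Irr) : rowCheck 1 rowsE R = true := by cases R <;> decide +kernel

/-- The subalgebra generated by the atoms over the coefficient ring. -/
def AA : Subalgebra kk Aloc := Algebra.adjoin kk {x | ∃ k < 13, x = gl k}

theorem gl_mem (k : ℕ) : gl k ∈ AA := by
  rcases lt_or_ge k 13 with h | h
  · exact Algebra.subset_adjoin ⟨k, h, rfl⟩
  · obtain ⟨n, rfl⟩ := Nat.exists_eq_add_of_le' h
    exact AA.zero_mem

theorem W_mem_AA (w : List ℕ) : W w ∈ AA := by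
  induction w with
  | nil => rw [W_nil]; exact AA.one_mem
  | cons k w ih => rw [W_cons]; exact AA.mul_mem (gl_mem k) ih

theorem bt_mem_AA {a : Aloc} (ha : a ∈ AA) : bt a ∈ AA := by
  induction ha using Algebra.adjoin_induction with
  | mem x hx => obtain ⟨k, _, rfl⟩ := hx; rw [bt_gl]; exact gl_mem _
  | algebraMap r =>
    rw [Algebra.algebraMap_eq_smul_one, bt_ksmul, bt_one]
    exact AA.smul_mem AA.one_mem r
  | add x y _ _ hx hy => rw [bt_add]; exact AA.add_mem hx hy
  | mul x y _ _ hx hy => rw [bt_mul]; exact AA.mul_mem hy hx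

theorem maps_AA {V : Submodule kk Aloc} (h : ∀ k < 13, Maps (gl k) V V) :
    ∀ a ∈ AA, Maps a V V := by
  intro a ha
  induction ha using Algebra.adjoin_induction with
  | mem x hx => obtain ⟨k, hk, rfl⟩ := hx; exact h k hk
  | algebraMap r =>
    intro x hx
    rw [Algebra.algebraMap_eq_smul_one, smul_mul_assoc, one_mul]
    exact V.smul_mem r hx
  | add x y _ _ hx hy => intro z hz; rw [add_mul]; exact V.add_mem (hx z hz) (hy z hz)
  | mul x y _ _ hx hy => exact hx.mul hy

theorem mul_mem_of_bt {V : Submodule kk Aloc} (hl : ∀ a ∈ AA, Maps a V V)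
    (hb : ∀ x ∈ V, bt x ∈ V) {x a : Aloc} (hx : x ∈ V) (ha : a ∈ AA) : x * a ∈ V := by
  have := hb _ (hl _ (bt_mem_AA ha) _ (hb x hx))
  rwa [bt_mul, bt_bt, bt_bt] at this

/-! ### Cut length at most one -/

/-- The words of the basis diagrams of cut length at most one, respectively two. -/
def bw1 : List (List ℕ) := [6] :: basisW 1
def bw2 : List (List ℕ) := bw1 ++ basisW 2

theorem rowsE_eq {w : List ℕ} {c : Ex} {v : List ℕ} (h : (w, [(c, v)]) ∈ rowsE) :
    W w = c.den • W v := by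
  have := row_eq rowsE_check h
  simpa [combVal] using this

theorem rowsE0_eq {w : List ℕ} (c : Ex) {v : List ℕ} (h : (w, [(c, v)]) ∈ rowsE0) :
    W w = c.den • W v := by
  refine rowsE_eq ?_
  simp only [rowsE, List.mem_append]
  exact Or.inl (Or.inl (Or.inl (Or.inl (Or.inl h))))

theorem wU_H2_Z4 {v : List ℕ} (h : v ∈ wU) : W v * gl 1 * gl 10 = phi • (W v * gl 3) := by
  have : W (v ++ [1, 10]) = ePhi.den • W (v ++ [3]) := by
    refine rowsE_eq ?_
    simp only [rowsE, List.mem_append]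
    exact Or.inl (Or.inl (Or.inl (Or.inl (Or.inr (List.mem_map.mpr ⟨v, h, rfl⟩)))))
  simpa [W_append, W_cons, W_nil, den_phi, mul_assoc] using this

theorem zip_wM1_eq {s : List ℕ × List ℕ} (h : s ∈ wU.zip wM1) : W s.1 * gl 1 = W s.2 := by
  have : W (s.1 ++ [1]) = (1 : Ex).den • W s.2 := by
    refine rowsE_eq ?_
    simp only [rowsE, List.mem_append]
    exact Or.inl (Or.inl (Or.inl (Or.inr (List.mem_map.mpr ⟨s, h, rfl⟩))))
  simpa [W_append, W_single] using this

theorem rowsY_eq {s : List ℕ × List ℕ × List ℕ} (h : s ∈ rowsY) :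
    W s.1 = W s.2.1 * W s.2.2 := by
  have : W s.1 = (1 : Ex).den • W (s.2.1 ++ s.2.2) := by
    refine rowsE_eq ?_
    simp only [rowsE, List.mem_append]
    exact Or.inl (Or.inl (Or.inr (List.mem_map.mpr ⟨s, h, rfl⟩)))
  simpa [W_append] using this

/-- The basis diagrams of cut length one as products. -/
def zipU : List (List ℕ × List ℕ) :=
  (basisW 1).zip (wU.flatMap fun v => wUr.map fun y => v ++ y)

theorem zipU_eq {s : List ℕ × List ℕ} (h : s ∈ zipU) : W s.1 = W s.2 := by
  have : W s.1 = (1 : Ex).den • W s.2 := by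
    refine rowsE_eq ?_
    simp only [rowsE, List.mem_append]
    exact Or.inl (Or.inr (List.mem_map.mpr ⟨s, h, rfl⟩))
  simpa using this

theorem zip_wN_eq {s : List ℕ × List ℕ} (h : s ∈ wM.zip wN) : W s.1 * gl 10 = phi • W s.2 := by
  have : W (s.1 ++ [10]) = ePhi.den • W s.2 := by
    refine rowsE_eq ?_
    simp only [rowsE, List.mem_append]
    exact Or.inr (List.mem_map.mpr ⟨s, h, rfl⟩)
  simpa [W_append, W_single, den_phi] using this

theorem maps_wU : ∀ a ∈ AA, Maps a (spn wU) (spn wU) := by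
  refine maps_AA fun k hk => maps_of_cover_one rowsU_check ?_
  interval_cases k <;> decide

theorem maps_Z0 : ∀ a ∈ AA, Maps a (spn [[6]]) (spn [[6]]) := by
  refine maps_AA fun k hk => maps_of_cover_one rowsU_check ?_
  interval_cases k <;> decide

theorem spn_mono {N N' : List (List ℕ)} (h : N ⊆ N') : spn N ≤ spn N' :=
  Submodule.span_mono fun _ ⟨w, hw, hx⟩ => ⟨w, h hw, hx⟩

theorem wU_mul_wUr {v y : List ℕ} (hv : v ∈ wU) (hy : y ∈ wUr) : W v * W y ∈ spn bw1 := by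
  have key : ∀ v ∈ wU, ∀ y ∈ wUr, ∃ s ∈ zipU, s.2 = v ++ y ∧ s.1 ∈ bw1 := by decide
  obtain ⟨s, hs, h2, h1⟩ := key v hv y hy
  rw [← W_append, ← h2, ← zipU_eq hs]
  exact W_mem h1

theorem bw1_cases {w : List ℕ} (hw : w ∈ bw1) :
    w = [6] ∨ ∃ v ∈ wU, ∃ y ∈ wUr, W w = W v * W y := by
  have key : ∀ w ∈ bw1, w = [6] ∨ ∃ s ∈ zipU, s.1 = w ∧ ∃ v ∈ wU, ∃ y ∈ wUr, s.2 = v ++ y := by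
    decide
  rcases key w hw with h | ⟨s, hs, h1, v, hv, y, hy, h2⟩
  · exact Or.inl h
  · exact Or.inr ⟨v, hv, y, hy, by rw [← h1, zipU_eq hs, h2, W_append]⟩

theorem maps_bw1 : ∀ a ∈ AA, Maps a (spn bw1) (spn bw1) := by
  refine fun a ha => maps_spn fun w hw => ?_
  rcases bw1_cases hw with rfl | ⟨v, hv, y, hy, h⟩
  · exact (maps_Z0 a ha).mono (spn_mono (by decide)) _ (W_mem (by decide))
  · rw [h, ← mul_assoc]
    exact spn_mul_mem (fun v hv => wU_mul_wUr hv hy) (maps_wU a ha _ (W_mem hv))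

theorem bt_bw1 : ∀ x ∈ spn bw1, bt x ∈ spn bw1 := by
  intro x hx
  refine bt_spn (fun w hw => ?_) hx
  have key : ∀ w ∈ bw1, w = [6] ∨ ∃ s ∈ zipU, s.1 = w ∧
      ∃ v ∈ wU, ∃ y ∈ wUr, rvw s.2 = v ++ y := by decide
  rcases key w hw with rfl | ⟨s, hs, h1, v, hv, y, hy, h2⟩
  · exact W_mem (by decide)
  · rw [← bt_W, ← h1, zipU_eq hs, bt_W, h2, W_append]
    exact wU_mul_wUr hv hy

theorem bw1_mul {x a : Aloc} (hx : x ∈ spn bw1) (ha : a ∈ AA) : x * a ∈ spn bw1 :=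
  mul_mem_of_bt maps_bw1 bt_bw1 hx ha

/-! ### Diagrams that end in `M₁*` -/

theorem wU_mul_H2 {x : Aloc} (hx : x ∈ spn wU) : x * gl 1 ∈ spn wMM := by
  refine spn_mul_mem (fun v hv => ?_) hx
  have key : ∀ v ∈ wU, ∃ s ∈ wU.zip wM1, s.1 = v ∧ s.2 ∈ wMM := by decide
  obtain ⟨s, hs, rfl, h⟩ := key v hv
  rw [zip_wM1_eq hs]
  exact W_mem h

theorem wM1_eq {w : List ℕ} (hw : w ∈ wM1) : ∃ v ∈ wU, W w = W v * gl 1 := by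
  have key : ∀ w ∈ wM1, ∃ s ∈ wU.zip wM1, s.2 = w ∧ s.1 ∈ wU := by decide
  obtain ⟨s, hs, rfl, h⟩ := key w hw
  exact ⟨s.1, h, (zip_wM1_eq hs).symm⟩

/-- Left multiplication by `a` preserves the span of the words that end in `M₁*`. -/
theorem wMM_stable {a : Aloc} (ha : a ∈ AA) (hM : Maps a (spn wM) (spn wMM)) :
    Maps a (spn wMM) (spn wMM) := by
  refine maps_spn fun w hw => ?_
  simp only [wMM, List.mem_append] at hw
  rcases hw with (hw | hw) | hw
  · exact hM _ (W_mem hw)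
  · obtain ⟨v, hv, h⟩ := wM1_eq hw
    rw [h, ← mul_assoc]
    exact wU_mul_H2 (maps_wU a ha _ (W_mem hv))
  · exact (maps_Z0 a ha).mono (spn_mono (by decide)) _ (W_mem hw)

theorem maps_wMM_of_cover {k : ℕ} (h : cover rowsK k wM wMM = true) :
    Maps (gl k) (spn wMM) (spn wMM) :=
  wMM_stable (gl_mem k) (maps_of_cover_one rowsK_check h)

theorem W_eq_smul {w : List ℕ} {k : ℕ} {c : Ex} (hc : c.den ≠ 0)
    (h : (w, [(c, [k])]) ∈ rowsE0) : gl k = c.den⁻¹ • W w := by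
  rw [rowsE0_eq c h, inv_smul_smul₀ hc, W_single]

theorem den_phi_ne : ePhi.den ≠ 0 := Ex.den_ne _ (by decide +kernel)

theorem maps_K1 : Maps (gl 2) (spn wM) (spn wP1) := maps_of_cover_one rowsK_check (by decide)
theorem maps_K2 : Maps (gl 3) (spn wM) (spn wP2) := maps_of_cover_one rowsK_check (by decide)

theorem maps_P {g : ℕ} {N N' : List (List ℕ)} (h : cover rowsP g N N' = true) :
    Maps (ePhi.den⁻¹ • gl g) (spn N) (spn N') := maps_of_cover rowsP_check den_phi_ne h

theorem wP1_le : spn wP1 ≤ spn wMM := spn_mono (by decide)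
theorem wP2_le : spn wP2 ≤ spn wMM := spn_mono (by decide)

theorem maps_wMM : ∀ a ∈ AA, Maps a (spn wMM) (spn wMM) := by
  have hp := den_phi_ne
  have h3 : (ePhi * ePhi * ePhi : Ex).den ≠ 0 := by simp [hp]
  have e7 : Maps (ePhi.den⁻¹ • gl 7) (spn wP1) (spn wP1) := maps_P (by decide)
  have e9 : Maps (ePhi.den⁻¹ • gl 9) (spn wP1) (spn wP2) := maps_P (by decide)
  have e8 : Maps (ePhi.den⁻¹ • gl 8) (spn wP2) (spn wP2) := maps_P (by decide)
  have e10 : Maps (ePhi.den⁻¹ • gl 10) (spn wP2) (spn wP1) := maps_P (by decide)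
  refine maps_AA fun k hk => ?_
  interval_cases k
  · exact maps_wMM_of_cover (by decide)
  · exact maps_wMM_of_cover (by decide)
  · exact wMM_stable (gl_mem _) (maps_K1.mono wP1_le)
  · exact wMM_stable (gl_mem _) (maps_K2.mono wP2_le)
  · exact maps_wMM_of_cover (by decide)
  · exact maps_wMM_of_cover (by decide)
  · exact maps_wMM_of_cover (by decide)
  · refine wMM_stable (gl_mem _) ?_
    rw [W_eq_smul (w := [7, 2]) hp (by simp [rowsE0])]
    simpa [W_cons, W_nil] using (e7.mul maps_K1).mono wP1_le
  · refine wMM_stable (gl_mem _) ?_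
    rw [W_eq_smul (w := [8, 3]) hp (by simp [rowsE0])]
    simpa [W_cons, W_nil] using (e8.mul maps_K2).mono wP2_le
  · refine wMM_stable (gl_mem _) ?_
    rw [W_eq_smul (w := [9, 2]) hp (by simp [rowsE0])]
    simpa [W_cons, W_nil] using (e9.mul maps_K1).mono wP2_le
  · refine wMM_stable (gl_mem _) ?_
    rw [W_eq_smul (w := [10, 3]) hp (by simp [rowsE0])]
    simpa [W_cons, W_nil] using (e10.mul maps_K2).mono wP1_le
  · refine wMM_stable (gl_mem _) ?_
    rw [W_eq_smul (w := [10, 8, 8, 3]) h3 (by simp [rowsE0])]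
    have := (e10.mul (e8.mul (e8.mul maps_K2))).mono wP1_le
    simpa [W_cons, W_nil, smul_smul, mul_inv, mul_assoc] using this
  · refine wMM_stable (gl_mem _) ?_
    rw [W_eq_smul (w := [9, 7, 7, 2]) h3 (by simp [rowsE0])]
    have := (e9.mul (e7.mul (e7.mul maps_K1))).mono wP2_le
    simpa [W_cons, W_nil, smul_smul, mul_inv, mul_assoc] using this

/-! ### Cut length two -/

theorem rowsY_word {w m y : List ℕ} (h : (w, m, y) ∈ rowsY) : W (m ++ y) = W w := by
  rw [rowsY_eq h, W_append]

theorem bw1_le : spn bw1 ≤ spn bw2 := spn_mono (by unfold bw2; exact List.subset_append_left _ _)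

theorem wMM_le : spn wMM ≤ spn bw2 := spn_mono (by decide)

theorem wN_le : spn wN ≤ spn bw2 := spn_mono (by decide)

/-- A left inverse of `K₁` on `M₁*`, followed by `M₂*`. -/
def yN : Aloc := phi⁻¹ • gl 10

theorem wMM_mul_yN {m : Aloc} (hm : m ∈ spn wMM) : m * yN ∈ spn wN ⊔ spn bw1 := by
  have hp := phi_ne
  refine spn_mul_mem (fun w hw => ?_) hm
  simp only [wMM, List.mem_append] at hw
  rw [yN, mul_smul_comm]
  rcases hw with (hw | hw) | hw
  · have key : ∀ w ∈ wM, ∃ s ∈ wM.zip wN, s.1 = w ∧ s.2 ∈ wN := by decide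
    obtain ⟨s, hs, rfl, h⟩ := key w hw
    rw [zip_wN_eq hs, inv_smul_smul₀ hp]
    exact Submodule.mem_sup_left (W_mem h)
  · obtain ⟨v, hv, h⟩ := wM1_eq hw
    rw [h, wU_H2_Z4 hv, inv_smul_smul₀ hp, ← W_single]
    exact Submodule.mem_sup_right (wU_mul_wUr hv (by decide))
  · obtain rfl : w = [6] := by simpa using hw
    have h : W [6, 10] = ePhi.den • W [6] := rowsE0_eq ePhi (by simp [rowsE0])
    rw [W_cons, W_single, ← W_single, den_phi] at h
    rw [h, inv_smul_smul₀ hp]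
    exact Submodule.mem_sup_right (W_mem (by decide))

theorem wMM_mul_yN' {m : Aloc} (hm : m ∈ spn wMM) : m * yN ∈ spn bw2 :=
  sup_le wN_le bw1_le (wMM_mul_yN hm)

theorem wN_eq {w : List ℕ} (hw : w ∈ wN) : ∃ m ∈ wM, W w = W m * yN := by
  have key : ∀ w ∈ wN, ∃ s ∈ wM.zip wN, s.2 = w ∧ s.1 ∈ wM := by decide
  obtain ⟨s, hs, rfl, h⟩ := key w hw
  exact ⟨s.1, h, by rw [yN, mul_smul_comm, zip_wN_eq hs, inv_smul_smul₀ phi_ne]⟩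

theorem wM_le : spn wM ≤ spn wMM := spn_mono (by decide)

/-- Words followed by a diagram that ends in a trivalent vertex. -/
theorem mul_K_mem {a : Aloc} (ha : a ∈ AA) {w : List ℕ} (hw : w ∈ wM ++ wN) :
    a * W w ∈ spn bw2 ∧ bt (a * W w) ∈ spn bw2 := by
  have hM : ∀ m ∈ spn wMM, bt m ∈ spn bw2 := by
    refine fun m hm => bt_spn (fun w hw => ?_) hm
    have key : ∀ w ∈ wMM, rvw w ∈ bw2 ∨ w ∈ wM1 := by decide
    rcases key w hw with h | h
    · exact W_mem h
    · obtain ⟨v, hv, h⟩ := wM1_eq h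
      rw [← bt_W, h]
      refine bw1_le (bt_bw1 _ ?_)
      rw [← W_single]
      exact wU_mul_wUr hv (by decide)
  have hN : ∀ n ∈ spn wN ⊔ spn bw1, bt n ∈ spn bw2 := by
    intro n hn
    obtain ⟨x, hx, y, hy, rfl⟩ := Submodule.mem_sup.mp hn
    rw [bt_add]
    exact add_mem (bt_spn (fun w hw => W_mem ((by decide : ∀ w ∈ wN, rvw w ∈ bw2) w hw)) hx)
      (bw1_le (bt_bw1 _ hy))
  rcases List.mem_append.mp hw with h | h
  · have := maps_wMM a ha _ (wM_le (W_mem h))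
    exact ⟨wMM_le this, hM _ this⟩
  · obtain ⟨m, hm, e⟩ := wN_eq h
    have := maps_wMM a ha _ (wM_le (W_mem hm))
    rw [e, ← mul_assoc]
    exact ⟨wMM_mul_yN' this, hN _ (wMM_mul_yN this)⟩

theorem K_mul_mem {a : Aloc} (ha : a ∈ AA) {w : List ℕ} (hw : rvw w ∈ wM ++ wN) :
    W w * a ∈ spn bw2 := by
  have := (mul_K_mem (bt_mem_AA ha) hw).2
  rwa [bt_mul, bt_bt, ← bt_W, bt_bt] at this

/-- `H₂` times a diagram that begins with `M₁`. -/
theorem H2_mul_bt {m : Aloc} (hm : m ∈ spn wMM) : gl 1 * bt m ∈ spn bw2 := by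
  have h : bt (m * gl 1) ∈ spn bw2 := by
    refine bt_mem (V := spn bw2) (S := {x | ∃ w ∈ wMM, x = W w * gl 1}) ?_ ?_
    · rintro _ ⟨w, hw, rfl⟩
      have e1 : W [1, 2, 1] = W [0, 3, 0] :=
        rowsY_word (w := [0, 3, 0]) (m := [1, 2]) (y := [1]) (by decide)
      have e2 : W [1, 2, 1, 0] = W [0, 3, 0, 0] :=
        rowsY_word (w := [0, 3, 0, 0]) (m := [1, 2]) (y := [1, 0]) (by decide)
      have e3 : W [1, 2, 1, 1] = W [0, 3, 0, 1] :=
        rowsY_word (w := [0, 3, 0, 1]) (m := [1, 2]) (y := [1, 1]) (by decide)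
      have e4 : W [1, 2, 3, 0] = W [0, 3, 2, 1] := by
        simpa using rowsE0_eq (w := [1, 2, 3, 0]) (v := [0, 3, 2, 1]) 1 (by simp [rowsE0])
      simp only [wMM, List.mem_append] at hw
      rw [bt_mul, bt_W, bt_gl]
      rcases hw with (hw | hw) | hw
      · have key : ∀ w ∈ wM, rvw w ∈ wM ++ wN ∨
            1 :: rvw w ∈ [[1, 2, 1], [1, 2, 1, 0], [1, 2, 1, 1], [1, 2, 3, 0]] := by decide
        rcases key w hw with h | h
        · exact (mul_K_mem (gl_mem _) h).1
        · change gl 1 * W (rvw w) ∈ _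
          rw [← W_cons]
          simp only [List.mem_cons, List.not_mem_nil, or_false] at h
          rcases h with h | h | h | h <;> rw [h]
          · rw [e1]; exact W_mem (by decide)
          · rw [e2]; exact W_mem (by decide)
          · rw [e3]; exact W_mem (by decide)
          · rw [e4]; exact W_mem (by decide)
      · obtain ⟨v, hv, h⟩ := wM1_eq hw
        rw [← bt_W, h]
        refine bw1_le (maps_bw1 _ (gl_mem _) _ (bt_bw1 _ ?_))
        rw [← W_single]
        exact wU_mul_wUr hv (by decide)
      · obtain rfl : w = [6] := by simpa using hw
        exact bw1_le (maps_bw1 _ (gl_mem _) _ (W_mem (by decide)))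
    · exact spn_mul_mem (V := Submodule.span kk {x | ∃ w ∈ wMM, x = W w * gl 1})
        (fun w hw => Submodule.subset_span ⟨w, hw, rfl⟩) hm
  rwa [bt_mul, bt_gl] at h

theorem H2_mul_mem {a : Aloc} (ha : a ∈ AA) {w : List ℕ} (hw : rvw w ∈ wM) :
    W (1 :: w) * a ∈ spn bw2 := by
  have := H2_mul_bt (maps_wMM _ (bt_mem_AA ha) _ (wM_le (W_mem hw)))
  rwa [bt_mul, bt_bt, ← bt_W, bt_bt, ← mul_assoc, ← W_cons] at this

theorem W_032 : W [0, 3, 2] = W [1, 7] := by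
  simpa using rowsE0_eq (w := [0, 3, 2]) (v := [1, 7]) 1 (by simp [rowsE0])

/-- Products with most of the words that end in `M₁*`. -/
theorem wMM_mul_mem {y : Aloc} (hy : y ∈ AA) {w : List ℕ} (hw : w ∈ wMM)
    (h1 : w ≠ [0, 1, 2]) (h2 : w ≠ [1, 1, 2]) : W w * y ∈ spn bw2 := by
  have key : ∀ w ∈ wMM, w = [0, 1, 2] ∨ w = [1, 1, 2] ∨ w = [1, 2] ∨ w = [0, 3, 2] ∨
      rvw w ∈ wM ++ wN ∨ w ∈ bw1 ∨ w ∈ wM1 := by decide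
  rcases key w hw with h | h | rfl | rfl | h | h | h
  · exact absurd h h1
  · exact absurd h h2
  · exact H2_mul_mem hy (by decide)
  · rw [W_032]; exact H2_mul_mem hy (by decide)
  · exact K_mul_mem hy h
  · exact bw1_le (bw1_mul (W_mem h) hy)
  · obtain ⟨v, hv, e⟩ := wM1_eq h
    rw [e, ← W_single]
    exact bw1_le (bw1_mul (wU_mul_wUr hv (by decide)) hy)

theorem c11_smul_cancel {x : Aloc} {V : Submodule kk Aloc} (h : c11 • x ∈ V) : x ∈ V := by
  have := V.smul_mem (⟨c11⁻¹, c11_inv_mem⟩ : kk) h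
  change c11⁻¹ • c11 • x ∈ V at this
  rwa [inv_smul_smul₀ c11_ne] at this

theorem combVal_mul (l : List (Ex × List ℕ)) (y : Aloc) :
    combVal l * y = (l.map fun t => t.1.den • (W t.2 * y)).sum := by
  rw [combVal, ← List.sum_map_mul_right]
  simp only [smul_mul_assoc]

theorem row0_eq {s : Row1} (h : s ∈ rowsK) : W s.1 = combVal s.2 := by
  simpa using row_eq rowsK_check h

/-- One term of a linear combination lies in a submodule if all others and the sum do. -/
theorem smul_mem_of_sum {V : Submodule kk Aloc} (f : List ℕ → Aloc) (l₁ l₂ : List (Ex × List ℕ))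
    (t : Ex × List ℕ) (h : ((l₁ ++ t :: l₂).map fun t => t.1.den • f t.2).sum ∈ V)
    (hl : ∀ t ∈ l₁ ++ l₂, f t.2 ∈ V) : t.1.den • f t.2 ∈ V := by
  rw [List.map_append, List.map_cons, List.sum_append, List.sum_cons] at h
  have hs : ∀ l : List (Ex × List ℕ), (∀ t ∈ l, f t.2 ∈ V) →
      (l.map fun t => t.1.den • f t.2).sum ∈ V := fun l hl => list_sum_mem fun x hx => by
    obtain ⟨t, ht, rfl⟩ := List.mem_map.mp hx
    exact den_smul_mem _ (hl t ht)
  have h1 := hs l₁ fun t ht => hl t (List.mem_append_left _ ht)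
  have h2 := hs l₂ fun t ht => hl t (List.mem_append_right _ ht)
  exact (V.add_mem_iff_left h2).mp ((V.add_mem_iff_right h1).mp h)

theorem rowA_mul {y : Aloc} (hy : y ∈ AA) (h : W [0, 1, 2] * y ∈ spn bw2) :
    W [1, 1, 2] * y ∈ spn bw2 := by
  refine c11_smul_cancel ?_
  rw [← den_c11]
  have e : W [0, 12] = combVal rowA.2 := row0_eq (s := rowA) (by simp [rowsK])
  have e2 : W [0, 12] = W [1, 2, 3, 2] := by
    simpa using rowsE0_eq (w := [0, 12]) (v := [1, 2, 3, 2]) 1 (by simp [rowsE0])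
  have h0 : W [0, 12] * y ∈ spn bw2 := by rw [e2]; exact H2_mul_mem hy (by decide)
  rw [e, combVal_mul] at h0
  refine smul_mem_of_sum (fun w => W w * y) (rowA.2.take 9) (rowA.2.drop 10) (eC11, [1, 1, 2]) h0 ?_
  intro t ht
  have key : ∀ t ∈ rowA.2.take 9 ++ rowA.2.drop 10, t.2 ∈ wMM ∧ t.2 ≠ [1, 1, 2] := by decide
  by_cases h3 : t.2 = [0, 1, 2]
  · rw [h3]; exact h
  · exact wMM_mul_mem hy (key t ht).1 h3 (key t ht).2

theorem rowB_mul {y : Aloc} (hy : y ∈ AA) (h : W [0, 1, 2] * y ∈ spn bw2)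
    (h' : W [1, 1, 2] * y ∈ spn bw2) : W [0, 0, 3, 2] * y ∈ spn bw2 := by
  have e : W [0, 0, 3, 2] = combVal rowB.2 := row0_eq (s := rowB) (by simp [rowsK])
  rw [e, combVal_mul]
  refine list_sum_mem fun x hx => ?_
  obtain ⟨t, ht, rfl⟩ := List.mem_map.mp hx
  refine den_smul_mem _ ?_
  have key : ∀ t ∈ rowB.2, t.2 ∈ wMM := by decide
  by_cases h3 : t.2 = [0, 1, 2]
  · rw [h3]; exact h
  by_cases h4 : t.2 = [1, 1, 2]
  · rw [h4]; exact h'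
  exact wMM_mul_mem hy (key t ht) h3 h4

theorem bt_combVal (l : List (Ex × List ℕ)) :
    bt (combVal l) = (l.map fun t => t.1.den • W (rvw t.2)).sum := by
  induction l with
  | nil => exact bt_zero
  | cons t l ih =>
    simp only [combVal, List.map_cons, List.sum_cons, bt_add, bt_smul, bt_W] at ih ⊢
    rw [ih]

theorem W_0121 : W [0, 1, 2] * W [1] ∈ spn bw2 := by
  rw [← W_append, rowsY_word (w := [0, 0, 3, 0]) (by decide)]
  exact W_mem (by decide)

theorem W_01210 : W [0, 1, 2] * W [1, 0] ∈ spn bw2 := by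
  rw [← W_append, rowsY_word (w := [0, 0, 3, 0, 0]) (by decide)]
  exact W_mem (by decide)

theorem W_1121 : W [1, 1, 2] * W [1] ∈ spn bw2 := rowA_mul (W_mem_AA _) W_0121

theorem W_11210 : W [1, 1, 2] * W [1, 0] ∈ spn bw2 := rowA_mul (W_mem_AA _) W_01210

theorem W_01211 : W [0, 1, 2] * W [1, 1] ∈ spn bw2 := by
  have h := rowB_mul (W_mem_AA [1, 0]) W_01210 W_11210
  have e1 : W [0, 0, 3, 2] = W [0, 1, 7] := by rw [W_cons, W_032, ← W_cons]
  have e2 : W [7, 1, 0] = (rowB.2.map fun t => t.1.den • W (rvw t.2)).sum := by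
    rw [← bt_combVal, ← row0_eq (s := rowB) (by simp [rowsK])]
    change _ = bt (W [0, 0, 3, 2])
    rw [e1, bt_W]
    rfl
  have e3 : W [0, 0, 3, 2] * W [1, 0] = W [0, 1] * W [7, 1, 0] := by
    rw [e1, ← W_append, ← W_append]
    rfl
  rw [e3, e2, ← List.sum_map_mul_left] at h
  simp only [mul_smul_comm] at h
  refine c11_smul_cancel ?_
  rw [← den_c11]
  have h2 := smul_mem_of_sum (fun w => W [0, 1] * W (rvw w)) (rowB.2.take 9) (rowB.2.drop 10)
    (eC11, [1, 1, 2]) h ?_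
  · have : W [0, 1, 2] * W [1, 1] = W [0, 1] * W [2, 1, 1] := by
      rw [← W_append, ← W_append]
      rfl
    rw [this]
    exact h2
  · intro t ht
    have key : ∀ t ∈ rowB.2.take 9 ++ rowB.2.drop 10, t.2 = [1, 2] ∨ t.2 = [0, 3, 2] ∨
        t.2 = [0, 1, 2] ∨ rvw t.2 ∈ wM ++ wN ∨ t.2 ∈ bw1 ∨ t.2 ∈ wM1 := by decide
    rcases key t ht with h | h | h | h | h | h
    · have e6 : W [0, 1] * W (rvw t.2) = W [0, 1, 2] * W [1] := by
        rw [h, ← W_append, ← W_append]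
        rfl
      change W [0, 1] * W (rvw t.2) ∈ _
      rw [e6]
      exact W_0121
    · have e4 : W [1, 2, 3, 0] = W [0, 3, 2, 1] := by
        simpa using rowsE0_eq (w := [1, 2, 3, 0]) (v := [0, 3, 2, 1]) 1 (by simp [rowsE0])
      have e5 : W [0, 1] * W (rvw t.2) = W [0, 0, 3, 2] * W [1] := by
        rw [h, ← W_append, ← W_append]
        change W (0 :: [1, 2, 3, 0]) = W (0 :: [0, 3, 2, 1])
        rw [W_cons, e4, ← W_cons]
      change W [0, 1] * W (rvw t.2) ∈ _
      rw [e5]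
      exact rowB_mul (W_mem_AA _) W_0121 W_1121
    · have e6 : W [0, 1] * W (rvw t.2) = W [0, 1, 2] * W [1, 0] := by
        rw [h, ← W_append, ← W_append]
        rfl
      change W [0, 1] * W (rvw t.2) ∈ _
      rw [e6]
      exact W_01210
    · exact (mul_K_mem (W_mem_AA _) h).1
    · change W [0, 1] * W (rvw t.2) ∈ _
      rw [← bt_W]
      exact bw1_le (maps_bw1 _ (W_mem_AA _) _ (bt_bw1 _ (W_mem h)))
    · obtain ⟨v, hv, e⟩ := wM1_eq h
      change W [0, 1] * W (rvw t.2) ∈ _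
      rw [← bt_W, e, ← W_single]
      exact bw1_le (maps_bw1 _ (W_mem_AA _) _ (bt_bw1 _ (wU_mul_wUr hv (by decide))))

theorem W_11211 : W [1, 1, 2] * W [1, 1] ∈ spn bw2 := rowA_mul (W_mem_AA _) W_01211

/-- The span of the words that end in `M₁*`, continued on the right. -/
theorem wMM_mul_right {y : List ℕ} (hy : y ∈ [[1], [1, 1], [1, 0]]) {m : Aloc}
    (hm : m ∈ spn wMM) : m * W y ∈ spn bw2 := by
  refine spn_mul_mem (fun w hw => ?_) hm
  simp only [List.mem_cons, List.not_mem_nil, or_false] at hy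
  by_cases h1 : w = [0, 1, 2]
  · subst h1
    rcases hy with rfl | rfl | rfl
    exacts [W_0121, W_01211, W_01210]
  by_cases h2 : w = [1, 1, 2]
  · subst h2
    rcases hy with rfl | rfl | rfl
    exacts [W_1121, W_11211, W_11210]
  exact wMM_mul_mem (W_mem_AA _) hw h1 h2

theorem maps_bw2 : ∀ a ∈ AA, Maps a (spn bw2) (spn bw2) := by
  refine fun a ha => maps_spn fun w hw => ?_
  have key : ∀ w ∈ bw2, w ∈ bw1 ∨ w ∈ wMM ∨ w ∈ wN ∨
      ∃ s ∈ rowsY, s.1 = w ∧ s.2.1 ∈ wMM ∧ s.2.2 ∈ [[1], [1, 1], [1, 0]] := by decide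
  rcases key w hw with h | h | h | ⟨s, hs, rfl, h1, h2⟩
  · exact (maps_bw1 a ha).mono bw1_le _ (W_mem h)
  · exact (maps_wMM a ha).mono wMM_le _ (W_mem h)
  · obtain ⟨m, hm, e⟩ := wN_eq h
    rw [e, ← mul_assoc]
    exact wMM_mul_yN' (maps_wMM a ha _ (wM_le (W_mem hm)))
  · rw [rowsY_eq hs, ← mul_assoc]
    exact wMM_mul_right h2 (maps_wMM a ha _ (W_mem h1))

theorem bt_bw2 : ∀ x ∈ spn bw2, bt x ∈ spn bw2 := by
  refine fun x hx => bt_spn (fun w hw => ?_) hx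
  have key : ∀ w ∈ bw2, w ∈ bw1 ∨ rvw w ∈ bw2 ∨ w = [0, 3, 0, 1] ∨ w = [0, 3, 2, 1] := by decide
  rcases key w hw with h | h | rfl | rfl
  · rw [← bt_W]
    exact bw1_le (bt_bw1 _ (W_mem h))
  · exact W_mem h
  · change W (1 :: [0, 3, 0]) ∈ _
    rw [W_cons, ← rowsY_word (w := [0, 3, 0]) (m := [1, 2]) (y := [1]) (by decide), ← W_cons]
    have := W_1121
    rwa [← W_append] at this
  · have e4 : W [1, 2, 3, 0] = W [0, 3, 2, 1] := by
      simpa using rowsE0_eq (w := [1, 2, 3, 0]) (v := [0, 3, 2, 1]) 1 (by simp [rowsE0])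
    change W [1, 2, 3, 0] ∈ _
    rw [e4]
    exact W_mem (by decide)

theorem bw2_mul {x a : Aloc} (hx : x ∈ spn bw2) (ha : a ∈ AA) : x * a ∈ spn bw2 :=
  mul_mem_of_bt maps_bw2 bt_bw2 hx ha

/-! ### The ideals -/

/-- The ideal of `A(3)` given by a stable submodule. -/
def idealOf {A : Subalgebra kk Aloc} (V : Submodule kk Aloc) (hl : ∀ a ∈ A, ∀ x ∈ V, a * x ∈ V)
    (hr : ∀ a ∈ A, ∀ x ∈ V, x * a ∈ V) : TwoSidedIdeal A :=
  TwoSidedIdeal.mk' {x | (x : Aloc) ∈ V} V.zero_mem (fun hx hy => V.add_mem hx hy)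
    (fun hx => V.neg_mem hx) (fun {x y} hy => hl x x.2 y hy) (fun {x y} hx => hr y y.2 x hx)

theorem mem_idealOf {A : Subalgebra kk Aloc} {V : Submodule kk Aloc}
    {hl : ∀ a ∈ A, ∀ x ∈ V, a * x ∈ V} {hr : ∀ a ∈ A, ∀ x ∈ V, x * a ∈ V} (x : A) :
    x ∈ idealOf V hl hr ↔ (x : Aloc) ∈ V := TwoSidedIdeal.mem_mk' _ _ _ _ _ _ _

theorem basis_mem (n : ℕ) (x : Aloc) (hn : n ≠ 3) : x ∈ basis n ↔ ∃ w ∈ basisW n, x = W w := by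
  rw [basis_eq n hn]
  simp only [List.mem_map, W, eq_comm]

theorem J_zero : J 0 = spn [[6]] := by
  unfold J spn
  congr 1
  ext x
  constructor
  · rintro ⟨j, hj, hx⟩
    obtain rfl : j = 0 := by omega
    exact (basis_mem 0 x (by norm_num)).mp hx
  · rintro hx
    exact ⟨0, le_rfl, (basis_mem 0 x (by norm_num)).mpr hx⟩

theorem J_one : J 1 = spn bw1 := by
  unfold J spn
  congr 1
  ext x
  constructor
  · rintro ⟨j, hj, hx⟩
    have : j ≤ 1 := by omega
    obtain ⟨w, hw, e⟩ := (basis_mem j x (by omega)).mp hx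
    refine ⟨w, ?_, e⟩
    interval_cases j
    · exact (by decide : basisW 0 ⊆ bw1) hw
    · exact (by decide : basisW 1 ⊆ bw1) hw
  · rintro ⟨w, hw, e⟩
    rcases List.mem_cons.mp hw with h | h
    · exact ⟨0, by norm_num, (basis_mem 0 x (by norm_num)).mpr ⟨w, by rw [h]; decide, e⟩⟩
    · exact ⟨1, by norm_num, (basis_mem 1 x (by norm_num)).mpr ⟨w, h, e⟩⟩

theorem J_two : J 2 = spn bw2 := by
  unfold J spn
  congr 1
  ext x
  constructor
  · rintro ⟨j, hj, hx⟩
    have : j ≤ 2 := by omega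
    obtain ⟨w, hw, e⟩ := (basis_mem j x (by omega)).mp hx
    refine ⟨w, ?_, e⟩
    interval_cases j
    · exact (by decide : basisW 0 ⊆ bw2) hw
    · exact (by decide : basisW 1 ⊆ bw2) hw
    · exact (by decide : basisW 2 ⊆ bw2) hw
  · rintro ⟨w, hw, e⟩
    rcases List.mem_append.mp hw with h | h
    · rcases List.mem_cons.mp h with h | h
      · exact ⟨0, by norm_num, (basis_mem 0 x (by norm_num)).mpr ⟨w, by rw [h]; decide, e⟩⟩
      · exact ⟨1, by norm_num, (basis_mem 1 x (by norm_num)).mpr ⟨w, h, e⟩⟩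
    · exact ⟨2, by norm_num, (basis_mem 2 x (by norm_num)).mpr ⟨w, h, e⟩⟩

theorem J_mono {i j : ℤ} (h : i ≤ j) : J i ≤ J j :=
  Submodule.span_mono fun _ ⟨k, hk, hx⟩ => ⟨k, hk.trans h, hx⟩

theorem J_neg {j : ℤ} (h : j < 0) : J j = ⊥ := by
  unfold J
  rw [Submodule.span_eq_bot]
  rintro x ⟨k, hk, -⟩
  omega

theorem J_of_ge {j : ℤ} (h : 3 ≤ j) : J j = J 3 := by
  refine le_antisymm (Submodule.span_le.mpr ?_) (J_mono h)
  rintro x ⟨k, hk, hx⟩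
  rcases Nat.lt_or_ge k 4 with h4 | h4
  · exact Submodule.subset_span ⟨k, by omega, hx⟩
  · obtain ⟨n, rfl⟩ := Nat.exists_eq_add_of_le' h4
    exact absurd hx (by simp [basis])

theorem mem_J_three {w : List ℕ} (h : w ∈ basisW 3) : W w ∈ J 3 :=
  Submodule.subset_span ⟨3, le_rfl, by
    rw [basis_eq_three]; exact List.mem_append_left _ (List.mem_map.mpr ⟨w, h, rfl⟩)⟩

theorem Z7_mem : Z7 ∈ J 3 :=
  Submodule.subset_span ⟨3, le_rfl, by rw [basis_eq_three]; simp⟩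

theorem spn_bw2_le : spn bw2 ≤ J 3 := by rw [← J_two]; exact J_mono (by norm_num)

/-- The ideal of diagrams of cut length at most two. -/
def I2 : TwoSidedIdeal AA := idealOf (spn bw2) maps_bw2 fun _ ha _ hx => bw2_mul hx ha

/-- The projection modulo diagrams of cut length at most two. -/
def mk2 : AA →ₐ[kk] I2.ringCon.Quotient := RingCon.mkₐ kk I2.ringCon

theorem mk2_eq {x y : AA} : mk2 x = mk2 y ↔ (x : Aloc) - y ∈ spn bw2 := by
  have h : x - y ∈ I2 ↔ I2.ringCon x y := by
    rw [TwoSidedIdeal.rel_iff]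
  rw [← AddSubgroupClass.coe_sub, ← mem_idealOf (hl := maps_bw2)
    (hr := fun _ ha _ hx => bw2_mul hx ha)]
  exact (RingCon.eq _).trans h.symm

/-! ### The top algebra -/

/-- The relations of the top algebra for two elements. -/
structure TopPair {S : Type*} [Ring S] [Algebra kk S] (a b : S) : Prop where
  ha : (a - algebraMap kk S kxi) * (a - algebraMap kk S kzeta) * (a - algebraMap kk S kzetas) = 0
  hb : (b - algebraMap kk S kxi) * (b - algebraMap kk S kzeta) * (b - algebraMap kk S kzetas) = 0
  hq1 : a ^ 2 * b * a - a * b * a ^ 2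
    = (kc11 - kc12) • (b * a ^ 2 - a ^ 2 * b) + (kc5 - kc7) • (b * a - a * b)
  hq2 : b ^ 2 * a * b - b * a * b ^ 2
    = (kc11 - kc12) • (a * b ^ 2 - b ^ 2 * a) + (kc5 - kc7) • (a * b - b * a)
  hE : b ^ 2 * a * b - a ^ 2 * b * a = kc15 • (b * a * b - a * b * a)
    + kc11 • (a * b ^ 2 - b * a ^ 2) + kc12 • (b ^ 2 * a - a ^ 2 * b)
    + (kc5 - kc7) • (a * b - b * a) + kc1 • (a - b)

theorem TopPair.stable {S : Type*} [Ring S] [Algebra kk S] {a b : S} (h : TopPair a b) {x : S}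
    (hx : x ∈ Submodule.span kk
      {y | y ∈ words20 (a - algebraMap kk S kxi) (b - algebraMap kk S kxi)}) :
    a * x ∈ Submodule.span kk
      {y | y ∈ words20 (a - algebraMap kk S kxi) (b - algebraMap kk S kxi)} ∧
    b * x ∈ Submodule.span kk
      {y | y ∈ words20 (a - algebraMap kk S kxi) (b - algebraMap kk S kxi)} := by
  have ht : kc12 = kc11 + kxi := Subtype.ext (by
    change c12 = c11 + xi
    linear_combination -c11_sub_c12)
  have hd : kc5 - kc7 = kxi ^ 2 := Subtype.ext c5_sub_c7
  have h15 : kc15 = (kzeta + kzetas - 2 * kxi) - 2 * kc11 + 2 * kxi := Subtype.ext c15_eq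
  have h1 : kc1 = kxi ^ 3 + (kzeta + kzetas - 2 * kxi) * kxi ^ 2
      + (kzeta - kxi) * (kzetas - kxi) * kxi
      - kc11 * (kc11 * (kzeta + kzetas - 2 * kxi) - (kzeta - kxi) * (kzetas - kxi)) :=
    Subtype.ext c1_eq
  have hT := TopRel.of_rel h.ha h.hb h.hq1 h.hq2 h.hE ht hd h15 h1
  obtain ⟨η, hη, e⟩ := eta_inv
  have hs : (⟨c11⁻¹, c11_inv_mem⟩ : kk) * kc11 = 1 := Subtype.ext (inv_mul_cancel₀ c11_ne)
  have st := hT.mul_mem_span (s' := ⟨c11⁻¹, c11_inv_mem⟩) (η' := ⟨η, hη⟩) hs (Subtype.ext e) hx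
  have key : ∀ z : S, (z - algebraMap kk S kxi) * x ∈ Submodule.span kk
      {y | y ∈ words20 (a - algebraMap kk S kxi) (b - algebraMap kk S kxi)} →
      z * x ∈ Submodule.span kk
        {y | y ∈ words20 (a - algebraMap kk S kxi) (b - algebraMap kk S kxi)} := by
    intro z hz
    have := add_mem hz (Submodule.smul_mem _ kxi hx)
    rwa [sub_mul, ← Algebra.smul_def, sub_add_cancel] at this
  exact ⟨key a st.1, key b st.2⟩

/-- The square-pentagon relation of `H_i² H_j H_i` and its mirror image, up to diagrams of cut
length at most two. -/
def nQ (i j : Fin 2) : NE :=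
  nH i * nH i * nH j * nH i - nH i * nH j * nH i * nH i
    - ((eC11 - eC12) • (nH j * nH i * nH i - nH i * nH i * nH j)
      + (eC5 - eC7) • (nH j * nH i - nH i * nH j))

/-- The diagrams of cut length at most two in the difference of the square-pentagon relation of
`H_i² H_j H_i` and its mirror image. -/
def lowQ (i j : ℕ) : List (Ex × List ℕ) :=
  [(eC0, [4 + i, j]), (-eC0, [j, 4 + i]), (eC1 - eC2, [9 + i]), (eC2 - eC1, [10 - i]),
    (eC2, [j, 4 + i]), (-eC2, [4 + i, j]), (eC7 - eC6, [j, 2 + i]), (eC6 - eC7, [2 + i, j]),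
    (eC10, [2 + i, j, i]), (-eC10, [i, j, 2 + i]), (eC12, [i, j, 2 + i]), (-eC12, [2 + i, j, i])]

/-- The part of the quartic relation of cut length three. -/
def nE : NE :=
  nH 1 * nH 1 * nH 0 * nH 1 - nH 0 * nH 0 * nH 1 * nH 0
    - (eC15 • (nH 1 * nH 0 * nH 1 - nH 0 * nH 1 * nH 0)
      + eC11 • (nH 0 * nH 1 * nH 1 - nH 1 * nH 0 * nH 0)
      + eC12 • (nH 1 * nH 1 * nH 0 - nH 0 * nH 0 * nH 1)
      + (eC5 - eC7) • (nH 0 * nH 1 - nH 1 * nH 0) + eC1 • (nH 0 - nH 1))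

def lowE : List (Ex × List ℕ) :=
  [(eC2 - eC1, [9]), (eC1 - eC2, [10]), (eC10, [3, 0, 1]), (-eC10, [2, 1, 0]), (eC12, [1, 0, 3]),
    (-eC12, [0, 1, 2]), (eC6, [8]), (-eC6, [7]), (eC6, [3, 0]), (-eC6, [2, 1]), (eC7, [0, 3]),
    (-eC7, [1, 2]), (eC0, [5, 0]), (-eC0, [4, 1]), (eC2, [0, 5]), (-eC2, [1, 4])]

/-- The cubic relation of `H_i`. -/
def nC (i : Fin 2) : NE := (nH i - eXi • 1) * (nH i - eZeta • 1) * (nH i - eZetas • 1)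

def rowsT : List (NE × List (Ex × List ℕ)) :=
  [(nQ 0 1, lowQ 0 1), (nQ 1 0, lowQ 1 0), (nE, lowE), (nC 0, [(eB2, [2]), (eB1, [4])]),
    (nC 1, [(eB2, [3]), (eB1, [5])])]

set_option maxHeartbeats 1000000 in
theorem rowsT_check (R : Irr) :
    (rowsT.all fun s => (s.1 - combNE s.2).check R.dim (atomsE R)) = true := by
  cases R <;> decide +kernel

theorem rowsT_mem {s : NE × List (Ex × List ℕ)} (hs : s ∈ rowsT) : s.1.den gl ∈ spn bw2 := by
  have := eq_zero_of_check fun R => List.all_eq_true.mp (rowsT_check R) s hs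
  rw [NE.den_sub, combNE_den] at this
  rw [sub_eq_zero.mp this]
  refine combVal_mem fun t ht => W_mem ?_
  have key : ∀ s ∈ rowsT, ∀ t ∈ s.2, t.2 ∈ bw2 := by decide
  exact key s hs t ht

/-- The generators `H₁`, `H₂` of `A(3)`. -/
def aH (i : Fin 2) : AA := ⟨gl i, gl_mem i⟩

theorem mk2_topPair : TopPair (mk2 (aH 0)) (mk2 (aH 1)) := by
  have h1 := rowsT_mem (s := (nQ 0 1, lowQ 0 1)) (by simp [rowsT])
  have h2 := rowsT_mem (s := (nQ 1 0, lowQ 1 0)) (by simp [rowsT])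
  have h3 := rowsT_mem (s := (nE, lowE)) (by simp [rowsT])
  have h4 := rowsT_mem (s := (nC 0, [(eB2, [2]), (eB1, [4])])) (by simp [rowsT])
  have h5 := rowsT_mem (s := (nC 1, [(eB2, [3]), (eB1, [5])])) (by simp [rowsT])
  simp only [nQ, nE, nC, nH, NE.den_sub, NE.den_add, NE.den_mul, NE.den_smul, NE.den_atom,
    NE.den_one, Ex.den_sub, den_c1, den_c5, den_c7, den_c11, den_c12, den_c15, den_xi, den_zeta,
    den_zetas] at h1 h2 h3 h4 h5
  have hc : ∀ c : kk, algebraMap kk I2.ringCon.Quotient c = mk2 (algebraMap kk AA c) :=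
    fun c => (mk2.commutes c).symm
  constructor
  · simp only [hc, ← map_sub, ← map_mul]
    rw [← map_zero mk2, mk2_eq]
    simp only [Algebra.algebraMap_eq_smul_one, AA.coe_zero, sub_zero]
    exact h4
  · simp only [hc, ← map_sub, ← map_mul]
    rw [← map_zero mk2, mk2_eq]
    simp only [Algebra.algebraMap_eq_smul_one, AA.coe_zero, sub_zero]
    exact h5
  · simp only [← map_sub, ← map_mul, ← map_pow, ← map_smul, ← map_add]
    rw [mk2_eq]
    simp only [pow_two, mul_assoc] at h1 ⊢
    exact h1
  · simp only [← map_sub, ← map_mul, ← map_pow, ← map_smul, ← map_add]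
    rw [mk2_eq]
    simp only [pow_two, mul_assoc] at h2 ⊢
    exact h2
  · simp only [← map_sub, ← map_mul, ← map_pow, ← map_smul, ← map_add]
    rw [mk2_eq]
    simp only [pow_two, mul_assoc] at h3 ⊢
    exact h3

/-- The span of the words in `H₁-ξ`, `H₂-ξ` in `A(3)`. -/
def topSpan : Submodule kk AA :=
  Submodule.span kk {y | y ∈ words20 (aH 0 - algebraMap kk AA kxi) (aH 1 - algebraMap kk AA kxi)}

theorem map_span_list {R M N : Type*} [Semiring R] [AddCommMonoid M] [AddCommMonoid N] [Module R M]
    [Module R N] (f : M →ₗ[R] N) (l : List M) :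
    (Submodule.span R {y | y ∈ l}).map f = Submodule.span R {y | y ∈ l.map f} := by
  rw [Submodule.map_span]
  congr 1
  ext y
  simp

theorem map_topSpan : topSpan.map mk2.toLinearMap = Submodule.span kk
    {y | y ∈ words20 (mk2 (aH 0) - algebraMap kk _ kxi) (mk2 (aH 1) - algebraMap kk _ kxi)} := by
  have h := words20_map mk2 (map_one mk2) (map_mul mk2) (aH 0 - algebraMap kk AA kxi)
    (aH 1 - algebraMap kk AA kxi)
  rw [map_sub, map_sub, AlgHom.commutes] at h
  rw [← h]
  exact map_span_list mk2.toLinearMap _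

/-- Every element of `A(3)` is a combination of the twenty words and diagrams of cut length at
most two. -/
theorem exists_topSpan (a : AA) : ∃ x ∈ topSpan, (a : Aloc) - x ∈ spn bw2 := by
  have key : ∀ (i : Fin 2) (x : AA), x ∈ topSpan → ∃ y ∈ topSpan, mk2 (aH i * x) = mk2 y := by
    intro i x hx
    have hx' := Submodule.mem_map_of_mem (f := mk2.toLinearMap) hx
    rw [map_topSpan] at hx'
    have st := mk2_topPair.stable hx'
    rw [← map_topSpan] at st
    have : mk2 (aH i) * mk2 x ∈ topSpan.map mk2.toLinearMap := by
      fin_cases i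
      · exact st.1
      · exact st.2
    obtain ⟨y, hy, e⟩ := this
    exact ⟨y, hy, by rw [map_mul]; exact e.symm⟩
  have hmap : ∀ k < 13, Maps (gl k) (topSpan.map AA.val.toLinearMap ⊔ spn bw2)
      (topSpan.map AA.val.toLinearMap ⊔ spn bw2) := by
    intro k hk z hz
    obtain ⟨_, ⟨x, hx, rfl⟩, y, hy, rfl⟩ := Submodule.mem_sup.mp hz
    rw [mul_add]
    refine add_mem ?_ (Submodule.mem_sup_right (maps_bw2 _ (gl_mem k) _ hy))
    rcases Nat.lt_or_ge k 2 with h | h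
    · obtain ⟨y, hy, e⟩ := key ⟨k, h⟩ x hx
      have := Submodule.add_mem_sup (Submodule.mem_map_of_mem (f := AA.val.toLinearMap) hy)
        (mk2_eq.mp e)
      rwa [AlgHom.toLinearMap_apply, AA.coe_val, add_sub_cancel] at this
    · refine Submodule.mem_sup_right (bw2_mul ?_ x.2)
      rw [← W_single]
      refine W_mem ?_
      interval_cases k <;> decide
  have h1 : (1 : Aloc) ∈ topSpan.map AA.val.toLinearMap ⊔ spn bw2 :=
    Submodule.mem_sup_left ⟨1, Submodule.subset_span (by simp [words20]), rfl⟩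
  have h2 := maps_AA hmap a a.2 1 h1
  rw [mul_one] at h2
  obtain ⟨_, ⟨x, hx, rfl⟩, y, hy, e⟩ := Submodule.mem_sup.mp h2
  exact ⟨x, hx, by rw [← e]; simpa using hy⟩

theorem W_000 : W [0, 0, 0] ∈ J 3 := by
  have h4 := rowsT_mem (s := (nC 0, [(eB2, [2]), (eB1, [4])])) (by simp [rowsT])
  have e : (nC 0).den gl = W [0, 0, 0] - ((eXi + eZeta + eZetas).den • W [0, 0]
      - (eXi * eZeta + eXi * eZetas + eZeta * eZetas).den • W [0]
      + (eXi * eZeta * eZetas).den • W []) := by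
    simp only [nC, nH, NE.den_sub, NE.den_mul, NE.den_smul, NE.den_atom, NE.den_one, W_cons, W_nil,
      Ex.den_add, Ex.den_mul, mul_one, sub_mul, mul_sub, smul_mul_assoc, mul_smul_comm, one_mul,
      smul_sub, smul_smul, mul_assoc, add_smul]
    simp only [Fin.val_zero, mul_comm, mul_left_comm, mul_assoc]
    abel
  have h := spn_bw2_le h4
  rw [e] at h
  refine (Submodule.sub_mem_iff_left _ ?_).mp h
  exact add_mem (sub_mem (den_smul_mem _ (mem_J_three (by decide)))
    (den_smul_mem _ (mem_J_three (by decide)))) (den_smul_mem _ (mem_J_three (by decide)))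

/-- The terms of the square-pentagon relation. -/
def pentW : List (Ex × List ℕ) :=
  [(eC0, [4, 1]), (eC1, [9]), (eC2, [10]), (eC2, [1, 4]), (eC1, [1]), (eC5, [1, 0]), (eC6, [7]),
    (eC7, [1, 2]), (eC7, [0, 1]), (eC6, [2, 1]), (eC10, [2, 1, 0]), (eC11, [1, 0, 0]),
    (eC12, [0, 0, 1]), (eC12, [0, 1, 2]), (eC15, [0, 1, 0])]

theorem Z7_eq : c11 • Z7 = W [0, 0, 1, 0] - combVal pentW := by
  rw [Z7, smul_inv_smul_eq c11_ne]
  simp only [combVal, pentW, List.map_cons, List.map_nil, List.sum_cons, List.sum_nil, W_cons, W_nil,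
    mul_one, pow_two, mul_assoc, den_c0, den_c1, den_c2, den_c5, den_c6, den_c7, den_c10, den_c11,
    den_c12, den_c15, c3, c4, c8, c9, c13, add_assoc, add_zero]
  rfl

theorem pentW_mem : combVal pentW ∈ J 3 := by
  refine combVal_mem fun t ht => ?_
  have key : ∀ t ∈ pentW, t.2 ∈ bw2 ∨ t.2 ∈ basisW 3 := by decide
  rcases key t ht with h | h
  · exact spn_bw2_le (W_mem h)
  · exact mem_J_three h

theorem W_0010 : W [0, 0, 1, 0] ∈ J 3 := by
  have h : c11 • Z7 ∈ J 3 := by rw [← den_c11]; exact den_smul_mem _ Z7_mem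
  rw [Z7_eq] at h
  exact (Submodule.sub_mem_iff_left _ pentW_mem).mp h

theorem W_0100 : W [0, 1, 0, 0] ∈ J 3 := by
  have h1 := spn_bw2_le (rowsT_mem (s := (nQ 0 1, lowQ 0 1)) (by simp [rowsT]))
  have e : (nQ 0 1).den gl = W [0, 0, 1, 0] - W [0, 1, 0, 0]
      - ((eC11 - eC12).den • (W [1, 0, 0] - W [0, 0, 1])
        + (eC5 - eC7).den • (W [1, 0] - W [0, 1])) := by
    simp only [nQ, nH, NE.den_sub, NE.den_add, NE.den_mul, NE.den_smul, NE.den_atom, W_cons, W_nil,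
      mul_one, mul_assoc]
    rfl
  rw [e] at h1
  have h2 := (Submodule.sub_mem_iff_left _ (add_mem
    (den_smul_mem _ (sub_mem (mem_J_three (by decide)) (mem_J_three (by decide))))
    (den_smul_mem _ (sub_mem (mem_J_three (by decide)) (mem_J_three (by decide)))))).mp h1
  exact (Submodule.sub_mem_iff_right _ W_0010).mp h2

/-- A product of shifted generators. -/
def shW (w : List ℕ) : Aloc := (w.map fun k => gl k - xi • 1).prod

theorem shW_cons (k : ℕ) (w : List ℕ) : shW (k :: w) = gl k * shW w - eXi.den • shW w := by
  rw [shW, List.map_cons, List.prod_cons, sub_mul, smul_mul_assoc, one_mul, den_xi]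
  rfl

theorem shW_mem (w : List ℕ) : shW w ∈ spn w.sublists := by
  induction w with
  | nil =>
    have : shW [] = W [] := rfl
    rw [this]
    exact W_mem (by simp)
  | cons k w ih =>
    rw [shW_cons]
    refine sub_mem ?_ (den_smul_mem _ ?_)
    · refine maps_spn (fun v hv => ?_) _ ih
      rw [← W_cons]
      exact W_mem (List.mem_sublists.mpr ((List.mem_sublists.mp hv).cons_cons k))
    · exact spn_mono (fun v hv => List.mem_sublists.mpr ((List.mem_sublists.mp hv).cons k)) ih

theorem topSpan_le : topSpan.map AA.val.toLinearMap ≤ J 3 := by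
  have key : ((basisW 3 ++ [[0, 0, 1, 0]]).all fun w => w.sublists.all fun v =>
      v == [0, 1, 0, 0] || v == [0, 0, 1, 0] || v == [0, 0, 0] || (basisW 3).contains v) = true := by
    decide +kernel
  simp only [List.all_eq_true, Bool.or_eq_true, beq_iff_eq, List.contains_iff_mem] at key
  have e : (words20 (aH 0 - algebraMap kk AA kxi) (aH 1 - algebraMap kk AA kxi)).map AA.val
      = (basisW 3 ++ [[0, 0, 1, 0]]).map shW := by
    have hA : ∀ i : Fin 2, AA.val (aH i - algebraMap kk AA kxi) = gl i - xi • 1 := by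
      intro i
      change gl i - algebraMap kk Aloc kxi = _
      rw [Algebra.algebraMap_eq_smul_one]
      rfl
    rw [words20_map AA.val rfl fun _ _ => rfl, hA, hA]
    simp only [words20, basisW, shW, List.map_cons, List.map_nil, List.prod_cons, List.prod_nil,
      mul_one, List.cons_append, List.nil_append]
    rfl
  have h := map_span_list AA.val.toLinearMap
    (words20 (aH 0 - algebraMap kk AA kxi) (aH 1 - algebraMap kk AA kxi))
  refine h.le.trans (Submodule.span_le.mpr ?_)
  intro x hx
  have hx' : x ∈ (basisW 3 ++ [[0, 0, 1, 0]]).map shW := e ▸ hx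
  obtain ⟨w, hw', rfl⟩ := List.mem_map.mp hx'
  refine Submodule.span_le.mpr ?_ (shW_mem w)
  rintro _ ⟨v, hv, rfl⟩
  rcases key w hw' v hv with ((rfl | rfl) | rfl) | h
  exacts [W_0100, W_0010, W_000, mem_J_three h]

theorem J_three : Subalgebra.toSubmodule AA = J 3 := by
  refine le_antisymm (fun a ha => ?_) (Submodule.span_le.mpr ?_)
  · obtain ⟨x, hx, h⟩ := exists_topSpan ⟨a, ha⟩
    have := add_mem (spn_bw2_le h) (topSpan_le (Submodule.mem_map_of_mem hx))
    simpa using this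
  · rintro x ⟨j, hj, hx⟩
    rcases eq_or_ne j 3 with rfl | h3
    · rw [basis_eq_three] at hx
      rcases List.mem_append.mp hx with h | h
      · obtain ⟨w, -, rfl⟩ := List.mem_map.mp h
        exact W_mem_AA w
      · obtain rfl : x = Z7 := by simpa using h
        have h1 : W [0, 0, 1, 0] - combVal pentW ∈ Subalgebra.toSubmodule AA :=
          sub_mem (W_mem_AA _) (combVal_mem fun t _ => W_mem_AA _)
        rw [← Z7_eq] at h1
        exact c11_smul_cancel h1
    · obtain ⟨w, -, rfl⟩ := (basis_mem j x h3).mp hx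
      exact W_mem_AA w

theorem J_le (j : ℤ) : J j ≤ Subalgebra.toSubmodule AA := by
  rw [J_three]
  rcases le_total 3 j with h | h
  · exact (J_of_ge h).le
  · exact J_mono h

theorem maps_J (j : ℤ) : ∀ a ∈ AA, ∀ x ∈ J j, a * x ∈ J j := by
  rcases lt_or_ge j 0 with h | h
  · rw [J_neg h]
    rintro a - x hx
    rw [(Submodule.mem_bot kk).mp hx, mul_zero]
    exact zero_mem _
  rcases le_or_gt 3 j with h3 | h3
  · rw [J_of_ge h3, ← J_three]
    exact fun a ha x hx => AA.mul_mem ha hx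
  interval_cases j
  · rw [J_zero]; exact maps_Z0
  · rw [J_one]; exact maps_bw1
  · rw [J_two]; exact maps_bw2

theorem J_maps (j : ℤ) : ∀ a ∈ AA, ∀ x ∈ J j, x * a ∈ J j := by
  rcases lt_or_ge j 0 with h | h
  · rw [J_neg h]
    rintro a - x hx
    rw [(Submodule.mem_bot kk).mp hx, zero_mul]
    exact zero_mem _
  rcases le_or_gt 3 j with h3 | h3
  · rw [J_of_ge h3, ← J_three]
    exact fun a ha x hx => AA.mul_mem hx ha
  interval_cases j
  · rw [J_zero]
    refine fun a ha x hx => mul_mem_of_bt maps_Z0 (fun x hx => bt_spn ?_ hx) hx ha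
    rintro w hw
    obtain rfl := List.mem_singleton.mp hw
    exact W_mem (by decide)
  · rw [J_one]; exact fun a ha x hx => bw1_mul hx ha
  · rw [J_two]; exact fun a ha x hx => bw2_mul hx ha

/-- The ideals of diagrams of bounded cut length. -/
def Jid (j : ℤ) : TwoSidedIdeal AA := idealOf (J j) (maps_J j) (J_maps j)

/-! ### The representations over the coefficient ring -/

/-- Extension of scalars of matrices. -/
def extMat (R : Irr) : Mat R kk →ₐ[kk] Mat R Kpq := (Algebra.ofId kk Kpq).mapMatrix

theorem extMat_injective (R : Irr) : Function.Injective (extMat R) :=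
  Matrix.map_injective Subtype.val_injective

theorem rhoK_mem_range (R : Irr) (a : AA) : rhoK R a ∈ (extMat R).range := by
  have h : AA ≤ (extMat R).range.comap ((rhoK R).restrictScalars kk) := by
    refine Algebra.adjoin_le ?_
    rintro _ ⟨k, hk, rfl⟩
    change rhoK R (gl k) ∈ (extMat R).range
    rw [rhoK_gl R k hk]
    exact ⟨fun i j => ⟨_, Ex.den_mem _⟩, rfl⟩
  exact h a.2

/-- The representations of `A(3)`. -/
def rho (R : Irr) : AA →ₐ[kk] Mat R kk :=
  ((AlgEquiv.ofInjective (extMat R) (extMat_injective R)).symm : _ →ₐ[kk] _).comp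
    ((((rhoK R).restrictScalars kk).comp AA.val).codRestrict (extMat R).range (rhoK_mem_range R))

theorem extMat_rho (R : Irr) (a : AA) : extMat R (rho R a) = rhoK R a :=
  congrArg Subtype.val ((AlgEquiv.ofInjective (extMat R) (extMat_injective R)).apply_symm_apply _)

theorem rho_map (R : Irr) (a : AA) : (rho R a).map (algebraMap kk Kpq) = rhoK R a := extMat_rho R a

/-! ### The layers -/

/-- Words whose images form a basis of `J j` modulo `J (j - 1)`. -/
def lvW : ℕ → List (List ℕ)
  | 3 => basisW 3 ++ [[0, 0, 1, 0]]
  | j => basisW j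

/-- Words that span `J (j - 1)`. -/
def lowW : ℕ → List (List ℕ)
  | 1 => [[6]]
  | 2 => bw1
  | 3 => bw2
  | _ => []

/-- The representations of level `j`. -/
def lvR : ℕ → List Irr
  | 0 => [.I]
  | 1 => [.L]
  | 2 => [.X2, .Y2, .Y2s]
  | _ => [.X3, .Y3, .Y3s, .A, .C, .Cs]

theorem lowW_check (R : Irr) :
    ((lowW R.level).all fun w => (nw w).check R.dim (atomsE R)) = true := by
  cases R <;> decide +kernel

theorem lvW_check : ∀ j ≤ 3, indepCheck (lvR j) ((lvW j).map nw) = true := by decide +kernel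

theorem lvR_level : ∀ j ≤ 3, ∀ R ∈ lvR j, R.level = j := by decide

theorem lvW_length : ∀ j ≤ 3, ∑ R : {R : Irr // R.level = j}, R.1.dim * R.1.dim
    = ((lvW j).map nw).length := by decide

theorem J_pred (j : ℕ) (hj : j ≤ 3) : J (j - 1) = spn (lowW j) := by
  interval_cases j
  · rw [J_neg (by norm_num)]
    simp [spn, lowW]
  · exact J_zero
  · exact J_one
  · exact J_two

theorem J_layer (j : ℕ) (hj : j ≤ 3) : J j = J (j - 1) ⊔ spn (lvW j) := by
  have hd : spn (lvW j) ≤ J j := by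
    refine Submodule.span_le.mpr ?_
    rintro _ ⟨w, hw, rfl⟩
    rcases eq_or_ne j 3 with rfl | h
    · exact J_three.le (W_mem_AA w)
    · refine Submodule.subset_span ⟨j, le_rfl, (basis_mem j _ h).mpr ⟨w, ?_, rfl⟩⟩
      interval_cases j <;> first | exact hw | exact absurd rfl h
  refine le_antisymm (Submodule.span_le.mpr ?_) (sup_le (J_mono (by omega)) hd)
  rintro x ⟨k, hk, hx⟩
  rcases Nat.lt_or_ge k j with h | h
  · exact Submodule.mem_sup_left (Submodule.subset_span ⟨k, by omega, hx⟩)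
  obtain rfl : k = j := by omega
  rcases eq_or_ne k 3 with rfl | h3
  · rw [basis_eq_three] at hx
    rcases List.mem_append.mp hx with h | h
    · obtain ⟨w, hw, rfl⟩ := List.mem_map.mp h
      exact Submodule.mem_sup_right (W_mem (List.mem_append_left _ hw))
    · obtain rfl : x = Z7 := by simpa using h
      refine c11_smul_cancel ?_
      rw [Z7_eq]
      refine sub_mem (Submodule.mem_sup_right (W_mem (by decide))) (combVal_mem fun t ht => ?_)
      have key : ∀ t ∈ pentW, t.2 ∈ bw2 ∨ t.2 ∈ lvW 3 := by decide
      rcases key t ht with h | h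
      · exact Submodule.mem_sup_left (J_two.ge (W_mem h))
      · exact Submodule.mem_sup_right (W_mem h)
  · obtain ⟨w, hw, rfl⟩ := (basis_mem k x h3).mp hx
    refine Submodule.mem_sup_right (W_mem ?_)
    interval_cases k <;> first | exact hw | exact absurd rfl h3

theorem rhoK_J_pred (R : Irr) {x : Aloc} (hx : x ∈ J (R.level - 1)) : rhoK R x = 0 := by
  rw [J_pred _ (by cases R <;> decide)] at hx
  have h : spn (lowW R.level) ≤ LinearMap.ker ((rhoK R).restrictScalars kk).toLinearMap := by
    refine Submodule.span_le.mpr ?_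
    rintro _ ⟨w, hw, rfl⟩
    have h1 := rhoK_den R (nw w)
    rw [den_nw] at h1
    exact h1.trans (NE.den_eq_zero (List.all_eq_true.mp (lowW_check R) w hw))
  exact h hx

/-- A map that sends a generating set modulo its kernel to a basis becomes an isomorphism after
extension of scalars. -/
theorem exists_baseChange_equiv {k K M N ι : Type*} [CommRing k] [Field K] [Algebra k K]
    [AddCommGroup M] [Module k M] [AddCommGroup N] [Module k N] [Module K N] [IsScalarTower k K N]
    [FiniteDimensional K N] [Fintype ι] (g : M →ₗ[k] N) (p : Submodule k M)
    (hp : LinearMap.ker g = p) (b : ι → M) (hb : p ⊔ Submodule.span k (Set.range b) = ⊤)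
    (hi : LinearIndependent K fun i => g (b i)) (hn : Fintype.card ι = Module.finrank K N) :
    ∃ Φ : (K ⊗[k] (M ⧸ p)) ≃ₗ[K] N, ∀ (c : K) (x : M),
      Φ (c ⊗ₜ[k] Submodule.Quotient.mk x) = c • g x := by
  let F : K ⊗[k] (M ⧸ p) →ₗ[K] N := (p.liftQ g hp.ge).liftBaseChange K
  have hF : ∀ (c : K) (x : M), F (c ⊗ₜ[k] Submodule.Quotient.mk x) = c • g x := fun c x => by
    simp only [F, LinearMap.liftBaseChange_tmul]
    rfl
  have hs : Submodule.span K (Set.range fun i => (1 : K) ⊗ₜ[k] (Submodule.Quotient.mk (b i) : M ⧸ p))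
      = ⊤ := by
    have h1 : Submodule.span k (Set.range fun i => (Submodule.Quotient.mk (b i) : M ⧸ p)) = ⊤ := by
      have h := congrArg (Submodule.map p.mkQ) hb
      rw [Submodule.map_sup, Submodule.mkQ_map_self, bot_sup_eq, Submodule.map_span,
        Submodule.map_top, Submodule.range_mkQ, ← Set.range_comp] at h
      exact h
    have h2 := Submodule.baseChange_span (R := k) (A := K)
      (Set.range fun i => (Submodule.Quotient.mk (b i) : M ⧸ p))
    rw [h1, Submodule.baseChange_top, ← Set.range_comp] at h2
    exact h2.symm
  have hinj : Function.Injective F := by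
    rw [← LinearMap.ker_eq_bot, LinearMap.ker_eq_bot']
    intro z hz
    obtain ⟨c, rfl⟩ := (Submodule.mem_span_range_iff_exists_fun K).mp (hs ▸ Submodule.mem_top (x := z))
    rw [map_sum] at hz
    simp only [map_smul, hF, one_smul] at hz
    have := Fintype.linearIndependent_iff.mp hi c hz
    simp [this]
  have hsurj : Function.Surjective F := by
    rw [← LinearMap.range_eq_top, eq_top_iff, ← hi.span_eq_top_of_card_eq_finrank' hn,
      Submodule.span_le]
    rintro _ ⟨i, rfl⟩
    exact ⟨1 ⊗ₜ[k] Submodule.Quotient.mk (b i), by rw [hF, one_smul]⟩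
  exact ⟨LinearEquiv.ofBijective F ⟨hinj, hsurj⟩, hF⟩

/-- The bimodule map on `J j`. -/
def layerMap (j : ℕ) : J j →ₗ[kk] MatLevel j kk :=
  LinearMap.pi fun R => (rho R.1).toLinearMap ∘ₗ Submodule.inclusion (J_le j)

theorem layerMap_map (j : ℕ) (x : J j) (R : {R : Irr // R.level = j}) :
    (layerMap j x R).map (algebraMap kk Kpq) = rhoK R.1 x :=
  rho_map R.1 ⟨x, J_le j x.2⟩

theorem layerMap_mul (j : ℕ) (a : AA) (x y : J j) :
    ((y : Aloc) = a * x → layerMap j y = fun R => rho R.1 a * layerMap j x R) ∧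
    ((y : Aloc) = x * a → layerMap j y = fun R => layerMap j x R * rho R.1 a) := by
  have key : ∀ (b c d : AA) (R : Irr), (b : Aloc) = c * d → rho R b = rho R c * rho R d :=
    fun b c d R h => by rw [← map_mul]; exact congrArg _ (Subtype.ext h)
  exact ⟨fun h => funext fun R => key ⟨y, J_le j y.2⟩ a ⟨x, J_le j x.2⟩ R.1 h,
    fun h => funext fun R => key ⟨y, J_le j y.2⟩ ⟨x, J_le j x.2⟩ a R.1 h⟩

/-- The bimodule map with values over the field. -/
def layerMapK (j : ℕ) : J j →ₗ[kk] MatLevel j Kpq :=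
  ((rhoP fun R => R.level = j).restrictScalars kk).toLinearMap ∘ₗ (J j).subtype

theorem layerMapK_eq (j : ℕ) (x : J j) :
    layerMapK j x = fun R => (layerMap j x R).map (algebraMap kk Kpq) :=
  funext fun R => (layerMap_map j x R).symm

theorem ker_layerMapK_eq (j : ℕ) : LinearMap.ker (layerMapK j) = LinearMap.ker (layerMap j) := by
  ext x
  rw [LinearMap.mem_ker, LinearMap.mem_ker, layerMapK_eq]
  constructor
  · intro h
    funext R
    refine extMat_injective R.1 ((congrFun h R).trans (map_zero _).symm)
  · intro h
    funext R
    rw [h]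
    exact map_zero (extMat R.1)

/-- The elements of the layer that map to a basis. -/
def layerBasis (j : ℕ) (hj : j ≤ 3) (i : Fin ((lvW j).map nw).length) : J j :=
  ⟨(((lvW j).map nw).get i).den gl, by
    obtain ⟨w, hw, h⟩ := List.mem_map.mp (List.get_mem ((lvW j).map nw) i)
    rw [← h, den_nw, J_layer j hj]
    exact Submodule.mem_sup_right (W_mem hw)⟩

theorem layerBasis_indep (j : ℕ) (hj : j ≤ 3) :
    LinearIndependent Kpq fun i => layerMapK j (layerBasis j hj i) := by
  have h := linearIndependent_reps (lvW_check j hj) (fun R => R.level = j) (lvR_level j hj)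
  convert h using 2 with i
  exact rhoP_den _ _

theorem layer_span (j : ℕ) (hj : j ≤ 3) : (J (j - 1)).submoduleOf (J j)
    ⊔ Submodule.span kk (Set.range (layerBasis j hj)) = ⊤ := by
  rw [eq_top_iff]
  rintro x -
  have h := (J_layer j hj).le x.2
  obtain ⟨y, hy, z, hz, e⟩ := Submodule.mem_sup.mp h
  have hz' : z ∈ (Submodule.span kk (Set.range (layerBasis j hj))).map (J j).subtype := by
    rw [Submodule.map_span, ← Set.range_comp]
    refine Submodule.span_mono ?_ hz
    rintro _ ⟨w, hw, rfl⟩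
    obtain ⟨i, hi⟩ := List.get_of_mem (List.mem_map_of_mem (f := nw) hw)
    exact ⟨i, (congrArg (NE.den gl) hi).trans (den_nw gl w)⟩
  obtain ⟨z', hz', rfl⟩ := hz'
  exact Submodule.mem_sup.mpr ⟨⟨y, J_mono (by omega) hy⟩, hy, z', hz', Subtype.ext e⟩

theorem ker_layerMapK (j : ℕ) (hj : j ≤ 3) :
    LinearMap.ker (layerMapK j) = (J (j - 1)).submoduleOf (J j) := by
  have hlow : (J (j - 1)).submoduleOf (J j) ≤ LinearMap.ker (layerMapK j) := by
    intro x hx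
    rw [LinearMap.mem_ker]
    funext R
    obtain ⟨R, rfl⟩ := R
    exact rhoK_J_pred R hx
  refine le_antisymm (fun x hx => ?_) hlow
  obtain ⟨y, hy, z, hz, rfl⟩ := Submodule.mem_sup.mp (layer_span j hj ▸ Submodule.mem_top (x := x))
  obtain ⟨c, rfl⟩ := (Submodule.mem_span_range_iff_exists_fun kk).mp hz
  have h : layerMapK j y + ∑ i, (c i : Kpq) • layerMapK j (layerBasis j hj i) = 0 := by
    rw [LinearMap.mem_ker, map_add, map_sum] at hx
    simp only [map_smul] at hx
    exact hx
  rw [LinearMap.mem_ker.mp (hlow hy), zero_add] at h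
  have h0 := Fintype.linearIndependent_iff.mp (layerBasis_indep j hj) _ h
  have hc : ∀ i, c i = 0 := fun i => Subtype.ext (h0 i)
  simpa [hc] using hy

theorem exists_layerEquiv (j : ℕ) (hj : j ≤ 3) :
    ∃ Φ : (Kpq ⊗[kk] (J j ⧸ LinearMap.ker (layerMap j))) ≃ₗ[Kpq] MatLevel j Kpq,
      ∀ (c : Kpq) (x : J j), Φ (c ⊗ₜ[kk] Submodule.Quotient.mk x) = c • layerMapK j x := by
  refine exists_baseChange_equiv (layerMapK j) _ (ker_layerMapK_eq j) (layerBasis j hj) ?_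
    (layerBasis_indep j hj) ?_
  · rw [← ker_layerMapK_eq, ker_layerMapK j hj, layer_span]
  · rw [Fintype.card_fin, Module.finrank_pi_fintype, ← lvW_length j hj]
    refine Finset.sum_congr rfl fun R _ => ?_
    rw [Module.finrank_matrix, Fintype.card_fin, Module.finrank_self, mul_one]

/-- Transport of the bimodule structure of a quotient algebra along a linear equivalence. -/
theorem exists_conj_actions {K A S T : Type*} [Field K] [Ring A] [Algebra K A] [Ring S]
    [Algebra K S] [AddCommGroup T] [Module K T] (Φ : T ≃ₗ[K] S) (π : A →ₐ[K] S) :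
    ∃ (l : A →ₐ[K] Module.End K T) (r : Aᵐᵒᵖ →ₐ[K] Module.End K T),
      ∀ a z, Φ (l a z) = π a * Φ z ∧ Φ (r (MulOpposite.op a) z) = Φ z * π a :=
  ⟨(Φ.symm.conjAlgEquiv K).toAlgHom.comp ((Algebra.lsmul K K S).comp π),
    (Φ.symm.conjAlgEquiv K).toAlgHom.comp ((Algebra.lsmul K K S).comp (AlgHom.op π)),
    fun _ _ => ⟨Φ.apply_symm_apply _, Φ.apply_symm_apply _⟩⟩

/-- The bimodule structure on the layer. -/
theorem exists_layer_actions (j : ℕ) (hj : j ≤ 3) :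
    ∃ (lact : Aloc →ₐ[Kpq] Module.End Kpq (Kpq ⊗[kk] (J j ⧸ LinearMap.ker (layerMap j))))
      (ract : Alocᵐᵒᵖ →ₐ[Kpq] Module.End Kpq (Kpq ⊗[kk] (J j ⧸ LinearMap.ker (layerMap j))))
      (Phi : (Kpq ⊗[kk] (J j ⧸ LinearMap.ker (layerMap j))) ≃ₗ[Kpq] MatLevel j Kpq),
      (∀ (a : AA) (c : Kpq) (x y : J j),
        ((y : Aloc) = a * x →
          lact a (c ⊗ₜ[kk] Submodule.Quotient.mk x) = c ⊗ₜ[kk] Submodule.Quotient.mk y) ∧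
        ((y : Aloc) = x * a →
          ract (MulOpposite.op a) (c ⊗ₜ[kk] Submodule.Quotient.mk x)
            = c ⊗ₜ[kk] Submodule.Quotient.mk y)) ∧
      (∀ (c : Kpq) (x : J j), Phi (c ⊗ₜ[kk] Submodule.Quotient.mk x)
        = fun R => c • (layerMap j x R).map (algebraMap kk Kpq)) ∧
      (∀ (a : Aloc) (z : Kpq ⊗[kk] (J j ⧸ LinearMap.ker (layerMap j))),
        Phi (lact a z) = (fun R => rhoK R.1 a * Phi z R) ∧
        Phi (ract (MulOpposite.op a) z) = fun R => Phi z R * rhoK R.1 a) := by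
  have key := exists_layerEquiv j hj
  cases key with
  | intro Φ hΦ =>
  have h2 := exists_conj_actions Φ (rhoP fun R => R.level = j)
  cases h2 with
  | intro l h =>
  cases h with
  | intro r h =>
  have h1 : ∀ (c : Kpq) (x : J j), Φ (c ⊗ₜ[kk] Submodule.Quotient.mk x)
        = fun R => c • (layerMap j x R).map (algebraMap kk Kpq) := fun c x => by
    rw [hΦ, layerMapK_eq]
    rfl
  refine ⟨l, r, Φ, fun a c x y => ⟨fun e => ?_, fun e => ?_⟩, h1, fun a z => ?_⟩
  · have e' : layerMapK j y = rhoP (fun R => R.level = j) a * layerMapK j x :=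
      (congrArg _ e).trans (map_mul (rhoP fun R => R.level = j) _ _)
    apply Φ.injective
    rw [(h _ _).1, hΦ, hΦ, e', mul_smul_comm]
  · have e' : layerMapK j y = layerMapK j x * rhoP (fun R => R.level = j) a :=
      (congrArg _ e).trans (map_mul (rhoP fun R => R.level = j) _ _)
    apply Φ.injective
    rw [(h _ _).2, hΦ, hΦ, e', smul_mul_assoc]
  · exact ⟨(h a z).1, (h a z).2⟩

/-! ### The top quotient -/

theorem topH_pair : TopPair (topH 0) (topH 1) := by
  have hr : ∀ {x y}, RelT x y → (RingQuot.mkAlgHom kk RelT x : Atop) = RingQuot.mkAlgHom kk RelT y :=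
    fun h => RingQuot.mkAlgHom_rel kk h
  have h0 := hr (RelT.cubic 0)
  have h1 := hr (RelT.cubic 1)
  have h2 := hr (RelT.quartic 0)
  have h3 := hr (RelT.quartic 1)
  have h4 := hr RelT.quartic'
  have e2 : (1 + 1 : Fin 2) = 0 := rfl
  simp only [map_sub, map_add, map_mul, map_smul, map_pow, map_zero, AlgHom.commutes, zero_add, e2]
    at h0 h1 h2 h3 h4
  exact ⟨h0, h1, h2, h3, h4⟩

/-- The homomorphism from the top algebra given by two elements that satisfy the relations. -/
def topLift {S : Type*} [Ring S] [Algebra kk S] {a b : S} (h : TopPair a b) : Atop →ₐ[kk] S :=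
  RingQuot.liftAlgHom kk ⟨FreeAlgebra.lift kk ![a, b], fun x y hxy => by
    have e2 : (1 + 1 : Fin 2) = 0 := rfl
    have t0 : FreeAlgebra.lift kk ![a, b] (tH 0) = a := FreeAlgebra.lift_ι_apply _ _
    have t1 : FreeAlgebra.lift kk ![a, b] (tH 1) = b := FreeAlgebra.lift_ι_apply _ _
    cases hxy with
    | cubic i =>
      fin_cases i <;> simp only [Fin.zero_eta, Fin.mk_one, map_sub, map_mul, map_zero,
        AlgHom.commutes, t0, t1]
      exacts [h.ha, h.hb]
    | quartic i =>
      fin_cases i <;> simp only [Fin.zero_eta, Fin.mk_one, map_sub, map_add, map_mul, map_smul,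
        map_pow, zero_add, e2, t0, t1]
      exacts [h.hq1, h.hq2]
    | quartic' =>
      simp only [map_sub, map_add, map_mul, map_smul, map_pow, t0, t1]
      exact h.hE⟩

theorem topLift_mk {S : Type*} [Ring S] [Algebra kk S] {a b : S} (h : TopPair a b) (x : FrT) :
    topLift h (RingQuot.mkAlgHom kk RelT x) = FreeAlgebra.lift kk ![a, b] x :=
  RingQuot.liftAlgHom_mkAlgHom_apply kk _ _ x

/-- The twenty words in the free algebra. -/
def freeWords : List FrT := words20 (tH 0 - algebraMap kk FrT kxi) (tH 1 - algebraMap kk FrT kxi)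

theorem freeWords_map {S : Type*} [Ring S] [Algebra kk S] (f : FrT →ₐ[kk] S) :
    freeWords.map f
      = words20 (f (tH 0) - algebraMap kk S kxi) (f (tH 1) - algebraMap kk S kxi) := by
  rw [freeWords, words20_map f (map_one f) (map_mul f), map_sub, map_sub, AlgHom.commutes]

/-- The words span the top algebra. -/
theorem exists_freeWords (x : Atop) : ∃ y ∈ Submodule.span kk {y | y ∈ freeWords},
    (RingQuot.mkAlgHom kk RelT y : Atop) = x := by
  let m : FrT →ₐ[kk] Atop := RingQuot.mkAlgHom kk RelT
  let V : Submodule kk Atop := Submodule.span kk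
    {y | y ∈ words20 (topH 0 - algebraMap kk Atop kxi) (topH 1 - algebraMap kk Atop kxi)}
  have hm : (Submodule.span kk {y | y ∈ freeWords}).map m.toLinearMap = V := by
    rw [map_span_list]
    change Submodule.span kk {y | y ∈ freeWords.map m} = V
    rw [freeWords_map]
    rfl
  have h1 : (1 : Atop) ∈ V := Submodule.subset_span (by simp [words20])
  have hst : ∀ y : FrT, ∀ v ∈ V, m y * v ∈ V := by
    intro y
    induction y using FreeAlgebra.induction with
    | grade0 r =>
      intro v hv
      rw [AlgHom.commutes, ← Algebra.smul_def]
      exact V.smul_mem r hv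
    | grade1 i =>
      intro v hv
      have := topH_pair.stable hv
      fin_cases i
      exacts [this.1, this.2]
    | mul a b ha hb =>
      intro v hv
      rw [map_mul, mul_assoc]
      exact ha _ (hb _ hv)
    | add a b ha hb =>
      intro v hv
      rw [map_add, add_mul]
      exact add_mem (ha _ hv) (hb _ hv)
  obtain ⟨y, rfl⟩ := RingQuot.mkAlgHom_surjective kk RelT x
  have := hst y 1 h1
  rw [mul_one, ← hm] at this
  exact this

/-- A combination of list elements with independent images is zero when its image is zero. -/
theorem eq_zero_of_list_indep {k K M N E : Type*} [CommRing k] [Field K] [Algebra k K]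
    [FaithfulSMul k K] [AddCommGroup M] [Module k M] [AddCommGroup N] [Module k N] [Module K N]
    [IsScalarTower k K N] (f : M →ₗ[k] N) {l : List M} {L : List E} {d : E → N}
    (h : l.map f = L.map d) (hi : LinearIndependent K fun i : Fin L.length => d (L.get i)) {y : M}
    (hy : y ∈ Submodule.span k {z | z ∈ l}) (h0 : f y = 0) : y = 0 := by
  have hl : l.length = L.length := by simpa using congrArg List.length h
  have hr : {z | z ∈ l} = Set.range l.get := by
    ext z
    exact List.mem_iff_get
  rw [hr] at hy
  obtain ⟨c, rfl⟩ := (Submodule.mem_span_range_iff_exists_fun k).mp hy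
  have hk : ∀ i : Fin l.length, f (l.get i) = d (L.get (Fin.cast hl i)) := fun i => by
    have := congrArg (fun t : List N => t[(i : ℕ)]?) h
    have hi : (i : ℕ) < L.length := hl ▸ i.2
    simp only [List.getElem?_map, List.getElem?_eq_getElem i.2, List.getElem?_eq_getElem hi,
      Option.map_some, Option.some.injEq] at this
    exact this
  rw [map_sum] at h0
  simp only [map_smul, hk] at h0
  have h1 := (hi.restrict_scalars (R := k) (by
    intro a b hab
    exact FaithfulSMul.algebraMap_injective k K (by
      simpa only [Algebra.algebraMap_eq_smul_one] using hab))).comp (Fin.cast hl)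
      (Fin.cast_injective hl)
  have := Fintype.linearIndependent_iff.mp h1 c h0
  simp [this]

theorem mk2_lift (x : FrT) : mk2 (FreeAlgebra.lift kk ![aH 0, aH 1] x)
    = topLift mk2_topPair (RingQuot.mkAlgHom kk RelT x) := by
  rw [topLift_mk]
  have h : mk2.comp (FreeAlgebra.lift kk ![aH 0, aH 1])
      = FreeAlgebra.lift kk ![mk2 (aH 0), mk2 (aH 1)] := by
    ext i
    fin_cases i <;> simp
  exact congrArg (fun f => f x) h

theorem topLift_injective : Function.Injective (topLift mk2_topPair) := by
  rw [injective_iff_map_eq_zero]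
  intro x hx
  obtain ⟨y, hy, rfl⟩ := exists_freeWords x
  let χ : FrT →ₐ[kk] Aloc := AA.val.comp (FreeAlgebra.lift kk ![aH 0, aH 1])
  have hχ : χ y ∈ J 2 := by
    rw [← mk2_lift, ← map_zero mk2, mk2_eq, AA.coe_zero, sub_zero, ← J_two] at hx
    exact hx
  let f : FrT →ₗ[kk] MatLevel 3 Kpq :=
    ((rhoP fun R => R.level = 3).restrictScalars kk).toLinearMap ∘ₗ χ.toLinearMap
  have h0 : χ (tH 0) = gl 0 := congrArg Subtype.val (FreeAlgebra.lift_ι_apply ![aH 0, aH 1] 0)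
  have h1 : χ (tH 1) = gl 1 := congrArg Subtype.val (FreeAlgebra.lift_ι_apply ![aH 0, aH 1] 1)
  have hw : freeWords.map χ = topW.map (·.den gl) := by
    rw [freeWords_map, topW_den, h0, h1]
    rfl
  have hf : freeWords.map f = topW.map fun e => fun R : {R : Irr // R.level = 3} =>
      e.den (atomsM R.1) := by
    have : freeWords.map f = (freeWords.map χ).map (rhoP fun R => R.level = 3) := by
      rw [List.map_map]; rfl
    rw [this, hw, List.map_map]
    exact List.map_congr_left fun e _ => rhoP_den _ e
  have hz : f y = 0 := by
    funext R
    refine rhoK_J_pred R.1 ?_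
    rw [R.2]
    exact hχ
  rw [eq_zero_of_list_indep f hf (linearIndependent_reps topW_check _ (by decide)) hy hz]
  exact map_zero _

theorem topLift_surjective : Function.Surjective (topLift mk2_topPair) := by
  intro z
  obtain ⟨a, rfl⟩ : ∃ a, mk2 a = z := RingCon.mk'_surjective _ z
  obtain ⟨x, hx, h⟩ := exists_topSpan a
  have hs : (Submodule.span kk {y | y ∈ freeWords}).map
      (FreeAlgebra.lift kk ![aH 0, aH 1]).toLinearMap = topSpan := by
    rw [map_span_list]
    change Submodule.span kk {y | y ∈ freeWords.map (FreeAlgebra.lift kk ![aH 0, aH 1])} = _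
    rw [freeWords_map, topSpan]
    simp [tH]
  rw [← hs] at hx
  obtain ⟨y, -, rfl⟩ := hx
  exact ⟨RingQuot.mkAlgHom kk RelT y, by rw [← mk2_lift]; exact (mk2_eq.mpr h).symm⟩

theorem Jid_two : Jid 2 = I2 := by
  refine TwoSidedIdeal.ext fun x => ?_
  exact (mem_idealOf x).trans ((by rw [J_two] : (x : Aloc) ∈ J 2 ↔ (x : Aloc) ∈ spn bw2).trans
    (mem_idealOf x).symm)

theorem exists_topEquiv {I : TwoSidedIdeal AA} (hI : I = I2) :
    ∃ e : Atop ≃ₐ[kk] I.ringCon.Quotient,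
      (∃ h : AA, (h : Aloc) = H1 ∧ e (topH 0) = (h : I.ringCon.Quotient)) ∧
      ∃ h : AA, (h : Aloc) = H2 ∧ e (topH 1) = (h : I.ringCon.Quotient) := by
  subst hI
  refine ⟨AlgEquiv.ofBijective (topLift mk2_topPair) ⟨topLift_injective, topLift_surjective⟩,
    ⟨aH 0, rfl, ?_⟩, aH 1, rfl, ?_⟩
  · exact (topLift_mk mk2_topPair (tH 0)).trans (FreeAlgebra.lift_ι_apply _ _)
  · exact (topLift_mk mk2_topPair (tH 1)).trans (FreeAlgebra.lift_ι_apply _ _)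

end ExcSeries

end

open ExcSeries
theorem mainTheorem9 :
    -- the subring `A(3)`, its ideals `J^(j)` and the representations, over both coefficient rings
    ∃ (A : Subalgebra kk Aloc) (Jid : ℤ → TwoSidedIdeal A)
      (rhoK : ∀ R : Irr, Aloc →ₐ[Kpq] Mat R Kpq) (rho : ∀ R : Irr, A →ₐ[kk] Mat R kk),
      Subalgebra.toSubmodule A = J 3 ∧
      (∀ (j : ℤ) (x : A), x ∈ Jid j ↔ (x : Aloc) ∈ J j) ∧
      (∀ R : Irr, rhoK R H1 = matH R ∧ rhoK R H2 = rot180 (matH R)) ∧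
      (∀ (R : Irr) (a : A), (rho R a).map (algebraMap kk Kpq) = rhoK R a) ∧
      -- the bimodule maps
      (∀ j : ℕ, j ≤ 3 → ∃ f : J j →ₗ[kk] MatLevel j kk,
        (∀ (x : J j) (R : {R : Irr // R.level = j}),
          (f x R).map (algebraMap kk Kpq) = rhoK R.1 x) ∧
        (∀ (a : A) (x y : J j),
          ((y : Aloc) = a * x → f y = fun R => rho R.1 a * f x R) ∧
          ((y : Aloc) = x * a → f y = fun R => f x R * rho R.1 a)) ∧
        LinearMap.ker f = (J (j - 1)).submoduleOf (J j) ∧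
        -- the bimodule structure on the tensor product, and the isomorphism of bimodules
        ∃ (lact : Aloc →ₐ[Kpq] Module.End Kpq (Kpq ⊗[kk] (J j ⧸ LinearMap.ker f)))
          (ract : Alocᵐᵒᵖ →ₐ[Kpq] Module.End Kpq (Kpq ⊗[kk] (J j ⧸ LinearMap.ker f)))
          (Phi : (Kpq ⊗[kk] (J j ⧸ LinearMap.ker f)) ≃ₗ[Kpq] MatLevel j Kpq),
          (∀ (a : A) (c : Kpq) (x y : J j),
            ((y : Aloc) = a * x →
              lact a (c ⊗ₜ[kk] Submodule.Quotient.mk x) = c ⊗ₜ[kk] Submodule.Quotient.mk y) ∧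
            ((y : Aloc) = x * a →
              ract (MulOpposite.op a) (c ⊗ₜ[kk] Submodule.Quotient.mk x)
                = c ⊗ₜ[kk] Submodule.Quotient.mk y)) ∧
          (∀ (c : Kpq) (x : J j),
            Phi (c ⊗ₜ[kk] Submodule.Quotient.mk x)
              = fun R => c • (f x R).map (algebraMap kk Kpq)) ∧
          (∀ (a : Aloc) (z : Kpq ⊗[kk] (J j ⧸ LinearMap.ker f)),
            Phi (lact a z) = (fun R => rhoK R.1 a * Phi z R) ∧
            Phi (ract (MulOpposite.op a) z) = fun R => Phi z R * rhoK R.1 a)) ∧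
      -- the top quotient
      ∃ e : Atop ≃ₐ[kk] (Jid 2).ringCon.Quotient,
        (∃ h : A, (h : Aloc) = H1 ∧ e (topH 0) = (h : (Jid 2).ringCon.Quotient)) ∧
        ∃ h : A, (h : Aloc) = H2 ∧ e (topH 1) = (h : (Jid 2).ringCon.Quotient) := by
  refine ⟨AA, Jid, ExcSeries.rhoK, rho, J_three, fun j x => mem_idealOf x,
    fun R => ⟨rhoK_H1 R, rhoK_H2 R⟩, rho_map, fun j hj => ⟨layerMap j, layerMap_map j,
      layerMap_mul j, (ker_layerMapK_eq j).symm.trans (ker_layerMapK j hj),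
      exists_layer_actions j hj⟩, exists_topEquiv Jid_two⟩
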